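/- Fix coupling constants $c_1,c_2,c_{12}\ge 0$ and consider the defocusing two-component cubic (Gross--Pitaevskii) system on $\mathbb R\times\mathbb R^3$ \[ \begin{cases} i\partial_t\phi_1=-\Delta\phi_1+8\pi c_1|\phi_1|^2\phi_1+8\pi c_{12}|\phi_2|^2\phi_1,\\ i\partial_t\phi_2=-\Delta\phi_2+8\pi c_2|\phi_2|^2\phi_2+8\pi c_{12}|\phi_1|^2\phi_2 . \end{cases} \] A global $H^1$ solution is a function $\phi=(\phi_1,\phi_2)\in C(\mathbb R;H^1(\mathbb R^3;\mathbb C^2))$ such that, for every Schwartz function $\psi$ on $\mathbb R^3$ and each $j\in\{1,2\}$, the function $t\mapsto\int\phi_{j}(t,x)\psi(x)\,dx$ is differentiable on $\mathbb R$ and satisfies the $j$-th equation tested against $\psi$ at every time $t$. Then for every $M$ there exists a constant $C>0$ (depending only on $M$ and on the fixed constants $c_1,c_2,c_{12}$ of the system) such that every global $H^1$ solution $\phi$ with $\|\phi(0)\|_{H^1(\mathbb R^3;\mathbb C^2)}\le M$ satisfies \[ \|\phi\|_{L^4_{t,x}(\mathbb R\times\mathbb R^3)}:=\Big(\int_{\mathbb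 R}\big(\|\phi_1(t)\|_{L^4_x}^2+\|\phi_2(t)\|_{L^4_x}^2\big)^{2}\,dt\Big)^{1/4}\le C . \] -/

import Mathlib

open MeasureTheory SchwartzMap TemperedDistribution
open scoped ENNReal LineDeriv Laplacian

/-- Physical space `ℝ³` with its Euclidean norm and Lebesgue measure. -/
abbrev R3 : Type := EuclideanSpace ℝ (Fin 3)

/-- The Lebesgue space `L²(ℝ³; ℂ)`. -/
abbrev L2R3 : Type := Lp ℂ 2 (volume : Measure R3)

/-- The Sobolev space `H¹(ℝ³; ℂ)`: pairs `(f, (g₁, g₂, g₃))` of `L²` functions such that `g_k` is the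
distributional derivative of `f` in the `k`-th coordinate direction. As `f` determines the `g_k`, these
pairs are the functions of `H¹`, and the norm inherited from the `ℓ²` product is
`‖f‖_{H¹} = (‖f‖_{L²}² + ∑ k, ‖∂_k f‖_{L²}²)^{1/2}`. -/
noncomputable def H1R3 : Submodule ℂ (WithLp 2 (L2R3 × PiLp 2 (fun _ : Fin 3 => L2R3))) where
  carrier := {p | ∀ k : Fin 3,
    ∂_{EuclideanSpace.single k (1 : ℝ)} (p.fst : 𝓢'(R3, ℂ)) = (p.snd k : 𝓢'(R3, ℂ))}
  add_mem' := by
    intro p q hp hq k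
    have hp' := hp k
    have hq' := hq k
    simp only [← Lp.toTemperedDistributionCLM_apply] at hp' hq' ⊢
    rw [WithLp.add_fst, WithLp.add_snd, PiLp.add_apply, map_add, map_add,
      LineDeriv.lineDerivOp_add, hp', hq']
  zero_mem' := by
    intro k
    simp only [← Lp.toTemperedDistributionCLM_apply]
    rw [WithLp.zero_fst, WithLp.zero_snd, PiLp.zero_apply, map_zero, LineDeriv.lineDerivOp_zero]
  smul_mem' := by
    intro a p hp k
    have hp' := hp k
    simp only [← Lp.toTemperedDistributionCLM_apply] at hp' ⊢
    rw [WithLp.smul_fst, WithLp.smul_snd, PiLp.smul_apply, map_smul, map_smul,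
      LineDeriv.lineDerivOp_smul, hp']

/-- The Sobolev space `H¹(ℝ³; ℂ²)`, with norm `(‖φ₁‖_{H¹}² + ‖φ₂‖_{H¹}²)^{1/2}`. -/
abbrev H1Pair : Type := PiLp 2 (fun _ : Fin 2 => H1R3)

/-- The `i`-th component of an element of `H¹(ℝ³; ℂ²)`, as a function on `ℝ³`
(defined up to null sets). -/
noncomputable def H1Pair.comp (u : H1Pair) (i : Fin 2) : R3 → ℂ :=
  ((u i : WithLp 2 (L2R3 × PiLp 2 (fun _ : Fin 3 => L2R3))).fst : R3 → ℂ)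

/-- The cubic nonlinearity `F_c(z) z` of the two-component Gross-Pitaevskii system. -/
noncomputable def gpNonlinearity (c₁ c₂ c₁₂ : ℝ) (z : Fin 2 → ℂ) : Fin 2 → ℂ :=
  ![((8 * Real.pi * c₁ * ‖z 0‖ ^ 2 + 8 * Real.pi * c₁₂ * ‖z 1‖ ^ 2 : ℝ) : ℂ) * z 0,
    ((8 * Real.pi * c₂ * ‖z 1‖ ^ 2 + 8 * Real.pi * c₁₂ * ‖z 0‖ ^ 2 : ℝ) : ℂ) * z 1]

/-- `φ` is a global `H¹` solution of the two-component Gross-Pitaevskii system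
`i ∂ₜ φ = -Δ φ + F_c(φ) φ` on `ℝ × ℝ³`: it belongs to `C(ℝ; H¹(ℝ³; ℂ²))`, and for every Schwartz
function `ψ` the pairings `⟨φ_i(t), ψ⟩` are differentiable in `t` and satisfy the equation tested
against `ψ`. -/
structure IsGlobalGPSolution (c₁ c₂ c₁₂ : ℝ) (φ : ℝ → H1Pair) : Prop where
  continuous : Continuous φ
  equation : ∀ (i : Fin 2) (ψ : 𝓢(R3, ℂ)) (t : ℝ),
    HasDerivAt (fun s : ℝ => Complex.I * ∫ x, (φ s).comp i x * ψ x)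
      ((∫ x, (φ t).comp i x * (-(Δ ψ) x)) +
        ∫ x, gpNonlinearity c₁ c₂ c₁₂ (fun j => (φ t).comp j x) i * ψ x) t

/-- The norm `‖u‖_{L⁴_x} = (‖u₁‖_{L⁴}² + ‖u₂‖_{L⁴}²)^{1/2}` of a pair of functions on `ℝ³`. -/
noncomputable def l4Norm (u : Fin 2 → R3 → ℂ) : ℝ≥0∞ :=
  (∑ i, eLpNorm (u i) 4 volume ^ 2) ^ (1 / 2 : ℝ)

/-- The space-time norm `‖φ‖_{L⁴_{t,x}(ℝ × ℝ³)} = (∫ ‖φ(t)‖_{L⁴_x}⁴ dt)^{1/4}`. -/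
noncomputable def spaceTimeL4Norm (φ : ℝ → H1Pair) : ℝ≥0∞ :=
  (∫⁻ t : ℝ, l4Norm (φ t).comp ^ 4) ^ (1 / 4 : ℝ)

open scoped ContDiff Topology Convolution NNReal FourierTransform

/-! The estimate is an interaction Morawetz inequality. Let m be the mass density, p the momentum
density, and a(z) = √(δ² + |z|²). The functional ∑ₗ ∬ ∂ₗa(x − y) pₗ(x) m(y) dx dy is bounded by the
fourth power of the H¹ norm, uniformly in δ. Its time derivative is a sum of three terms. The
Hessian term is nonnegative because a is convex (`sum_dint_mom_le`). The potential term is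
nonnegative because the couplings are. The third term is (15/2) ∬ δ⁴ (δ² + |x − y|²)^(-7/2) m(x)
m(y), which comes from −Δ²a (`sum_dint_momDeriv`, `le_interactionDeriv`). On the ball of radius δ
this kernel has mass bounded below independently of δ, so letting δ → 0 controls the time integral
of ∫ m² (`IsSol.integral_autocorr_le`), and ∫ m² dominates the fourth powers of the L⁴ norms of the
components.

These computations need more regularity than H¹ provides, so every density is built from the
mollification ρ ∗ φ. It is smooth in x, differentiable in t at each point, and solves the system up
to the commutator `defect`, that is N(ρ ∗ φ) − ρ ∗ N(φ). The orbit over a compact time interval is a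
compact subset of H¹, hence the defect tends to zero in L² uniformly there (`exists_defect_le`). The
mass law and the Morawetz identity pair the defect with at most first derivatives of ρ ∗ φ, so this
suffices for them.

The H¹ bound that is uniform in time needs conservation of energy, and this is the delicate point:
the energy of ρ ∗ φ changes by the pairing of the defect with Δ(ρ ∗ φ), and the latter may grow like
ε⁻¹ when the scale ε of the mollifier tends to zero. Two facts compensate. The linear term of the
Taylor expansion of N at the mollified value averages to zero, so the defect is quadratic in the
increments of φ (`enorm_gpNonlinearity_mol_sub_le`). On a short time interval the increments φ(· −
y) − φ are O(|y|) in L³ of space-time (`exists_strichartz`). In the resulting trilinear estimate the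
powers of ε cancel, and smallness comes from the continuity of translations in L⁶, uniform on the
compact orbit (`IsSol.exists_energyError_le`).

The short-time estimate is a Strichartz estimate for the difference of two solutions. It combines
the dispersive bound (`enorm_schL_le`), its interpolation with the L² isometry
(`lintegral_cube_le_of_dispersive`), Duhamel's formula for weak solutions (`IsWeakSol.duhamel`), and
a TT* argument (`enorm_integral_bil_le`). The time kernel is |t|^(-1/2), and on a bounded interval
the local integrability of |t|^(-3/4) takes the place of the Hardy–Littlewood–Sobolev inequality. No
well-posedness theory enters: every solution of the class is treated directly. -/

/-- Smooth compactly supported complex-valued functions on `ℝ³`. -/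
structure BumpKernel where
  toFun : R3 → ℂ
  smooth : ContDiff ℝ ∞ toFun
  compact : HasCompactSupport toFun

/-! ### Smooth kernels: derivatives, reflections, scalings -/

namespace BumpKernel

instance : CoeFun BumpKernel (fun _ => R3 → ℂ) := ⟨toFun⟩

/-- The derivative of a kernel in the direction `v`. -/
noncomputable def d (v : R3) (ψ : BumpKernel) : BumpKernel where
  toFun x := fderiv ℝ ψ.toFun x v
  smooth := (ψ.smooth.fderiv_right (m := ∞) (by simp)).clm_apply contDiff_const
  compact := by
    have h := ψ.compact.fderiv (𝕜 := ℝ)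
    exact h.comp_left (g := fun L : R3 →L[ℝ] ℂ => L v) (by simp)

theorem continuous (ψ : BumpKernel) : Continuous ψ := ψ.smooth.continuous

theorem memLp (ψ : BumpKernel) (p : ℝ≥0∞) : MemLp ψ p volume :=
  ψ.continuous.memLp_of_hasCompactSupport ψ.compact

theorem integrable (ψ : BumpKernel) : Integrable ψ volume :=
  ψ.continuous.integrable_of_hasCompactSupport ψ.compact

/-- The Schwartz function attached to a kernel. -/
noncomputable def toSchwartz (ψ : BumpKernel) : 𝓢(R3, ℂ) := ψ.compact.toSchwartzMap ψ.smooth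

@[simp] theorem toSchwartz_apply (ψ : BumpKernel) (x : R3) : ψ.toSchwartz x = ψ x := rfl

/-- The reflected and translated kernel `y ↦ ψ (x - y)`. -/
noncomputable def refl (ψ : BumpKernel) (x : R3) : BumpKernel where
  toFun y := ψ (x - y)
  smooth := ψ.smooth.comp (contDiff_const.sub contDiff_id)
  compact := ψ.compact.comp_homeomorph (Homeomorph.subLeft x)

@[simp] theorem refl_apply (ψ : BumpKernel) (x y : R3) : ψ.refl x y = ψ (x - y) := rfl

theorem d_refl (ψ : BumpKernel) (x v y : R3) : (ψ.refl x).d v y = - (ψ.d v (x - y)) := by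
  have h1 : HasFDerivAt ψ.toFun (fderiv ℝ ψ.toFun (x - y)) (x - y) :=
    (ψ.smooth.differentiable (by simp) _).hasFDerivAt
  have h2 : HasFDerivAt (fun y : R3 => x - y) (-(ContinuousLinearMap.id ℝ R3)) y := by
    simpa using (hasFDerivAt_id y).const_sub x
  have h3 := (h1.comp y h2).fderiv
  change fderiv ℝ (fun y => ψ.toFun (x - y)) y v = - fderiv ℝ ψ.toFun (x - y) v
  have h4 : (fun y => ψ.toFun (x - y)) = ψ.toFun ∘ fun y => x - y := rfl
  rw [h4, h3]
  simp

theorem lineDeriv_toSchwartz (ψ : BumpKernel) (v : R3) : ∂_{v} ψ.toSchwartz = (ψ.d v).toSchwartz := by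
  ext x
  rw [SchwartzMap.lineDerivOp_apply_eq_fderiv]
  rfl

end BumpKernel

/-- The unit vector in the `k`-th coordinate direction. -/
noncomputable abbrev e3 (k : Fin 3) : R3 := EuclideanSpace.single k (1 : ℝ)

theorem laplacian_schwartz_eq (ψ : 𝓢(R3, ℂ)) : Δ ψ = ∑ k : Fin 3, ∂_{e3 k} (∂_{e3 k} ψ) := by
  rw [SchwartzMap.laplacian_eq_sum (EuclideanSpace.basisFun (Fin 3) ℝ)]
  simp [e3]

/-! ### Convolution of an L² function with a smooth kernel -/

/-- The convolution of `f` with the kernel `ψ`. -/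
noncomputable def mol (ψ f : R3 → ℂ) (x : R3) : ℂ := ∫ y, f y * ψ (x - y)

theorem mol_swap (ψ f : R3 → ℂ) (x : R3) : mol ψ f x = ∫ y, f (x - y) * ψ y := by
  unfold mol
  rw [← integral_sub_left_eq_self _ volume x]
  simp

theorem mol_congr_ae {ψ f g : R3 → ℂ} (h : f =ᵐ[volume] g) : mol ψ f = mol ψ g := by
  funext x
  refine integral_congr_ae ?_
  filter_upwards [h] with y hy
  rw [hy]

theorem mol_integrand_integrable (ψ : BumpKernel) {f : R3 → ℂ} (hf : MemLp f 2 volume) (x : R3) :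
    Integrable (fun y => f y * ψ (x - y)) volume :=
  hf.integrable_mul ((ψ.refl x).memLp 2)

theorem mol_sub (ψ : BumpKernel) {f g : R3 → ℂ} (hf : MemLp f 2 volume) (hg : MemLp g 2 volume) :
    mol ψ (f - g) = mol ψ f - mol ψ g := by
  funext x
  simp only [mol, Pi.sub_apply, sub_mul]
  exact integral_sub (mol_integrand_integrable ψ hf x) (mol_integrand_integrable ψ hg x)

theorem mol_eq_convolution (ψ f : R3 → ℂ) :
    mol ψ f = (f ⋆[ContinuousLinearMap.mul ℝ ℂ, volume] ψ) := by
  funext x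
  simp [mol, convolution_def]

theorem mol_hasFDerivAt (ψ : BumpKernel) {f : R3 → ℂ} (hf : MemLp f 2 volume) (x : R3) :
    HasFDerivAt (mol ψ f)
      ((f ⋆[(ContinuousLinearMap.mul ℝ ℂ).precompR R3, volume] fderiv ℝ ψ) x) x := by
  rw [mol_eq_convolution]
  exact ψ.compact.hasFDerivAt_convolution_right _ (hf.locallyIntegrable (by norm_num))
    (ψ.smooth.of_le (by simp)) x

/-- The derivative falls on the kernel, so no regularity of f is required. All later calculus of
mollified functions goes through this rule and the operator `d` on kernels. -/
theorem mol_hasLineDerivAt (ψ : BumpKernel) {f : R3 → ℂ} (hf : MemLp f 2 volume) (x v : R3) :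
    HasLineDerivAt ℝ (mol ψ f) (mol (ψ.d v) f x) x v := by
  have h := (mol_hasFDerivAt ψ hf x).hasLineDerivAt v
  rw [convolution_precompR_apply _ (hf.locallyIntegrable (by norm_num)) (ψ.compact.fderiv (𝕜 := ℝ))
    (ψ.smooth.continuous_fderiv (by simp))] at h
  rw [mol_eq_convolution (ψ.d v).toFun]
  exact h

theorem mol_continuous (ψ : BumpKernel) {f : R3 → ℂ} (hf : MemLp f 2 volume) :
    Continuous (mol ψ f) :=
  continuous_iff_continuousAt.2 fun x => (mol_hasFDerivAt ψ hf x).continuousAt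

theorem mol_contDiff (ψ : BumpKernel) {f : R3 → ℂ} (hf : MemLp f 2 volume) :
    ContDiff ℝ ∞ (mol ψ f) := by
  rw [mol_eq_convolution]
  exact ψ.compact.contDiff_convolution_right _ (hf.locallyIntegrable (by norm_num)) ψ.smooth

/-! ### Jensen's inequality and Lᵖ bounds for convolutions -/

/-- Jensen's inequality for powers, for a finite measure. -/
theorem lintegral_pow_le_measure_mul {α : Type*} [MeasurableSpace α] {σ : Measure α} {h : α → ℝ≥0∞}
    (hh : AEMeasurable h σ) (k : ℕ) :
    (∫⁻ a, h a ∂σ) ^ (k + 1) ≤ σ Set.univ ^ k * ∫⁻ a, h a ^ (k + 1) ∂σ := by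
  rcases Nat.eq_zero_or_pos k with rfl | hk
  · simp
  have hk' : (1 : ℝ) < (k : ℝ) + 1 := by
    have : (0 : ℝ) < k := by exact_mod_cast hk
    linarith
  -- Hölder with exponents k + 1 and (k + 1)/k against the constant function 1 leaves the total mass
  -- to the power k.
  have hpq : ((k : ℝ) + 1).HolderConjugate (((k : ℝ) + 1) / k) := by
    rw [Real.holderConjugate_iff]
    refine ⟨hk', ?_⟩
    have : (k : ℝ) ≠ 0 := by positivity
    field_simp
    ring
  have h1 := ENNReal.lintegral_mul_le_Lp_mul_Lq σ hpq hh (g := fun _ => 1) aemeasurable_const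
  simp only [Pi.mul_apply, mul_one, ENNReal.one_rpow, lintegral_const, one_mul] at h1
  calc (∫⁻ a, h a ∂σ) ^ (k + 1)
      ≤ ((∫⁻ a, h a ^ ((k : ℝ) + 1) ∂σ) ^ (1 / ((k : ℝ) + 1)) *
          σ Set.univ ^ (1 / (((k : ℝ) + 1) / k))) ^ (k + 1) := by gcongr
    _ = σ Set.univ ^ k * ∫⁻ a, h a ^ (k + 1) ∂σ := by
      rw [mul_pow, ← ENNReal.rpow_natCast, ← ENNReal.rpow_natCast, ← ENNReal.rpow_mul,
        ← ENNReal.rpow_mul, mul_comm]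
      congr 1
      · rw [← ENNReal.rpow_natCast]
        congr 1
        push_cast
        have : (k : ℝ) + 1 ≠ 0 := by positivity
        field_simp
      · push_cast
        have : (k : ℝ) + 1 ≠ 0 := by positivity
        rw [one_div, inv_mul_cancel₀ this, ENNReal.rpow_one]
        congr 1
        funext a
        rw [← ENNReal.rpow_natCast]
        push_cast
        rfl

/-- Jensen's inequality for an integral against a kernel `K`, integrated over a parameter. -/
theorem lintegral_lintegral_mul_pow_le {α β : Type*} [MeasurableSpace α] [MeasurableSpace β]
    {μ : Measure α} {ν : Measure β} [SFinite μ] [SFinite ν] {h : α → β → ℝ≥0∞} {K : β → ℝ≥0∞}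
    (hh : AEMeasurable (Function.uncurry h) (μ.prod ν)) (hK : Measurable K) (k : ℕ) :
    ∫⁻ x, (∫⁻ y, h x y * K y ∂ν) ^ (k + 1) ∂μ ≤
      (∫⁻ y, K y ∂ν) ^ k * ∫⁻ y, (∫⁻ x, h x y ^ (k + 1) ∂μ) * K y ∂ν := by
  have hx : ∀ᵐ x ∂μ, AEMeasurable (h x) ν := by
    filter_upwards [hh.aestronglyMeasurable.prodMk_left] with x hx
    exact hx.aemeasurable
  have h1 : ∀ᵐ x ∂μ, (∫⁻ y, h x y * K y ∂ν) ^ (k + 1) ≤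
      (∫⁻ y, K y ∂ν) ^ k * ∫⁻ y, h x y ^ (k + 1) * K y ∂ν := by
    filter_upwards [hx] with x hx
    -- For fixed x the bound is Jensen's inequality for the measure of density K; the remaining
    -- steps are Tonelli.
    have hac : ν.withDensity K ≪ ν := withDensity_absolutelyContinuous _ _
    have := lintegral_pow_le_measure_mul (σ := ν.withDensity K) (hx.mono_ac hac) k
    rw [withDensity_apply _ MeasurableSet.univ, Measure.restrict_univ,
      lintegral_withDensity_eq_lintegral_mul₀ hK.aemeasurable hx,
      lintegral_withDensity_eq_lintegral_mul₀ hK.aemeasurable (hx.pow_const _)] at this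
    simpa [mul_comm] using this
  have hm : AEMeasurable (fun z : α × β => h z.1 z.2 ^ (k + 1) * K z.2) (μ.prod ν) :=
    (hh.pow_const (k + 1)).mul (hK.comp measurable_snd).aemeasurable
  calc ∫⁻ x, (∫⁻ y, h x y * K y ∂ν) ^ (k + 1) ∂μ
      ≤ ∫⁻ x, (∫⁻ y, K y ∂ν) ^ k * ∫⁻ y, h x y ^ (k + 1) * K y ∂ν ∂μ := lintegral_mono_ae h1
    _ = (∫⁻ y, K y ∂ν) ^ k * ∫⁻ x, ∫⁻ y, h x y ^ (k + 1) * K y ∂ν ∂μ := by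
      rw [lintegral_const_mul'' _ hm.lintegral_prod_right']
    _ = (∫⁻ y, K y ∂ν) ^ k * ∫⁻ y, ∫⁻ x, h x y ^ (k + 1) * K y ∂μ ∂ν := by
      rw [lintegral_lintegral_swap hm]
    _ = _ := by
      congr 1
      refine lintegral_congr_ae ?_
      have := (hh.comp_quasiMeasurePreserving Measure.measurePreserving_swap.quasiMeasurePreserving : AEMeasurable (fun z : β × α => h z.2 z.1) (ν.prod μ))
      filter_upwards [this.aestronglyMeasurable.prodMk_left] with y hy
      rw [lintegral_mul_const'' _ (AEMeasurable.pow_const (f := fun x => h x y) hy.aemeasurable _)]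

theorem aemeasurable_comp_sub {E : Type*} [NormedAddCommGroup E] {f : R3 → E}
    (hf : AEStronglyMeasurable f volume) :
    AEStronglyMeasurable (fun z : R3 × R3 => f (z.1 - z.2)) (volume.prod volume) :=
  hf.comp_quasiMeasurePreserving (quasiMeasurePreserving_sub volume volume)

/-- Young's inequality for L¹ ∗ Lᵖ with integer p: Jensen against the weight |ψ|, then translation
invariance of Lebesgue measure. -/
theorem mol_lintegral_pow_le (ψ : BumpKernel) {f : R3 → ℂ} (hf : AEStronglyMeasurable f volume)
    (k : ℕ) :
    ∫⁻ x, ‖mol ψ f x‖ₑ ^ (k + 1) ≤ (∫⁻ y, ‖ψ y‖ₑ) ^ (k + 1) * ∫⁻ x, ‖f x‖ₑ ^ (k + 1) := by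
  calc ∫⁻ x, ‖mol ψ f x‖ₑ ^ (k + 1)
      ≤ ∫⁻ x, (∫⁻ y, ‖f (x - y)‖ₑ * ‖ψ y‖ₑ) ^ (k + 1) := by
        refine lintegral_mono fun x => ?_
        dsimp only
        gcongr
        rw [mol_swap]
        refine (enorm_integral_le_lintegral_enorm _).trans (le_of_eq ?_)
        simp
    _ ≤ (∫⁻ y, ‖ψ y‖ₑ) ^ k * ∫⁻ y, (∫⁻ x, ‖f (x - y)‖ₑ ^ (k + 1)) * ‖ψ y‖ₑ :=
        lintegral_lintegral_mul_pow_le (aemeasurable_comp_sub hf).enorm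
          ψ.continuous.measurable.enorm k
    _ = _ := by
        have : ∀ y : R3, ∫⁻ x, ‖f (x - y)‖ₑ ^ (k + 1) = ∫⁻ x, ‖f x‖ₑ ^ (k + 1) := fun y =>
          lintegral_sub_right_eq_self (fun x => ‖f x‖ₑ ^ (k + 1)) y
        simp_rw [this]
        rw [lintegral_const_mul _ ψ.continuous.measurable.enorm, pow_succ]
        ring

theorem eLpNorm_two_sq {E : Type*} [NormedAddCommGroup E] {α : Type*} [MeasurableSpace α]
    {μ : Measure α} (f : α → E) : eLpNorm f 2 μ ^ 2 = ∫⁻ x, ‖f x‖ₑ ^ 2 ∂μ := by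
  have := eLpNorm_nnreal_pow_eq_lintegral (f := f) (μ := μ) (p := 2) (by norm_num)
  simpa using this

theorem mol_eLpNorm_two_le (ψ : BumpKernel) {f : R3 → ℂ} (hf : AEStronglyMeasurable f volume) :
    eLpNorm (mol ψ f) 2 volume ≤ (∫⁻ y, ‖ψ y‖ₑ) * eLpNorm f 2 volume := by
  rw [← ENNReal.pow_le_pow_left_iff two_ne_zero, mul_pow, eLpNorm_two_sq, eLpNorm_two_sq]
  exact mol_lintegral_pow_le ψ hf 1

theorem mol_memLp_two (ψ : BumpKernel) {f : R3 → ℂ} (hf : MemLp f 2 volume) :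
    MemLp (mol ψ f) 2 volume :=
  ⟨(mol_continuous ψ hf).aestronglyMeasurable, (mol_eLpNorm_two_le ψ hf.1).trans_lt
    (ENNReal.mul_lt_top ψ.integrable.2 hf.2)⟩

theorem norm_integral_mul_le {f g : R3 → ℂ} (hf : MemLp f 2 volume) (hg : MemLp g 2 volume) :
    ‖∫ y, f y * g y‖ ≤ (eLpNorm f 2 volume).toReal * (eLpNorm g 2 volume).toReal := by
  have h := eLpNorm_smul_le_mul_eLpNorm (p := 2) (q := 2) (r := 1) hg.1 hf.1
  rw [← ENNReal.toReal_mul]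
  have h2 : ‖∫ y, f y * g y‖ₑ ≤ eLpNorm f 2 volume * eLpNorm g 2 volume := by
    refine (enorm_integral_le_lintegral_enorm _).trans ?_
    rw [eLpNorm_one_eq_lintegral_enorm] at h
    simpa using h
  have h3 := ENNReal.toReal_mono (ENNReal.mul_lt_top hf.2 hg.2).ne h2
  simpa using h3

theorem norm_mol_le (ψ : BumpKernel) {f : R3 → ℂ} (hf : MemLp f 2 volume) (x : R3) :
    ‖mol ψ f x‖ ≤ (eLpNorm f 2 volume).toReal * (eLpNorm ψ 2 volume).toReal := by
  have h := norm_integral_mul_le hf ((ψ.refl x).memLp 2)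
  have h2 : eLpNorm (ψ.refl x) 2 volume = eLpNorm ψ 2 volume :=
    eLpNorm_comp_measurePreserving (f := fun y => x - y) ψ.continuous.aestronglyMeasurable
      (Measure.measurePreserving_sub_left volume x)
  rw [h2] at h
  exact h

/-- Convolutions of a continuous curve in `L²` are jointly continuous. -/
theorem mol_continuous_uncurry (ψ : BumpKernel) {f : ℝ → L2R3} (hf : Continuous f) :
    Continuous (fun p : ℝ × R3 => mol ψ (f p.1) p.2) := by
  rw [continuous_iff_continuousAt]
  rintro ⟨t, x⟩
  have h1 : Filter.Tendsto (fun p : ℝ × R3 => mol ψ (f t) p.2) (𝓝 (t, x)) (𝓝 (mol ψ (f t) x)) :=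
    ((mol_continuous ψ (Lp.memLp (f t))).continuousAt.tendsto).comp continuousAt_snd
  have h2 : Filter.Tendsto (fun p : ℝ × R3 => mol ψ (f p.1) p.2 - mol ψ (f t) p.2) (𝓝 (t, x))
      (𝓝 0) := by
    have hb : ∀ p : ℝ × R3, ‖mol ψ (f p.1) p.2 - mol ψ (f t) p.2‖ ≤
        ‖f p.1 - f t‖ * (eLpNorm ψ 2 volume).toReal := by
      intro p
      have h := norm_mol_le ψ ((Lp.memLp (f p.1)).sub (Lp.memLp (f t))) p.2
      rw [mol_sub ψ (Lp.memLp _) (Lp.memLp _)] at h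
      refine h.trans (le_of_eq ?_)
      rw [Lp.norm_def, eLpNorm_congr_ae (Lp.coeFn_sub (f p.1) (f t))]
    refine squeeze_zero_norm hb ?_
    have : Continuous fun p : ℝ × R3 => ‖f p.1 - f t‖ * (eLpNorm ψ 2 volume).toReal := by fun_prop
    have h := this.tendsto (t, x)
    simpa using h
  have := h2.add h1
  simpa [ContinuousAt] using this

/-! ### Translations on L² and on H¹ -/

/-- Translation by `y` on `L²(ℝ³)`: `f ↦ f(· - y)`. -/
noncomputable def trL (y : R3) : L2R3 →ₗᵢ[ℂ] L2R3 :=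
  Lp.compMeasurePreservingₗᵢ ℂ (fun x : R3 => x - y) (measurePreserving_sub_right volume y)

theorem trL_coeFn (y : R3) (f : L2R3) : trL y f =ᵐ[volume] fun x => f (x - y) :=
  Lp.coeFn_compMeasurePreserving f (measurePreserving_sub_right volume y)

theorem trL_continuous : Continuous (fun p : R3 × L2R3 => trL p.1 p.2) := by
  let g : R3 × L2R3 → C(R3, R3) := fun p => ⟨fun x => x - p.1, by fun_prop⟩
  have hg : Continuous g := by
    refine ContinuousMap.continuous_of_continuous_uncurry _ ?_
    change Continuous fun q : (R3 × L2R3) × R3 => q.2 - q.1.1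
    fun_prop
  exact Continuous.compMeasurePreservingLp (f := fun p : R3 × L2R3 => p.2) continuous_snd hg
    (fun p => measurePreserving_sub_right volume p.1) (by norm_num)

theorem trL_zero (f : L2R3) : trL 0 f = f := by
  refine Lp.ext ?_
  filter_upwards [trL_coeFn 0 f] with x hx
  rw [hx, sub_zero]

namespace H1

/-- The underlying `L²` function of an element of `H¹`. -/
noncomputable def fn : H1R3 →L[ℂ] L2R3 :=
  (WithLp.fstL 2 ℂ L2R3 (PiLp 2 (fun _ : Fin 3 => L2R3))).comp H1R3.subtypeL

/-- The partial derivatives of an element of `H¹`. -/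
noncomputable def grad (k : Fin 3) : H1R3 →L[ℂ] L2R3 :=
  ((PiLp.proj 2 (fun _ : Fin 3 => L2R3) k).comp
    (WithLp.sndL 2 ℂ L2R3 (PiLp 2 (fun _ : Fin 3 => L2R3)))).comp H1R3.subtypeL

theorem fn_apply (u : H1R3) : fn u = u.1.fst := rfl

theorem grad_apply (u : H1R3) (k : Fin 3) : grad k u = u.1.snd k := rfl

theorem norm_sq_eq (u : H1R3) : ‖u‖ ^ 2 = ‖fn u‖ ^ 2 + ∑ k, ‖grad k u‖ ^ 2 := by
  change ‖u.1‖ ^ 2 = _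
  rw [WithLp.prod_norm_sq_eq_of_L2, PiLp.norm_sq_eq_of_L2]
  rfl

theorem norm_fn_le (u : H1R3) : ‖fn u‖ ≤ ‖u‖ := by
  refine abs_le_of_sq_le_sq' ?_ (norm_nonneg _) |>.2
  rw [norm_sq_eq u]
  have : 0 ≤ ∑ k, ‖grad k u‖ ^ 2 := by positivity
  linarith

theorem norm_grad_le (u : H1R3) (k : Fin 3) : ‖grad k u‖ ≤ ‖u‖ := by
  refine abs_le_of_sq_le_sq' ?_ (norm_nonneg _) |>.2
  rw [norm_sq_eq u]
  have : ‖grad k u‖ ^ 2 ≤ ∑ k, ‖grad k u‖ ^ 2 :=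
    Finset.single_le_sum (f := fun k => ‖grad k u‖ ^ 2) (fun i _ => by positivity) (Finset.mem_univ k)
  nlinarith [sq_nonneg ‖fn u‖]

theorem integral_mul_lineDeriv (u : H1R3) (k : Fin 3) (ψ : 𝓢(R3, ℂ)) :
    ∫ x, fn u x * (∂_{e3 k} ψ) x = - ∫ x, grad k u x * ψ x := by
  have h := u.2 k
  have h2 := congrArg (fun T : 𝓢'(R3, ℂ) => T ψ) h
  simp only [TemperedDistribution.lineDerivOp_apply_apply, Lp.toTemperedDistribution_apply] at h2
  have h3 : ∫ x, fn u x * (∂_{e3 k} ψ) x = - ∫ x, (-∂_{e3 k} ψ) x • (u.1.fst : R3 → ℂ) x := by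
    rw [← integral_neg]
    congr 1
    funext x
    simp [fn_apply]
    ring
  rw [h3, h2]
  congr 2
  funext x
  simp [grad_apply]
  ring

/-- For fixed x the function y ↦ ψ(x − y) is a test function. The sign from the weak derivative
cancels the sign from the reflection. -/
theorem mol_d (u : H1R3) (k : Fin 3) (ψ : BumpKernel) : mol (ψ.d (e3 k)) (fn u) = mol ψ (grad k u) := by
  funext x
  have h := integral_mul_lineDeriv u k (ψ.refl x).toSchwartz
  rw [BumpKernel.lineDeriv_toSchwartz] at h
  simp only [BumpKernel.toSchwartz_apply, BumpKernel.d_refl, BumpKernel.refl_apply] at h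
  simp only [mul_neg, integral_neg, neg_inj] at h
  exact h

/-- Construct an element of `H¹` from a function and its weak derivatives. -/
noncomputable def mk (f : L2R3) (g : Fin 3 → L2R3)
    (h : ∀ (k : Fin 3) (ψ : 𝓢(R3, ℂ)), ∫ x, f x * (∂_{e3 k} ψ) x = - ∫ x, g k x * ψ x) : H1R3 :=
  ⟨WithLp.toLp 2 (f, WithLp.toLp 2 g), by
    intro k
    ext ψ
    simp only [TemperedDistribution.lineDerivOp_apply_apply, Lp.toTemperedDistribution_apply]
    have := h k ψ
    have h3 : ∫ x, (-∂_{e3 k} ψ) x • (f : R3 → ℂ) x = - ∫ x, f x * (∂_{e3 k} ψ) x := by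
      rw [← integral_neg]
      congr 1
      funext x
      simp
      ring
    change ∫ x, (-∂_{e3 k} ψ) x • (f : R3 → ℂ) x = ∫ x, ψ x • (g k : R3 → ℂ) x
    rw [h3, this, neg_neg]
    congr 1
    funext x
    simp [mul_comm]⟩

theorem integral_trL_mul (y : R3) (f : L2R3) (ψ : 𝓢(R3, ℂ)) :
    ∫ x, trL y f x * ψ x = ∫ x, f x * (ψ.compSubConstCLM ℂ (-y)) x := by
  have h1 : ∫ x, trL y f x * ψ x = ∫ x, f (x - y) * ψ x := by
    refine integral_congr_ae ?_
    filter_upwards [trL_coeFn y f] with x hx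
    rw [hx]
  rw [h1, ← integral_sub_right_eq_self (fun x => f x * (ψ.compSubConstCLM ℂ (-y)) x) y]
  simp

theorem lineDeriv_compSubConst (ψ : 𝓢(R3, ℂ)) (y v : R3) :
    ∂_{v} (ψ.compSubConstCLM ℂ y) = (∂_{v} ψ).compSubConstCLM ℂ y := by
  ext x
  rw [SchwartzMap.lineDerivOp_apply_eq_fderiv, SchwartzMap.compSubConstCLM_apply,
    SchwartzMap.lineDerivOp_apply_eq_fderiv]
  have : (ψ.compSubConstCLM ℂ y : R3 → ℂ) = fun x => ψ (x - y) := rfl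
  rw [this, fderiv_comp_sub]

/-- Translation on `H¹`. -/
noncomputable def tr (y : R3) (u : H1R3) : H1R3 :=
  mk (trL y (fn u)) (fun k => trL y (grad k u)) (by
    intro k ψ
    rw [integral_trL_mul, integral_trL_mul, ← lineDeriv_compSubConst, integral_mul_lineDeriv])

@[simp] theorem fn_tr (y : R3) (u : H1R3) : fn (tr y u) = trL y (fn u) := rfl

@[simp] theorem grad_tr (y : R3) (u : H1R3) (k : Fin 3) : grad k (tr y u) = trL y (grad k u) := rfl

theorem tr_continuous : Continuous (fun p : R3 × H1R3 => tr p.1 p.2) := by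
  rw [continuous_iff_continuousAt]
  intro p₀
  have h1 : Continuous fun p : R3 × H1R3 => ‖trL p.1 (fn p.2) - trL p₀.1 (fn p₀.2)‖ ^ 2 +
      ∑ k, ‖trL p.1 (grad k p.2) - trL p₀.1 (grad k p₀.2)‖ ^ 2 := by
    have h (L : H1R3 →L[ℂ] L2R3) : Continuous fun p : R3 × H1R3 => trL p.1 (L p.2) :=
      trL_continuous.comp (continuous_fst.prodMk (L.continuous.comp continuous_snd))
    exact (((h fn).sub continuous_const).norm.pow 2).add
      (continuous_finsetSum _ fun k _ => ((h (grad k)).sub continuous_const).norm.pow 2)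
  have h2 := h1.tendsto p₀
  have h3 : Filter.Tendsto (fun p : R3 × H1R3 => ‖tr p.1 p.2 - tr p₀.1 p₀.2‖ ^ 2) (𝓝 p₀) (𝓝 0) := by
    simp only [norm_sq_eq, map_sub, fn_tr, grad_tr]
    simpa using h2
  have h4 : Filter.Tendsto (fun p : R3 × H1R3 => ‖tr p.1 p.2 - tr p₀.1 p₀.2‖) (𝓝 p₀) (𝓝 0) := by
    have := h3.sqrt
    simpa [Real.sqrt_sq] using this
  exact tendsto_iff_norm_sub_tendsto_zero.2 h4

theorem ext_fn {u v : H1R3} (h : fn u = fn v) (h' : ∀ k, grad k u = grad k v) : u = v := by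
  have h1 : ‖u - v‖ ^ 2 = 0 := by
    rw [norm_sq_eq, map_sub, h, sub_self]
    simp [map_sub, h']
  exact sub_eq_zero.1 (norm_eq_zero.1 (pow_eq_zero_iff two_ne_zero |>.1 h1))

theorem tr_zero (u : H1R3) : tr 0 u = u :=
  ext_fn (by simp [trL_zero]) (by simp [trL_zero])

theorem norm_tr (y : R3) (u : H1R3) : ‖tr y u‖ = ‖u‖ := by
  have : ‖tr y u‖ ^ 2 = ‖u‖ ^ 2 := by
    rw [norm_sq_eq, norm_sq_eq]
    simp
  exact (pow_left_inj₀ (norm_nonneg _) (norm_nonneg _) two_ne_zero).1 this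

end H1

/-! ### A scaled family of mollifiers -/

/-- A real bump function supported in the unit ball. -/
noncomputable def baseBump : ContDiffBump (0 : R3) := ⟨1 / 2, 1, by norm_num, by norm_num⟩

/-- A nonnegative kernel of integral one, supported in the unit ball. -/
noncomputable def eta : BumpKernel where
  toFun x := (baseBump.normed volume x : ℝ)
  smooth := Complex.ofRealCLM.contDiff.comp baseBump.contDiff_normed
  compact := baseBump.hasCompactSupport_normed.comp_left (g := fun r : ℝ => (r : ℂ)) (by simp)

namespace BumpKernel

/-- The kernel `ε⁻³ ψ(x / ε)`. -/
noncomputable def scale (ε : ℝ) (ψ : BumpKernel) (hε : ε ≠ 0) : BumpKernel where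
  toFun x := (ε⁻¹ ^ 3 : ℝ) * ψ (ε⁻¹ • x)
  smooth := contDiff_const.mul (ψ.smooth.comp (contDiff_id.const_smul ε⁻¹))
  compact := (ψ.compact.comp_homeomorph (Homeomorph.smulOfNeZero ε⁻¹ (inv_ne_zero hε))).mul_left

theorem scale_apply {ε : ℝ} (hε : ε ≠ 0) (ψ : BumpKernel) (x : R3) :
    ψ.scale ε hε x = (ε⁻¹ ^ 3 : ℝ) * ψ (ε⁻¹ • x) := rfl

theorem d_scale {ε : ℝ} (hε : ε ≠ 0) (ψ : BumpKernel) (v x : R3) :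
    (ψ.scale ε hε).d v x = (ε⁻¹ : ℝ) * (ψ.d v).scale ε hε x := by
  have h1 : HasFDerivAt ψ.toFun (fderiv ℝ ψ.toFun (ε⁻¹ • x)) (ε⁻¹ • x) :=
    (ψ.smooth.differentiable (by simp) _).hasFDerivAt
  have h2 : HasFDerivAt (fun y : R3 => ε⁻¹ • y) (ε⁻¹ • ContinuousLinearMap.id ℝ R3) x :=
    (hasFDerivAt_id x).const_smul ε⁻¹
  have h3 := ((h1.comp x h2).const_mul ((ε⁻¹ ^ 3 : ℝ) : ℂ)).fderiv
  change fderiv ℝ (fun y => ((ε⁻¹ ^ 3 : ℝ) : ℂ) * ψ.toFun (ε⁻¹ • y)) x v =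
    (ε⁻¹ : ℝ) * (((ε⁻¹ ^ 3 : ℝ) : ℂ) * (fderiv ℝ ψ.toFun (ε⁻¹ • x) v))
  have h4 : (fun y => ((ε⁻¹ ^ 3 : ℝ) : ℂ) * ψ.toFun (ε⁻¹ • y)) =
    fun y => ((ε⁻¹ ^ 3 : ℝ) : ℂ) * (ψ.toFun ∘ fun y => ε⁻¹ • y) y := rfl
  rw [h4, h3]
  simp
  ring

theorem lintegral_scale {ε : ℝ} (hε : 0 < ε) (ψ : BumpKernel) :
    ∫⁻ x, ‖ψ.scale ε hε.ne' x‖ₑ = ∫⁻ x, ‖ψ x‖ₑ := by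
  rw [← ofReal_integral_norm_eq_lintegral_enorm (integrable _),
    ← ofReal_integral_norm_eq_lintegral_enorm (integrable _)]
  congr 1
  simp only [scale_apply, norm_mul, Complex.norm_real, Real.norm_eq_abs]
  rw [integral_const_mul, Measure.integral_comp_smul volume (fun x => ‖ψ x‖)]
  simp only [finrank_euclideanSpace, Fintype.card_fin, smul_eq_mul]
  have : |(ε⁻¹ ^ 3)| = ε⁻¹ ^ 3 := abs_of_pos (by positivity)
  have h2 : |(ε⁻¹ ^ 3)⁻¹| = (ε⁻¹ ^ 3)⁻¹ := abs_of_pos (by positivity)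
  rw [this, h2, ← mul_assoc, mul_inv_cancel₀ (by positivity), one_mul]

theorem integral_scale {ε : ℝ} (hε : 0 < ε) (ψ : BumpKernel) :
    ∫ x, ψ.scale ε hε.ne' x = ∫ x, ψ x := by
  simp only [scale_apply]
  rw [integral_const_mul, Measure.integral_comp_smul volume (fun x => ψ x)]
  simp only [finrank_euclideanSpace, Fintype.card_fin]
  have h2 : |(ε⁻¹ ^ 3)⁻¹| = (ε⁻¹ ^ 3)⁻¹ := abs_of_pos (by positivity)
  rw [h2, Complex.real_smul, ← mul_assoc, ← Complex.ofReal_mul, mul_inv_cancel₀ (by positivity)]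
  simp

theorem scale_eq_zero {ε : ℝ} (hε : 0 < ε) {ψ : BumpKernel} (hψ : ∀ x, 1 ≤ ‖x‖ → ψ x = 0) (x : R3)
    (hx : ε ≤ ‖x‖) : ψ.scale ε hε.ne' x = 0 := by
  rw [scale_apply, hψ, mul_zero]
  rw [norm_smul, Real.norm_of_nonneg (by positivity)]
  rw [← inv_mul_cancel₀ hε.ne']
  gcongr

end BumpKernel

theorem eta_eq_zero (x : R3) (hx : 1 ≤ ‖x‖) : eta x = 0 := by
  have h : x ∉ Function.support (baseBump.normed volume) := by
    rw [ContDiffBump.support_normed_eq]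
    simpa [baseBump] using hx
  have : baseBump.normed volume x = 0 := by simpa using h
  change ((baseBump.normed volume x : ℝ) : ℂ) = 0
  simp [this]

theorem lintegral_eta : ∫⁻ x, ‖eta x‖ₑ = 1 := by
  rw [← ofReal_integral_norm_eq_lintegral_enorm eta.integrable]
  have : ∀ x, ‖eta x‖ = baseBump.normed volume x := fun x => by
    change ‖((baseBump.normed volume x : ℝ) : ℂ)‖ = _
    rw [Complex.norm_real, Real.norm_of_nonneg (baseBump.nonneg_normed x)]
  simp_rw [this]
  simp [baseBump.integral_normed]

theorem integral_eta : ∫ x, eta x = 1 := by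
  have : ∫ x, eta x = ∫ x, ((baseBump.normed volume x : ℝ) : ℂ) := rfl
  rw [this, integral_complex_ofReal, baseBump.integral_normed]
  simp

/-- The standard mollifier at scale `ε`. -/
noncomputable def moll (ε : ℝ) (hε : 0 < ε) : BumpKernel := eta.scale ε hε.ne'

theorem lintegral_moll {ε : ℝ} (hε : 0 < ε) : ∫⁻ x, ‖moll ε hε x‖ₑ = 1 := by
  rw [moll, BumpKernel.lintegral_scale hε, lintegral_eta]

theorem integral_moll {ε : ℝ} (hε : 0 < ε) : ∫ x, moll ε hε x = 1 := by
  rw [moll, BumpKernel.integral_scale hε, integral_eta]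

theorem moll_eq_zero {ε : ℝ} (hε : 0 < ε) (x : R3) (hx : ε ≤ ‖x‖) : moll ε hε x = 0 :=
  BumpKernel.scale_eq_zero hε eta_eq_zero x hx

theorem mol_moll_eLpNorm_two_le {ε : ℝ} (hε : 0 < ε) {f : R3 → ℂ}
    (hf : AEStronglyMeasurable f volume) :
    eLpNorm (mol (moll ε hε) f) 2 volume ≤ eLpNorm f 2 volume := by
  have := mol_eLpNorm_two_le (moll ε hε) hf
  rwa [lintegral_moll, one_mul] at this

/-- The kernel has integral one, so any constant can be moved inside. With c = f(x) this expresses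
the error by increments; with c equal to the mollified value it expresses that the fluctuations
average to zero. -/
theorem mol_moll_sub_eq {ε : ℝ} (hε : 0 < ε) {f : R3 → ℂ} (hf : MemLp f 2 volume) (x : R3) (c : ℂ) :
    mol (moll ε hε) f x - c = ∫ y, (f (x - y) - c) * moll ε hε y := by
  have h : Integrable (fun y => f (x - y) * moll ε hε y) := by
    have := (mol_integrand_integrable (moll ε hε) hf x).comp_sub_left x
    simpa using this
  simp only [sub_mul]
  rw [integral_sub h ((moll ε hε).integrable.const_mul c), ← mol_swap, integral_const_mul,
    integral_moll, mul_one]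

/-- The `Lᵖ` distance of a mollification to the function is controlled by translations. -/
theorem mol_moll_sub_lintegral_pow_le {ε : ℝ} (hε : 0 < ε) {f : R3 → ℂ} (hf : MemLp f 2 volume)
    (k : ℕ) : ∫⁻ x, ‖mol (moll ε hε) f x - f x‖ₑ ^ (k + 1) ≤
      ∫⁻ y, (∫⁻ x, ‖f (x - y) - f x‖ₑ ^ (k + 1)) * ‖moll ε hε y‖ₑ := by
  have hm : AEMeasurable (Function.uncurry fun x y : R3 => ‖f (x - y) - f x‖ₑ)
      (volume.prod volume) :=
    ((aemeasurable_comp_sub hf.1).sub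
      (hf.1.comp_quasiMeasurePreserving Measure.quasiMeasurePreserving_fst)).enorm
  calc ∫⁻ x, ‖mol (moll ε hε) f x - f x‖ₑ ^ (k + 1)
      ≤ ∫⁻ x, (∫⁻ y, ‖f (x - y) - f x‖ₑ * ‖moll ε hε y‖ₑ) ^ (k + 1) := by
        refine lintegral_mono fun x => ?_
        dsimp only
        gcongr
        rw [mol_moll_sub_eq hε hf]
        refine (enorm_integral_le_lintegral_enorm _).trans (le_of_eq ?_)
        simp
    _ ≤ _ := by
        have := lintegral_lintegral_mul_pow_le hm (moll ε hε).continuous.measurable.enorm k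
        rwa [lintegral_moll, one_pow, one_mul] at this

theorem mol_moll_sub_lintegral_pow_le_of_forall {ε : ℝ} (hε : 0 < ε) {f : R3 → ℂ}
    (hf : MemLp f 2 volume) (k : ℕ) {A : ℝ≥0∞}
    (hA : ∀ y : R3, ‖y‖ < ε → ∫⁻ x, ‖f (x - y) - f x‖ₑ ^ (k + 1) ≤ A) :
    ∫⁻ x, ‖mol (moll ε hε) f x - f x‖ₑ ^ (k + 1) ≤ A := by
  refine (mol_moll_sub_lintegral_pow_le hε hf k).trans ?_
  calc ∫⁻ y, (∫⁻ x, ‖f (x - y) - f x‖ₑ ^ (k + 1)) * ‖moll ε hε y‖ₑ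
      ≤ ∫⁻ y, A * ‖moll ε hε y‖ₑ := by
        refine lintegral_mono fun y => ?_
        dsimp only
        rcases lt_or_ge ‖y‖ ε with h | h
        · gcongr
          exact hA y h
        · simp [moll_eq_zero hε y h]
    _ = A := by
        rw [lintegral_const_mul _ (moll ε hε).continuous.measurable.enorm, lintegral_moll, mul_one]

theorem trL_sub_eLpNorm (y : R3) (f : L2R3) :
    eLpNorm (fun x => f (x - y) - f x) 2 volume = ENNReal.ofReal ‖trL y f - f‖ := by
  rw [Lp.norm_def, ENNReal.ofReal_toReal (Lp.eLpNorm_ne_top _)]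
  refine eLpNorm_congr_ae ?_
  filter_upwards [trL_coeFn y f, Lp.coeFn_sub (trL y f) f] with x h1 h2
  rw [h2, Pi.sub_apply, h1]

/-- The open set {F < r} contains {0} × K, hence by the tube lemma a product of neighbourhoods. This
is the source of all statements that are uniform along a compact piece of the orbit: for
translations in L², for L⁶ increments, and for the autocorrelation of the density. -/
theorem exists_forall_norm_lt_of_isCompact {X : Type*} [TopologicalSpace X] {F : R3 × X → ℝ}
    (hF : Continuous F) (h0 : ∀ f, F (0, f) = 0) {K : Set X} (hK : IsCompact K) {r : ℝ}
    (hr : 0 < r) : ∃ δ > 0, ∀ f ∈ K, ∀ y : R3, ‖y‖ < δ → F (y, f) < r := by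
  have hopen : IsOpen {p : R3 × X | F p < r} := isOpen_lt hF continuous_const
  have hsub : ({(0 : R3)} : Set R3) ×ˢ K ⊆ {p : R3 × X | F p < r} := by
    rintro ⟨y, f⟩ ⟨hy, -⟩
    obtain rfl : y = 0 := hy
    simpa [h0] using hr
  obtain ⟨U, V, hU, -, h0U, hKV, hUV⟩ := generalized_tube_lemma isCompact_singleton hK hopen hsub
  obtain ⟨δ, hδ, hball⟩ := Metric.isOpen_iff.1 hU 0 (h0U rfl)
  exact ⟨δ, hδ, fun f hf y hy => hUV (Set.mk_mem_prod (hball (by simpa using hy)) (hKV hf))⟩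

/-- Mollifications converge in `L²`, uniformly on compact sets of functions. -/
theorem exists_mol_sub_le {K : Set L2R3} (hK : IsCompact K) {r : ℝ} (hr : 0 < r) :
    ∃ ε₀ > 0, ∀ f ∈ K, ∀ ε (hε : 0 < ε), ε ≤ ε₀ →
      eLpNorm (mol (moll ε hε) f - (f : R3 → ℂ)) 2 volume ≤ ENNReal.ofReal r := by
  obtain ⟨δ, hδ, hδr⟩ := exists_forall_norm_lt_of_isCompact
    (F := fun p : R3 × L2R3 => ‖trL p.1 p.2 - p.2‖)
    (trL_continuous.sub continuous_snd).norm (fun f => by simp [trL_zero]) hK hr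
  refine ⟨δ, hδ, fun f hf ε hε hεδ => ?_⟩
  rw [← ENNReal.pow_le_pow_left_iff two_ne_zero, eLpNorm_two_sq]
  refine mol_moll_sub_lintegral_pow_le_of_forall hε (Lp.memLp f) 1 fun y hy => ?_
  rw [← eLpNorm_two_sq (fun x => f (x - y) - f x), trL_sub_eLpNorm]
  gcongr
  exact (hδr f hf y (hy.trans_le hεδ)).le

/-- Along a sequence of scales tending to zero, mollifications converge almost everywhere. -/
theorem exists_seq_mol_tendsto (f : L2R3) : ∃ ε : ℕ → ℝ, ∃ hε : ∀ n, 0 < ε n,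
    ∀ᵐ x, Filter.Tendsto (fun n => mol (moll (ε n) (hε n)) f x) Filter.atTop (𝓝 (f x)) := by
  have h : ∀ n : ℕ, ∃ ε : ℝ, ∃ hε : 0 < ε,
      eLpNorm (mol (moll ε hε) f - (f : R3 → ℂ)) 2 volume ≤ ENNReal.ofReal (1 / ((n : ℝ) + 1)) := by
    intro n
    obtain ⟨ε₀, h0, h⟩ := exists_mol_sub_le (isCompact_singleton (x := f))
      (r := 1 / ((n : ℝ) + 1)) (by positivity)
    exact ⟨ε₀, h0, h f rfl ε₀ h0 le_rfl⟩
  choose ε hε hle using h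
  have ht : Filter.Tendsto (fun n => eLpNorm (mol (moll (ε n) (hε n)) f - (f : R3 → ℂ)) 2 volume)
      Filter.atTop (𝓝 0) := by
    refine tendsto_of_tendsto_of_tendsto_of_le_of_le tendsto_const_nhds ?_ (fun _ => zero_le) hle
    rw [← ENNReal.ofReal_zero]
    exact (ENNReal.continuous_ofReal.tendsto 0).comp tendsto_one_div_add_atTop_nhds_zero_nat
  obtain ⟨ns, -, hns⟩ := (tendstoInMeasure_of_tendsto_eLpNorm two_ne_zero
    (fun n => (mol_continuous _ (Lp.memLp f)).aestronglyMeasurable) (Lp.aestronglyMeasurable f)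
    ht).exists_seq_tendsto_ae
  exact ⟨fun n => ε (ns n), fun n => hε (ns n), hns⟩

/-! ### The Sobolev embeddings H¹ ⊂ Lᵖ -/

theorem norm_clm_le_sum (L : R3 →L[ℝ] ℂ) : ‖L‖ ≤ ∑ k, ‖L (e3 k)‖ := by
  refine L.opNorm_le_bound (by positivity) fun y => ?_
  have h : y = ∑ k, y k • e3 k := by
    have := (EuclideanSpace.basisFun (Fin 3) ℝ).sum_repr y
    simpa [e3] using this.symm
  calc ‖L y‖ = ‖∑ k, y k • L (e3 k)‖ := by
        conv_lhs => rw [h]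
        simp only [map_sum, map_smul]
    _ ≤ ∑ k, ‖y k • L (e3 k)‖ := norm_sum_le _ _
    _ ≤ ∑ k, ‖L (e3 k)‖ * ‖y‖ := by
        refine Finset.sum_le_sum fun k _ => ?_
        rw [norm_smul, mul_comm]
        gcongr
        exact PiLp.norm_apply_le y k
    _ = _ := by rw [Finset.sum_mul]

/-- A smooth cutoff function equal to one on the unit ball. -/
noncomputable def cutoff : ContDiffBump (0 : R3) := ⟨1, 2, by norm_num, by norm_num⟩

theorem exists_norm_fderiv_cutoff_le : ∃ C : ℝ, 0 ≤ C ∧ ∀ x, ‖fderiv ℝ cutoff x‖ ≤ C := by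
  have hc : Continuous (fderiv ℝ cutoff) :=
    (cutoff.contDiff (n := 1)).continuous_fderiv (by simp)
  have hs : HasCompactSupport (fderiv ℝ cutoff) := cutoff.hasCompactSupport.fderiv ℝ
  obtain ⟨C, hC⟩ := hc.bounded_above_of_compact_support hs
  exact ⟨C, (norm_nonneg _).trans (hC 0), hC⟩

/-- Sobolev inequality for smooth functions without decay assumptions other than integrability. -/
theorem exists_sobolev_smooth : ∃ S : ℝ≥0, ∀ v : R3 → ℂ, ContDiff ℝ ∞ v → MemLp v 2 volume →
    eLpNorm v 6 volume ≤ S * ∑ k, eLpNorm (fun x => fderiv ℝ v x (e3 k)) 2 volume := by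
  let S : ℝ≥0 := SNormLESNormFDerivOfEqConst ℂ (volume : Measure R3) 2
  refine ⟨S, fun v hv hv2 => ?_⟩
  obtain ⟨C, hC0, hC⟩ := exists_norm_fderiv_cutoff_le
  -- The Gagliardo–Nirenberg–Sobolev inequality wants compact support. A cutoff at scale n + 1 adds
  -- a gradient term of size C/(n + 1) times the L² norm of v, which vanishes in the limit; Fatou's
  -- lemma recovers v.
  let χ : ℕ → R3 → ℝ := fun n x => cutoff (((n : ℝ) + 1)⁻¹ • x)
  have hχs : ∀ n, ContDiff ℝ 1 (χ n) := fun n =>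
    cutoff.contDiff.comp (contDiff_id.const_smul _)
  have hχc : ∀ n, HasCompactSupport (χ n) := fun n =>
    cutoff.hasCompactSupport.comp_homeomorph
      (Homeomorph.smulOfNeZero (((n : ℝ) + 1)⁻¹) (by positivity))
  have hχ1 : ∀ n x, ‖χ n x‖ ≤ 1 := fun n x => by
    rw [Real.norm_of_nonneg cutoff.nonneg]
    exact cutoff.le_one
  have hχd : ∀ n x, ‖fderiv ℝ (χ n) x‖ ≤ C * ((n : ℝ) + 1)⁻¹ := fun n x => by
    have h1 : HasFDerivAt cutoff (fderiv ℝ cutoff (((n : ℝ) + 1)⁻¹ • x)) (((n : ℝ) + 1)⁻¹ • x) :=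
      ((cutoff.contDiff (n := 1)).differentiable (by simp) _).hasFDerivAt
    have h2 : HasFDerivAt (fun y : R3 => ((n : ℝ) + 1)⁻¹ • y)
        (((n : ℝ) + 1)⁻¹ • ContinuousLinearMap.id ℝ R3) x :=
      (hasFDerivAt_id x).const_smul (((n : ℝ) + 1)⁻¹)
    have h3 : HasFDerivAt (χ n) _ x := h1.comp x h2
    rw [h3.fderiv]
    have : (fderiv ℝ cutoff (((n : ℝ) + 1)⁻¹ • x)).comp
        (((n : ℝ) + 1)⁻¹ • ContinuousLinearMap.id ℝ R3) =
        ((n : ℝ) + 1)⁻¹ • fderiv ℝ cutoff (((n : ℝ) + 1)⁻¹ • x) := by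
      ext y
      simp
    rw [this, norm_smul, Real.norm_of_nonneg (by positivity), mul_comm]
    gcongr
    exact hC _
  have hdv : ∀ x, DifferentiableAt ℝ v x := hv.differentiable (by simp)
  have hcd : Continuous (fderiv ℝ v) := hv.continuous_fderiv (by simp)
  let A : ℝ≥0∞ := ∑ k, eLpNorm (fun x => fderiv ℝ v x (e3 k)) 2 volume
  have hbound : ∀ n : ℕ, eLpNorm (fun x => χ n x • v x) 6 volume ≤
      S * (A + ENNReal.ofReal (C * ((n : ℝ) + 1)⁻¹) * eLpNorm v 2 volume) := by
    intro n
    have h1 := eLpNorm_le_eLpNorm_fderiv_of_eq (F := ℂ) (E := R3) volume (u := fun x => χ n x • v x)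
      ((hχs n).smul (hv.of_le (by simp))) (hχc n).smul_right (p := 2) (p' := 6) (by norm_num)
      (by simp) (by simp; norm_num)
    refine h1.trans ?_
    refine mul_le_mul_right ?_ _
    calc eLpNorm (fderiv ℝ fun x => χ n x • v x) 2 volume
        ≤ eLpNorm (fun x => (∑ k, ‖fderiv ℝ v x (e3 k)‖) + (C * ((n : ℝ) + 1)⁻¹) • ‖v x‖) 2 volume := by
          refine eLpNorm_mono_real fun x => ?_
          rw [fderiv_fun_smul ((hχs n).differentiable (by simp) x) (hdv x)]
          refine (norm_add_le _ _).trans (add_le_add ?_ ?_)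
          · rw [norm_smul]
            refine (mul_le_of_le_one_left (norm_nonneg _) (hχ1 n x)).trans (norm_clm_le_sum _)
          · rw [ContinuousLinearMap.norm_smulRight_apply, smul_eq_mul]
            gcongr
            exact hχd n x
      _ ≤ eLpNorm (fun x => ∑ k, ‖fderiv ℝ v x (e3 k)‖) 2 volume +
          eLpNorm (fun x => (C * ((n : ℝ) + 1)⁻¹) • ‖v x‖) 2 volume := by
          refine eLpNorm_add_le ?_ ?_ (by norm_num)
          · exact (continuous_finsetSum _ fun k _ =>
              (hcd.clm_apply continuous_const).norm).aestronglyMeasurable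
          · exact (hv.continuous.norm.const_smul (C * ((n : ℝ) + 1)⁻¹)).aestronglyMeasurable
      _ ≤ A + ENNReal.ofReal (C * ((n : ℝ) + 1)⁻¹) * eLpNorm v 2 volume := by
          refine add_le_add ?_ ?_
          · have h := eLpNorm_sum_le (μ := (volume : Measure R3)) (p := 2) (s := Finset.univ)
              (f := fun k x => ‖fderiv ℝ v x (e3 k)‖)
              (fun k _ => (hcd.clm_apply continuous_const).norm.aestronglyMeasurable) (by norm_num)
            simp only [eLpNorm_norm] at h
            refine le_trans (le_of_eq ?_) h
            congr 1
          · have := eLpNorm_const_smul (C * ((n : ℝ) + 1)⁻¹) (fun x => ‖v x‖) 2 (volume : Measure R3)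
            rw [eLpNorm_norm, Real.enorm_of_nonneg (by positivity)] at this
            exact this.le
  have hlim : ∀ᵐ x, Filter.Tendsto (fun n : ℕ => χ n x • v x) Filter.atTop (𝓝 (v x)) := by
    refine Filter.Eventually.of_forall fun x => ?_
    refine tendsto_const_nhds.congr' ?_
    obtain ⟨N, hN⟩ := exists_nat_ge ‖x‖
    filter_upwards [Filter.eventually_ge_atTop N] with n hn
    have : χ n x = 1 := by
      refine cutoff.one_of_mem_closedBall ?_
      rw [mem_closedBall_zero_iff, norm_smul, Real.norm_of_nonneg (by positivity)]
      change _ ≤ (1 : ℝ)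
      rw [inv_mul_le_iff₀ (by positivity), mul_one]
      have : (N : ℝ) ≤ n := by exact_mod_cast hn
      linarith
    rw [this, one_smul]
  refine (Lp.eLpNorm_lim_le_liminf_eLpNorm (fun n =>
    ((hχs n).continuous.smul hv.continuous).aestronglyMeasurable) v hlim).trans ?_
  refine (Filter.liminf_le_liminf (Filter.Eventually.of_forall hbound)).trans ?_
  have ht : Filter.Tendsto (fun n : ℕ =>
      (S : ℝ≥0∞) * (A + ENNReal.ofReal (C * ((n : ℝ) + 1)⁻¹) * eLpNorm v 2 volume))
      Filter.atTop (𝓝 (S * (A + 0 * eLpNorm v 2 volume))) := by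
    refine ENNReal.Tendsto.const_mul ?_ (Or.inr ENNReal.coe_ne_top)
    refine tendsto_const_nhds.add ?_
    refine ENNReal.Tendsto.mul_const ?_ (Or.inr hv2.eLpNorm_ne_top)
    rw [← ENNReal.ofReal_zero]
    refine (ENNReal.continuous_ofReal.tendsto 0).comp ?_
    have := tendsto_one_div_add_atTop_nhds_zero_nat (𝕜 := ℝ)
    have h2 := this.const_mul C
    simpa using h2
  rw [ht.liminf_eq]
  simp [A]

theorem mol_fderiv_apply (ψ : BumpKernel) {f : R3 → ℂ} (hf : MemLp f 2 volume) (x v : R3) :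
    fderiv ℝ (mol ψ f) x v = mol (ψ.d v) f x := by
  rw [← (mol_hasFDerivAt ψ hf x).differentiableAt.lineDeriv_eq_fderiv]
  exact (mol_hasLineDerivAt ψ hf x v).lineDeriv

namespace H1

theorem enorm_grad_eq (u : H1R3) (k : Fin 3) : eLpNorm (grad k u) 2 volume = ‖grad k u‖ₑ := by
  rw [Lp.enorm_def]

/-- The Sobolev embedding `H¹ ⊂ L⁶`. -/
theorem exists_sobolev : ∃ S : ℝ≥0, ∀ u : H1R3,
    eLpNorm (fn u) 6 volume ≤ S * ∑ k, ‖grad k u‖ₑ := by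
  obtain ⟨S, hS⟩ := exists_sobolev_smooth
  refine ⟨S, fun u => ?_⟩
  -- The smooth inequality is applied to mollifications converging almost everywhere. Mollification
  -- does not increase the L² norm of the derivatives, and Fatou's lemma passes to the limit.
  obtain ⟨ε, hε, hlim⟩ := exists_seq_mol_tendsto (fn u)
  refine (Lp.eLpNorm_lim_le_liminf_eLpNorm (fun n =>
    (mol_continuous _ (Lp.memLp (fn u))).aestronglyMeasurable) _ hlim).trans ?_
  refine Filter.liminf_le_of_frequently_le' (Filter.Frequently.of_forall fun n => ?_)
  refine (hS _ (mol_contDiff _ (Lp.memLp _)) (mol_memLp_two _ (Lp.memLp _))).trans ?_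
  gcongr with k
  have : (fun x => fderiv ℝ (mol (moll (ε n) (hε n)) (fn u)) x (e3 k)) =
      mol (moll (ε n) (hε n)) (grad k u) := by
    funext x
    rw [mol_fderiv_apply _ (Lp.memLp _), mol_d]
  rw [this, ← enorm_grad_eq]
  exact mol_moll_eLpNorm_two_le _ (Lp.aestronglyMeasurable _)

/-- A crude substitute for interpolation between L² and L⁶. The loss of homogeneity is repaired by
normalising the H¹ norm to one. -/
theorem enorm_rpow_le_add (a : ℝ≥0∞) {p : ℝ} (h2 : 2 ≤ p) (h6 : p ≤ 6) :
    a ^ p ≤ a ^ (2 : ℝ) + a ^ (6 : ℝ) := by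
  rcases le_total a 1 with h | h
  · exact (ENNReal.rpow_le_rpow_of_exponent_ge h h2).trans le_self_add
  · exact (ENNReal.rpow_le_rpow_of_exponent_le h h6).trans le_add_self

theorem lintegral_rpow_eq {α : Type*} [MeasurableSpace α] {μ : Measure α} (f : α → ℂ) {p : ℝ}
    (hp : 0 < p) : ∫⁻ x, ‖f x‖ₑ ^ p ∂μ = eLpNorm f (ENNReal.ofReal p) μ ^ p := by
  have h := eLpNorm_nnreal_pow_eq_lintegral (f := f) (μ := μ) (p := p.toNNReal)
    (by simpa using hp)
  rw [Real.coe_toNNReal p hp.le] at h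
  exact h.symm

/-- The embeddings `H¹ ⊂ Lᵖ`, `2 ≤ p ≤ 6`. -/
theorem exists_eLpNorm_le : ∃ S : ℝ, 1 ≤ S ∧ ∀ (u : H1R3) (p : ℝ), 2 ≤ p → p ≤ 6 →
    eLpNorm (fn u) (ENNReal.ofReal p) volume ≤ ENNReal.ofReal (S * ‖u‖) := by
  obtain ⟨S₀, hS₀⟩ := exists_sobolev
  have h6 : ∀ u : H1R3, eLpNorm (fn u) 6 volume ≤ ENNReal.ofReal ((3 * S₀) * ‖u‖) := by
    intro u
    refine (hS₀ u).trans ?_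
    have : ∑ k, ‖grad k u‖ₑ ≤ ∑ _k : Fin 3, ENNReal.ofReal ‖u‖ := by
      refine Finset.sum_le_sum fun k _ => ?_
      rw [← ofReal_norm]
      exact ENNReal.ofReal_le_ofReal (norm_grad_le u k)
    calc (S₀ : ℝ≥0∞) * ∑ k, ‖grad k u‖ₑ ≤ S₀ * ∑ _k : Fin 3, ENNReal.ofReal ‖u‖ := by gcongr
      _ = _ := by
        rw [ENNReal.ofReal_mul (by positivity), ENNReal.ofReal_mul (by norm_num),
          ENNReal.ofReal_coe_nnreal]
        simp
        ring
  have h2 : ∀ u : H1R3, eLpNorm (fn u) 2 volume ≤ ENNReal.ofReal ‖u‖ := by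
    intro u
    rw [← Lp.enorm_def, ← ofReal_norm]
    exact ENNReal.ofReal_le_ofReal (norm_fn_le u)
  -- The sum of the two endpoint integrals when ‖u‖ ≤ 1. Since S ≥ 1, taking a p-th root leaves a
  -- bound by S itself, so one constant serves every p.
  set S : ℝ := 1 + (3 * S₀) ^ 6 with hS
  have hS1 : 1 ≤ S := by
    have : (0 : ℝ) ≤ (3 * S₀) ^ 6 := by positivity
    linarith
  have key : ∀ (u : H1R3) (p : ℝ), ‖u‖ ≤ 1 → 2 ≤ p → p ≤ 6 →
      eLpNorm (fn u) (ENNReal.ofReal p) volume ≤ ENNReal.ofReal S := by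
    intro u p hu hp2 hp6
    have hp0 : 0 < p := by linarith
    have hi : ∫⁻ x, ‖fn u x‖ₑ ^ p ≤ ENNReal.ofReal S := by
      calc ∫⁻ x, ‖fn u x‖ₑ ^ p ≤ ∫⁻ x, ‖fn u x‖ₑ ^ (2 : ℝ) + ‖fn u x‖ₑ ^ (6 : ℝ) :=
            lintegral_mono fun x => enorm_rpow_le_add _ hp2 hp6
        _ = eLpNorm (fn u) 2 volume ^ (2 : ℝ) + eLpNorm (fn u) 6 volume ^ (6 : ℝ) := by
            rw [lintegral_add_left' ((Lp.aestronglyMeasurable _).enorm.pow_const _),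
              lintegral_rpow_eq _ (by norm_num), lintegral_rpow_eq _ (by norm_num)]
            simp
        _ ≤ ENNReal.ofReal 1 ^ (2 : ℝ) + ENNReal.ofReal (3 * S₀) ^ (6 : ℝ) := by
            gcongr
            · exact (h2 u).trans (ENNReal.ofReal_le_ofReal hu)
            · refine (h6 u).trans (ENNReal.ofReal_le_ofReal ?_)
              exact mul_le_of_le_one_right (by positivity) hu
        _ = ENNReal.ofReal S := by
            rw [hS, ENNReal.ofReal_add zero_le_one (by positivity), ENNReal.ofReal_pow (by positivity)]
            simp
    rw [lintegral_rpow_eq _ hp0] at hi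
    by_contra hcon
    push Not at hcon
    have h1 : ENNReal.ofReal S ≤ ENNReal.ofReal S ^ p := by
      conv_lhs => rw [← ENNReal.rpow_one (ENNReal.ofReal S)]
      exact ENNReal.rpow_le_rpow_of_exponent_le (by simpa using hS1) (by linarith)
    exact absurd (hi.trans h1) (not_le.2 (ENNReal.rpow_lt_rpow hcon hp0))
  refine ⟨S, hS1, fun u p hp2 hp6 => ?_⟩
  rcases eq_or_ne u 0 with rfl | hu
  · simp only [map_zero, norm_zero, mul_zero, ENNReal.ofReal_zero, nonpos_iff_eq_zero]
    rw [eLpNorm_congr_ae (Lp.coeFn_zero ℂ 2 volume)]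
    exact eLpNorm_zero'
  have hn : 0 < ‖u‖ := norm_pos_iff.2 hu
  have h := key (((‖u‖⁻¹ : ℝ) : ℂ) • u) p (by
    rw [norm_smul, Complex.norm_real, norm_inv, norm_norm, inv_mul_cancel₀ hn.ne']) hp2 hp6
  rw [map_smul, eLpNorm_congr_ae (Lp.coeFn_smul _ _), eLpNorm_const_smul] at h
  have hinv : ‖((‖u‖⁻¹ : ℝ) : ℂ)‖ₑ = (ENNReal.ofReal ‖u‖)⁻¹ := by
    rw [← ofReal_norm, Complex.norm_real, norm_inv, norm_norm, ENNReal.ofReal_inv_of_pos hn]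
  rw [hinv, mul_comm, ← div_eq_mul_inv, ENNReal.div_le_iff (by simpa using hu) (by simp)] at h
  rwa [ENNReal.ofReal_mul (by linarith)]

/-- A constant for the embeddings `H¹ ⊂ Lᵖ`, `2 ≤ p ≤ 6`. -/
noncomputable def sob : ℝ := exists_eLpNorm_le.choose

theorem one_le_sob : 1 ≤ sob := exists_eLpNorm_le.choose_spec.1

theorem eLpNorm_le (u : H1R3) {p : ℝ} (h2 : 2 ≤ p) (h6 : p ≤ 6) :
    eLpNorm (fn u) (ENNReal.ofReal p) volume ≤ ENNReal.ofReal (sob * ‖u‖) :=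
  exists_eLpNorm_le.choose_spec.2 u p h2 h6

theorem eLpNorm_ofNat_le (u : H1R3) (n : ℕ) [n.AtLeastTwo] (h6 : n ≤ 6) :
    eLpNorm (fn u) (OfNat.ofNat n) volume ≤ ENNReal.ofReal (sob * ‖u‖) := by
  have h2 : (2 : ℝ) ≤ n := by exact_mod_cast Nat.AtLeastTwo.prop
  have h := eLpNorm_le u (p := n) h2 (by exact_mod_cast h6)
  rw [ENNReal.ofReal_natCast] at h
  exact h

theorem memLp (u : H1R3) (n : ℕ) [n.AtLeastTwo] (h6 : n ≤ 6) :
    MemLp (fn u) (OfNat.ofNat n) volume :=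
  ⟨Lp.aestronglyMeasurable _, (eLpNorm_ofNat_le u n h6).trans_lt ENNReal.ofReal_lt_top⟩

/-! ### Duality in L² and the Lipschitz bound for translations -/

theorem inner_self_integral (D : L2R3) : ∫ x, D x * (star D : L2R3) x = ((‖D‖ ^ 2 : ℝ) : ℂ) := by
  have := inner_self_eq_norm_sq_to_K (𝕜 := ℂ) D
  rw [MeasureTheory.L2.inner_def] at this
  push_cast
  refine Eq.trans ?_ this
  refine integral_congr_ae ?_
  filter_upwards [Lp.coeFn_star D] with x hx
  rw [hx]
  simp [Complex.mul_conj, Complex.normSq_eq_norm_sq]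

theorem L2R3_norm_star (D : L2R3) : ‖star D‖ = ‖D‖ := by
  rw [Lp.norm_def, Lp.norm_def, eLpNorm_congr_ae (Lp.coeFn_star D)]
  congr 1
  exact eLpNorm_congr_norm_ae (Filter.Eventually.of_forall fun x => by simp)

/-- Density of smooth compactly supported functions in L². The auxiliary K exceeds ‖D‖ + A, so
approximating F within r/K costs at most r in total. -/
theorem norm_integral_mul_le_of_forall (D : L2R3) {A : ℝ} (hA : 0 ≤ A)
    (key : ∀ ψ : BumpKernel, ‖∫ x, D x * ψ x‖ ≤ A * (eLpNorm ψ 2 volume).toReal) (F : L2R3) :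
    ‖∫ x, D x * F x‖ ≤ A * ‖F‖ := by
  refine le_of_forall_pos_le_add fun r hr => ?_
  obtain ⟨K, hK⟩ : ∃ K, K = ‖D‖ + A + 1 := ⟨_, rfl⟩
  have hKpos : 0 < K := by rw [hK]; positivity
  obtain ⟨g, hg1, hg2, hg3⟩ := MemLp.exist_eLpNorm_sub_le (p := 2) (by norm_num) (by norm_num)
    (Lp.memLp F) (ε := r / K) (by positivity)
  let ψ : BumpKernel := ⟨g, hg2, hg1⟩
  have hg : MemLp g 2 volume := ψ.memLp 2
  have hsub : (eLpNorm ((F : R3 → ℂ) - g) 2 volume).toReal ≤ r / K := by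
    have := ENNReal.toReal_mono ENNReal.ofReal_ne_top hg3
    rwa [ENNReal.toReal_ofReal (by positivity)] at this
  have hi {h : R3 → ℂ} (hh : MemLp h 2 volume) : Integrable (fun x => D x * h x) :=
    (Lp.memLp D).integrable_mul hh
  have h1 : ∫ x, D x * F x = (∫ x, D x * ψ x) + ∫ x, D x * ((F : R3 → ℂ) - g) x := by
    rw [← integral_add (hi hg) (hi ((Lp.memLp F).sub hg))]
    congr 1
    funext x
    simp
    ring
  have h2 := norm_integral_mul_le (Lp.memLp D) ((Lp.memLp F).sub hg)
  have h3 : (eLpNorm g 2 volume).toReal ≤ ‖F‖ + r / K := by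
    have : eLpNorm g 2 volume ≤ eLpNorm F 2 volume + eLpNorm ((F : R3 → ℂ) - g) 2 volume := by
      have h := eLpNorm_sub_le (p := 2) (Lp.memLp F).1 ((Lp.memLp F).sub hg).1 (by norm_num)
      simpa using h
    have h4 := ENNReal.toReal_mono (ENNReal.add_lt_top.2 ⟨(Lp.memLp F).2,
      ((Lp.memLp F).sub hg).2⟩).ne this
    rw [ENNReal.toReal_add (Lp.memLp F).2.ne ((Lp.memLp F).sub hg).2.ne, ← Lp.norm_def] at h4
    linarith
  rw [h1]
  refine (norm_add_le _ _).trans ?_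
  have h5 := key ψ
  rw [← Lp.norm_def] at h2
  have h6 : A * (eLpNorm ψ 2 volume).toReal ≤ A * (‖F‖ + r / K) := by
    gcongr
  have h7 : ‖D‖ * (eLpNorm ((F : R3 → ℂ) - g) 2 volume).toReal ≤ ‖D‖ * (r / K) := by gcongr
  have h8 : (‖D‖ + A) * (r / K) ≤ r := by
    rw [mul_div_assoc', div_le_iff₀ hKpos, mul_comm]
    gcongr
    linarith
  nlinarith

/-- The norm in `L²` is detected by pairings with smooth compactly supported functions. -/
theorem norm_le_of_forall_integral_mul_le (D : L2R3) {A : ℝ} (hA : 0 ≤ A)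
    (key : ∀ ψ : BumpKernel, ‖∫ x, D x * ψ x‖ ≤ A * (eLpNorm ψ 2 volume).toReal) : ‖D‖ ≤ A := by
  have hstar := norm_integral_mul_le_of_forall D hA key (star D)
  rw [inner_self_integral] at hstar
  rw [L2R3_norm_star] at hstar
  rw [Complex.norm_real, Real.norm_of_nonneg (sq_nonneg ‖D‖)] at hstar
  rcases (norm_nonneg D).eq_or_lt with h0 | h0
  · rw [← h0]
    exact hA
  · rw [pow_two] at hstar
    exact le_of_mul_le_mul_right hstar h0

/-- Translation differences of `H¹` functions in `L²`. -/
theorem norm_trL_sub_le (u : H1R3) (y : R3) : ‖trL y (fn u) - fn u‖ ≤ 3 * ‖u‖ * ‖y‖ := by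
  have key : ∀ ψ : BumpKernel, ‖∫ x, (trL y (fn u) - fn u : L2R3) x * ψ x‖ ≤
      3 * ‖u‖ * ‖y‖ * (eLpNorm ψ 2 volume).toReal := by
    intro ψ
    -- With ρ(x) = ψ(−x), the pairing of the translation difference with ψ is the difference of the
    -- smooth function ρ ∗ u between −y and 0. The mean value inequality applies, and the gradient
    -- of ρ ∗ u is ρ convolved with the weak gradient of u.
    let ρ : BumpKernel := ψ.refl 0
    have hρ : eLpNorm ρ 2 volume = eLpNorm ψ 2 volume :=
      eLpNorm_comp_measurePreserving (f := fun y => 0 - y) ψ.continuous.aestronglyMeasurable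
        (Measure.measurePreserving_sub_left volume 0)
    have h1 : ∫ x, (trL y (fn u) - fn u : L2R3) x * ψ x = mol ρ (fn u) (-y) - mol ρ (fn u) 0 := by
      have ha : ∫ x, trL y (fn u) x * ψ x = mol ρ (fn u) (-y) := by
        have h := integral_trL_mul y (fn u) ψ.toSchwartz
        simp only [BumpKernel.toSchwartz_apply, SchwartzMap.compSubConstCLM_apply] at h
        rw [h]
        refine integral_congr_ae (Filter.Eventually.of_forall fun x => ?_)
        simp [ρ, sub_eq_add_neg, add_comm]
      have hb : ∫ x, fn u x * ψ x = mol ρ (fn u) 0 := by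
        refine integral_congr_ae (Filter.Eventually.of_forall fun x => ?_)
        simp [ρ]
      have hi (f : L2R3) : Integrable (fun x => f x * ψ x) := (Lp.memLp f).integrable_mul (ψ.memLp 2)
      rw [← ha, ← hb, ← integral_sub (hi _) (hi _)]
      refine integral_congr_ae ?_
      filter_upwards [Lp.coeFn_sub (trL y (fn u)) (fn u)] with x hx
      rw [hx, Pi.sub_apply, sub_mul]
    rw [h1]
    have hd : ∀ z ∈ (Set.univ : Set R3), HasFDerivWithinAt (mol ρ (fn u))
        (fderiv ℝ (mol ρ (fn u)) z) Set.univ z := fun z _ =>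
      ((mol_hasFDerivAt ρ (Lp.memLp _) z).differentiableAt.hasFDerivAt).hasFDerivWithinAt
    have hb : ∀ z ∈ (Set.univ : Set R3), ‖fderiv ℝ (mol ρ (fn u)) z‖ ≤
        3 * ‖u‖ * (eLpNorm ψ 2 volume).toReal := by
      intro z _
      refine (norm_clm_le_sum _).trans ?_
      have : ∀ k : Fin 3, ‖fderiv ℝ (mol ρ (fn u)) z (e3 k)‖ ≤
          ‖u‖ * (eLpNorm ψ 2 volume).toReal := by
        intro k
        rw [mol_fderiv_apply _ (Lp.memLp _), mol_d]
        refine (norm_mol_le ρ (Lp.memLp _) z).trans ?_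
        rw [hρ, ← Lp.norm_def]
        gcongr
        exact norm_grad_le u k
      refine (Finset.sum_le_sum fun k _ => this k).trans (le_of_eq ?_)
      simp
      ring
    have := convex_univ.norm_image_sub_le_of_norm_hasFDerivWithin_le hd hb (Set.mem_univ 0)
      (Set.mem_univ (-y))
    simp only [sub_zero, norm_neg] at this
    linarith
  exact norm_le_of_forall_integral_mul_le _ (by positivity) key

end H1

/-! ### The free Schrödinger group -/

/-- The Fourier symbol of the free Schrödinger group. -/
noncomputable def schSymbol (t : ℝ) (ξ : R3) : ℂ :=
  Complex.exp ((-(4 * Real.pi ^ 2 * t) * Complex.I) * (‖ξ‖ ^ 2 : ℝ))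

theorem norm_schSymbol (t : ℝ) (ξ : R3) : ‖schSymbol t ξ‖ = 1 := by
  rw [schSymbol, Complex.norm_exp]
  simp [← Complex.ofReal_pow]

theorem schSymbol_zero : schSymbol 0 = fun _ => 1 := by
  funext ξ
  simp [schSymbol]

theorem schSymbol_mul (s t : ℝ) : schSymbol s * schSymbol t = schSymbol (s + t) := by
  funext ξ
  simp only [schSymbol, Pi.mul_apply, ← Complex.exp_add]
  congr 1
  push_cast
  ring

/-- Each derivative only produces a factor ic in front of a unimodular function, so all derivatives
are bounded and polynomial degree 0 suffices. -/
theorem hasTemperateGrowth_cexp_mul_I (c : ℝ) :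
    Function.HasTemperateGrowth (fun r : ℝ => Complex.exp ((c * Complex.I) * (r : ℂ))) := by
  refine ⟨(contDiff_const.mul Complex.ofRealCLM.contDiff).cexp, fun n => ⟨0, |c| ^ n, fun r => ?_⟩⟩
  have h : ∀ n : ℕ, iteratedDeriv n (fun r : ℝ => Complex.exp ((c * Complex.I) * (r : ℂ))) =
      fun r : ℝ => (c * Complex.I) ^ n * Complex.exp ((c * Complex.I) * (r : ℂ)) := by
    intro n
    induction n with
    | zero => simp
    | succ n ih =>
      rw [iteratedDeriv_succ, ih]
      funext r
      have h1 : HasDerivAt (fun r : ℝ => (c * Complex.I) * (r : ℂ)) (c * Complex.I) r := by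
        simpa using (Complex.ofRealCLM.hasDerivAt (x := r)).const_mul (c * Complex.I)
      rw [((h1.cexp).const_mul ((c * Complex.I) ^ n)).deriv]
      ring
  rw [norm_iteratedFDeriv_eq_norm_iteratedDeriv, h]
  simp [Complex.norm_exp]

theorem hasTemperateGrowth_schSymbol (t : ℝ) : Function.HasTemperateGrowth (schSymbol t) := by
  have h := (hasTemperateGrowth_cexp_mul_I (-(4 * Real.pi ^ 2 * t))).comp
    (Function.hasTemperateGrowth_norm_sq R3)
  have e : schSymbol t = (fun r : ℝ => Complex.exp ((((-(4 * Real.pi ^ 2 * t) : ℝ) : ℂ) *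
      Complex.I) * (r : ℂ))) ∘ fun ξ : R3 => ‖ξ‖ ^ 2 := by
    funext ξ
    simp [schSymbol]
  rw [e]
  exact h

/-- The free Schrödinger group on Schwartz functions. -/
noncomputable def schS (t : ℝ) : 𝓢(R3, ℂ) →L[ℂ] 𝓢(R3, ℂ) :=
  SchwartzMap.fourierMultiplierCLM ℂ (schSymbol t)

theorem schS_schS (s t : ℝ) (ψ : 𝓢(R3, ℂ)) : schS s (schS t ψ) = schS (s + t) ψ := by
  rw [schS, schS, SchwartzMap.fourierMultiplierCLM_fourierMultiplierCLM_apply (hasTemperateGrowth_schSymbol s)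
    (hasTemperateGrowth_schSymbol t), schSymbol_mul, schS]

theorem schS_zero (ψ : 𝓢(R3, ℂ)) : schS 0 ψ = ψ := by
  rw [schS, schSymbol_zero, SchwartzMap.fourierMultiplierCLM_const]
  simp

theorem fourier_schS (t : ℝ) (ψ : 𝓢(R3, ℂ)) (ξ : R3) :
    (𝓕 (schS t ψ)) ξ = schSymbol t ξ * (𝓕 ψ) ξ := by
  rw [schS, SchwartzMap.fourierMultiplierCLM_apply, FourierTransform.fourier_fourierInv_eq,
    SchwartzMap.smulLeftCLM_apply_apply (hasTemperateGrowth_schSymbol t), smul_eq_mul]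

/-- The embedding of Schwartz functions in `L²`. -/
noncomputable def toL2 : 𝓢(R3, ℂ) →L[ℂ] L2R3 := toLpCLM ℂ (E := R3) ℂ 2 volume

theorem toL2_coeFn (f : 𝓢(R3, ℂ)) : toL2 f =ᵐ[volume] f := f.coeFn_toLp 2 volume

theorem norm_toL2 (f : 𝓢(R3, ℂ)) : ‖toL2 f‖ = (eLpNorm f 2 volume).toReal := SchwartzMap.norm_toLp

theorem norm_toL2_fourier (f : 𝓢(R3, ℂ)) : ‖toL2 (𝓕 f)‖ = ‖toL2 f‖ := norm_fourier_toL2_eq f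

theorem toReal_eLpNorm_two_le {f g : R3 → ℂ} {c : ℝ} (hc : 0 ≤ c) (hg : MemLp g 2 volume)
    (h : ∀ x, ‖f x‖ ≤ c * ‖g x‖) :
    (eLpNorm f 2 volume).toReal ≤ c * (eLpNorm g 2 volume).toReal := by
  have h1 : eLpNorm f 2 volume ≤ ENNReal.ofReal c * eLpNorm g 2 volume :=
    eLpNorm_le_mul_eLpNorm_of_ae_le_mul (Filter.Eventually.of_forall h) 2
  refine (ENNReal.toReal_mono (ENNReal.mul_ne_top ENNReal.ofReal_ne_top hg.2.ne) h1).trans ?_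
  rw [ENNReal.toReal_mul, ENNReal.toReal_ofReal hc]

theorem norm_toL2_le_of_norm_le {f g : 𝓢(R3, ℂ)} {c : ℝ} (hc : 0 ≤ c)
    (h : ∀ x, ‖f x‖ ≤ c * ‖g x‖) : ‖toL2 f‖ ≤ c * ‖toL2 g‖ := by
  have h1 := toReal_eLpNorm_two_le hc (g.memLp 2 volume) h
  rw [← norm_toL2, ← norm_toL2] at h1
  exact h1

theorem norm_toL2_le_of_norm_fourier_le {f g : 𝓢(R3, ℂ)} {c : ℝ} (hc : 0 ≤ c)
    (h : ∀ ξ, ‖(𝓕 f) ξ‖ ≤ c * ‖(𝓕 g) ξ‖) : ‖toL2 f‖ ≤ c * ‖toL2 g‖ := by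
  rw [← norm_toL2_fourier f, ← norm_toL2_fourier g]
  exact norm_toL2_le_of_norm_le hc h

theorem norm_toL2_schS (t : ℝ) (ψ : 𝓢(R3, ℂ)) : ‖toL2 (schS t ψ)‖ = ‖toL2 ψ‖ := by
  have h (ξ : R3) : ‖(𝓕 (schS t ψ)) ξ‖ = ‖(𝓕 ψ) ξ‖ := by
    rw [fourier_schS, norm_mul, norm_schSymbol, one_mul]
  refine le_antisymm ?_ ?_
  · simpa using norm_toL2_le_of_norm_fourier_le zero_le_one (f := schS t ψ) (g := ψ)
      fun ξ => by rw [h, one_mul]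
  · simpa using norm_toL2_le_of_norm_fourier_le zero_le_one (f := ψ) (g := schS t ψ)
      fun ξ => by rw [h, one_mul]

/-- The free Schrödinger group on Schwartz functions, as a linear equivalence. -/
noncomputable def schSEquiv (t : ℝ) : 𝓢(R3, ℂ) ≃ₗ[ℂ] 𝓢(R3, ℂ) :=
  LinearEquiv.ofLinearMap (schS t : 𝓢(R3, ℂ) →ₗ[ℂ] 𝓢(R3, ℂ)) (schS (-t) : 𝓢(R3, ℂ) →ₗ[ℂ] 𝓢(R3, ℂ))
    (by ext1 ψ; simp [schS_schS, schS_zero]) (by ext1 ψ; simp [schS_schS, schS_zero])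

theorem denseRange_toL2 : DenseRange toL2 :=
  denseRange_toLpCLM ENNReal.ofNat_ne_top

/-- The free Schrödinger group on `L²(ℝ³)`. -/
noncomputable def schL (t : ℝ) : L2R3 ≃ₗᵢ[ℂ] L2R3 :=
  (schSEquiv t).extendOfIsometry toL2 toL2
    denseRange_toL2 denseRange_toL2 (norm_toL2_schS t)

theorem schL_toL2 (t : ℝ) (ψ : 𝓢(R3, ℂ)) : schL t (toL2 ψ) = toL2 (schS t ψ) := by
  apply LinearMap.extendOfNorm_eq
  · exact denseRange_toL2
  use 1
  intro f
  rw [one_mul]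
  exact (norm_toL2_schS t f).le

theorem L2R3_induction {p : L2R3 → Prop} (hc : IsClosed {f | p f}) (h : ∀ ψ : 𝓢(R3, ℂ), p (toL2 ψ))
    (f : L2R3) : p f :=
  DenseRange.induction_on (p := p) denseRange_toL2 f hc h

theorem schL_schL (s t : ℝ) (f : L2R3) : schL s (schL t f) = schL (s + t) f := by
  refine L2R3_induction (p := fun f => schL s (schL t f) = schL (s + t) f) ?_ ?_ f
  · exact isClosed_eq ((schL s).continuous.comp (schL t).continuous) (schL (s + t)).continuous
  · intro ψ
    simp only [schL_toL2, schS_schS]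

theorem schL_zero (f : L2R3) : schL 0 f = f := by
  refine L2R3_induction (p := fun f => schL 0 f = f) ?_ ?_ f
  · exact isClosed_eq (schL 0).continuous continuous_id
  · intro ψ
    simp only [schL_toL2, schS_zero]

theorem inner_schL_left (t : ℝ) (f g : L2R3) : inner ℂ (schL t f) g = inner ℂ f (schL (-t) g) := by
  have h : g = schL t (schL (-t) g) := by rw [schL_schL, add_neg_cancel, schL_zero]
  conv_lhs => rw [h]
  exact (schL t).inner_map_map _ _

theorem fourier_laplacian (ψ : 𝓢(R3, ℂ)) (ξ : R3) :
    (𝓕 (Δ ψ)) ξ = ((-(4 * Real.pi ^ 2) * ‖ξ‖ ^ 2 : ℝ) : ℂ) * (𝓕 ψ) ξ := by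
  rw [SchwartzMap.laplacian_eq_fourierMultiplierCLM, SchwartzMap.fourierMultiplierCLM_apply]
  have hg : Function.HasTemperateGrowth (fun ξ : R3 => ‖ξ‖ ^ 2) :=
    Function.hasTemperateGrowth_norm_sq R3
  have h1 : 𝓕 (-(2 * Real.pi) ^ 2 • 𝓕⁻ (SchwartzMap.smulLeftCLM ℂ (fun ξ : R3 => ‖ξ‖ ^ 2) (𝓕 ψ))) =
      (((-(2 * Real.pi) ^ 2 : ℝ)) : ℂ) • SchwartzMap.smulLeftCLM ℂ (fun ξ : R3 => ‖ξ‖ ^ 2) (𝓕 ψ) := by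
    have h2 : (-(2 * Real.pi) ^ 2 • 𝓕⁻ (SchwartzMap.smulLeftCLM ℂ (fun ξ : R3 => ‖ξ‖ ^ 2) (𝓕 ψ)) : 𝓢(R3, ℂ)) =
        (((-(2 * Real.pi) ^ 2 : ℝ)) : ℂ) • 𝓕⁻ (SchwartzMap.smulLeftCLM ℂ (fun ξ : R3 => ‖ξ‖ ^ 2) (𝓕 ψ)) := by
      ext x
      simp
    rw [h2, FourierTransform.fourier_smul, FourierTransform.fourier_fourierInv_eq]
  change (𝓕 (-(2 * Real.pi) ^ 2 • 𝓕⁻ (SchwartzMap.smulLeftCLM ℂ (fun ξ : R3 => ‖ξ‖ ^ 2) (𝓕 ψ)))) ξ = _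
  rw [h1]
  simp only [smul_apply, SchwartzMap.smulLeftCLM_apply_apply hg, smul_eq_mul, Complex.real_smul]
  push_cast
  ring

/-- For |θ| ≤ 1 this is the second-order Taylor bound; for |θ| ≥ 1 each of the two pieces is at most
|θ| ≤ θ². -/
theorem norm_exp_mul_I_sub_le (θ : ℝ) :
    ‖Complex.exp (θ * Complex.I) - 1 - θ * Complex.I‖ ≤ 2 * θ ^ 2 := by
  rcases le_total |θ| 1 with h | h
  · have := Complex.norm_exp_sub_one_sub_id_le (x := θ * Complex.I) (by simpa using h)
    have h2 : ‖(θ : ℂ) * Complex.I‖ ^ 2 = θ ^ 2 := by simp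
    nlinarith [sq_nonneg θ]
  · have h1 : ‖Complex.exp (θ * Complex.I) - 1‖ ≤ |θ| := by
      have := Real.norm_exp_I_mul_ofReal_sub_one_le (x := θ)
      rwa [mul_comm, Real.norm_eq_abs] at this
    calc ‖Complex.exp (θ * Complex.I) - 1 - θ * Complex.I‖
        ≤ ‖Complex.exp (θ * Complex.I) - 1‖ + ‖θ * Complex.I‖ := norm_sub_le _ _
      _ ≤ |θ| + |θ| := by
        gcongr
        simp
      _ ≤ 2 * θ ^ 2 := by rw [← sq_abs]; nlinarith

/-- Quadratic expansion of the Schrödinger group on Schwartz functions. -/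
theorem norm_schS_sub_sub_le (t h : ℝ) (ψ : 𝓢(R3, ℂ)) :
    ‖toL2 ((schS (t + h) ψ - schS t ψ) - ((h : ℂ) * Complex.I) • Δ (schS t ψ))‖ ≤
      2 * h ^ 2 * ‖toL2 (Δ (Δ ψ))‖ := by
  refine norm_toL2_le_of_norm_fourier_le (by positivity) fun ξ => ?_
  rw [fourier_laplacian, fourier_laplacian]
  have h1 : 𝓕 ((schS (t + h) ψ - schS t ψ) - ((h : ℂ) * Complex.I) • Δ (schS t ψ)) =
      (𝓕 (schS (t + h) ψ) - 𝓕 (schS t ψ)) - ((h : ℂ) * Complex.I) • 𝓕 (Δ (schS t ψ)) := by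
    simp only [← FourierTransform.fourierCLM_apply (R := ℂ), map_sub, map_smul]
  rw [h1]
  simp only [sub_apply, smul_apply, fourier_schS, fourier_laplacian, smul_eq_mul]
  -- On the Fourier side the remainder is multiplication by a unimodular factor times e^{iθ} − 1 −
  -- iθ, and θ² is h² times the symbol of Δ².
  set θ : ℝ := -(4 * Real.pi ^ 2 * h) * ‖ξ‖ ^ 2 with hθ
  have h2 : schSymbol (t + h) ξ = schSymbol t ξ * Complex.exp (θ * Complex.I) := by
    simp only [schSymbol, ← Complex.exp_add, hθ]
    congr 1
    push_cast
    ring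
  have h3 : schSymbol (t + h) ξ * (𝓕 ψ) ξ - schSymbol t ξ * (𝓕 ψ) ξ -
      (h : ℂ) * Complex.I * (((-(4 * Real.pi ^ 2) * ‖ξ‖ ^ 2 : ℝ) : ℂ) * (schSymbol t ξ * (𝓕 ψ) ξ)) =
      schSymbol t ξ * (Complex.exp (θ * Complex.I) - 1 - θ * Complex.I) * (𝓕 ψ) ξ := by
    rw [h2, hθ]
    push_cast
    ring
  rw [h3, norm_mul, norm_mul, norm_schSymbol, one_mul, norm_mul, norm_mul]
  refine (mul_le_mul_of_nonneg_right (norm_exp_mul_I_sub_le θ) (norm_nonneg _)).trans (le_of_eq ?_)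
  rw [hθ, Complex.norm_real, Real.norm_eq_abs]
  rw [← mul_assoc |_|, abs_mul_abs_self]
  ring

theorem fourier_schS_laplacian (t : ℝ) (ψ : 𝓢(R3, ℂ)) : Δ (schS t ψ) = schS t (Δ ψ) := by
  have : 𝓕 (Δ (schS t ψ)) = 𝓕 (schS t (Δ ψ)) := by
    ext ξ
    rw [fourier_laplacian, fourier_schS, fourier_schS, fourier_laplacian]
    ring
  have h2 := congrArg (fun f : 𝓢(R3, ℂ) => 𝓕⁻ f) this
  simpa using h2

/-- Strong continuity of the Schrödinger group. -/
theorem schL_continuous : Continuous fun p : ℝ × L2R3 => schL p.1 p.2 := by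
  have h1 : ∀ f : L2R3, Continuous fun t => schL t f := by
    intro f
    have hψ : ∀ ψ : 𝓢(R3, ℂ), Continuous fun t => schL t (toL2 ψ) := by
      intro ψ
      rw [continuous_iff_continuousAt]
      intro t
      have hb : ∀ s : ℝ, ‖schL s (toL2 ψ) - schL t (toL2 ψ)‖ ≤
          2 * (s - t) ^ 2 * ‖toL2 (Δ (Δ ψ))‖ + |s - t| * ‖toL2 (Δ (schS t ψ))‖ := by
        intro s
        have h := norm_schS_sub_sub_le t (s - t) ψ
        rw [add_sub_cancel] at h
        have e1 : toL2 (schS s ψ - schS t ψ - (((s - t : ℝ) : ℂ) * Complex.I) • Δ (schS t ψ)) =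
            schL s (toL2 ψ) - schL t (toL2 ψ) -
              (((s - t : ℝ) : ℂ) * Complex.I) • toL2 (Δ (schS t ψ)) := by
          rw [schL_toL2, schL_toL2]
          simp only [map_sub, map_smul]
        rw [e1] at h
        have h2 := norm_le_norm_sub_add (schL s (toL2 ψ) - schL t (toL2 ψ))
          ((((s - t : ℝ) : ℂ) * Complex.I) • toL2 (Δ (schS t ψ)))
        refine h2.trans (add_le_add h (le_of_eq ?_))
        rw [norm_smul, norm_mul, Complex.norm_I, mul_one, Complex.norm_real, Real.norm_eq_abs]
      refine tendsto_iff_norm_sub_tendsto_zero.2 (squeeze_zero (fun _ => norm_nonneg _) hb ?_)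
      have hc : Continuous fun s : ℝ => 2 * (s - t) ^ 2 * ‖toL2 (Δ (Δ ψ))‖ +
          |s - t| * ‖toL2 (Δ (schS t ψ))‖ := by fun_prop
      simpa using hc.tendsto t
    rw [continuous_iff_continuousAt]
    intro t
    rw [Metric.continuousAt_iff']
    intro r hr
    -- Approximation by a Schwartz function: all the operators are isometries, so the error is the
    -- same at times s and t.
    obtain ⟨ψ, hψr⟩ := Metric.denseRange_iff.1 denseRange_toL2 f (r / 3) (by positivity)
    have h3 := Metric.continuousAt_iff'.1 ((hψ ψ).continuousAt (x := t)) (r / 3) (by positivity)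
    filter_upwards [h3] with s hs
    have a1 : dist (schL s f) (schL s (toL2 ψ)) < r / 3 := by
      rwa [(schL s).dist_map]
    have a2 : dist (schL t (toL2 ψ)) (schL t f) < r / 3 := by
      rwa [(schL t).dist_map, dist_comm]
    calc dist (schL s f) (schL t f) ≤ _ := dist_triangle4 _ (schL s (toL2 ψ)) (schL t (toL2 ψ)) _
      _ < r := by linarith
  rw [continuous_iff_continuousAt]
  rintro ⟨t, f⟩
  have hb : ∀ p : ℝ × L2R3, ‖schL p.1 p.2 - schL t f‖ ≤ ‖p.2 - f‖ + ‖schL p.1 f - schL t f‖ := by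
    intro p
    have : schL p.1 p.2 - schL t f = schL p.1 (p.2 - f) + (schL p.1 f - schL t f) := by
      rw [map_sub]
      abel
    rw [this]
    refine (norm_add_le _ _).trans ?_
    rw [(schL p.1).norm_map]
  refine tendsto_iff_norm_sub_tendsto_zero.2 (squeeze_zero (fun _ => norm_nonneg _) hb ?_)
  have hc : Continuous fun p : ℝ × L2R3 => ‖p.2 - f‖ + ‖schL p.1 f - schL t f‖ :=
    (continuous_snd.sub continuous_const).norm.add
      (((h1 f).comp continuous_fst).sub continuous_const).norm
  simpa using hc.tendsto (t, f)

attribute [irreducible] schL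

/-! ### The bilinear pairing on `L²` -/

/-- The bilinear pairing `∫ f g` on `L²`. -/
noncomputable def bil : L2R3 →L[ℂ] L2R3 →L[ℂ] ℂ :=
  LinearMap.mkContinuous₂ (LinearMap.mk₂ ℂ (fun f g : L2R3 => ∫ x, f x * g x)
    (fun f f' g => by
      refine Eq.trans ?_ (integral_add ((Lp.memLp f).integrable_mul (Lp.memLp g))
        ((Lp.memLp f').integrable_mul (Lp.memLp g)))
      refine integral_congr_ae ?_
      filter_upwards [Lp.coeFn_add f f'] with x hx
      rw [hx, Pi.add_apply, add_mul])
    (fun c f g => by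
      rw [smul_eq_mul, ← integral_const_mul]
      refine integral_congr_ae ?_
      filter_upwards [Lp.coeFn_smul c f] with x hx
      rw [hx, Pi.smul_apply, smul_eq_mul, mul_assoc])
    (fun f g g' => by
      refine Eq.trans ?_ (integral_add ((Lp.memLp f).integrable_mul (Lp.memLp g))
        ((Lp.memLp f).integrable_mul (Lp.memLp g')))
      refine integral_congr_ae ?_
      filter_upwards [Lp.coeFn_add g g'] with x hx
      rw [hx, Pi.add_apply, mul_add])
    (fun c f g => by
      rw [smul_eq_mul, ← integral_const_mul]
      refine integral_congr_ae ?_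
      filter_upwards [Lp.coeFn_smul c g] with x hx
      rw [hx, Pi.smul_apply, smul_eq_mul, mul_left_comm])) 1
    (fun f g => by
      rw [one_mul, LinearMap.mk₂_apply, Lp.norm_def, Lp.norm_def]
      exact norm_integral_mul_le (Lp.memLp f) (Lp.memLp g))

theorem bil_apply (f g : L2R3) : bil f g = ∫ x, f x * g x := rfl

theorem bil_toL2 (f : L2R3) (ψ : 𝓢(R3, ℂ)) : bil f (toL2 ψ) = ∫ x, f x * ψ x := by
  rw [bil_apply]
  refine integral_congr_ae ?_
  filter_upwards [toL2_coeFn ψ] with x hx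
  rw [hx]

theorem bil_comm (f g : L2R3) : bil f g = bil g f := by
  simp only [bil_apply, mul_comm]

theorem norm_bil_le (f g : L2R3) : ‖bil f g‖ ≤ ‖f‖ * ‖g‖ := by
  rw [bil_apply, Lp.norm_def, Lp.norm_def]
  exact norm_integral_mul_le (Lp.memLp f) (Lp.memLp g)

/-- An element of `L²` is determined by its pairings with Schwartz functions. -/
theorem eq_of_forall_bil_toL2 {f g : L2R3} (h : ∀ ψ : 𝓢(R3, ℂ), bil f (toL2 ψ) = bil g (toL2 ψ)) :
    f = g := by
  have h1 : ∀ k : L2R3, bil f k = bil g k := fun k =>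
    L2R3_induction (p := fun k => bil f k = bil g k)
      (isClosed_eq (bil f).continuous (bil g).continuous) h k
  have h2 : ‖f - g‖ ^ 2 = 0 := by
    have := H1.inner_self_integral (f - g)
    rw [← bil_apply, map_sub, sub_apply, h1, sub_self] at this
    exact_mod_cast this.symm
  rw [← sub_eq_zero, ← norm_eq_zero]
  exact pow_eq_zero_iff two_ne_zero |>.1 h2

/-- The symbol is even in ξ, so the group is symmetric for the bilinear pairing ∫ f g, without a
reversal of time. The sign of time changes only for the Hermitian product. -/
theorem integral_schS_mul (t : ℝ) (f g : 𝓢(R3, ℂ)) :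
    ∫ x, (schS t f) x * g x = ∫ x, f x * (schS t g) x := by
  have h0 : ∀ (f g : 𝓢(R3, ℂ)), ∫ x, (𝓕 f) x * g x = ∫ x, f x * (𝓕 g) x :=
    fun f g => SchwartzMap.integral_fourier_mul_eq f g
  have h1 : ∀ (f g : 𝓢(R3, ℂ)), ∫ x, (𝓕⁻ f) x * g x = ∫ x, f x * (𝓕⁻ g) x := by
    intro f g
    have := h0 (𝓕⁻ f) (𝓕⁻ g)
    rw [FourierTransform.fourier_fourierInv_eq, FourierTransform.fourier_fourierInv_eq] at this
    exact this.symm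
  have h2 : ∀ (f : 𝓢(R3, ℂ)) (x : R3), (𝓕⁻ f) x = (𝓕 f) (-x) := by
    intro f x
    rw [SchwartzMap.fourierInv_coe, SchwartzMap.fourier_coe, Real.fourierInv_eq_fourier_neg]
  have key : ∀ (f g : 𝓢(R3, ℂ)), ∫ x, (schS t f) x * g x =
      ∫ ξ, schSymbol t ξ * (𝓕 f) ξ * (𝓕⁻ g) ξ := by
    intro f g
    have e : schS t f = 𝓕⁻ (𝓕 (schS t f)) := (FourierTransform.fourierInv_fourier_eq _).symm
    rw [e, h1]
    simp only [fourier_schS]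
  have : ∫ x, f x * (schS t g) x = ∫ x, (schS t g) x * f x := by simp only [mul_comm]
  rw [this, key, key, ← integral_neg_eq_self]
  refine integral_congr_ae (Filter.Eventually.of_forall fun ξ => ?_)
  have h3 : schSymbol t (-ξ) = schSymbol t ξ := by simp [schSymbol]
  simp only [h2, h3, neg_neg]
  ring

theorem bil_schL_toL2 (t : ℝ) (f : L2R3) (ψ : 𝓢(R3, ℂ)) :
    bil (schL t f) (toL2 ψ) = bil f (toL2 (schS t ψ)) := by
  refine L2R3_induction (p := fun f => bil (schL t f) (toL2 ψ) = bil f (toL2 (schS t ψ))) ?_ ?_ f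
  · exact isClosed_eq ((bil.flip (toL2 ψ)).continuous.comp (schL t).continuous)
      (bil.flip (toL2 (schS t ψ))).continuous
  · intro φ
    have h : ∀ a b : 𝓢(R3, ℂ), bil (toL2 a) (toL2 b) = ∫ x, a x * b x := by
      intro a b
      rw [bil_toL2]
      refine integral_congr_ae ?_
      filter_upwards [toL2_coeFn a] with x hx
      rw [hx]
    rw [schL_toL2, h, h, integral_schS_mul]

attribute [irreducible] bil

/-! ### The dispersive estimate -/

/-- The constant of the dispersive estimate. -/
noncomputable def dispA (t : ℝ) : ℝ := (4 * Real.pi * |t|) ^ (-(3 / 2) : ℝ)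

theorem dispA_nonneg (t : ℝ) : 0 ≤ dispA t := by
  unfold dispA
  positivity

/-- The transform of a complex Gaussian is explicit: a prefactor (π/b)^(3/2) and an exponential of
modulus at most one because Re b > 0. Only a lower bound on |b| enters, so the estimate survives the
limit Re b → 0. -/
theorem norm_fourier_gaussian_le {b : ℂ} (hb : 0 < b.re) {t : ℝ} (ht : t ≠ 0)
    (hbt : 4 * Real.pi ^ 2 * |t| ≤ ‖b‖) (x w : R3) :
    ‖𝓕 (fun v : R3 => Complex.exp (-b * ‖v‖ ^ 2 +
      2 * Real.pi * Complex.I * (inner ℝ x v : ℝ))) w‖ ≤ dispA t := by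
  rw [fourier_gaussian_innerProductSpace' hb]
  have h1 : ‖Complex.exp (-(Real.pi : ℂ) ^ 2 * ‖x - w‖ ^ 2 / b)‖ ≤ 1 := by
    rw [Complex.norm_exp, Real.exp_le_one_iff]
    have : -(Real.pi : ℂ) ^ 2 * ‖x - w‖ ^ 2 / b = ((-(Real.pi ^ 2 * ‖x - w‖ ^ 2) : ℝ) : ℂ) * b⁻¹ := by
      push_cast
      ring
    rw [this, Complex.re_ofReal_mul, Complex.inv_re]
    have : 0 ≤ b.re / Complex.normSq b := div_nonneg hb.le (Complex.normSq_nonneg _)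
    nlinarith [mul_nonneg (by positivity : 0 ≤ Real.pi ^ 2 * ‖x - w‖ ^ 2) this]
  have h2 : ((Module.finrank ℝ R3 : ℂ) / 2) = ((3 / 2 : ℝ) : ℂ) := by
    rw [finrank_euclideanSpace_fin]
    push_cast
    ring
  rw [norm_mul, h2, Complex.norm_cpow_real, norm_div, Complex.norm_real,
    Real.norm_of_nonneg Real.pi_pos.le]
  have hp := Real.pi_pos
  have ht' := abs_pos.2 ht
  have h3 : Real.pi / ‖b‖ ≤ (4 * Real.pi * |t|)⁻¹ := by
    rw [div_le_iff₀ (lt_of_lt_of_le (by positivity) hbt), inv_mul_eq_div, le_div_iff₀ (by positivity)]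
    nlinarith
  calc _ ≤ (Real.pi / ‖b‖) ^ (3 / 2 : ℝ) * 1 := by gcongr
    _ ≤ ((4 * Real.pi * |t|)⁻¹) ^ (3 / 2 : ℝ) := by
      rw [mul_one]
      gcongr
    _ = dispA t := by rw [dispA, Real.rpow_neg (by positivity), Real.inv_rpow (by positivity)]

theorem integral_fourier_mul_flip {f g : R3 → ℂ} (hf : Integrable f) (hg : Integrable g) :
    ∫ x, 𝓕 f x * g x = ∫ x, f x * 𝓕 g x := by
  simpa using! (VectorFourier.integral_fourierIntegral_smul_eq_flip (L := innerₗ R3)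
    Real.continuous_fourierChar continuous_inner hf hg)

/-- The oscillating symbol is not integrable. It is damped by e^{−ε|ξ|²}, the Fourier transform is
moved onto the resulting Gaussian, where the bound is uniform in ε, and dominated convergence
removes the damping. -/
theorem norm_schS_le {t : ℝ} (ht : t ≠ 0) (ψ : 𝓢(R3, ℂ)) (x : R3) :
    ‖schS t ψ x‖ ≤ dispA t * ∫ y, ‖ψ y‖ := by
  set g : ℝ → R3 → ℂ := fun ε v => Complex.exp (-((ε : ℂ) + (4 * Real.pi ^ 2 * t : ℝ) * Complex.I) *
    ‖v‖ ^ 2 + 2 * Real.pi * Complex.I * (inner ℝ x v : ℝ)) with hg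
  have e1 : schS t ψ x = ∫ v, g 0 v * (𝓕 ψ) v := by
    have e : schS t ψ = 𝓕⁻ (𝓕 (schS t ψ)) := (FourierTransform.fourierInv_fourier_eq _).symm
    rw [e, SchwartzMap.fourierInv_coe, Real.fourierInv_eq']
    refine integral_congr_ae (Filter.Eventually.of_forall fun v => ?_)
    simp only [smul_eq_mul, fourier_schS, schSymbol, hg, Complex.exp_add]
    rw [← mul_assoc, ← Complex.exp_add, ← Complex.exp_add]
    congr 2
    rw [real_inner_comm]
    push_cast
    ring
  have hgn : ∀ ε v, ‖g ε v‖ = Real.exp (-(ε * ‖v‖ ^ 2)) := by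
    intro ε v
    rw [hg, Complex.norm_exp]
    congr 1
    simp [← Complex.ofReal_pow]
  have hgc : Continuous fun p : ℝ × R3 => g p.1 p.2 := by
    rw [hg]
    fun_prop
  have hint : Integrable (fun v => (𝓕 ψ) v) := (𝓕 ψ).integrable
  have lim : Filter.Tendsto (fun ε => ∫ v, g ε v * (𝓕 ψ) v) (𝓝[>] 0) (𝓝 (∫ v, g 0 v * (𝓕 ψ) v)) := by
    refine tendsto_integral_filter_of_dominated_convergence (fun v => ‖(𝓕 ψ) v‖) ?_ ?_ hint.norm ?_
    · refine Filter.Eventually.of_forall fun ε => ?_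
      exact ((hgc.comp (by fun_prop : Continuous fun v : R3 => (ε, v))).mul
        (𝓕 ψ).continuous).aestronglyMeasurable
    · filter_upwards [self_mem_nhdsWithin] with ε hε
      refine Filter.Eventually.of_forall fun v => ?_
      rw [norm_mul, hgn]
      have : Real.exp (-(ε * ‖v‖ ^ 2)) ≤ 1 := by
        rw [Real.exp_le_one_iff]
        have := mul_nonneg (le_of_lt hε) (sq_nonneg ‖v‖)
        linarith
      exact mul_le_of_le_one_left (norm_nonneg _) this
    · refine Filter.Eventually.of_forall fun v => ?_
      have hc : Continuous fun ε => g ε v * (𝓕 ψ) v :=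
        (hgc.comp (by fun_prop : Continuous fun ε : ℝ => (ε, v))).mul continuous_const
      exact (hc.tendsto 0).mono_left nhdsWithin_le_nhds
  rw [e1]
  refine le_of_tendsto lim.norm ?_
  filter_upwards [self_mem_nhdsWithin] with ε hε
  have hb : 0 < ((ε : ℂ) + (4 * Real.pi ^ 2 * t : ℝ) * Complex.I).re := by
    rw [Complex.add_re, Complex.re_ofReal_mul, Complex.I_re, mul_zero, add_zero]
    exact hε
  have hbt : 4 * Real.pi ^ 2 * |t| ≤ ‖(ε : ℂ) + (4 * Real.pi ^ 2 * t : ℝ) * Complex.I‖ := by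
    refine le_trans (le_of_eq ?_) (Complex.abs_im_le_norm _)
    rw [Complex.add_im, Complex.im_ofReal_mul, Complex.I_im, Complex.ofReal_im, mul_one, zero_add, abs_mul (4 * Real.pi ^ 2) t,
      abs_of_pos (by positivity : 0 < 4 * Real.pi ^ 2)]
  have hgi : Integrable (g ε) :=
    GaussianFourier.integrable_cexp_neg_mul_sq_norm_add hb (2 * Real.pi * Complex.I) x
  have e2 : ∫ v, g ε v * (𝓕 ψ) v = ∫ v, 𝓕 (g ε) v * ψ v := by
    rw [integral_fourier_mul_flip hgi ψ.integrable]
    rfl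
  rw [e2]
  have hψ : Integrable (fun v => dispA t * ‖ψ v‖) := ψ.integrable.norm.const_mul _
  rw [← integral_const_mul]
  refine norm_integral_le_of_norm_le hψ (Filter.Eventually.of_forall fun v => ?_)
  rw [norm_mul]
  gcongr
  exact norm_fourier_gaussian_le hb ht hbt x v

/-- At almost every x the value is the limit of pairings with mollifiers centred at x. By symmetry
of the group the evolution passes to the mollifier, a Schwartz function of L¹ norm one, to which the
dispersive bound applies. If f is not in L¹ the right-hand side is infinite. -/
theorem enorm_schL_le {t : ℝ} (ht : t ≠ 0) (f : L2R3) :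
    ∀ᵐ x, ‖schL t f x‖ₑ ≤ ENNReal.ofReal (dispA t) * ∫⁻ y, ‖f y‖ₑ := by
  obtain ⟨ε, hε, h⟩ := exists_seq_mol_tendsto (schL t f)
  filter_upwards [h] with x hx
  refine le_of_tendsto hx.enorm (Filter.Eventually.of_forall fun n => ?_)
  have e1 : mol (moll (ε n) (hε n)) (schL t f) x =
      bil (schL t f) (toL2 ((moll (ε n) (hε n)).refl x).toSchwartz) := by
    rw [bil_toL2]
    rfl
  rw [e1, bil_schL_toL2, bil_toL2]
  refine (enorm_integral_le_lintegral_enorm _).trans ?_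
  rw [← lintegral_const_mul' _ _ ENNReal.ofReal_ne_top]
  refine lintegral_mono fun y => ?_
  rw [enorm_mul, mul_comm]
  gcongr
  rw [← ofReal_norm]
  refine ENNReal.ofReal_le_ofReal ((norm_schS_le ht _ y).trans (mul_le_of_le_one_right
    (dispA_nonneg t) (le_of_eq ?_)))
  have e2 : ∫⁻ z, ‖moll (ε n) (hε n) (x - z)‖ₑ = 1 :=
    (lintegral_sub_left_eq_self (fun z => ‖moll (ε n) (hε n) z‖ₑ) x).trans (lintegral_moll (hε n))
  rw [integral_norm_eq_lintegral_enorm (SchwartzMap.continuous _).aestronglyMeasurable]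
  exact (congrArg ENNReal.toReal e2).trans ENNReal.toReal_one

/-! ### Interpolation -/

theorem rpow_three_halves {r : ℝ} (hr : 0 ≤ r) : r ^ (3 / 2 : ℝ) = √r * r := by
  rw [Real.sqrt_eq_rpow]
  nth_rewrite 3 [← Real.rpow_one r]
  rw [← Real.rpow_add_of_nonneg hr (by norm_num) (by norm_num)]
  norm_num

section Interpolation

variable {α : Type*} [MeasurableSpace α] {μ : Measure α} (T : Lp ℂ 2 μ →ₗᵢ[ℂ] Lp ℂ 2 μ) {A : ℝ}
  (f : Lp ℂ 2 μ) {Φ : ℝ}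

/-- Off the set S one has 2AΦ|f| ≤ l|f|^(3/2). Integration gives A∫|f| ≤ l/2 for this part of f, and
the L¹ → L^∞ bound keeps its image below half the level l. -/
theorem enorm_dispersive_large_le (hA : 0 < A)
    (hT : ∀ f : Lp ℂ 2 μ, ∀ᵐ x ∂μ, ‖T f x‖ₑ ≤ ENNReal.ofReal A * ∫⁻ y, ‖f y‖ₑ ∂μ)
    (hΦ0 : 0 ≤ Φ) (hΦ' : ∫⁻ x, ‖f x‖ₑ ^ (3 / 2 : ℝ) ∂μ = ENNReal.ofReal Φ) {l : ℝ} (hl : 0 < l)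
    {S : Set α} (hS : S = {x | l * √‖f x‖ ≤ 2 * A * Φ}) (m2 : MemLp (Sᶜ.indicator f) 2 μ) :
    ∀ᵐ x ∂μ, ‖T m2.toLp x‖ₑ ≤ ENNReal.ofReal (l / 2) := by
  have h1 : ENNReal.ofReal (2 * A * Φ) * ∫⁻ y, ‖(m2.toLp : Lp ℂ 2 μ) y‖ₑ ∂μ ≤
      ENNReal.ofReal l * ENNReal.ofReal Φ := by
    rw [← hΦ', ← lintegral_const_mul' _ _ ENNReal.ofReal_ne_top,
      ← lintegral_const_mul' _ _ ENNReal.ofReal_ne_top]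
    refine lintegral_mono_ae ?_
    filter_upwards [m2.coeFn_toLp] with y hy
    rw [hy]
    by_cases hyS : y ∈ S
    · rw [Set.indicator_of_notMem (by simpa using hyS)]
      simp
    · rw [Set.indicator_of_mem (by simpa using hyS)]
      have h2 : 2 * A * Φ ≤ l * √‖f y‖ := by
        rw [hS] at hyS
        exact (not_le.1 hyS).le
      rw [← ofReal_norm, ENNReal.ofReal_rpow_of_nonneg (norm_nonneg _) (by norm_num),
        ← ENNReal.ofReal_mul (by positivity), ← ENNReal.ofReal_mul hl.le]
      refine ENNReal.ofReal_le_ofReal ?_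
      rw [rpow_three_halves (norm_nonneg _), ← mul_assoc]
      gcongr
  -- The argument cancels a factor 2Φ; when Φ = 0 the function f vanishes almost everywhere.
  rcases hΦ0.eq_or_lt with h0 | hpos
  · have hz : m2.toLp = 0 := by
      refine Lp.eq_zero_iff_ae_eq_zero.2 ?_
      rw [← h0, ENNReal.ofReal_zero, lintegral_eq_zero_iff'
        ((Lp.aestronglyMeasurable f).enorm.pow_const _)] at hΦ'
      filter_upwards [hΦ', m2.coeFn_toLp] with x hx hx2
      have : f x = 0 := by
        by_contra hne
        simp [hne] at hx
      rw [hx2]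
      simp [this]
    rw [hz, map_zero]
    filter_upwards [Lp.coeFn_zero ℂ 2 μ] with x hx
    rw [hx]
    simp
  · filter_upwards [hT m2.toLp] with x hx
    refine hx.trans ?_
    have h2 : ENNReal.ofReal (2 * Φ) * (ENNReal.ofReal A * ∫⁻ y, ‖(m2.toLp : Lp ℂ 2 μ) y‖ₑ ∂μ) ≤
        ENNReal.ofReal (2 * Φ) * ENNReal.ofReal (l / 2) := by
      rw [← mul_assoc, ← ENNReal.ofReal_mul (by positivity), ← ENNReal.ofReal_mul (by positivity)]
      convert h1 using 1
      · ring_nf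
      · rw [← ENNReal.ofReal_mul (by positivity)]
        ring_nf
    exact (ENNReal.mul_le_mul_iff_right (by simpa using hpos) ENNReal.ofReal_ne_top).1 h2

/-- The truncation height depends on the level l. The large part of f contributes at most l/2 to T
f, so |T f| > l forces the image of the small part to reach l/2. Chebyshev's inequality and the L²
isometry then give the factor 4. -/
theorem measure_dispersive_le (hA : 0 < A)
    (hT : ∀ f : Lp ℂ 2 μ, ∀ᵐ x ∂μ, ‖T f x‖ₑ ≤ ENNReal.ofReal A * ∫⁻ y, ‖f y‖ₑ ∂μ)
    (hΦ0 : 0 ≤ Φ) (hΦ' : ∫⁻ x, ‖f x‖ₑ ^ (3 / 2 : ℝ) ∂μ = ENNReal.ofReal Φ) {l : ℝ} (hl : 0 < l) :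
    μ {x | l < ‖T f x‖} * ENNReal.ofReal (l ^ (3 - 1 : ℝ)) ≤
      4 * ∫⁻ x, ‖f x‖ₑ ^ 2 * Set.indicator {x | l * √‖f x‖ ≤ 2 * A * Φ} 1 x ∂μ := by
  have hfm : Measurable fun x => ‖f x‖ := (Lp.stronglyMeasurable f).norm.measurable
  set S : Set α := {x | l * √‖f x‖ ≤ 2 * A * Φ} with hS
  have hSm : MeasurableSet S := measurableSet_le (hfm.sqrt.const_mul l) measurable_const
  have m1 : MemLp (S.indicator f) 2 μ := (Lp.memLp f).indicator hSm
  have m2 : MemLp (Sᶜ.indicator f) 2 μ := (Lp.memLp f).indicator hSm.compl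
  have hdec : f = m1.toLp + m2.toLp := by
    rw [← MemLp.toLp_add]
    refine Lp.ext ?_
    filter_upwards [MemLp.coeFn_toLp (m1.add m2)] with x hx
    rw [hx, Set.indicator_self_add_compl]
  have hlarge := enorm_dispersive_large_le T f hA hT hΦ0 hΦ' hl hS m2
  have hsub : μ {x | l < ‖T f x‖} ≤ μ {x | ENNReal.ofReal (l / 2) ≤ ‖T m1.toLp x‖ₑ} := by
    refine measure_mono_ae ?_
    have hadd : T f =ᵐ[μ] fun x => T m1.toLp x + T m2.toLp x := by
      conv_lhs => rw [hdec, map_add]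
      exact Lp.coeFn_add _ _
    filter_upwards [hlarge, hadd] with x h1 h2 h3
    have h3' : l < ‖T f x‖ := h3
    rw [h2] at h3'
    have h4 := norm_add_le (T m1.toLp x) (T m2.toLp x)
    rw [← ofReal_norm, ENNReal.ofReal_le_ofReal_iff (by positivity)] at h1
    change ENNReal.ofReal (l / 2) ≤ ‖T m1.toLp x‖ₑ
    rw [← ofReal_norm]
    exact ENNReal.ofReal_le_ofReal (by linarith)
  have hcheb := mul_meas_ge_le_lintegral₀ (μ := μ)
    (f := fun x => ‖T m1.toLp x‖ₑ ^ 2) (by fun_prop) (ENNReal.ofReal (l / 2) ^ 2)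
  have hset : {x | ENNReal.ofReal (l / 2) ≤ ‖T m1.toLp x‖ₑ} ⊆
      {x | ENNReal.ofReal (l / 2) ^ 2 ≤ ‖T m1.toLp x‖ₑ ^ 2} := fun x hx => by
    simp only [Set.mem_ofPred_eq] at hx ⊢
    gcongr
  have hn : ∫⁻ x, ‖T m1.toLp x‖ₑ ^ 2 ∂μ = ∫⁻ x, ‖f x‖ₑ ^ 2 * S.indicator 1 x ∂μ := by
    rw [← eLpNorm_two_sq, ← Lp.enorm_def, T.enorm_map, Lp.enorm_def, eLpNorm_two_sq]
    refine lintegral_congr_ae ?_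
    filter_upwards [m1.coeFn_toLp] with x hx
    rw [hx]
    by_cases hxS : x ∈ S <;> simp [hxS]
  have h4 : ENNReal.ofReal (l ^ (3 - 1 : ℝ)) = 4 * ENNReal.ofReal (l / 2) ^ 2 := by
    rw [← ENNReal.ofReal_pow (by positivity), ← ENNReal.ofReal_ofNat, ← ENNReal.ofReal_mul (by norm_num)]
    congr 1
    rw [show (3 - 1 : ℝ) = (2 : ℕ) by norm_num, Real.rpow_natCast]
    ring
  rw [h4, ← hn, mul_comm, mul_assoc]
  gcongr
  exact le_trans (mul_le_mul_right (hsub.trans (measure_mono hset)) _) hcheb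

/-- A linear isometry of `L²` which maps `L¹` to `L^∞` with norm `A` maps `L^{3/2}` to `L³`. -/
theorem lintegral_cube_le_of_dispersive [SFinite μ] (hA : 0 < A)
    (hT : ∀ f : Lp ℂ 2 μ, ∀ᵐ x ∂μ, ‖T f x‖ₑ ≤ ENNReal.ofReal A * ∫⁻ y, ‖f y‖ₑ ∂μ) :
    ∫⁻ x, ‖T f x‖ₑ ^ 3 ∂μ ≤ ENNReal.ofReal (24 * A) * (∫⁻ x, ‖f x‖ₑ ^ (3 / 2 : ℝ) ∂μ) ^ 2 := by
  by_cases htop : ∫⁻ x, ‖f x‖ₑ ^ (3 / 2 : ℝ) ∂μ = ⊤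
  · rw [htop]
    simp [ENNReal.mul_top, hA]
  obtain ⟨Φ, hΦ⟩ : ∃ Φ : ℝ, Φ = (∫⁻ x, ‖f x‖ₑ ^ (3 / 2 : ℝ) ∂μ).toReal := ⟨_, rfl⟩
  have hΦ' : ∫⁻ x, ‖f x‖ₑ ^ (3 / 2 : ℝ) ∂μ = ENNReal.ofReal Φ := by
    rw [hΦ, ENNReal.ofReal_toReal htop]
  have hΦ0 : 0 ≤ Φ := hΦ ▸ ENNReal.toReal_nonneg
  have hfm : Measurable fun x => ‖f x‖ := (Lp.stronglyMeasurable f).norm.measurable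
  have hlc := lintegral_rpow_eq_lintegral_meas_lt_mul μ (f := fun x => ‖T f x‖)
    (Filter.Eventually.of_forall fun x => norm_nonneg _)
    (Lp.aestronglyMeasurable (T f)).norm.aemeasurable (p := 3) (by norm_num)
  have e1 : ∫⁻ x, ‖T f x‖ₑ ^ 3 ∂μ = ∫⁻ x, ENNReal.ofReal (‖T f x‖ ^ (3 : ℝ)) ∂μ := by
    refine lintegral_congr fun x => ?_
    rw [← ofReal_norm, ← ENNReal.ofReal_pow (norm_nonneg _)]
    norm_cast
  rw [e1, hlc]
  have e2 : ∫⁻ l in Set.Ioi (0 : ℝ), μ {x | l < ‖T f x‖} * ENNReal.ofReal (l ^ (3 - 1 : ℝ)) ≤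
      ∫⁻ l in Set.Ioi (0 : ℝ), 4 * ∫⁻ x, ‖f x‖ₑ ^ 2 *
        Set.indicator {x | l * √‖f x‖ ≤ 2 * A * Φ} 1 x ∂μ := by
    refine setLIntegral_mono' measurableSet_Ioi fun l hl => measure_dispersive_le T f hA hT hΦ0 hΦ' hl
  have hmeas : Measurable (Function.uncurry fun (l : ℝ) (x : α) => ‖f x‖ₑ ^ 2 *
        Set.indicator {x | l * √‖f x‖ ≤ 2 * A * Φ} (1 : α → ℝ≥0∞) x) := by
    have hm : MeasurableSet {p : ℝ × α | p.1 * √‖f p.2‖ ≤ 2 * A * Φ} :=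
      measurableSet_le (measurable_fst.mul (hfm.comp measurable_snd).sqrt) measurable_const
    have : (Function.uncurry fun (l : ℝ) (x : α) => ‖f x‖ₑ ^ 2 *
        Set.indicator {x | l * √‖f x‖ ≤ 2 * A * Φ} (1 : α → ℝ≥0∞) x) = fun p => ‖f p.2‖ₑ ^ 2 *
        Set.indicator {p : ℝ × α | p.1 * √‖f p.2‖ ≤ 2 * A * Φ} 1 p := by
      funext p
      simp [Function.uncurry, Set.indicator_apply]
    rw [this]
    exact (((Lp.stronglyMeasurable f).enorm.comp measurable_snd).pow_const 2).mul
      (measurable_one.indicator hm)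
  -- For fixed x the admissible levels form an interval of length 2AΦ/√|f(x)|, which turns |f|² into
  -- |f|^(3/2). The final constant is 24 = 3 · 4 · 2, from the layer cake formula, Chebyshev's
  -- inequality and this length.
  have e3 : ∫⁻ l in Set.Ioi (0 : ℝ), ∫⁻ x, ‖f x‖ₑ ^ 2 *
        Set.indicator {x | l * √‖f x‖ ≤ 2 * A * Φ} 1 x ∂μ ≤
      ∫⁻ x, ENNReal.ofReal (2 * A * Φ) * ‖f x‖ₑ ^ (3 / 2 : ℝ) ∂μ := by
    rw [lintegral_lintegral_swap hmeas.aemeasurable]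
    refine lintegral_mono fun x => ?_
    rcases eq_or_ne (f x) 0 with h0 | hne
    · simp [h0]
    have hp : 0 < √‖f x‖ := Real.sqrt_pos.2 (norm_pos_iff.2 hne)
    have e4 : ∫⁻ l in Set.Ioi (0 : ℝ), ‖f x‖ₑ ^ 2 *
        Set.indicator {x | l * √‖f x‖ ≤ 2 * A * Φ} (1 : α → ℝ≥0∞) x =
        ‖f x‖ₑ ^ 2 * ENNReal.ofReal (2 * A * Φ / √‖f x‖) := by
      rw [lintegral_const_mul' _ _ (by simp)]
      congr 1
      have : ∀ l : ℝ, Set.indicator {x | l * √‖f x‖ ≤ 2 * A * Φ} (1 : α → ℝ≥0∞) x =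
          Set.indicator (Set.Iic (2 * A * Φ / √‖f x‖)) 1 l := by
        intro l
        simp only [Set.indicator_apply, Set.mem_ofPred_eq, Set.mem_Iic, le_div_iff₀ hp, Pi.one_apply]
      simp only [this]
      rw [lintegral_indicator_one measurableSet_Iic, Measure.restrict_apply measurableSet_Iic,
        Set.inter_comm, Set.Ioi_inter_Iic, Real.volume_Ioc, sub_zero]
    rw [e4, ← ofReal_norm, ENNReal.ofReal_rpow_of_nonneg (norm_nonneg _) (by norm_num),
      ← ENNReal.ofReal_pow (norm_nonneg _), ← ENNReal.ofReal_mul (by positivity),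
      ← ENNReal.ofReal_mul (by positivity)]
    refine ENNReal.ofReal_le_ofReal (le_of_eq ?_)
    rw [rpow_three_halves (norm_nonneg _)]
    have h5 := Real.mul_self_sqrt (norm_nonneg (f x))
    field_simp
    nlinarith
  calc ENNReal.ofReal 3 * _ ≤ ENNReal.ofReal 3 * (4 * ∫⁻ l in Set.Ioi (0 : ℝ), ∫⁻ x, ‖f x‖ₑ ^ 2 *
        Set.indicator {x | l * √‖f x‖ ≤ 2 * A * Φ} 1 x ∂μ) := by
        rw [← lintegral_const_mul' 4 _ (by norm_num)]
        exact mul_le_mul_right e2 _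
    _ ≤ ENNReal.ofReal 3 * (4 * ∫⁻ x, ENNReal.ofReal (2 * A * Φ) * ‖f x‖ₑ ^ (3 / 2 : ℝ) ∂μ) := by
        gcongr
    _ = _ := by
        rw [lintegral_const_mul' _ _ ENNReal.ofReal_ne_top, hΦ', ← ENNReal.ofReal_pow hΦ0,
          ← ENNReal.ofReal_ofNat 4, ← ENNReal.ofReal_mul (by positivity),
          ← ENNReal.ofReal_mul (by norm_num), ← ENNReal.ofReal_mul (by norm_num),
          ← ENNReal.ofReal_mul (by positivity)]
        congr 1
        ring

end Interpolation

theorem lintegral_schL_cube_le {t : ℝ} (ht : t ≠ 0) (f : L2R3) :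
    ∫⁻ x, ‖schL t f x‖ₑ ^ 3 ≤
      ENNReal.ofReal (24 * dispA t) * (∫⁻ x, ‖f x‖ₑ ^ (3 / 2 : ℝ)) ^ 2 := by
  have hA : 0 < dispA t := by
    have := abs_pos.2 ht
    unfold dispA
    positivity
  exact lintegral_cube_le_of_dispersive (schL t).toLinearIsometry f hA (enorm_schL_le ht)

/-! ### Duhamel's formula -/

theorem hasDerivAt_toL2_schS (ψ : 𝓢(R3, ℂ)) (t : ℝ) :
    HasDerivAt (fun s => toL2 (schS s ψ)) (Complex.I • toL2 (schS t (Δ ψ))) t := by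
  rw [hasDerivAt_iff_isLittleO_nhds_zero]
  have h : ∀ h : ℝ, ‖toL2 (schS (t + h) ψ) - toL2 (schS t ψ) - h • Complex.I • toL2 (schS t (Δ ψ))‖ ≤
      2 * h ^ 2 * ‖toL2 (Δ (Δ ψ))‖ := by
    intro h
    refine le_trans (le_of_eq ?_) (norm_schS_sub_sub_le t h ψ)
    rw [fourier_schS_laplacian, map_sub, map_sub, map_smul, ← smul_assoc, Complex.real_smul]
  have hO : (fun h => toL2 (schS (t + h) ψ) - toL2 (schS t ψ) - h • Complex.I • toL2 (schS t (Δ ψ)))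
      =O[𝓝 0] fun h : ℝ => h ^ 2 := by
    refine Asymptotics.IsBigO.of_bound (2 * ‖toL2 (Δ (Δ ψ))‖) (Filter.Eventually.of_forall fun x => ?_)
    refine (h x).trans (le_of_eq ?_)
    rw [norm_pow, Real.norm_eq_abs, sq_abs]
    ring
  refine hO.trans_isLittleO ?_
  simpa using Asymptotics.isLittleO_pow_pow (𝕜 := ℝ) one_lt_two

/-- A product rule in which w is differentiable only when tested against the frozen vector P(s). The
cross term of the increments is o(1) · O(r − s), because w is norm continuous and P is norm
differentiable. -/
theorem hasDerivAt_bil_of_weak {w P : ℝ → L2R3} {s : ℝ} {a : ℂ} {P' : L2R3} (hw : ContinuousAt w s)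
    (h1 : HasDerivAt (fun r => bil (w r) (P s)) a s) (hP : HasDerivAt P P' s) :
    HasDerivAt (fun r => bil (w r) (P r)) (a + bil (w s) P') s := by
  have h2 : HasDerivAt (fun r => bil (w s) (P r)) (bil (w s) P') s :=
    ((bil (w s)).restrictScalars ℝ).hasFDerivAt.comp_hasDerivAt s hP
  have h3 : HasDerivAt (fun r => bil (w r - w s) (P r - P s)) 0 s := by
    rw [hasDerivAt_iff_isLittleO]
    have e : (fun r => bil (w r - w s) (P r - P s) - bil (w s - w s) (P s - P s) - (r - s) • (0 : ℂ)) =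
        fun r => bil (w r - w s) (P r - P s) := by
      funext r
      simp
    rw [e]
    have hb : (fun r => bil (w r - w s) (P r - P s)) =O[𝓝 s] fun r => ‖w r - w s‖ * ‖P r - P s‖ := by
      refine Asymptotics.IsBigO.of_bound 1 (Filter.Eventually.of_forall fun r => ?_)
      rw [one_mul, norm_mul, norm_norm, norm_norm]
      exact norm_bil_le _ _
    have ho : (fun r => ‖w r - w s‖) =o[𝓝 s] fun _ => (1 : ℝ) := by
      rw [Asymptotics.isLittleO_one_iff]
      exact tendsto_iff_norm_sub_tendsto_zero.1 hw
    have hO : (fun r => ‖P r - P s‖) =O[𝓝 s] fun r => r - s :=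
      (hP.differentiableAt.isBigO_sub).norm_left
    simpa using hb.trans_isLittleO (ho.mul_isBigO hO)
  have e : (fun r => bil (w r) (P r)) =
      fun r => bil (w r) (P s) + bil (w s) (P r) + bil (w r - w s) (P r - P s) - bil (w s) (P s) := by
    funext r
    simp only [map_sub, sub_apply]
    ring
  rw [e]
  simpa using ((h1.add h2).add h3).sub_const (bil (w s) (P s))

/-- `w` solves `i ∂ₜ w = -Δ w + G` weakly. -/
def IsWeakSol (w G : ℝ → L2R3) : Prop :=
  ∀ (ψ : 𝓢(R3, ℂ)) (t : ℝ), HasDerivAt (fun s => Complex.I * bil (w s) (toL2 ψ))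
    (-bil (w t) (toL2 (Δ ψ)) + bil (G t) (toL2 ψ)) t

theorem IsWeakSol.hasDerivAt {w G : ℝ → L2R3} (h : IsWeakSol w G) (ψ : 𝓢(R3, ℂ)) (t : ℝ) :
    HasDerivAt (fun s => bil (w s) (toL2 ψ))
      (Complex.I * bil (w t) (toL2 (Δ ψ)) - Complex.I * bil (G t) (toL2 ψ)) t := by
  have h1 := (h ψ t).const_mul (-Complex.I)
  have e : (fun s => -Complex.I * (Complex.I * bil (w s) (toL2 ψ))) = fun s => bil (w s) (toL2 ψ) := by
    funext s
    rw [← mul_assoc]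
    simp
  rw [e] at h1
  have e2 : Complex.I * bil (w t) (toL2 (Δ ψ)) - Complex.I * bil (G t) (toL2 ψ) =
      -Complex.I * (-bil (w t) (toL2 (Δ ψ)) + bil (G t) (toL2 ψ)) := by ring
  rw [e2]
  exact h1

theorem continuous_bil : Continuous fun p : L2R3 × L2R3 => bil p.1 p.2 := bil.continuous₂

theorem continuous_schL_sub {G : ℝ → L2R3} (hG : Continuous G) (t : ℝ) :
    Continuous fun s => schL (t - s) (G s) := by
  have h : Continuous fun s => (t - s, G s) := by fun_prop
  exact schL_continuous.comp h

theorem bil_intervalIntegral {F : ℝ → L2R3} (hF : Continuous F) (a b : ℝ) (g : L2R3) :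
    bil (∫ s in a..b, F s) g = ∫ s in a..b, bil (F s) g :=
  (ContinuousLinearMap.intervalIntegral_comp_comm (bil.flip g) (hF.intervalIntegrable a b)).symm

theorem bil_duhamel_integral {G : ℝ → L2R3} (hG : Continuous G) (t : ℝ) (g : L2R3) :
    bil (∫ s in (0 : ℝ)..t, schL (t - s) (G s)) g = ∫ s in (0 : ℝ)..t, bil (schL (t - s) (G s)) g :=
  bil_intervalIntegral (continuous_schL_sub hG t) 0 t g

theorem hasDerivAt_toL2_schS_sub (ψ : 𝓢(R3, ℂ)) (t s : ℝ) :
    HasDerivAt (fun s => toL2 (schS (t - s) ψ)) (-(Complex.I • toL2 (schS (t - s) (Δ ψ)))) s :=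
  (hasDerivAt_toL2_schS ψ (t - s)).comp_const_sub t s

theorem bil_neg_I_smul (f g : L2R3) : bil f (-(Complex.I • g)) = -(Complex.I * bil f g) := by
  rw [map_neg, map_smul, smul_eq_mul]

/-- Testing against the backward free evolution of ψ makes the two Laplacian terms cancel and leaves
only the source. Integrating in s gives Duhamel's formula. -/
theorem IsWeakSol.hasDerivAt_bil_schS {w G : ℝ → L2R3} (h : IsWeakSol w G) (hw : Continuous w)
    (t s : ℝ) (ψ : 𝓢(R3, ℂ)) :
    HasDerivAt (fun s => bil (w s) (toL2 (schS (t - s) ψ)))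
      (-Complex.I * bil (schL (t - s) (G s)) (toL2 ψ)) s := by
  have h1 := hasDerivAt_bil_of_weak hw.continuousAt (h.hasDerivAt (schS (t - s) ψ) s)
    (hasDerivAt_toL2_schS_sub ψ t s)
  rw [bil_neg_I_smul, fourier_schS_laplacian] at h1
  rw [bil_schL_toL2]
  refine h1.congr_deriv ?_
  ring

theorem continuous_bil_schL {G : ℝ → L2R3} (hG : Continuous G) (t : ℝ) (g : L2R3) :
    Continuous fun s => bil (schL (t - s) (G s)) g :=
  continuous_bil.comp ((continuous_schL_sub hG t).prodMk continuous_const)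

theorem IsWeakSol.bil_duhamel {w G : ℝ → L2R3} (h : IsWeakSol w G) (hw : Continuous w)
    (hG : Continuous G) (t : ℝ) (ψ : 𝓢(R3, ℂ)) :
    bil (w t) (toL2 ψ) = bil (schL t (w 0)) (toL2 ψ) -
      Complex.I * ∫ s in (0 : ℝ)..t, bil (schL (t - s) (G s)) (toL2 ψ) := by
  have hftc := intervalIntegral.integral_eq_sub_of_hasDerivAt (a := 0) (b := t)
    (fun s _ => h.hasDerivAt_bil_schS hw t s ψ)
    ((continuous_const.mul (continuous_bil_schL hG t (toL2 ψ))).intervalIntegrable 0 t)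
  rw [intervalIntegral.integral_const_mul, sub_self, sub_zero, schS_zero] at hftc
  rw [bil_schL_toL2]
  linear_combination -hftc

theorem IsWeakSol.duhamel {w G : ℝ → L2R3} (h : IsWeakSol w G) (hw : Continuous w)
    (hG : Continuous G) (t : ℝ) :
    w t = schL t (w 0) - Complex.I • ∫ s in (0 : ℝ)..t, schL (t - s) (G s) := by
  refine eq_of_forall_bil_toL2 fun ψ => ?_
  rw [map_sub, map_smul, sub_apply, smul_apply, smul_eq_mul, bil_duhamel_integral hG,
    h.bil_duhamel hw hG]

/-! ### The kernel -/

/-- The kernel `(24 A(t))^{1/3}` controlling the `L^{3/2} → L³` norm of the Schrödinger group. -/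
noncomputable def schK (t : ℝ) : ℝ := (24 * dispA t) ^ (1 / 3 : ℝ)

theorem schK_nonneg (t : ℝ) : 0 ≤ schK t :=
  Real.rpow_nonneg (mul_nonneg (by norm_num) (dispA_nonneg t)) _

/-- The constant of the kernel. -/
noncomputable def schC : ℝ := (24 * (4 * Real.pi) ^ (-(3 / 2) : ℝ)) ^ (1 / 3 : ℝ)

theorem schC_nonneg : 0 ≤ schC := by
  unfold schC
  positivity

theorem schK_eq (t : ℝ) : schK t = schC * |t| ^ (-(1 / 2) : ℝ) := by
  rw [schK, schC, dispA, Real.mul_rpow (by positivity) (abs_nonneg t), ← mul_assoc,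
    Real.mul_rpow (by positivity) (by positivity), ← Real.rpow_mul (abs_nonneg t)]
  norm_num

theorem measurable_schK : Measurable schK := by
  have : schK = fun t => schC * |t| ^ (-(1 / 2) : ℝ) :=
    funext schK_eq
  rw [this]
  fun_prop

theorem schK_neg (t : ℝ) : schK (-t) = schK t := by
  rw [schK_eq, schK_eq, abs_neg]

theorem locallyIntegrable_abs_rpow {r : ℝ} (hr : -1 < r) (c : ℝ) :
    LocallyIntegrable (fun t : ℝ => c * |t| ^ r) := by
  refine locallyIntegrable_of_norm_le_rpow (C := |c|) (α := -r) (by simp) (by simp; linarith)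
    (Filter.Eventually.of_forall fun t => ?_)
    ((measurable_id.abs.pow_const r).const_mul c).aestronglyMeasurable
  rw [neg_neg, norm_mul, Real.norm_eq_abs, Real.norm_eq_abs t,
    Real.norm_of_nonneg (Real.rpow_nonneg (abs_nonneg t) _)]

theorem lintegral_schK_lt_top : ∫⁻ t in Set.Ioo (-1) 1, ENNReal.ofReal (schK t) < ⊤ := by
  have h := locallyIntegrable_abs_rpow (r := -(1 / 2)) (by norm_num)
    schC
  simp only [← schK_eq] at h
  exact ((h.integrableOn_isCompact isCompact_Icc).mono_set Set.Ioo_subset_Icc_self).lintegral_lt_top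

/-- The power 3/2 of the kernel is |t|^(-3/4), still locally integrable. This slack is available
because the estimate is in L³ of a bounded time interval, below the admissible exponent L⁴ paired
with L³ in space. -/
theorem lintegral_schK_rpow_lt_top :
    ∫⁻ t in Set.Ioo (-1) 1, ENNReal.ofReal (schK t) ^ (3 / 2 : ℝ) < ⊤ := by
  have h := locallyIntegrable_abs_rpow (r := -(3 / 4)) (by norm_num)
    (schC ^ (3 / 2 : ℝ))
  have e : (fun t : ℝ => schC ^ (3 / 2 : ℝ) *
      |t| ^ (-(3 / 4) : ℝ)) = fun t => schK t ^ (3 / 2 : ℝ) := by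
    funext t
    rw [schK_eq, Real.mul_rpow schC_nonneg (by positivity), ← Real.rpow_mul (abs_nonneg t)]
    norm_num
  rw [e] at h
  have := ((h.integrableOn_isCompact isCompact_Icc).mono_set
    (Set.Ioo_subset_Icc_self (a := -1) (b := 1))).lintegral_lt_top
  simpa only [ENNReal.ofReal_rpow_of_nonneg (schK_nonneg _) (by norm_num : (0 : ℝ) ≤ 3 / 2)] using this

/-- Hölder's inequality for the pairing of `L³` and `L^{3/2}`. -/
theorem enorm_bil_schL_le {t : ℝ} (ht : t ≠ 0) (f g : L2R3) :
    ‖bil (schL t f) g‖ₑ ≤ ENNReal.ofReal (schK t) * (∫⁻ x, ‖f x‖ₑ ^ (3 / 2 : ℝ)) ^ (2 / 3 : ℝ) *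
      (∫⁻ x, ‖g x‖ₑ ^ (3 / 2 : ℝ)) ^ (2 / 3 : ℝ) := by
  have h1 := ENNReal.lintegral_mul_le_Lp_mul_Lq (volume : Measure R3)
    (Real.holderConjugate_iff.2 ⟨by norm_num, by norm_num⟩ : (3 : ℝ).HolderConjugate (3 / 2))
    (f := fun x => ‖schL t f x‖ₑ) (g := fun x => ‖g x‖ₑ)
    (Lp.aestronglyMeasurable _).enorm (Lp.aestronglyMeasurable _).enorm
  have h2 : ‖bil (schL t f) g‖ₑ ≤ ∫⁻ x, ‖schL t f x‖ₑ * ‖g x‖ₑ := by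
    rw [bil_apply]
    refine (enorm_integral_le_lintegral_enorm _).trans (le_of_eq ?_)
    simp only [enorm_mul]
  refine h2.trans (h1.trans ?_)
  have h3 : (1 / (3 / 2) : ℝ) = 2 / 3 := by norm_num
  rw [h3]
  gcongr
  have h4 := lintegral_schL_cube_le ht f
  have h5 : ∫⁻ x, ‖schL t f x‖ₑ ^ (3 : ℝ) = ∫⁻ x, ‖schL t f x‖ₑ ^ 3 := by
    refine lintegral_congr fun x => ?_
    norm_cast
  rw [h5]
  calc _ ≤ (ENNReal.ofReal (24 * dispA t) * (∫⁻ x, ‖f x‖ₑ ^ (3 / 2 : ℝ)) ^ 2) ^ (1 / 3 : ℝ) := by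
        gcongr
    _ = _ := by
        rw [ENNReal.mul_rpow_of_nonneg _ _ (by norm_num), schK,
          ENNReal.ofReal_rpow_of_nonneg (mul_nonneg (by norm_num) (dispA_nonneg t)) (by norm_num)]
        congr 1
        rw [← ENNReal.rpow_natCast, ← ENNReal.rpow_mul]
        norm_num

/-! ### Strichartz estimates -/

theorem bil_schL (t : ℝ) (f g : L2R3) : bil (schL t f) g = bil f (schL t g) := by
  refine L2R3_induction (p := fun g => bil (schL t f) g = bil f (schL t g)) ?_ ?_ g
  · exact isClosed_eq (bil (schL t f)).continuous ((bil f).continuous.comp (schL t).continuous)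
  · intro ψ
    rw [bil_schL_toL2, schL_toL2]

theorem inner_eq_bil (f g : L2R3) : inner ℂ f g = bil g (star f) := by
  rw [MeasureTheory.L2.inner_def, bil_apply]
  refine integral_congr_ae ?_
  filter_upwards [Lp.coeFn_star f] with x hx
  rw [hx]
  simp

/-- The TT* kernel: by unitarity only the elapsed time t − s matters, and the decay in L^{3/2} → L³
applies to it. -/
theorem norm_inner_schL_schL_le {s t : ℝ} (h : t - s ≠ 0) (f g : L2R3) :
    ‖inner ℂ (schL s f) (schL t g)‖ₑ ≤ ENNReal.ofReal (schK (t - s)) *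
      (∫⁻ x, ‖g x‖ₑ ^ (3 / 2 : ℝ)) ^ (2 / 3 : ℝ) * (∫⁻ x, ‖f x‖ₑ ^ (3 / 2 : ℝ)) ^ (2 / 3 : ℝ) := by
  rw [inner_schL_left, schL_schL, inner_eq_bil]
  have h1 : -s + t = t - s := by ring
  have h2 : ∫⁻ x, ‖(star f : L2R3) x‖ₑ ^ (3 / 2 : ℝ) = ∫⁻ x, ‖f x‖ₑ ^ (3 / 2 : ℝ) := by
    refine lintegral_congr_ae ?_
    filter_upwards [Lp.coeFn_star f] with x hx
    rw [hx]
    simp [← ofReal_norm]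
  rw [h1, ← h2]
  exact enorm_bil_schL_le h _ _

/-- The integral of the kernel over a short symmetric interval. -/
noncomputable def schKint (τ : ℝ) : ℝ≥0∞ := ∫⁻ r in Set.Ioo (-τ) τ, ENNReal.ofReal (schK r)

theorem lintegral_Ioc_comp_sub_le {k : ℝ → ℝ≥0∞} (τ : ℝ) {t : ℝ}
    (ht : t ∈ Set.Ioc 0 τ) : ∫⁻ s in Set.Ioc 0 τ, k (t - s) ≤ ∫⁻ r in Set.Ioo (-τ) τ, k r := by
  rw [← lintegral_indicator measurableSet_Ioo, ← lintegral_indicator measurableSet_Ioc,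
    ← lintegral_sub_left_eq_self ((Set.Ioo (-τ) τ).indicator k) t]
  refine lintegral_mono fun s => ?_
  by_cases hs : s ∈ Set.Ioc 0 τ
  · have : t - s ∈ Set.Ioo (-τ) τ := ⟨by linarith [ht.1, hs.2], by linarith [ht.2, hs.1]⟩
    rw [Set.indicator_of_mem hs, Set.indicator_of_mem this]
  · rw [Set.indicator_of_notMem hs]
    exact zero_le

theorem lintegral_Ioc_comp_sub_le' {k : ℝ → ℝ≥0∞} (τ : ℝ) {s : ℝ}
    (hs : s ∈ Set.Ioc 0 τ) : ∫⁻ t in Set.Ioc 0 τ, k (t - s) ≤ ∫⁻ r in Set.Ioo (-τ) τ, k r := by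
  rw [← lintegral_indicator measurableSet_Ioo, ← lintegral_indicator measurableSet_Ioc,
    ← lintegral_sub_right_eq_self ((Set.Ioo (-τ) τ).indicator k) s]
  refine lintegral_mono fun t => ?_
  by_cases ht : t ∈ Set.Ioc 0 τ
  · have : t - s ∈ Set.Ioo (-τ) τ := ⟨by linarith [ht.1, hs.2], by linarith [ht.2, hs.1]⟩
    rw [Set.indicator_of_mem ht, Set.indicator_of_mem this]
  · rw [Set.indicator_of_notMem ht]
    exact zero_le

/-- Absolute continuity of the integral. This is what permits the nonlinear contribution to be
absorbed on a short time interval. -/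
theorem exists_schKint_le {ε : ℝ≥0∞} (hε : ε ≠ 0) : ∃ τ : ℝ, 0 < τ ∧ τ ≤ 1 ∧ schKint τ ≤ ε := by
  obtain ⟨δ, hδ, h⟩ := exists_pos_setLIntegral_lt_of_measure_lt lintegral_schK_lt_top.ne hε
  obtain ⟨δ', hδ', hδ1⟩ : ∃ δ' : ℝ, 0 < δ' ∧ ENNReal.ofReal δ' < δ := by
    obtain ⟨r, hr, hr'⟩ := ENNReal.lt_iff_exists_nnreal_btwn.1 hδ
    exact ⟨r, by exact_mod_cast hr, by simpa using hr'⟩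
  refine ⟨min 1 (δ' / 2), by positivity, min_le_left _ _, ?_⟩
  have h1 : Set.Ioo (-(min 1 (δ' / 2))) (min 1 (δ' / 2)) ⊆ Set.Ioo (-1) 1 :=
    Set.Ioo_subset_Ioo (neg_le_neg (min_le_left _ _)) (min_le_left _ _)
  have h2 := h (Set.Ioo (-(min 1 (δ' / 2))) (min 1 (δ' / 2))) (by
    refine (Measure.restrict_apply_le _ _).trans_lt (lt_of_le_of_lt ?_ hδ1)
    rw [Real.volume_Ioo]
    refine ENNReal.ofReal_le_ofReal ?_
    linarith [min_le_right 1 (δ' / 2)])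
  rw [Measure.restrict_restrict measurableSet_Ioo, Set.inter_eq_left.2 h1] at h2
  exact h2.le

theorem continuous_schL_apply {F : ℝ → L2R3} (hF : Continuous F) : Continuous fun t => schL t (F t) := by
  have h : Continuous fun t => (t, F t) := by fun_prop
  exact schL_continuous.comp h

theorem enorm_intervalIntegral_le {E : Type*} [NormedAddCommGroup E] [NormedSpace ℝ E] {τ : ℝ}
    (hτ : 0 ≤ τ) (f : ℝ → E) : ‖∫ t in (0 : ℝ)..τ, f t‖ₑ ≤ ∫⁻ t in Set.Ioc 0 τ, ‖f t‖ₑ := by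
  rw [intervalIntegral.integral_of_le hτ]
  exact enorm_integral_le_lintegral_enorm _

theorem inner_intervalIntegral (f : L2R3) {F : ℝ → L2R3} (hF : Continuous F) (a b : ℝ) :
    inner ℂ f (∫ t in a..b, F t) = ∫ t in a..b, inner ℂ f (F t) :=
  (ContinuousLinearMap.intervalIntegral_comp_comm (innerSL ℂ f) (hF.intervalIntegrable a b)).symm

/-- The square of the norm of a time integral is the double integral of inner products, and each of
these is bounded by the TT* kernel. -/
theorem enorm_integral_schL_sq_le {F : ℝ → L2R3} (hF : Continuous F) {a : ℝ → ℝ≥0∞} {τ : ℝ}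
    (hτ : 0 ≤ τ) (ha : ∀ t ∈ Set.Ioc 0 τ, (∫⁻ x, ‖F t x‖ₑ ^ (3 / 2 : ℝ)) ^ (2 / 3 : ℝ) ≤ a t) :
    ‖∫ t in (0 : ℝ)..τ, schL t (F t)‖ₑ ^ 2 ≤ ∫⁻ t in Set.Ioc 0 τ, ∫⁻ s in Set.Ioc 0 τ,
      ENNReal.ofReal (schK (t - s)) * a s * a t := by
  set V := ∫ t in (0 : ℝ)..τ, schL t (F t) with hV
  have h1 : ‖V‖ₑ ^ 2 = ‖inner ℂ V V‖ₑ := by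
    rw [← ofReal_norm, ← ofReal_norm, ← ENNReal.ofReal_pow (norm_nonneg _),
      inner_self_eq_norm_sq_to_K]
    simp
  have h2 : inner ℂ V V = ∫ t in (0 : ℝ)..τ, inner ℂ V (schL t (F t)) := by
    conv_lhs => rw [hV]
    exact inner_intervalIntegral V (continuous_schL_apply hF) 0 τ
  rw [h1, h2]
  refine (enorm_intervalIntegral_le hτ _).trans (setLIntegral_mono' measurableSet_Ioc fun t ht => ?_)
  have h3 : ‖inner ℂ V (schL t (F t))‖ₑ = ‖inner ℂ (schL t (F t)) V‖ₑ := by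
    rw [← ofReal_norm, ← ofReal_norm, norm_inner_symm]
  rw [h3, hV, inner_intervalIntegral _ (continuous_schL_apply hF)]
  refine (enorm_intervalIntegral_le hτ _).trans (setLIntegral_mono_ae' measurableSet_Ioc ?_)
  -- The dispersive bound is unavailable at zero elapsed time; the diagonal is a null set.
  have hne : ∀ᵐ s : ℝ, s ≠ t := by simp [ae_iff]
  filter_upwards [hne] with s hs hs'
  refine (norm_inner_schL_schL_le (sub_ne_zero.2 hs) _ _).trans ?_
  rw [← neg_sub, schK_neg]
  gcongr
  · exact ha s hs'
  · exact ha t ht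

/-- Duhamel's formula splits the pairing. In the free part the group moves onto F by symmetry,
leaving w(0) paired with ∫ S(t)F(t) dt, to which TT* applies. In the source part Hölder and
dispersion are applied for each pair of times, and the range s ≤ t is enlarged to the whole
interval. -/
theorem enorm_integral_bil_le {w G F : ℝ → L2R3} (h : IsWeakSol w G) (hw : Continuous w)
    (hG : Continuous G) (hF : Continuous F) {a g : ℝ → ℝ≥0∞} {τ : ℝ} (hτ : 0 ≤ τ)
    (ha : ∀ t ∈ Set.Ioc 0 τ, (∫⁻ x, ‖F t x‖ₑ ^ (3 / 2 : ℝ)) ^ (2 / 3 : ℝ) ≤ a t)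
    (hg : ∀ t ∈ Set.Ioc 0 τ, (∫⁻ x, ‖G t x‖ₑ ^ (3 / 2 : ℝ)) ^ (2 / 3 : ℝ) ≤ g t) :
    ‖∫ t in (0 : ℝ)..τ, bil (w t) (F t)‖ₑ ≤
      ‖w 0‖ₑ * (∫⁻ t in Set.Ioc 0 τ, ∫⁻ s in Set.Ioc 0 τ,
        ENNReal.ofReal (schK (t - s)) * a s * a t) ^ (1 / 2 : ℝ) +
      ∫⁻ t in Set.Ioc 0 τ, ∫⁻ s in Set.Ioc 0 τ, ENNReal.ofReal (schK (t - s)) * g s * a t := by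
  have e1 : ∀ t, bil (w t) (F t) = bil (w 0) (schL t (F t)) + (bil (w t) (F t) - bil (schL t (w 0)) (F t)) := by
    intro t
    rw [bil_schL]
    ring
  have e2 : ∀ t, bil (w t) (F t) - bil (schL t (w 0)) (F t) =
      -(Complex.I * ∫ s in (0 : ℝ)..t, bil (schL (t - s) (G s)) (F t)) := by
    intro t
    conv_lhs => rw [h.duhamel hw hG t]
    rw [map_sub, map_smul, sub_apply, smul_apply, bil_duhamel_integral hG, smul_eq_mul]
    ring
  have c1 : Continuous fun t => bil (w 0) (schL t (F t)) :=
    (bil (w 0)).continuous.comp (continuous_schL_apply hF)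
  have c2 : Continuous fun t => bil (w t) (F t) - bil (schL t (w 0)) (F t) := by
    have h1 : Continuous fun t => bil (w t) (F t) := continuous_bil.comp (hw.prodMk hF)
    have h2 : Continuous fun t => bil (schL t (w 0)) (F t) :=
      continuous_bil.comp ((continuous_schL_apply continuous_const).prodMk hF)
    exact h1.sub h2
  have e3 : ∫ t in (0 : ℝ)..τ, bil (w t) (F t) = bil (w 0) (∫ t in (0 : ℝ)..τ, schL t (F t)) +
      ∫ t in (0 : ℝ)..τ, (bil (w t) (F t) - bil (schL t (w 0)) (F t)) := by
    rw [bil_comm, bil_intervalIntegral (continuous_schL_apply hF)]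
    simp only [bil_comm _ (w 0)]
    rw [← intervalIntegral.integral_add (c1.intervalIntegrable 0 τ) (c2.intervalIntegrable 0 τ)]
    simp only [← e1]
  rw [e3]
  refine (enorm_add_le _ _).trans (add_le_add ?_ ?_)
  · have h1 : ‖bil (w 0) (∫ t in (0 : ℝ)..τ, schL t (F t))‖ₑ ≤
        ‖w 0‖ₑ * ‖∫ t in (0 : ℝ)..τ, schL t (F t)‖ₑ := by
      rw [← ofReal_norm, ← ofReal_norm, ← ofReal_norm, ← ENNReal.ofReal_mul (norm_nonneg _)]
      exact ENNReal.ofReal_le_ofReal (norm_bil_le _ _)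
    refine h1.trans ?_
    gcongr
    have h2 := ENNReal.rpow_le_rpow (enorm_integral_schL_sq_le hF hτ ha) (by norm_num : (0 : ℝ) ≤ 1 / 2)
    rwa [← ENNReal.rpow_natCast, ← ENNReal.rpow_mul, Nat.cast_ofNat,
      mul_one_div_cancel two_ne_zero, ENNReal.rpow_one] at h2
  · refine (enorm_intervalIntegral_le hτ _).trans (setLIntegral_mono' measurableSet_Ioc fun t ht => ?_)
    rw [e2, enorm_neg, enorm_mul]
    have hI : ‖Complex.I‖ₑ = 1 := by simp [← ofReal_norm]
    rw [hI, one_mul]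
    refine (enorm_intervalIntegral_le ht.1.le _).trans ((lintegral_mono_set
      (Set.Ioc_subset_Ioc_right ht.2)).trans (setLIntegral_mono_ae' measurableSet_Ioc ?_))
    have hne : ∀ᵐ s : ℝ, s ≠ t := by simp [ae_iff]
    filter_upwards [hne] with s hs hs'
    refine (enorm_bil_schL_le (sub_ne_zero.2 hs.symm) _ _).trans ?_
    gcongr
    · exact hg s hs'
    · exact ha t ht

theorem mul_mul_le_cubes (p q r : ℝ≥0∞) : p * q * r ≤ p ^ 3 + q ^ 3 + r ^ 3 := by
  set M := max p (max q r) with hM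
  have h1 : p * q * r ≤ M ^ 3 := by
    rw [pow_succ, pow_two]
    gcongr
    · exact le_max_left _ _
    · exact (le_max_left _ _).trans (le_max_right _ _)
    · exact (le_max_right _ _).trans (le_max_right _ _)
  refine h1.trans ?_
  rcases max_choice p (max q r) with h | h
  · rw [hM, h, add_assoc]
    exact le_self_add
  · rcases max_choice q r with h' | h'
    · rw [hM, h, h', add_assoc]
      exact le_self_add.trans le_add_self
    · rw [hM, h, h']
      exact le_add_self

theorem measurable_schK_sub : Measurable fun p : ℝ × ℝ => ENNReal.ofReal (schK (p.1 - p.2)) :=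
  (measurable_schK.comp (measurable_fst.sub measurable_snd)).ennreal_ofReal

theorem lintegral_kernel_snd {k W : ℝ → ℝ≥0∞} (hk : Measurable k) (hW : Measurable W) (τ : ℝ) :
    ∫⁻ t in Set.Ioc 0 τ, ∫⁻ s in Set.Ioc 0 τ, k (t - s) * W t ≤
      (∫⁻ r in Set.Ioo (-τ) τ, k r) * ∫⁻ t in Set.Ioc 0 τ, W t := by
  rw [← lintegral_const_mul _ hW]
  refine setLIntegral_mono' measurableSet_Ioc fun t ht => ?_
  rw [lintegral_mul_const _ (by fun_prop)]
  exact mul_le_mul_left (lintegral_Ioc_comp_sub_le τ ht) _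

theorem lintegral_kernel_fst {k W : ℝ → ℝ≥0∞} (hk : Measurable k) (hW : Measurable W) (τ : ℝ) :
    ∫⁻ t in Set.Ioc 0 τ, ∫⁻ s in Set.Ioc 0 τ, k (t - s) * W s ≤
      (∫⁻ r in Set.Ioo (-τ) τ, k r) * ∫⁻ t in Set.Ioc 0 τ, W t := by
  rw [lintegral_lintegral_swap (by fun_prop), ← lintegral_const_mul _ hW]
  refine setLIntegral_mono' measurableSet_Ioc fun s hs => ?_
  rw [lintegral_mul_const _ (by fun_prop)]
  exact mul_le_mul_left (lintegral_Ioc_comp_sub_le' τ hs) _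

/-- Pointwise W(s)W(t)² ≤ W(s)³ + W(t)³; each term is then integrated first against the kernel in
the other variable. -/
theorem lintegral_kernel_inhomogeneous_le {W : ℝ → ℝ≥0∞} (hW : Measurable W) (τ : ℝ) :
    ∫⁻ t in Set.Ioc 0 τ, ∫⁻ s in Set.Ioc 0 τ, ENNReal.ofReal (schK (t - s)) * W s * W t ^ 2 ≤
      2 * schKint τ * ∫⁻ t in Set.Ioc 0 τ, W t ^ 3 := by
  have hk := measurable_schK.ennreal_ofReal
  have h1 : ∀ t s, ENNReal.ofReal (schK (t - s)) * W s * W t ^ 2 ≤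
      ENNReal.ofReal (schK (t - s)) * W s ^ 3 + ENNReal.ofReal (schK (t - s)) * W t ^ 3 := by
    intro t s
    rw [mul_assoc, ← mul_add]
    gcongr
    rcases le_total (W s) (W t) with h | h
    · refine le_trans (le_trans (mul_le_mul_left h _) (le_of_eq ?_)) le_add_self
      ring
    · refine le_trans (le_trans (mul_le_mul_right (pow_le_pow_left' h 2) _) (le_of_eq ?_)) le_self_add
      ring
  refine (lintegral_mono fun t => lintegral_mono fun s => h1 t s).trans ?_
  have h2 := lintegral_kernel_fst hk (hW.pow_const 3) τ
  have h3 := lintegral_kernel_snd hk (hW.pow_const 3) τ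
  have h4 : ∀ t, ∫⁻ s in Set.Ioc 0 τ, (ENNReal.ofReal (schK (t - s)) * W s ^ 3 +
      ENNReal.ofReal (schK (t - s)) * W t ^ 3) =
      (∫⁻ s in Set.Ioc 0 τ, ENNReal.ofReal (schK (t - s)) * W s ^ 3) +
      ∫⁻ s in Set.Ioc 0 τ, ENNReal.ofReal (schK (t - s)) * W t ^ 3 := fun t =>
    lintegral_add_left ((hk.comp (measurable_const.sub measurable_id)).mul (hW.pow_const 3)) _
  simp only [h4]
  rw [lintegral_add_left (Measurable.lintegral_prod_right
    ((measurable_schK_sub).mul ((hW.comp measurable_snd).pow_const 3)))]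
  refine (add_le_add h2 h3).trans (le_of_eq ?_)
  rw [schKint]
  ring

/-- With k = m², the integrand times l is the product of l W(s)W(t), m W(s) and m W(t), and is at
most the sum of their cubes. Since m³ = k^(3/2) is locally integrable, this replaces
Hardy–Littlewood–Sobolev; the free parameter l restores homogeneity. -/
theorem lintegral_kernel_homogeneous_le {W : ℝ → ℝ≥0∞} (hW : Measurable W) {τ : ℝ} (hτ : τ ≤ 1)
    (l : ℝ≥0∞) (hl : l ≠ ⊤) :
    l * ∫⁻ t in Set.Ioc 0 τ, ∫⁻ s in Set.Ioc 0 τ, ENNReal.ofReal (schK (t - s)) * W s ^ 2 * W t ^ 2 ≤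
      l ^ 3 * (∫⁻ t in Set.Ioc 0 τ, W t ^ 3) ^ 2 +
      2 * (∫⁻ r in Set.Ioo (-1) 1, ENNReal.ofReal (schK r) ^ (3 / 2 : ℝ)) *
        ∫⁻ t in Set.Ioc 0 τ, W t ^ 3 := by
  set k : ℝ → ℝ≥0∞ := fun r => ENNReal.ofReal (schK r) ^ (3 / 2 : ℝ) with hkdef
  have hk : Measurable k := measurable_schK.ennreal_ofReal.pow_const _
  have h1 : ∀ t s, l * (ENNReal.ofReal (schK (t - s)) * W s ^ 2 * W t ^ 2) ≤
      l ^ 3 * (W s ^ 3 * W t ^ 3) + (k (t - s) * W s ^ 3 + k (t - s) * W t ^ 3) := by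
    intro t s
    set m : ℝ≥0∞ := ENNReal.ofReal (schK (t - s)) ^ (1 / 2 : ℝ) with hm
    have hm2 : ENNReal.ofReal (schK (t - s)) = m ^ 2 := by
      rw [hm, ← ENNReal.rpow_natCast, ← ENNReal.rpow_mul]
      norm_num
    have hm3 : k (t - s) = m ^ 3 := by
      rw [hm, hkdef, ← ENNReal.rpow_natCast, ← ENNReal.rpow_mul]
      norm_num
    rw [hm2, hm3]
    have := mul_mul_le_cubes (l * (W s * W t)) (m * W s) (m * W t)
    calc _ = l * (W s * W t) * (m * W s) * (m * W t) := by ring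
      _ ≤ _ := this
      _ = _ := by ring
  rw [← lintegral_const_mul' _ _ hl]
  simp only [← lintegral_const_mul' l _ hl]
  refine (lintegral_mono fun t => lintegral_mono fun s => h1 t s).trans ?_
  have h2 := lintegral_kernel_fst hk (hW.pow_const 3) τ
  have h3 := lintegral_kernel_snd hk (hW.pow_const 3) τ
  have hks : Measurable fun p : ℝ × ℝ => k (p.1 - p.2) := hk.comp (measurable_fst.sub measurable_snd)
  have h4 : ∀ t, ∫⁻ s in Set.Ioc 0 τ, (l ^ 3 * (W s ^ 3 * W t ^ 3) +
      (k (t - s) * W s ^ 3 + k (t - s) * W t ^ 3)) =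
      l ^ 3 * ((∫⁻ s in Set.Ioc 0 τ, W s ^ 3) * W t ^ 3) +
      ((∫⁻ s in Set.Ioc 0 τ, k (t - s) * W s ^ 3) +
      ∫⁻ s in Set.Ioc 0 τ, k (t - s) * W t ^ 3) := by
    intro t
    rw [lintegral_add_left (by fun_prop), lintegral_add_left (by fun_prop),
      lintegral_const_mul _ (by fun_prop), lintegral_mul_const _ (by fun_prop)]
  simp only [h4]
  rw [lintegral_add_left (by fun_prop), lintegral_add_left (Measurable.lintegral_prod_right
    (hks.mul ((hW.comp measurable_snd).pow_const 3))), lintegral_const_mul _ (by fun_prop),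
    lintegral_const_mul _ (by fun_prop), ← pow_two]
  gcongr
  have h5 : ∫⁻ r in Set.Ioo (-τ) τ, k r ≤ ∫⁻ r in Set.Ioo (-1) 1, k r :=
    lintegral_mono_set (Set.Ioo_subset_Ioo (neg_le_neg hτ) hτ)
  refine (add_le_add h2 h3).trans ?_
  rw [← two_mul, ← mul_assoc]
  gcongr

/-- The choice l = (2p)⁻¹ makes the quadratic term B²/4 after multiplication by p², so it can be
absorbed on the left; what remains is linear in B. -/
theorem le_of_quadratic_interpolation {B κ X p : ℝ} (hB : 0 ≤ B) (hκ : 0 ≤ κ) (hp : 0 < p)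
    (h2 : B ^ 2 ≤ p ^ 2 * X) (h3 : (2 * p)⁻¹ * X ≤ (2 * p)⁻¹ ^ 3 * B ^ 2 + 2 * κ * B) :
    B ≤ 8 * p ^ 3 * κ := by
  have h4 : X ≤ (2 * p)⁻¹ ^ 2 * B ^ 2 + 4 * p * κ * B := by
    have := mul_le_mul_of_nonneg_left h3 (by positivity : 0 ≤ 2 * p)
    have e1 : 2 * p * ((2 * p)⁻¹ * X) = X := by field_simp
    have e2 : 2 * p * ((2 * p)⁻¹ ^ 3 * B ^ 2 + 2 * κ * B) =
        (2 * p)⁻¹ ^ 2 * B ^ 2 + 4 * p * κ * B := by field_simp; ring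
    linarith
  have h5 : B ^ 2 ≤ B ^ 2 / 4 + 4 * p ^ 3 * κ * B := by
    have := mul_le_mul_of_nonneg_left h4 (by positivity : 0 ≤ p ^ 2)
    have e : p ^ 2 * ((2 * p)⁻¹ ^ 2 * B ^ 2 + 4 * p * κ * B) = B ^ 2 / 4 + 4 * p ^ 3 * κ * B := by
      field_simp
      ring
    linarith
  rcases hB.eq_or_lt with rfl | hBp
  · positivity
  by_contra hlt
  push Not at hlt
  have h7 : 0 ≤ 4 * p ^ 3 * κ := by positivity
  nlinarith

/-- The numerical conclusion of the Strichartz argument. -/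
theorem le_of_strichartz_inequality {B N C K κ κ' X : ℝ≥0∞} (hB : B ≠ ⊤) (hN : N ≠ ⊤) (hN0 : N ≠ 0)
    (hC : C ≠ ⊤) (hC0 : C ≠ 0) (hκ' : κ' ≠ ⊤) (hK : C * K * κ ≤ 1 / 2)
    (hX : ∀ l : ℝ≥0∞, l ≠ ⊤ → l * X ≤ l ^ 3 * B ^ 2 + 2 * κ' * B)
    (h : B ≤ C * (N * X ^ (1 / 2 : ℝ) + K * (κ * B))) : B ≤ 64 * κ' * C ^ 3 * N ^ 3 := by
  -- The nonlinear contribution is at most B/2 by smallness of κ and is absorbed on the left; the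
  -- subtraction is legitimate because B is finite.
  have h1 : B ≤ 2 * C * N * X ^ (1 / 2 : ℝ) := by
    have h2 : B ≤ C * N * X ^ (1 / 2 : ℝ) + B / 2 := by
      refine h.trans ?_
      rw [mul_add, ← mul_assoc]
      gcongr
      calc C * (K * (κ * B)) = C * K * κ * B := by ring
        _ ≤ 1 / 2 * B := by gcongr
        _ = B / 2 := by rw [one_div, mul_comm, ENNReal.div_eq_inv_mul, mul_comm]
    have h3 : B / 2 ≤ C * N * X ^ (1 / 2 : ℝ) := by
      have h4 : B / 2 + B / 2 ≤ C * N * X ^ (1 / 2 : ℝ) + B / 2 := by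
        rwa [ENNReal.add_halves]
      exact (ENNReal.add_le_add_iff_right (ENNReal.div_ne_top hB (by norm_num))).1 h4
    calc B = 2 * (B / 2) := (ENNReal.mul_div_cancel (by norm_num) (by norm_num)).symm
      _ ≤ 2 * (C * N * X ^ (1 / 2 : ℝ)) := by gcongr
      _ = _ := by ring
  have h2 : B ^ 2 ≤ (2 * C * N) ^ 2 * X := by
    refine (pow_le_pow_left' h1 2).trans (le_of_eq ?_)
    rw [mul_pow, ← ENNReal.rpow_natCast (X ^ (1 / 2 : ℝ)), ← ENNReal.rpow_mul]
    norm_num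
  -- choose the parameter of the interpolation
  set q := 2 * C * N with hq
  have hq0 : q ≠ 0 := by simp [hq, hN0, hC0]
  have hqt : q ≠ ⊤ := by simp [hq, ENNReal.mul_eq_top, hN, hC]
  have h3 := hX ((2 * q)⁻¹) (by simp [hq0])
  have hXle : X ≤ 2 * q * ((2 * q)⁻¹ ^ 3 * B ^ 2 + 2 * κ' * B) := by
    calc X = 2 * q * ((2 * q)⁻¹ * X) := by
          rw [← mul_assoc, ENNReal.mul_inv_cancel (by simp [hq0]) (by simp [ENNReal.mul_eq_top, hqt]),
            one_mul]
      _ ≤ _ := by gcongr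
  have hXt : X ≠ ⊤ := by
    refine ne_top_of_le_ne_top ?_ hXle
    have : (2 * q)⁻¹ ≠ ⊤ := by simp [hq0]
    finiteness
  lift B to ℝ≥0 using hB
  lift κ' to ℝ≥0 using hκ'
  lift X to ℝ≥0 using hXt
  lift C to ℝ≥0 using hC
  lift N to ℝ≥0 using hN
  have hC0' : (C : ℝ) ≠ 0 := by exact_mod_cast hC0
  have hN0' : (N : ℝ) ≠ 0 := by exact_mod_cast hN0
  have hqq : q = ((2 * C * N : ℝ≥0) : ℝ≥0∞) := by rw [hq]; push_cast; rfl
  obtain ⟨p, hp⟩ : ∃ p : ℝ≥0, p = 2 * C * N := ⟨_, rfl⟩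
  rw [← hp] at hqq
  have hp0 : p ≠ 0 := by
    rintro rfl
    exact hq0 (by simpa using hqq)
  rw [hqq] at h2 h3
  have hinv : (2 * (p : ℝ≥0∞))⁻¹ = (((2 * p)⁻¹ : ℝ≥0) : ℝ≥0∞) := by
    rw [ENNReal.coe_inv (by simp [hp0])]
    push_cast
    rfl
  rw [hinv] at h3
  norm_cast at h2 h3 ⊢
  have h6 : (B : ℝ) ≤ 8 * p ^ 3 * κ' :=
    le_of_quadratic_interpolation (by positivity) κ'.2 (by positivity) (by exact_mod_cast h2)
      (by exact_mod_cast h3)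
  have h8 : (B : ℝ) ≤ 64 * κ' * C ^ 3 * N ^ 3 := by
    rw [hp] at h6
    push_cast at h6
    refine h6.trans (le_of_eq ?_)
    ring
  exact_mod_cast h8

/-- The local Strichartz estimate for a pair of weak solutions with source terms which are linearly
controlled in `L^{3/2}`. -/
theorem strichartz_of_isWeakSol {w G F : Fin 2 → ℝ → L2R3} (h : ∀ i, IsWeakSol (w i) (G i))
    (hw : ∀ i, Continuous (w i)) (hG : ∀ i, Continuous (G i)) (hF : ∀ i, Continuous (F i))
    {W : ℝ → ℝ≥0∞} (hW : Measurable W) {K N C₀ R : ℝ≥0∞} {τ : ℝ} (hτ : 0 ≤ τ) (hτ1 : τ ≤ 1)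
    (hWR : ∀ t ∈ Set.Ioc 0 τ, W t ≤ R) (hR : R ≠ ⊤)
    (hFW : ∀ i, ∀ t ∈ Set.Ioc 0 τ, (∫⁻ x, ‖F i t x‖ₑ ^ (3 / 2 : ℝ)) ^ (2 / 3 : ℝ) ≤ W t ^ 2)
    (hGW : ∀ i, ∀ t ∈ Set.Ioc 0 τ, (∫⁻ x, ‖G i t x‖ₑ ^ (3 / 2 : ℝ)) ^ (2 / 3 : ℝ) ≤ K * W t)
    (hK : K ≠ ⊤) (hpos : ∀ i t, 0 ≤ (bil (w i t) (F i t)).re)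
    (hwF : ∀ t ∈ Set.Ioc 0 τ, W t ^ 3 ≤ C₀ * ∑ i, ENNReal.ofReal (bil (w i t) (F i t)).re)
    (hC₀ : C₀ ≠ ⊤) (hC0 : C₀ ≠ 0) (hN : ∀ i, ‖w i 0‖ₑ ≤ N) (hNt : N ≠ ⊤) (hN0 : N ≠ 0)
    (hsmall : 2 * C₀ * K * (2 * schKint τ) ≤ 1 / 2) :
    ∫⁻ t in Set.Ioc 0 τ, W t ^ 3 ≤
      64 * (∫⁻ r in Set.Ioo (-1) 1, ENNReal.ofReal (schK r) ^ (3 / 2 : ℝ)) * (2 * C₀) ^ 3 * N ^ 3 := by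
  -- A priori finiteness from the crude bound by R, needed only so that the absorption makes sense;
  -- R does not enter the conclusion.
  have hB : ∫⁻ t in Set.Ioc 0 τ, W t ^ 3 ≠ ⊤ := by
    refine ne_top_of_le_ne_top ?_ (setLIntegral_mono' measurableSet_Ioc
      fun t ht => pow_le_pow_left' (hWR t ht) 3)
    rw [lintegral_const, Measure.restrict_apply_univ, Real.volume_Ioc]
    finiteness
  refine le_of_strichartz_inequality hB hNt hN0 (by finiteness) (by simpa using hC0)
    lintegral_schK_rpow_lt_top.ne hsmall (fun l hl => lintegral_kernel_homogeneous_le hW hτ1 l hl) ?_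
  set X := ∫⁻ t in Set.Ioc 0 τ, ∫⁻ s in Set.Ioc 0 τ, ENNReal.ofReal (schK (t - s)) * W s ^ 2 * W t ^ 2
  have hi : ∀ i, ∫⁻ t in Set.Ioc 0 τ, ENNReal.ofReal (bil (w i t) (F i t)).re ≤
      N * X ^ (1 / 2 : ℝ) + K * (2 * schKint τ * ∫⁻ t in Set.Ioc 0 τ, W t ^ 3) := by
    intro i
    have hc : Continuous fun t => bil (w i t) (F i t) := continuous_bil.comp ((hw i).prodMk (hF i))
    have hci := hc.intervalIntegrable (μ := volume) 0 τ
    have hr : Continuous fun t => (bil (w i t) (F i t)).re := Complex.continuous_re.comp hc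
    rw [← ofReal_integral_eq_lintegral_ofReal
      ((intervalIntegrable_iff_integrableOn_Ioc_of_le hτ).1 (hr.intervalIntegrable 0 τ))
      (Filter.Eventually.of_forall fun t => hpos i t)]
    have e : ∫ t in Set.Ioc 0 τ, (bil (w i t) (F i t)).re = (∫ t in (0 : ℝ)..τ, bil (w i t) (F i t)).re := by
      rw [intervalIntegral.integral_of_le hτ]
      exact integral_re ((intervalIntegrable_iff_integrableOn_Ioc_of_le hτ).1 hci)
    rw [e]
    have h1 : ENNReal.ofReal (∫ t in (0 : ℝ)..τ, bil (w i t) (F i t)).re ≤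
        ‖∫ t in (0 : ℝ)..τ, bil (w i t) (F i t)‖ₑ := by
      rw [← ofReal_norm]
      exact ENNReal.ofReal_le_ofReal (Complex.re_le_norm _)
    refine h1.trans ((enorm_integral_bil_le (h i) (hw i) (hG i) (hF i) hτ (hFW i) (hGW i)).trans ?_)
    refine add_le_add (mul_le_mul_left (hN i) _) ?_
    have e2 : ∀ t s, ENNReal.ofReal (schK (t - s)) * (K * W s) * W t ^ 2 =
        K * (ENNReal.ofReal (schK (t - s)) * W s * W t ^ 2) := by
      intro t s
      ring
    simp only [e2, lintegral_const_mul' K _ hK]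
    exact mul_le_mul_right (lintegral_kernel_inhomogeneous_le hW τ) _
  have hm : ∀ i, Measurable fun t => ENNReal.ofReal (bil (w i t) (F i t)).re := fun i =>
    (Complex.continuous_re.comp (continuous_bil.comp ((hw i).prodMk (hF i)))).measurable.ennreal_ofReal
  calc ∫⁻ t in Set.Ioc 0 τ, W t ^ 3
      ≤ ∫⁻ t in Set.Ioc 0 τ, C₀ * ∑ i, ENNReal.ofReal (bil (w i t) (F i t)).re :=
        setLIntegral_mono' measurableSet_Ioc hwF
    _ = C₀ * ∑ i, ∫⁻ t in Set.Ioc 0 τ, ENNReal.ofReal (bil (w i t) (F i t)).re := by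
        rw [lintegral_const_mul' _ _ hC₀, lintegral_finsetSum _ fun i _ => hm i]
    _ ≤ C₀ * ∑ i : Fin 2, (N * X ^ (1 / 2 : ℝ) + K * (2 * schKint τ * ∫⁻ t in Set.Ioc 0 τ, W t ^ 3)) := by
        gcongr with i
        exact hi i
    _ = _ := by
        rw [Finset.sum_const, Finset.card_univ, Fintype.card_fin, nsmul_eq_mul]
        push_cast
        ring

/-! ### Nonlinear estimates -/

/-- The sum of the moduli of the components. -/
noncomputable def mag (z : Fin 2 → ℂ) : ℝ := ‖z 0‖ + ‖z 1‖

theorem mag_nonneg (z : Fin 2 → ℂ) : 0 ≤ mag z := add_nonneg (norm_nonneg _) (norm_nonneg _)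

theorem norm_le_mag (z : Fin 2 → ℂ) (i : Fin 2) : ‖z i‖ ≤ mag z := by
  unfold mag
  fin_cases i
  · exact le_add_of_nonneg_right (norm_nonneg _)
  · exact le_add_of_nonneg_left (norm_nonneg _)

theorem mag_add_le (a b : Fin 2 → ℂ) : mag (a + b) ≤ mag a + mag b := by
  unfold mag
  have h0 := norm_add_le (a 0) (b 0)
  have h1 := norm_add_le (a 1) (b 1)
  simp only [Pi.add_apply]
  linarith

theorem mag_sub_le (a b : Fin 2 → ℂ) : mag (a - b) ≤ mag a + mag b := by
  unfold mag
  have h0 := norm_sub_le (a 0) (b 0)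
  have h1 := norm_sub_le (a 1) (b 1)
  simp only [Pi.sub_apply]
  linarith

@[fun_prop]
theorem continuous_mag : Continuous mag := by
  unfold mag
  fun_prop

theorem norm_sq_mul_sub_le (p q r s : ℂ) :
    ‖((‖p‖ ^ 2 : ℝ) : ℂ) * q - ((‖r‖ ^ 2 : ℝ) : ℂ) * s‖ ≤
      (‖p‖ + ‖r‖) * ‖p - r‖ * ‖q‖ + ‖r‖ ^ 2 * ‖q - s‖ := by
  have e : ((‖p‖ ^ 2 : ℝ) : ℂ) * q - ((‖r‖ ^ 2 : ℝ) : ℂ) * s =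
      (((‖p‖ + ‖r‖) * (‖p‖ - ‖r‖) : ℝ) : ℂ) * q + ((‖r‖ ^ 2 : ℝ) : ℂ) * (q - s) := by
    push_cast
    ring
  rw [e]
  refine (norm_add_le _ _).trans ?_
  rw [norm_mul, norm_mul, Complex.norm_real, Complex.norm_real, norm_mul, norm_pow, norm_norm,
    Real.norm_of_nonneg (by positivity : 0 ≤ ‖p‖ + ‖r‖)]
  gcongr
  exact abs_norm_sub_norm_le p r

/-- A Lipschitz constant for the cubic nonlinearity. -/
noncomputable def gpK (c₁ c₂ c₁₂ : ℝ) : ℝ := 32 * Real.pi * (|c₁| + |c₂| + |c₁₂|)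

theorem gpK_nonneg (c₁ c₂ c₁₂ : ℝ) : 0 ≤ gpK c₁ c₂ c₁₂ := by
  unfold gpK
  positivity

theorem norm_sq_mul_sub_le_mag (a b : Fin 2 → ℂ) (i j : Fin 2) :
    ‖((‖a i‖ ^ 2 : ℝ) : ℂ) * a j - ((‖b i‖ ^ 2 : ℝ) : ℂ) * b j‖ ≤
      2 * ((mag a + mag b) ^ 2 * mag (a - b)) := by
  refine (norm_sq_mul_sub_le _ _ _ _).trans ?_
  have ha := norm_le_mag a i
  have hb := norm_le_mag b i
  have ha' := norm_le_mag a j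
  have hd := norm_le_mag (a - b) i
  have hd' := norm_le_mag (a - b) j
  have m1 := mag_nonneg a
  have m2 := mag_nonneg b
  have m3 := mag_nonneg (a - b)
  have m4 : 0 ≤ (mag a + mag b) * mag (a - b) := by positivity
  simp only [Pi.sub_apply] at hd hd'
  calc _ ≤ (mag a + mag b) * mag (a - b) * (mag a + mag b) + (mag a + mag b) ^ 2 * mag (a - b) := by
        gcongr <;> linarith
    _ = _ := by ring

/-- In `Fin 2` the index 1 − i is the other component. Both equations thus take one form and every
estimate is proved once. -/
theorem gpNonlinearity_eq (c₁ c₂ c₁₂ : ℝ) (z : Fin 2 → ℂ) (i : Fin 2) :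
    gpNonlinearity c₁ c₂ c₁₂ z i =
      ((8 * Real.pi * ![c₁, c₂] i : ℝ) : ℂ) * (((‖z i‖ ^ 2 : ℝ) : ℂ) * z i) +
      ((8 * Real.pi * c₁₂ : ℝ) : ℂ) * (((‖z (1 - i)‖ ^ 2 : ℝ) : ℂ) * z i) := by
  fin_cases i <;> simp [gpNonlinearity] <;> ring

theorem norm_gpNonlinearity_sub_le (c₁ c₂ c₁₂ : ℝ) (a b : Fin 2 → ℂ) (i : Fin 2) :
    ‖gpNonlinearity c₁ c₂ c₁₂ a i - gpNonlinearity c₁ c₂ c₁₂ b i‖ ≤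
      gpK c₁ c₂ c₁₂ * ((mag a + mag b) ^ 2 * mag (a - b)) := by
  rw [gpNonlinearity_eq, gpNonlinearity_eq, add_sub_add_comm, ← mul_sub, ← mul_sub]
  refine (norm_add_le _ _).trans ?_
  rw [norm_mul, norm_mul, Complex.norm_real, Complex.norm_real]
  have h1 := norm_sq_mul_sub_le_mag a b i i
  have h2 := norm_sq_mul_sub_le_mag a b (1 - i) i
  have hD : 0 ≤ (mag a + mag b) ^ 2 * mag (a - b) := mul_nonneg (sq_nonneg _) (mag_nonneg _)
  have hc : ‖8 * Real.pi * ![c₁, c₂] i‖ ≤ 8 * Real.pi * (|c₁| + |c₂|) := by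
    rw [norm_mul, Real.norm_of_nonneg (by positivity : 0 ≤ 8 * Real.pi), Real.norm_eq_abs]
    gcongr
    fin_cases i <;> simp
  have hc' : ‖8 * Real.pi * c₁₂‖ = 8 * Real.pi * |c₁₂| := by
    rw [norm_mul, Real.norm_of_nonneg (by positivity : 0 ≤ 8 * Real.pi), Real.norm_eq_abs]
  rw [hc']
  calc _ ≤ 8 * Real.pi * (|c₁| + |c₂|) * (2 * ((mag a + mag b) ^ 2 * mag (a - b))) +
        8 * Real.pi * |c₁₂| * (2 * ((mag a + mag b) ^ 2 * mag (a - b))) := by gcongr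
    _ = 16 * Real.pi * (|c₁| + |c₂| + |c₁₂|) * ((mag a + mag b) ^ 2 * mag (a - b)) := by ring
    -- The Lipschitz bound needs only 16π. The larger factor 32π in `gpK` lets the same constant
    -- cover the Taylor remainder, which needs 24π.
    _ ≤ _ := by
      unfold gpK
      gcongr
      norm_num

@[fun_prop]
theorem continuous_gpNonlinearity (c₁ c₂ c₁₂ : ℝ) (i : Fin 2) :
    Continuous fun z => gpNonlinearity c₁ c₂ c₁₂ z i := by
  simp only [gpNonlinearity_eq]
  fun_prop

namespace H1Pair

theorem comp_eq (u : H1Pair) (i : Fin 2) : u.comp i = H1.fn (u i) := rfl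

theorem stronglyMeasurable_comp (u : H1Pair) (i : Fin 2) : StronglyMeasurable (u.comp i) :=
  Lp.stronglyMeasurable _

theorem comp_sub_ae (u v : H1Pair) :
    ∀ᵐ x, (fun i => (u - v).comp i x) = (fun i => u.comp i x) - fun i => v.comp i x := by
  have h : ∀ i, ∀ᵐ x, (u - v).comp i x = u.comp i x - v.comp i x := by
    intro i
    simp only [comp_eq, PiLp.sub_apply, map_sub]
    exact Lp.coeFn_sub _ _
  filter_upwards [ae_all_iff.2 h] with x hx
  funext i
  exact hx i

theorem norm_apply_le' (u : H1Pair) (i : Fin 2) : ‖u i‖ ≤ ‖u‖ := PiLp.norm_apply_le u i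

/-- The sum of the moduli of the components of a pair of functions. -/
noncomputable def smag (u : H1Pair) (x : R3) : ℝ := mag fun i => u.comp i x

theorem smag_nonneg (u : H1Pair) (x : R3) : 0 ≤ u.smag x := mag_nonneg _

theorem stronglyMeasurable_smag (u : H1Pair) : StronglyMeasurable u.smag :=
  (u.stronglyMeasurable_comp 0).norm.add (u.stronglyMeasurable_comp 1).norm

theorem eLpNorm_smag_le (u : H1Pair) (n : ℕ) [n.AtLeastTwo] (h6 : n ≤ 6) :
    eLpNorm u.smag (OfNat.ofNat n) volume ≤ ENNReal.ofReal (2 * H1.sob * ‖u‖) := by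
  have h1 : (1 : ℝ≥0∞) ≤ OfNat.ofNat n := by
    have : 1 ≤ n := le_trans (by norm_num) (Nat.AtLeastTwo.prop (n := n))
    have h' : (1 : ℝ≥0∞) ≤ (n : ℝ≥0∞) := by exact_mod_cast this
    exact h'
  have hi : ∀ i, eLpNorm (fun x => ‖u.comp i x‖) (OfNat.ofNat n) volume ≤ ENNReal.ofReal (H1.sob * ‖u‖) := by
    intro i
    rw [eLpNorm_norm]
    refine (H1.eLpNorm_ofNat_le (u i) n h6).trans (ENNReal.ofReal_le_ofReal ?_)
    exact mul_le_mul_of_nonneg_left (u.norm_apply_le' i) (zero_le_one.trans H1.one_le_sob)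
  have h := eLpNorm_add_le (p := OfNat.ofNat n) (μ := (volume : Measure R3))
    (u.stronglyMeasurable_comp 0).norm.aestronglyMeasurable
    (u.stronglyMeasurable_comp 1).norm.aestronglyMeasurable h1
  refine (h.trans (add_le_add (hi 0) (hi 1))).trans (le_of_eq ?_)
  have : 0 ≤ H1.sob * ‖u‖ := mul_nonneg (zero_le_one.trans H1.one_le_sob) (norm_nonneg _)
  rw [← ENNReal.ofReal_add this this]
  congr 1
  ring

theorem smag_add_le_ae (u v : H1Pair) : ∀ᵐ x, u.smag x ≤ v.smag x + (u - v).smag x := by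
  filter_upwards [comp_sub_ae u v] with x hx
  unfold smag
  rw [hx]
  refine le_trans (le_of_eq ?_) (mag_add_le _ _)
  congr 1
  abel

theorem memLp_smag (u : H1Pair) (n : ℕ) [n.AtLeastTwo] (h6 : n ≤ 6) :
    MemLp u.smag (OfNat.ofNat n) volume :=
  ⟨u.stronglyMeasurable_smag.aestronglyMeasurable,
    (u.eLpNorm_smag_le n h6).trans_lt ENNReal.ofReal_lt_top⟩

theorem eLpNorm_smag_le_add (u v : H1Pair) (n : ℕ) [n.AtLeastTwo] (h6 : n ≤ 6) :
    eLpNorm u.smag (OfNat.ofNat n) volume ≤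
      eLpNorm v.smag (OfNat.ofNat n) volume + ENNReal.ofReal (2 * H1.sob * ‖u - v‖) := by
  have h1 : (1 : ℝ≥0∞) ≤ OfNat.ofNat n := by
    have : 1 ≤ n := le_trans (by norm_num) (Nat.AtLeastTwo.prop (n := n))
    have h' : (1 : ℝ≥0∞) ≤ (n : ℝ≥0∞) := by exact_mod_cast this
    exact h'
  have h2 : eLpNorm u.smag (OfNat.ofNat n) volume ≤
      eLpNorm (v.smag + (u - v).smag) (OfNat.ofNat n) volume := by
    refine eLpNorm_mono_ae ?_
    filter_upwards [smag_add_le_ae u v] with x hx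
    rw [Real.norm_of_nonneg (u.smag_nonneg x), Pi.add_apply,
      Real.norm_of_nonneg (add_nonneg (v.smag_nonneg x) ((u - v).smag_nonneg x))]
    exact hx
  refine h2.trans ((eLpNorm_add_le v.stronglyMeasurable_smag.aestronglyMeasurable
    (u - v).stronglyMeasurable_smag.aestronglyMeasurable h1).trans ?_)
  gcongr
  exact (u - v).eLpNorm_smag_le n h6

/-- The `L^n` norm of a pair, as a real number. -/
noncomputable def lpn (n : ℕ) [n.AtLeastTwo] (u : H1Pair) : ℝ :=
  (eLpNorm u.smag (OfNat.ofNat n) volume).toReal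

theorem ofReal_lpn (u : H1Pair) (n : ℕ) [n.AtLeastTwo] (h6 : n ≤ 6) :
    ENNReal.ofReal (lpn n u) = eLpNorm u.smag (OfNat.ofNat n) volume :=
  ENNReal.ofReal_toReal (u.memLp_smag n h6).2.ne

theorem sob_nonneg : 0 ≤ H1.sob := zero_le_one.trans H1.one_le_sob

theorem continuous_lpn (n : ℕ) [n.AtLeastTwo] (h6 : n ≤ 6) : Continuous (lpn n) := by
  refine (LipschitzWith.of_le_add_mul (Real.toNNReal (2 * H1.sob)) fun u v => ?_).continuous
  have h := u.eLpNorm_smag_le_add v n h6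
  have hs := sob_nonneg
  have h2 := ENNReal.toReal_mono (ENNReal.add_ne_top.2 ⟨(v.memLp_smag n h6).2.ne, ENNReal.ofReal_ne_top⟩) h
  rw [ENNReal.toReal_add (v.memLp_smag n h6).2.ne ENNReal.ofReal_ne_top,
    ENNReal.toReal_ofReal (by positivity)] at h2
  rw [Real.coe_toNNReal _ (by positivity), dist_eq_norm]
  exact h2

/-- The square of a solution lies in L³ by (6, 6; 3). The triple (3, 6; 2) then places the
nonlinearity in L², (3, 3; 3/2) serves the Strichartz source term, and (4, 4; 2) serves |u|ū. -/
instance holderTriple_six_six_three : ENNReal.HolderTriple 6 6 3 := ⟨by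
  rw [← ENNReal.toReal_eq_toReal_iff' (by simp) (by simp), ENNReal.toReal_add (by simp) (by simp)]
  simp only [ENNReal.toReal_inv, ENNReal.toReal_ofNat]
  norm_num⟩

instance holderTriple_three_six_two : ENNReal.HolderTriple 3 6 2 := ⟨by
  rw [← ENNReal.toReal_eq_toReal_iff' (by simp) (by simp), ENNReal.toReal_add (by simp) (by simp)]
  simp only [ENNReal.toReal_inv, ENNReal.toReal_ofNat]
  norm_num⟩

instance holderTriple_four_four_two : ENNReal.HolderTriple 4 4 2 := ⟨by
  rw [← ENNReal.toReal_eq_toReal_iff' (by simp) (by simp), ENNReal.toReal_add (by simp) (by simp)]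
  simp only [ENNReal.toReal_inv, ENNReal.toReal_ofNat]
  norm_num⟩

instance holderTriple_three_three_threeHalves :
    ENNReal.HolderTriple 3 3 (ENNReal.ofReal (3 / 2)) := ⟨by
  rw [← ENNReal.toReal_eq_toReal_iff' (by simp) (by simp), ENNReal.toReal_add (by simp) (by simp)]
  simp only [ENNReal.toReal_inv, ENNReal.toReal_ofNat, ENNReal.toReal_ofReal (by norm_num : (0:ℝ) ≤ 3 / 2)]
  norm_num⟩

/-- Hölder's inequality for the difference of two values of the cubic nonlinearity. -/
theorem eLpNorm_sq_mul_smag_le (u v w : H1Pair) (n : ℕ) [n.AtLeastTwo] {r : ℝ≥0∞}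
    [ENNReal.HolderTriple 3 (OfNat.ofNat n) r] :
    eLpNorm (fun x => (u.smag x + v.smag x) ^ 2 * w.smag x) r volume ≤
      ENNReal.ofReal (2 * H1.sob * (‖u‖ + ‖v‖)) ^ 2 * eLpNorm w.smag (OfNat.ofNat n) volume := by
  have hm := (u.stronglyMeasurable_smag.add v.stronglyMeasurable_smag).aestronglyMeasurable
    (μ := volume)
  have h1 : eLpNorm (u.smag + v.smag) 6 volume ≤ ENNReal.ofReal (2 * H1.sob * (‖u‖ + ‖v‖)) := by
    have hs := sob_nonneg
    rw [mul_add, ENNReal.ofReal_add (by positivity) (by positivity)]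
    exact (eLpNorm_add_le u.stronglyMeasurable_smag.aestronglyMeasurable
      v.stronglyMeasurable_smag.aestronglyMeasurable (by norm_num)).trans
      (add_le_add (u.eLpNorm_smag_le 6 le_rfl) (v.eLpNorm_smag_le 6 le_rfl))
  have h2 : eLpNorm ((u.smag + v.smag) • (u.smag + v.smag)) 3 volume ≤
      ENNReal.ofReal (2 * H1.sob * (‖u‖ + ‖v‖)) ^ 2 := by
    rw [pow_two]
    exact (eLpNorm_smul_le_mul_eLpNorm (p := 6) (q := 6) hm hm).trans (mul_le_mul' h1 h1)
  have h3 := eLpNorm_smul_le_mul_eLpNorm (p := 3) (q := OfNat.ofNat n) (r := r)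
    w.stronglyMeasurable_smag.aestronglyMeasurable (hm.smul hm)
  have e : (fun x => (u.smag x + v.smag x) ^ 2 * w.smag x) =
      ((u.smag + v.smag) • (u.smag + v.smag)) • w.smag := by
    funext x
    simp [pow_two]
  rw [e]
  exact h3.trans (mul_le_mul_left h2 _)

variable (c₁ c₂ c₁₂ : ℝ)

theorem eLpNorm_gpNonlinearity_sub_le (u v : H1Pair) (i : Fin 2) (n : ℕ) [n.AtLeastTwo] {r : ℝ≥0∞}
    [ENNReal.HolderTriple 3 (OfNat.ofNat n) r] :
    eLpNorm (fun x => gpNonlinearity c₁ c₂ c₁₂ (fun j => u.comp j x) i -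
      gpNonlinearity c₁ c₂ c₁₂ (fun j => v.comp j x) i) r volume ≤
      ENNReal.ofReal (gpK c₁ c₂ c₁₂) * (ENNReal.ofReal (2 * H1.sob * (‖u‖ + ‖v‖)) ^ 2 *
        eLpNorm (u - v).smag (OfNat.ofNat n) volume) := by
  refine (eLpNorm_le_mul_eLpNorm_of_ae_le_mul (c := gpK c₁ c₂ c₁₂)
    (g := fun x => (u.smag x + v.smag x) ^ 2 * (u - v).smag x) ?_ r).trans ?_
  · filter_upwards [comp_sub_ae u v] with x hx
    refine (norm_gpNonlinearity_sub_le c₁ c₂ c₁₂ _ _ i).trans ?_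
    refine mul_le_mul_of_nonneg_left ?_ (gpK_nonneg _ _ _)
    rw [← hx]
    exact le_abs_self _
  · exact mul_le_mul_right (eLpNorm_sq_mul_smag_le u v (u - v) n) _

theorem gpNonlinearity_zero (i : Fin 2) : gpNonlinearity c₁ c₂ c₁₂ 0 i = 0 := by
  rw [gpNonlinearity_eq]
  simp

theorem measurable_gpNonlinearity (u : H1Pair) (i : Fin 2) :
    StronglyMeasurable fun x => gpNonlinearity c₁ c₂ c₁₂ (fun j => u.comp j x) i :=
  ((continuous_gpNonlinearity c₁ c₂ c₁₂ i).measurable.comp (measurable_pi_lambda _ fun j =>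
    (u.stronglyMeasurable_comp j).measurable)).stronglyMeasurable

theorem memLp_gpNonlinearity (u : H1Pair) (i : Fin 2) :
    MemLp (fun x => gpNonlinearity c₁ c₂ c₁₂ (fun j => u.comp j x) i) 2 volume := by
  refine ⟨(u.measurable_gpNonlinearity c₁ c₂ c₁₂ i).aestronglyMeasurable, ?_⟩
  refine lt_of_le_of_lt (eLpNorm_le_mul_eLpNorm_of_ae_le_mul (c := gpK c₁ c₂ c₁₂)
    (g := fun x => (u.smag x + u.smag x) ^ 2 * u.smag x) (Filter.Eventually.of_forall fun x => ?_) 2) ?_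
  · have h := norm_gpNonlinearity_sub_le c₁ c₂ c₁₂ (fun j => u.comp j x) 0 i
    rw [gpNonlinearity_zero, sub_zero, sub_zero] at h
    refine h.trans (mul_le_mul_of_nonneg_left (le_trans ?_ (le_abs_self _)) (gpK_nonneg _ _ _))
    have h0 : mag 0 = 0 := by simp [mag]
    have := u.smag_nonneg x
    rw [h0, add_zero]
    change u.smag x ^ 2 * u.smag x ≤ _
    gcongr
    linarith
  · refine ENNReal.mul_lt_top ENNReal.ofReal_lt_top
      ((eLpNorm_sq_mul_smag_le u u u 6).trans_lt ?_)
    have := (u.memLp_smag 6 le_rfl).2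
    finiteness

/-- The nonlinearity of the system, as a map from `H¹` to `L²`. -/
noncomputable def gpn (i : Fin 2) (u : H1Pair) : L2R3 := (u.memLp_gpNonlinearity c₁ c₂ c₁₂ i).toLp

theorem gpn_coeFn (i : Fin 2) (u : H1Pair) :
    gpn c₁ c₂ c₁₂ i u =ᵐ[volume] fun x => gpNonlinearity c₁ c₂ c₁₂ (fun j => u.comp j x) i :=
  MemLp.coeFn_toLp _

theorem eLpNorm_gpn_sub_le (u v : H1Pair) (i : Fin 2) (n : ℕ) [n.AtLeastTwo] {r : ℝ≥0∞}
    [ENNReal.HolderTriple 3 (OfNat.ofNat n) r] :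
    eLpNorm (gpn c₁ c₂ c₁₂ i u - gpn c₁ c₂ c₁₂ i v : L2R3) r volume ≤
      ENNReal.ofReal (gpK c₁ c₂ c₁₂) * (ENNReal.ofReal (2 * H1.sob * (‖u‖ + ‖v‖)) ^ 2 *
        eLpNorm (u - v).smag (OfNat.ofNat n) volume) := by
  refine le_trans (le_of_eq (eLpNorm_congr_ae ?_)) (eLpNorm_gpNonlinearity_sub_le c₁ c₂ c₁₂ u v i n)
  filter_upwards [Lp.coeFn_sub (gpn c₁ c₂ c₁₂ i u) (gpn c₁ c₂ c₁₂ i v), gpn_coeFn c₁ c₂ c₁₂ i u,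
    gpn_coeFn c₁ c₂ c₁₂ i v] with x h1 h2 h3
  rw [h1, Pi.sub_apply, h2, h3]

/-- The cubic map is locally Lipschitz from H¹ to L², by Hölder with three factors in L⁶.
Consequently the source of the weak equation is a norm continuous curve in L². -/
theorem norm_gpn_sub_le (u v : H1Pair) (i : Fin 2) :
    ‖gpn c₁ c₂ c₁₂ i u - gpn c₁ c₂ c₁₂ i v‖ ≤
      gpK c₁ c₂ c₁₂ * ((2 * H1.sob * (‖u‖ + ‖v‖)) ^ 2 * (2 * H1.sob * ‖u - v‖)) := by
  have h := (eLpNorm_gpn_sub_le c₁ c₂ c₁₂ u v i 6 (r := 2)).trans (mul_le_mul_right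
    (mul_le_mul_right ((u - v).eLpNorm_smag_le 6 le_rfl) _) _)
  have hs := sob_nonneg
  have hK := gpK_nonneg c₁ c₂ c₁₂
  rw [← ENNReal.ofReal_pow (by positivity), ← ENNReal.ofReal_mul (by positivity),
    ← ENNReal.ofReal_mul (by positivity)] at h
  rw [Lp.norm_def]
  exact ENNReal.toReal_le_of_le_ofReal (by positivity) h

theorem continuous_gpn (i : Fin 2) : Continuous (gpn c₁ c₂ c₁₂ i) := by
  rw [continuous_iff_continuousAt]
  intro v
  refine tendsto_iff_norm_sub_tendsto_zero.2 (squeeze_zero (fun _ => norm_nonneg _)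
    (fun u => norm_gpn_sub_le c₁ c₂ c₁₂ u v i) ?_)
  have hc : Continuous fun u : H1Pair =>
      gpK c₁ c₂ c₁₂ * ((2 * H1.sob * (‖u‖ + ‖v‖)) ^ 2 * (2 * H1.sob * ‖u - v‖)) := by fun_prop
  simpa using hc.tendsto v

end H1Pair

/-! ### The dual function |u|ū -/

theorem norm_norm_mul_conj_sub_le (a b : ℂ) :
    ‖(‖a‖ : ℂ) * (starRingEnd ℂ) a - (‖b‖ : ℂ) * (starRingEnd ℂ) b‖ ≤ (‖a‖ + ‖b‖) * ‖a - b‖ := by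
  have e : (‖a‖ : ℂ) * (starRingEnd ℂ) a - (‖b‖ : ℂ) * (starRingEnd ℂ) b =
      ((‖a‖ - ‖b‖ : ℝ) : ℂ) * (starRingEnd ℂ) a + (‖b‖ : ℂ) * (starRingEnd ℂ) (a - b) := by
    rw [map_sub]
    push_cast
    ring
  rw [e]
  refine (norm_add_le _ _).trans ?_
  rw [norm_mul, norm_mul, RCLike.norm_conj, RCLike.norm_conj, Complex.norm_real, Complex.norm_real,
    norm_norm, Real.norm_eq_abs]
  have := abs_norm_sub_norm_le a b
  nlinarith [norm_nonneg a, norm_nonneg b]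

namespace H1

theorem memLp_norm_mul_conj (u : H1R3) :
    MemLp (fun x => (‖fn u x‖ : ℂ) * (starRingEnd ℂ) (fn u x)) 2 volume := by
  have h := (memLp u 4 (by norm_num)).norm.mul (memLp u 4 (by norm_num)).norm (r := 2)
  refine h.of_le ?_ (Filter.Eventually.of_forall fun x => ?_)
  · have := Lp.stronglyMeasurable (fn u)
    exact ((Complex.continuous_ofReal.comp_stronglyMeasurable this.norm).mul
      (Complex.continuous_conj.comp_stronglyMeasurable this)).aestronglyMeasurable
  · simp

/-- The function `|u| ū`. -/
noncomputable def sqc (u : H1R3) : L2R3 := (memLp_norm_mul_conj u).toLp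

theorem sqc_coeFn (u : H1R3) : sqc u =ᵐ[volume] fun x => (‖fn u x‖ : ℂ) * (starRingEnd ℂ) (fn u x) :=
  MemLp.coeFn_toLp _

theorem norm_sqc_sub_le (u v : H1R3) :
    ‖sqc u - sqc v‖ ≤ H1.sob * (‖u‖ + ‖v‖) * (H1.sob * ‖u - v‖) := by
  have hs : 0 ≤ sob := zero_le_one.trans one_le_sob
  have hu := (memLp u 4 (by norm_num)).1.norm
  have hv := (memLp v 4 (by norm_num)).1.norm
  have h1 : eLpNorm ((fun x => ‖fn u x‖) + fun x => ‖fn v x‖) 4 volume ≤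
      ENNReal.ofReal (H1.sob * (‖u‖ + ‖v‖)) := by
    rw [mul_add, ENNReal.ofReal_add (by positivity) (by positivity)]
    refine (eLpNorm_add_le hu hv (by norm_num)).trans (add_le_add ?_ ?_)
    · rw [eLpNorm_norm]
      exact eLpNorm_ofNat_le u 4 (by norm_num)
    · rw [eLpNorm_norm]
      exact eLpNorm_ofNat_le v 4 (by norm_num)
  have h2 : eLpNorm (sqc u - sqc v : L2R3) 2 volume ≤
      eLpNorm (((fun x => ‖fn u x‖) + fun x => ‖fn v x‖) • (fn (u - v) : R3 → ℂ)) 2 volume := by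
    refine eLpNorm_mono_ae ?_
    have hd : fn (u - v) =ᵐ[volume] fun x => fn u x - fn v x := by
      rw [map_sub]
      exact Lp.coeFn_sub _ _
    filter_upwards [Lp.coeFn_sub (sqc u) (sqc v), sqc_coeFn u, sqc_coeFn v, hd] with x a1 a2 a3 a4
    rw [a1, Pi.sub_apply, a2, a3, Pi.smul_apply', a4, norm_smul, Pi.add_apply,
      Real.norm_of_nonneg (by positivity)]
    exact norm_norm_mul_conj_sub_le _ _
  have h3 := h2.trans ((eLpNorm_smul_le_mul_eLpNorm (p := 4) (q := 4) (r := 2)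
    (memLp (u - v) 4 (by norm_num)).1 (hu.add hv)).trans
    (mul_le_mul' h1 (eLpNorm_ofNat_le (u - v) 4 (by norm_num))))
  rw [← ENNReal.ofReal_mul (by positivity)] at h3
  rw [Lp.norm_def]
  exact ENNReal.toReal_le_of_le_ofReal (by positivity) h3

theorem continuous_sqc : Continuous sqc := by
  rw [continuous_iff_continuousAt]
  intro v
  refine tendsto_iff_norm_sub_tendsto_zero.2 (squeeze_zero (fun _ => norm_nonneg _)
    (fun u => norm_sqc_sub_le u v) ?_)
  have hc : Continuous fun u : H1R3 => H1.sob * (‖u‖ + ‖v‖) * (H1.sob * ‖u - v‖) := by fun_prop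
  simpa using hc.tendsto v

/-- The function |u|ū realises the L³ norm by duality, and its L^{3/2} norm is the square of the L³
norm of u. Testing Duhamel's formula against it therefore produces a closed inequality for the L³
norm. -/
theorem bil_fn_sqc (u : H1R3) : bil (fn u) (sqc u) = ((∫ x, ‖fn u x‖ ^ 3 : ℝ) : ℂ) := by
  rw [bil_apply, ← integral_complex_ofReal]
  refine integral_congr_ae ?_
  filter_upwards [sqc_coeFn u] with x hx
  rw [hx, mul_left_comm, Complex.mul_conj, Complex.normSq_eq_norm_sq]
  push_cast
  ring

end H1

/-! ### Solutions and their translates -/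

theorem laplacian_compSubConst (ψ : 𝓢(R3, ℂ)) (y : R3) :
    Δ (ψ.compSubConstCLM ℂ y) = (Δ ψ).compSubConstCLM ℂ y := by
  rw [laplacian_schwartz_eq, laplacian_schwartz_eq, map_sum]
  refine Finset.sum_congr rfl fun k _ => ?_
  rw [H1.lineDeriv_compSubConst, H1.lineDeriv_compSubConst]

theorem bil_trL_toL2 (y : R3) (f : L2R3) (ψ : 𝓢(R3, ℂ)) :
    bil (trL y f) (toL2 ψ) = bil f (toL2 (ψ.compSubConstCLM ℂ (-y))) := by
  rw [bil_toL2, bil_toL2, H1.integral_trL_mul]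

theorem IsWeakSol.trL {w G : ℝ → L2R3} (h : IsWeakSol w G) (y : R3) :
    IsWeakSol (fun t => trL y (w t)) (fun t => trL y (G t)) := by
  intro ψ t
  have h1 := h (ψ.compSubConstCLM ℂ (-y)) t
  rw [laplacian_compSubConst] at h1
  simpa only [bil_trL_toL2] using h1

theorem IsWeakSol.sub {w G w' G' : ℝ → L2R3} (h : IsWeakSol w G) (h' : IsWeakSol w' G') :
    IsWeakSol (fun t => w t - w' t) (fun t => G t - G' t) := by
  intro ψ t
  have h1 := (h ψ t).sub (h' ψ t)
  have e1 : (fun s => Complex.I * bil (w s - w' s) (toL2 ψ)) =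
      (fun s => Complex.I * bil (w s) (toL2 ψ)) - fun s => Complex.I * bil (w' s) (toL2 ψ) := by
    funext s
    rw [map_sub, sub_apply, mul_sub]
    rfl
  rw [e1]
  refine h1.congr_deriv ?_
  rw [map_sub, map_sub, sub_apply, sub_apply]
  ring

theorem IsWeakSol.shift {w G : ℝ → L2R3} (h : IsWeakSol w G) (a : ℝ) :
    IsWeakSol (fun t => w (t + a)) (fun t => G (t + a)) := fun ψ t => by
  exact (h ψ (t + a)).comp_add_const t a

namespace H1Pair

/-- Translation of pairs. -/
noncomputable def tr (y : R3) (u : H1Pair) : H1Pair := WithLp.toLp 2 fun i => H1.tr y (u i)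

@[simp] theorem tr_apply (y : R3) (u : H1Pair) (i : Fin 2) : tr y u i = H1.tr y (u i) := rfl

theorem continuous_tr_apply (i : Fin 2) : Continuous fun p : R3 × H1Pair => H1.tr p.1 (p.2 i) := by
  have h1 : Continuous fun u : H1Pair => u i := by fun_prop
  have h2 : Continuous (Prod.map id fun u : H1Pair => u i : R3 × H1Pair → R3 × H1R3) :=
    continuous_id.prodMap h1
  have h3 := H1.tr_continuous.comp h2
  simpa only [Function.comp_def, Prod.map_fst, Prod.map_snd, id_eq] using h3

theorem continuous_tr : Continuous fun p : R3 × H1Pair => tr p.1 p.2 :=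
  (PiLp.continuous_toLp 2 _).comp (continuous_pi continuous_tr_apply)

theorem norm_tr (y : R3) (u : H1Pair) : ‖tr y u‖ = ‖u‖ := by
  rw [PiLp.norm_eq_of_L2, PiLp.norm_eq_of_L2]
  simp only [tr_apply, H1.norm_tr]

theorem tr_zero (u : H1Pair) : tr 0 u = u := by
  ext1 i
  simp [H1.tr_zero]

theorem ae_comp_sub {p : R3 → Prop} (h : ∀ᵐ x, p x) (y : R3) : ∀ᵐ x, p (x - y) :=
  (measurePreserving_sub_right volume y).quasiMeasurePreserving.ae h

theorem comp_tr_ae (y : R3) (u : H1Pair) :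
    ∀ᵐ x, (fun i => (tr y u).comp i x) = fun i => u.comp i (x - y) := by
  filter_upwards [ae_all_iff.2 fun i => trL_coeFn y (H1.fn (u i))] with x hx
  funext i
  exact hx i

variable (c₁ c₂ c₁₂ : ℝ)

theorem gpn_tr (i : Fin 2) (y : R3) (u : H1Pair) : gpn c₁ c₂ c₁₂ i (tr y u) = trL y (gpn c₁ c₂ c₁₂ i u) := by
  refine Lp.ext ?_
  filter_upwards [gpn_coeFn c₁ c₂ c₁₂ i (tr y u), trL_coeFn y (gpn c₁ c₂ c₁₂ i u), comp_tr_ae y u,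
    ae_comp_sub (gpn_coeFn c₁ c₂ c₁₂ i u) y] with x h1 h2 h3 h4
  rw [h1, h2, h4, h3]

theorem ennreal_add_cube_le (a b : ℝ≥0∞) : (a + b) ^ 3 ≤ 4 * (a ^ 3 + b ^ 3) := by
  rcases eq_or_ne a ⊤ with rfl | ha
  · simp
  rcases eq_or_ne b ⊤ with rfl | hb
  · simp
  lift a to ℝ≥0 using ha
  lift b to ℝ≥0 using hb
  norm_cast
  rw [← NNReal.coe_le_coe]
  push_cast
  nlinarith [mul_nonneg (add_nonneg (NNReal.coe_nonneg a) (NNReal.coe_nonneg b)) (sq_nonneg ((a : ℝ) - b))]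

/-- Continuous `H¹` solutions, in terms of elements of `L²`. -/
structure IsSol (φ : ℝ → H1Pair) : Prop where
  continuous : Continuous φ
  weak : ∀ i, IsWeakSol (fun t => H1.fn (φ t i)) (fun t => gpn c₁ c₂ c₁₂ i (φ t))

variable {c₁ c₂ c₁₂}

theorem _root_.IsGlobalGPSolution.isSol {φ : ℝ → H1Pair} (h : IsGlobalGPSolution c₁ c₂ c₁₂ φ) :
    IsSol c₁ c₂ c₁₂ φ := by
  refine ⟨h.continuous, fun i ψ t => ?_⟩
  have h1 := h.equation i ψ t
  simp only [bil_toL2]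
  refine h1.congr_deriv ?_
  congr 1
  · rw [← integral_neg]
    refine integral_congr_ae (Filter.Eventually.of_forall fun x => ?_)
    change (φ t).comp i x * -(Δ ψ) x = -((φ t).comp i x * (Δ ψ) x)
    ring
  · refine integral_congr_ae ?_
    filter_upwards [gpn_coeFn c₁ c₂ c₁₂ i (φ t)] with x hx
    rw [hx]

theorem IsSol.shift {φ : ℝ → H1Pair} (h : IsSol c₁ c₂ c₁₂ φ) (a : ℝ) :
    IsSol c₁ c₂ c₁₂ fun t => φ (t + a) :=
  ⟨h.continuous.comp (continuous_id.add continuous_const), fun i => (h.weak i).shift a⟩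

theorem continuous_apply (i : Fin 2) : Continuous fun u : H1Pair => u i := by fun_prop

theorem IsSol.continuous_tr_sub {φ : ℝ → H1Pair} (h : IsSol c₁ c₂ c₁₂ φ) (y : R3) :
    Continuous fun t => tr y (φ t) - φ t := by
  have h1 : Continuous fun t => (y, φ t) := continuous_const.prodMk h.continuous
  exact (continuous_tr.comp h1).sub h.continuous

theorem eLpNorm_threeHalves (f : R3 → ℂ) : eLpNorm f (ENNReal.ofReal (3 / 2)) volume =
    (∫⁻ x, ‖f x‖ₑ ^ (3 / 2 : ℝ)) ^ (2 / 3 : ℝ) := by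
  rw [eLpNorm_eq_lintegral_rpow_enorm_toReal (by simp) (by simp),
    ENNReal.toReal_ofReal (by norm_num)]
  norm_num

theorem lintegral_norm_cube_le (u : H1Pair) (i : Fin 2) :
    ∫⁻ x, ‖H1.fn (u i) x‖ₑ ^ 3 ≤ ENNReal.ofReal (lpn 3 u) ^ 3 := by
  rw [ofReal_lpn u 3 (by norm_num), eLpNorm_eq_lintegral_rpow_enorm_toReal (by simp) (by simp),
    ← ENNReal.rpow_natCast, ← ENNReal.rpow_mul]
  simp only [ENNReal.toReal_ofNat, Nat.cast_ofNat]
  norm_num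
  refine lintegral_mono fun x => ?_
  gcongr
  rw [enorm_le_iff_norm_le, Real.norm_of_nonneg (u.smag_nonneg x)]
  exact norm_le_mag (fun i => u.comp i x) i

/-- The L³ norm is taken of the sum of the two moduli; separating the components costs the 4 of (a +
b)³ ≤ 4(a³ + b³), which is the constant C₀ of the Strichartz argument. -/
theorem lpn_cube_le (u : H1Pair) :
    ENNReal.ofReal (lpn 3 u) ^ 3 ≤ 4 * ∑ i, ENNReal.ofReal (bil (H1.fn (u i)) (H1.sqc (u i))).re := by
  have h1 : ∀ i, ENNReal.ofReal (bil (H1.fn (u i)) (H1.sqc (u i))).re = ∫⁻ x, ‖u.comp i x‖ₑ ^ 3 := by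
    intro i
    rw [H1.bil_fn_sqc, Complex.ofReal_re, ofReal_integral_eq_lintegral_ofReal]
    · refine lintegral_congr fun x => ?_
      rw [ENNReal.ofReal_pow (norm_nonneg _), ofReal_norm]
      rfl
    · exact_mod_cast (H1.memLp (u i) 3 (by norm_num)).integrable_norm_pow (by norm_num)
    · exact Filter.Eventually.of_forall fun x => by positivity
  simp only [h1, Fin.sum_univ_two]
  rw [ofReal_lpn u 3 (by norm_num), eLpNorm_eq_lintegral_rpow_enorm_toReal (by simp) (by simp),
    ← ENNReal.rpow_natCast, ← ENNReal.rpow_mul]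
  simp only [ENNReal.toReal_ofNat, Nat.cast_ofNat]
  norm_num
  rw [← lintegral_add_left ((u.stronglyMeasurable_comp 0).enorm.pow_const 3),
    ← lintegral_const_mul' _ _ (by norm_num)]
  refine lintegral_mono fun x => ?_
  have e : ‖u.smag x‖ₑ = ‖u.comp 0 x‖ₑ + ‖u.comp 1 x‖ₑ := by
    rw [← ofReal_norm, Real.norm_of_nonneg (u.smag_nonneg x), smag, mag,
      ENNReal.ofReal_add (norm_nonneg _) (norm_nonneg _), ofReal_norm, ofReal_norm]
  rw [e]
  exact ennreal_add_cube_le _ _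

/-- The local Strichartz estimate for differences of translates of solutions. -/
theorem exists_strichartz (c₁ c₂ c₁₂ A : ℝ) : ∃ τ C : ℝ, 0 < τ ∧ τ ≤ 1 ∧ 0 ≤ C ∧
    ∀ φ, IsSol c₁ c₂ c₁₂ φ → (∀ t ∈ Set.Icc 0 τ, ‖φ t‖ ≤ A) → ∀ y : R3,
      ∫⁻ t in Set.Ioc 0 τ, ENNReal.ofReal (lpn 3 (tr y (φ t) - φ t)) ^ 3 ≤ ENNReal.ofReal (C * ‖y‖ ^ 3) := by
  have hs := sob_nonneg
  -- The difference of the nonlinearities in L^{3/2} is linear in the L³ norm of the increment, with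
  -- a coefficient given by the squared L⁶ norms. It depends only on A and the couplings, hence so
  -- do τ and C.
  set K : ℝ≥0∞ := ENNReal.ofReal (gpK c₁ c₂ c₁₂) * ENNReal.ofReal (2 * H1.sob * (A + A)) ^ 2 with hK
  have hKt : K ≠ ⊤ := by finiteness
  -- Chosen so that 2 · 4 · K · 2κ ≤ 16K/(32(K + 1)) ≤ 1/2; the summand 1 avoids dividing by zero.
  obtain ⟨τ, hτ, hτ1, hκ⟩ := exists_schKint_le (ε := (32 * (K + 1))⁻¹)
    (by simp [ENNReal.mul_eq_top, hKt])
  set κ' := ∫⁻ r in Set.Ioo (-1) 1, ENNReal.ofReal (schK r) ^ (3 / 2 : ℝ) with hκ'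
  have hκt : κ' ≠ ⊤ := lintegral_schK_rpow_lt_top.ne
  refine ⟨τ, (64 * κ' * (2 * 4) ^ 3).toReal * (3 * (|A| + 1)) ^ 3, hτ, hτ1, by positivity,
    fun φ hφ hA y => ?_⟩
  -- The numerical lemma needs a nonzero bound N for the initial data, and N is proportional to |y|.
  rcases eq_or_ne y 0 with rfl | hy
  · have h0 : lpn 3 (0 : H1Pair) = 0 := by
      have := (0 : H1Pair).eLpNorm_smag_le 3 (by norm_num)
      rw [norm_zero, mul_zero, ENNReal.ofReal_zero, nonpos_iff_eq_zero] at this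
      rw [lpn, this, ENNReal.toReal_zero]
    simp [tr_zero, h0]
  have hy' : 0 < ‖y‖ := norm_pos_iff.2 hy
  -- The system is translation invariant, so the increment solves a linear equation forced by the
  -- difference of two nonlinearities. Its initial L² norm is O(|y|) since φ(0) is in H¹, which
  -- yields the cubic power of |y|.
  have key := strichartz_of_isWeakSol (w := fun i t => H1.fn ((tr y (φ t) - φ t) i))
    (G := fun i t => gpn c₁ c₂ c₁₂ i (tr y (φ t)) - gpn c₁ c₂ c₁₂ i (φ t))
    (F := fun i t => H1.sqc ((tr y (φ t) - φ t) i))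
    (W := fun t => ENNReal.ofReal (lpn 3 (tr y (φ t) - φ t)))
    (K := K) (N := ENNReal.ofReal (3 * (|A| + 1) * ‖y‖)) (C₀ := 4)
    (R := ENNReal.ofReal (2 * H1.sob * (A + A))) (τ := τ) ?_ ?_ ?_ ?_ ?_ hτ.le hτ1 ?_ ?_ ?_ ?_ hKt ?_ ?_
    (by norm_num) (by norm_num) ?_ ENNReal.ofReal_ne_top ?_ ?_
  · refine key.trans (le_of_eq ?_)
    have e : 64 * κ' * (2 * 4) ^ 3 = ENNReal.ofReal (64 * κ' * (2 * 4) ^ 3).toReal :=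
      (ENNReal.ofReal_toReal (by finiteness)).symm
    obtain ⟨X, hX⟩ : ∃ X : ℝ, X = (64 * κ' * (2 * 4) ^ 3).toReal := ⟨_, rfl⟩
    have hX0 : 0 ≤ X := hX ▸ ENNReal.toReal_nonneg
    rw [← hX] at e ⊢
    rw [e, ← ENNReal.ofReal_pow (by positivity), ← ENNReal.ofReal_mul hX0]
    congr 1
    ring
  · intro i
    have h1 := ((hφ.weak i).trL y).sub (hφ.weak i)
    have e1 : (fun t => H1.fn ((tr y (φ t) - φ t) i)) =
        fun t => trL y (H1.fn (φ t i)) - H1.fn (φ t i) := by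
      funext t
      rw [PiLp.sub_apply, map_sub]
      rfl
    have e2 : (fun t => gpn c₁ c₂ c₁₂ i (tr y (φ t)) - gpn c₁ c₂ c₁₂ i (φ t)) =
        fun t => trL y (gpn c₁ c₂ c₁₂ i (φ t)) - gpn c₁ c₂ c₁₂ i (φ t) := by
      funext t
      rw [gpn_tr]
    simp only [e1, e2]
    exact h1
  · exact fun i => H1.fn.continuous.comp ((continuous_apply i).comp (hφ.continuous_tr_sub y))
  · intro i
    have h1 : Continuous fun t => (y, φ t) := continuous_const.prodMk hφ.continuous
    exact ((continuous_gpn c₁ c₂ c₁₂ i).comp (continuous_tr.comp h1)).sub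
      ((continuous_gpn c₁ c₂ c₁₂ i).comp hφ.continuous)
  · exact fun i => H1.continuous_sqc.comp ((continuous_apply i).comp (hφ.continuous_tr_sub y))
  · exact ((continuous_lpn 3 (by norm_num)).comp (hφ.continuous_tr_sub y)).measurable.ennreal_ofReal
  · intro t ht
    rw [ofReal_lpn _ 3 (by norm_num)]
    refine (eLpNorm_smag_le _ 3 (by norm_num)).trans (ENNReal.ofReal_le_ofReal ?_)
    have := hA t ⟨ht.1.le, ht.2⟩
    have h2 := norm_sub_le (tr y (φ t)) (φ t)
    rw [norm_tr] at h2
    gcongr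
    linarith
  · exact ENNReal.ofReal_ne_top
  · intro i t ht
    have e : ∫⁻ x, ‖H1.sqc ((tr y (φ t) - φ t) i) x‖ₑ ^ (3 / 2 : ℝ) =
        ∫⁻ x, ‖H1.fn ((tr y (φ t) - φ t) i) x‖ₑ ^ 3 := by
      refine lintegral_congr_ae ?_
      filter_upwards [H1.sqc_coeFn ((tr y (φ t) - φ t) i)] with x hx
      rw [hx, enorm_mul]
      have e1 : ‖((‖H1.fn ((tr y (φ t) - φ t) i) x‖ : ℝ) : ℂ)‖ₑ = ‖H1.fn ((tr y (φ t) - φ t) i) x‖ₑ := by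
        rw [← ofReal_norm, Complex.norm_real, norm_norm, ofReal_norm]
      have e2 : ‖(starRingEnd ℂ) (H1.fn ((tr y (φ t) - φ t) i) x)‖ₑ =
          ‖H1.fn ((tr y (φ t) - φ t) i) x‖ₑ := by
        rw [← ofReal_norm, RCLike.norm_conj, ofReal_norm]
      rw [e1, e2, ← pow_two, ← ENNReal.rpow_natCast, ← ENNReal.rpow_natCast, ← ENNReal.rpow_mul]
      norm_num
    rw [e]
    refine (ENNReal.rpow_le_rpow (lintegral_norm_cube_le _ i) (by norm_num)).trans (le_of_eq ?_)
    rw [← ENNReal.rpow_natCast, ← ENNReal.rpow_natCast, ← ENNReal.rpow_mul]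
    norm_num
  · intro i t ht
    rw [← eLpNorm_threeHalves, ofReal_lpn _ 3 (by norm_num), hK, mul_assoc]
    refine (eLpNorm_gpn_sub_le c₁ c₂ c₁₂ _ _ i 3).trans ?_
    have := hA t ⟨ht.1.le, ht.2⟩
    rw [norm_tr]
    gcongr
  · intro i t
    rw [H1.bil_fn_sqc, Complex.ofReal_re]
    positivity
  · exact fun t _ => lpn_cube_le _
  · intro i
    have h1 : H1.fn ((tr y (φ 0) - φ 0) i) = trL y (H1.fn (φ 0 i)) - H1.fn (φ 0 i) := by
      rw [PiLp.sub_apply, map_sub]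
      rfl
    simp only [h1]
    rw [← ofReal_norm]
    refine ENNReal.ofReal_le_ofReal ((H1.norm_trL_sub_le (φ 0 i) y).trans ?_)
    have h2 := ((φ 0).norm_apply_le' i).trans (hA 0 ⟨le_rfl, hτ.le⟩)
    gcongr
    linarith [le_abs_self A]
  · rw [Ne, ENNReal.ofReal_eq_zero, not_le]
    positivity
  · calc 2 * 4 * K * (2 * schKint τ) ≤ 2 * 4 * K * (2 * (32 * (K + 1))⁻¹) := by gcongr
      _ = 16 * K * (32 * (K + 1))⁻¹ := by ring
      _ ≤ 16 * (K + 1) * (32 * (K + 1))⁻¹ := by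
        gcongr
        exact le_self_add
      _ = 1 / 2 := by
        have : (32 : ℝ≥0∞) = 2 * 16 := by norm_num
        rw [this, mul_assoc 2, ENNReal.mul_inv (by simp) (by simp), ENNReal.mul_inv (by simp) (by simp)]
        calc 16 * (K + 1) * (2⁻¹ * (16⁻¹ * (K + 1)⁻¹)) =
              2⁻¹ * ((16 * 16⁻¹) * ((K + 1) * (K + 1)⁻¹)) := by ring
          _ = _ := by
            rw [ENNReal.mul_inv_cancel (by simp) (by finiteness),
              ENNReal.mul_inv_cancel (by simp) (by finiteness), mul_one, mul_one, one_div]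

end H1Pair

/-! ### Calculus of mollified functions -/

/-- Integration by parts on `ℝ³`. -/
theorem integral_mul_eq_neg_of_hasLineDerivAt {F F' G G' : R3 → ℂ} {v : R3}
    (hF : MemLp F 2 volume) (hF' : MemLp F' 2 volume) (hG : MemLp G 2 volume) (hG' : MemLp G' 2 volume)
    (dF : ∀ x, HasLineDerivAt ℝ F (F' x) x v) (dG : ∀ x, HasLineDerivAt ℝ G (G' x) x v) :
    ∫ x, F x * G' x = -∫ x, F' x * G x :=
  integral_bilinear_hasLineDerivAt_right_eq_neg_left_of_integrable (B := ContinuousLinearMap.mul ℝ ℂ)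
    (hF'.integrable_mul hG) (hF.integrable_mul hG') (hF.integrable_mul hG) (fun x _ => dF x) (fun x _ => dG x)

theorem schwartz_hasLineDerivAt (ψ : 𝓢(R3, ℂ)) (v x : R3) : HasLineDerivAt ℝ ψ ((∂_{v} ψ) x) x v := by
  rw [SchwartzMap.lineDerivOp_apply_eq_fderiv]
  exact ψ.differentiableAt.hasFDerivAt.hasLineDerivAt v

/-- Mollification as a map of `L²`. -/
noncomputable def molL (ψ : BumpKernel) (f : L2R3) : L2R3 := (mol_memLp_two ψ (Lp.memLp f)).toLp

theorem molL_coeFn (ψ : BumpKernel) (f : L2R3) : molL ψ f =ᵐ[volume] mol ψ f := MemLp.coeFn_toLp _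

theorem molL_sub (ψ : BumpKernel) (f g : L2R3) : molL ψ (f - g) = molL ψ f - molL ψ g := by
  refine Lp.ext ?_
  filter_upwards [molL_coeFn ψ (f - g), molL_coeFn ψ f, molL_coeFn ψ g,
    Lp.coeFn_sub (molL ψ f) (molL ψ g)] with x h1 h2 h3 h4
  rw [h1, h4, Pi.sub_apply, h2, h3, mol_congr_ae (Lp.coeFn_sub f g),
    mol_sub ψ (Lp.memLp f) (Lp.memLp g), Pi.sub_apply]

theorem norm_molL_le (ψ : BumpKernel) (f : L2R3) : ‖molL ψ f‖ ≤ (∫ y, ‖ψ y‖) * ‖f‖ := by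
  have h := mol_eLpNorm_two_le ψ (Lp.aestronglyMeasurable f)
  rw [Lp.norm_def, Lp.norm_def, eLpNorm_congr_ae (molL_coeFn ψ f),
    integral_norm_eq_lintegral_enorm ψ.integrable.1, ← ENNReal.toReal_mul]
  exact ENNReal.toReal_mono (ENNReal.mul_ne_top ψ.integrable.2.ne (Lp.memLp f).2.ne) h

theorem integral_norm_moll {ε : ℝ} (hε : 0 < ε) : ∫ y, ‖moll ε hε y‖ = 1 := by
  rw [integral_norm_eq_lintegral_enorm (moll ε hε).integrable.1, lintegral_moll, ENNReal.toReal_one]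

theorem norm_molL_moll_le {ε : ℝ} (hε : 0 < ε) (f : L2R3) : ‖molL (moll ε hε) f‖ ≤ ‖f‖ := by
  simpa [integral_norm_moll] using norm_molL_le (moll ε hε) f

theorem continuous_molL (ψ : BumpKernel) : Continuous (molL ψ) := by
  rw [continuous_iff_continuousAt]
  intro f
  refine tendsto_iff_norm_sub_tendsto_zero.2 (squeeze_zero (fun _ => norm_nonneg _)
    (fun g => (molL_sub ψ g f ▸ norm_molL_le ψ (g - f))) ?_)
  have hc : Continuous fun g : L2R3 => (∫ y, ‖ψ y‖) * ‖g - f‖ := by fun_prop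
  simpa using hc.tendsto f

/-- Mollifications converge in `L²`, uniformly on compact sets of functions. -/
theorem exists_molL_sub_le {K : Set L2R3} (hK : IsCompact K) {r : ℝ} (hr : 0 < r) :
    ∃ ε₀ > 0, ∀ f ∈ K, ∀ ε (hε : 0 < ε), ε ≤ ε₀ → ‖molL (moll ε hε) f - f‖ ≤ r := by
  obtain ⟨ε₀, h0, h⟩ := exists_mol_sub_le hK hr
  refine ⟨ε₀, h0, fun f hf ε hε hle => ?_⟩
  have h1 := h f hf ε hε hle
  rw [Lp.norm_def]
  refine ENNReal.toReal_le_of_le_ofReal hr.le (le_trans (le_of_eq (eLpNorm_congr_ae ?_)) h1)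
  filter_upwards [Lp.coeFn_sub (molL (moll ε hε) f) f, molL_coeFn (moll ε hε) f] with x h2 h3
  rw [h2, Pi.sub_apply, Pi.sub_apply, h3]

namespace H1

/-- Mollification on `H¹`. -/
noncomputable def molH (ψ : BumpKernel) (u : H1R3) : H1R3 :=
  mk (molL ψ (fn u)) (fun k => molL ψ (grad k u)) (by
    intro k φ
    have h1 : ∫ x, molL ψ (fn u) x * (∂_{e3 k} φ) x = ∫ x, mol ψ (fn u) x * (∂_{e3 k} φ) x := by
      refine integral_congr_ae ?_
      filter_upwards [molL_coeFn ψ (fn u)] with x hx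
      rw [hx]
    have h2 : ∫ x, molL ψ (grad k u) x * φ x = ∫ x, mol ψ (grad k u) x * φ x := by
      refine integral_congr_ae ?_
      filter_upwards [molL_coeFn ψ (grad k u)] with x hx
      rw [hx]
    rw [h1, h2, ← mol_d]
    exact integral_mul_eq_neg_of_hasLineDerivAt (mol_memLp_two ψ (Lp.memLp _))
      (mol_memLp_two (ψ.d (e3 k)) (Lp.memLp _)) (φ.memLp 2) ((∂_{e3 k} φ).memLp 2)
      (fun x => mol_hasLineDerivAt ψ (Lp.memLp _) x _) (fun x => schwartz_hasLineDerivAt φ _ x))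

theorem fn_molH (ψ : BumpKernel) (u : H1R3) : fn (molH ψ u) = molL ψ (fn u) := rfl

theorem grad_molH (ψ : BumpKernel) (u : H1R3) (k : Fin 3) : grad k (molH ψ u) = molL ψ (grad k u) := rfl

theorem norm_le_sum (u : H1R3) : ‖u‖ ≤ ‖fn u‖ + ∑ k, ‖grad k u‖ := by
  refine abs_le_of_sq_le_sq' ?_ (by positivity) |>.2
  rw [norm_sq_eq]
  have h1 : ∑ k, ‖grad k u‖ ^ 2 ≤ (∑ k, ‖grad k u‖) ^ 2 :=
    Finset.sum_sq_le_sq_sum_of_nonneg fun i _ => norm_nonneg _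
  have h2 : 0 ≤ ∑ k, ‖grad k u‖ := by positivity
  nlinarith [norm_nonneg (fn u)]

end H1

namespace H1Pair

/-- Mollification of pairs. -/
noncomputable def molP (ψ : BumpKernel) (u : H1Pair) : H1Pair := WithLp.toLp 2 fun i => H1.molH ψ (u i)

@[simp] theorem molP_apply (ψ : BumpKernel) (u : H1Pair) (i : Fin 2) : molP ψ u i = H1.molH ψ (u i) := rfl

theorem comp_molP_ae (ψ : BumpKernel) (u : H1Pair) :
    ∀ᵐ x, (fun i => (molP ψ u).comp i x) = fun i => mol ψ (u.comp i) x := by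
  filter_upwards [ae_all_iff.2 fun i => molL_coeFn ψ (H1.fn (u i))] with x hx
  funext i
  exact hx i

theorem norm_le_sum (u : H1Pair) : ‖u‖ ≤ ∑ i, ‖u i‖ := by
  refine abs_le_of_sq_le_sq' ?_ (by positivity) |>.2
  rw [PiLp.norm_sq_eq_of_L2]
  exact Finset.sum_sq_le_sq_sum_of_nonneg fun i _ => norm_nonneg _

/-- Mollifications converge in `H¹`, uniformly on compact sets. -/
theorem exists_molP_sub_le {K : Set H1Pair} (hK : IsCompact K) {r : ℝ} (hr : 0 < r) :
    ∃ ε₀ > 0, ∀ u ∈ K, ∀ ε (hε : 0 < ε), ε ≤ ε₀ → ‖molP (moll ε hε) u - u‖ ≤ r := by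
  have hc : ∀ i, Continuous fun u : H1Pair => u i := continuous_apply
  have h1 : ∀ i : Fin 2, ∃ ε₀ > 0, ∀ u ∈ K, ∀ ε (hε : 0 < ε), ε ≤ ε₀ →
      ‖molL (moll ε hε) (H1.fn (u i)) - H1.fn (u i)‖ ≤ r / 8 := by
    intro i
    obtain ⟨ε₀, h0, h⟩ := exists_molL_sub_le (hK.image (H1.fn.continuous.comp (hc i)))
      (r := r / 8) (by positivity)
    exact ⟨ε₀, h0, fun u hu => h _ (Set.mem_image_of_mem _ hu)⟩
  have h2 : ∀ (i : Fin 2) (k : Fin 3), ∃ ε₀ > 0, ∀ u ∈ K, ∀ ε (hε : 0 < ε), ε ≤ ε₀ →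
      ‖molL (moll ε hε) (H1.grad k (u i)) - H1.grad k (u i)‖ ≤ r / 8 := by
    intro i k
    obtain ⟨ε₀, h0, h⟩ := exists_molL_sub_le (hK.image ((H1.grad k).continuous.comp (hc i)))
      (r := r / 8) (by positivity)
    exact ⟨ε₀, h0, fun u hu => h _ (Set.mem_image_of_mem _ hu)⟩
  choose e1 he1 h1 using h1
  choose e2 he2 h2 using h2
  obtain ⟨ε₀, h0, hle1, hle2⟩ : ∃ ε₀ : ℝ, 0 < ε₀ ∧ (∀ i, ε₀ ≤ e1 i) ∧ ∀ i k, ε₀ ≤ e2 i k := by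
    refine ⟨min (⨅ i, e1 i) (⨅ p : Fin 2 × Fin 3, e2 p.1 p.2), ?_, ?_, ?_⟩
    · obtain ⟨i, hi⟩ := exists_eq_ciInf_of_finite (f := e1)
      obtain ⟨p, hp⟩ := exists_eq_ciInf_of_finite (f := fun p : Fin 2 × Fin 3 => e2 p.1 p.2)
      rw [← hi, ← hp]
      exact lt_min (he1 i) (he2 p.1 p.2)
    · exact fun i => (min_le_left _ _).trans (ciInf_le (Finite.bddBelow_range _) i)
    · exact fun i k => (min_le_right _ _).trans (ciInf_le (f := fun p : Fin 2 × Fin 3 => e2 p.1 p.2)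
        (Finite.bddBelow_range _) (i, k))
  refine ⟨ε₀, h0, fun u hu ε hε hle => (norm_le_sum _).trans ?_⟩
  have hi : ∀ i, ‖(molP (moll ε hε) u - u) i‖ ≤ r / 2 := by
    intro i
    refine (H1.norm_le_sum _).trans ?_
    rw [PiLp.sub_apply, molP_apply, map_sub, H1.fn_molH]
    simp only [map_sub, H1.grad_molH]
    have a1 := h1 i u hu ε hε (hle.trans (hle1 i))
    have a2 := fun k => h2 i k u hu ε hε (hle.trans (hle2 i k))
    rw [Fin.sum_univ_three]
    linarith [a2 0, a2 1, a2 2]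
  rw [Fin.sum_univ_two]
  linarith [hi 0, hi 1]

theorem norm_molP_le {ε : ℝ} (hε : 0 < ε) (u : H1Pair) : ‖molP (moll ε hε) u‖ ≤ ‖u‖ := by
  refine abs_le_of_sq_le_sq' ?_ (norm_nonneg _) |>.2
  rw [PiLp.norm_sq_eq_of_L2, PiLp.norm_sq_eq_of_L2]
  simp only [molP_apply, H1.norm_sq_eq, H1.fn_molH, H1.grad_molH]
  gcongr <;> exact norm_molL_moll_le hε _

theorem continuous_molP (ψ : BumpKernel) : Continuous (molP ψ) := by
  refine (PiLp.continuous_toLp 2 _).comp (continuous_pi fun i => ?_)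
  rw [continuous_iff_continuousAt]
  intro u
  refine tendsto_iff_norm_sub_tendsto_zero.2 (squeeze_zero (fun _ => norm_nonneg _)
    (fun v => H1.norm_le_sum _) ?_)
  have h1 : Continuous fun v : H1Pair => molL ψ (H1.fn (v i)) :=
    (continuous_molL ψ).comp (H1.fn.continuous.comp (continuous_apply i))
  have h2 : ∀ k, Continuous fun v : H1Pair => molL ψ (H1.grad k (v i)) := fun k =>
    (continuous_molL ψ).comp ((H1.grad k).continuous.comp (continuous_apply i))
  have hc : Continuous fun v : H1Pair => ‖molL ψ (H1.fn (v i)) - molL ψ (H1.fn (u i))‖ +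
      ∑ k, ‖molL ψ (H1.grad k (v i)) - molL ψ (H1.grad k (u i))‖ :=
    (h1.sub continuous_const).norm.add
      (continuous_finsetSum _ fun k _ => ((h2 k).sub continuous_const).norm)
  have := hc.tendsto u
  simp only [map_sub, H1.fn_molH, H1.grad_molH]
  simpa using this

end H1Pair

namespace BumpKernel

theorem d_d_refl (ψ : BumpKernel) (x v y : R3) : ((ψ.refl x).d v).d v y = (ψ.d v).d v (x - y) := by
  have e : ((ψ.refl x).d v).toFun = fun y => -((ψ.d v).refl x).toFun y := by
    funext y
    exact d_refl ψ x v y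
  have h : ((ψ.refl x).d v).d v y = -(((ψ.d v).refl x).d v y) := by
    change fderiv ℝ ((ψ.refl x).d v).toFun y v = -(fderiv ℝ ((ψ.d v).refl x).toFun y v)
    rw [e, fderiv_fun_neg]
    rfl
  rw [h, d_refl, neg_neg]

end BumpKernel

theorem bil_refl (ψ : BumpKernel) (f : L2R3) (x : R3) : bil f (toL2 (ψ.refl x).toSchwartz) = mol ψ f x := by
  rw [bil_toL2]
  rfl

/-- The Laplacian of a mollified function. -/
noncomputable def molLap (ψ : BumpKernel) (f : R3 → ℂ) (x : R3) : ℂ :=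
  ∑ k, mol ((ψ.d (e3 k)).d (e3 k)) f x

theorem bil_laplacian_refl (ψ : BumpKernel) (f : L2R3) (x : R3) :
    bil f (toL2 (Δ (ψ.refl x).toSchwartz)) = molLap ψ f x := by
  rw [laplacian_schwartz_eq, map_sum, map_sum, molLap]
  refine Finset.sum_congr rfl fun k _ => ?_
  rw [BumpKernel.lineDeriv_toSchwartz, BumpKernel.lineDeriv_toSchwartz, bil_toL2]
  refine integral_congr_ae (Filter.Eventually.of_forall fun y => ?_)
  change f y * ((ψ.refl x).d (e3 k)).d (e3 k) y = _
  rw [BumpKernel.d_d_refl]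

/-- The equation satisfied by mollified solutions. -/
theorem IsWeakSol.hasDerivAt_mol {w G : ℝ → L2R3} (h : IsWeakSol w G) (ψ : BumpKernel) (x : R3) (t : ℝ) :
    HasDerivAt (fun s => mol ψ (w s) x) (Complex.I * (molLap ψ (w t) x - mol ψ (G t) x)) t := by
  have h1 := h.hasDerivAt (ψ.refl x).toSchwartz t
  simp only [bil_refl, bil_laplacian_refl] at h1
  refine h1.congr_deriv ?_
  ring

/-- Differentiation under the integral sign in integrated form. -/
theorem integral_sub_integral_eq_intervalIntegral {X : Type*} [TopologicalSpace X]
    [SecondCountableTopology X] [MeasurableSpace X] [BorelSpace X] {μ : Measure X} [SFinite μ]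
    {f f' : ℝ → X → ℝ} {a b : ℝ} (hab : a ≤ b) (hf : ∀ t x, HasDerivAt (fun s => f s x) (f' t x) t)
    (hc : Continuous (Function.uncurry f')) (hfa : Integrable (f a) μ) (hfb : Integrable (f b) μ)
    {C : ℝ≥0∞} (hC : C ≠ ⊤) (hb : ∀ t ∈ Set.Ioc a b, ∫⁻ x, ‖f' t x‖ₑ ∂μ ≤ C) :
    (∫ x, f b x ∂μ) - ∫ x, f a x ∂μ = ∫ t in a..b, ∫ x, f' t x ∂μ := by
  -- The fundamental theorem of calculus at each point followed by Fubini. Only a bound on the L¹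
  -- norm of the derivative is needed, not a dominating function uniform in t.
  have h1 : ∀ x, f b x - f a x = ∫ t in a..b, f' t x := by
    intro x
    have hcx : Continuous fun t => f' t x := hc.comp (by fun_prop : Continuous fun t : ℝ => (t, x))
    exact (intervalIntegral.integral_eq_sub_of_hasDerivAt (fun t _ => hf t x)
      (hcx.intervalIntegrable a b)).symm
  have hm : AEStronglyMeasurable (Function.uncurry f') ((volume.restrict (Set.Ioc a b)).prod μ) :=
    hc.aestronglyMeasurable
  have hi : Integrable (Function.uncurry f') ((volume.restrict (Set.Ioc a b)).prod μ) := by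
    refine ⟨hm, ?_⟩
    rw [HasFiniteIntegral, lintegral_prod _ hm.enorm]
    refine lt_of_le_of_lt (setLIntegral_mono' measurableSet_Ioc hb) ?_
    rw [lintegral_const, Measure.restrict_apply_univ, Real.volume_Ioc]
    exact ENNReal.mul_lt_top hC.lt_top ENNReal.ofReal_lt_top
  rw [← integral_sub hfb hfa]
  simp only [h1, intervalIntegral.integral_of_le hab]
  exact (integral_integral_swap hi).symm

/-! ### Taylor expansion of the nonlinearity and its commutator with mollification -/

theorem norm_sq_mul_taylor_le (a b : Fin 2 → ℂ) (i j : Fin 2) :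
    ‖((‖(a + b) j‖ ^ 2 : ℝ) : ℂ) * (a + b) i - ((‖a j‖ ^ 2 : ℝ) : ℂ) * a i -
      (((‖a j‖ ^ 2 : ℝ) : ℂ) * b i + ((2 * (inner ℝ (a j) (b j)) : ℝ) : ℂ) * a i)‖ ≤
      3 * ((mag a + mag b) * mag b ^ 2) := by
  have h1 : ‖(a + b) j‖ ^ 2 = ‖a j‖ ^ 2 + 2 * inner ℝ (a j) (b j) + ‖b j‖ ^ 2 := by
    rw [Pi.add_apply, norm_add_sq_real]
  -- The remainder is exact: |b_j|²(a_i + b_i) + 2⟨a_j, b_j⟩ b_i, every term of which is at least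
  -- quadratic in b.
  have h2 : ((‖(a + b) j‖ ^ 2 : ℝ) : ℂ) * (a + b) i - ((‖a j‖ ^ 2 : ℝ) : ℂ) * a i -
      (((‖a j‖ ^ 2 : ℝ) : ℂ) * b i + ((2 * (inner ℝ (a j) (b j)) : ℝ) : ℂ) * a i) =
      ((‖b j‖ ^ 2 : ℝ) : ℂ) * (a i + b i) + ((2 * (inner ℝ (a j) (b j)) : ℝ) : ℂ) * b i := by
    rw [h1, Pi.add_apply]; push_cast; ring
  rw [h2]
  have h3 := abs_real_inner_le_norm (a j) (b j)
  have hm : ∀ z : Fin 2 → ℂ, ∀ k, ‖z k‖ ≤ mag z := norm_le_mag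
  refine (norm_add_le _ _).trans ?_
  rw [norm_mul, norm_mul, Complex.norm_real, Complex.norm_real, Real.norm_eq_abs, Real.norm_eq_abs,
    abs_mul, abs_two, abs_of_nonneg (sq_nonneg ‖b j‖)]
  have h4 : |inner ℝ (a j) (b j)| ≤ mag a * mag b := h3.trans (mul_le_mul (hm _ _) (hm _ _) (norm_nonneg _) (mag_nonneg a))
  have h5 : ‖a i + b i‖ ≤ mag a + mag b := (norm_add_le _ _).trans (by gcongr <;> apply hm)
  have h6 : ‖b j‖ ^ 2 ≤ mag b ^ 2 := by gcongr; apply hm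
  have e1 := mul_le_mul h6 h5 (norm_nonneg _) (sq_nonneg _)
  have e2 := mul_le_mul (mul_le_mul_of_nonneg_left h4 zero_le_two) (hm b i) (norm_nonneg _)
    (mul_nonneg zero_le_two (mul_nonneg (mag_nonneg a) (mag_nonneg b)))
  have := mul_nonneg (mag_nonneg b) (sq_nonneg (mag b))
  nlinarith

/-- The differential of z ↦ |z_j|² z_i is only real linear. Of L nothing but linearity will be used:
applied to fluctuations of zero mean it averages to zero. -/
theorem exists_gpNonlinearity_taylor (c₁ c₂ c₁₂ : ℝ) (a : Fin 2 → ℂ) (i : Fin 2) :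
    ∃ L : (Fin 2 → ℂ) →L[ℝ] ℂ, ∀ b, ‖gpNonlinearity c₁ c₂ c₁₂ (a + b) i -
      gpNonlinearity c₁ c₂ c₁₂ a i - L b‖ ≤ gpK c₁ c₂ c₁₂ * ((mag a + mag b) * mag b ^ 2) := by
  let l : Fin 2 → (Fin 2 → ℂ) →L[ℝ] ℂ := fun j =>
    (‖a j‖ ^ 2) • ContinuousLinearMap.proj i + ((2 : ℝ) • ((innerSL ℝ (a j)).comp
      (ContinuousLinearMap.proj j : (Fin 2 → ℂ) →L[ℝ] ℂ))).smulRight (a i)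
  have hl : ∀ j b, l j b = ((‖a j‖ ^ 2 : ℝ) : ℂ) * b i + ((2 * (inner ℝ (a j) (b j)) : ℝ) : ℂ) * a i := by
    intro j b
    simp [l, Complex.real_smul]
  refine ⟨(8 * Real.pi * ![c₁, c₂] i : ℝ) • l i + (8 * Real.pi * c₁₂ : ℝ) • l (1 - i), fun b => ?_⟩
  rw [gpNonlinearity_eq, gpNonlinearity_eq, add_apply, smul_apply,
    smul_apply, hl, hl, Complex.real_smul, Complex.real_smul]
  have e1 := norm_sq_mul_taylor_le a b i i
  have e2 := norm_sq_mul_taylor_le a b i (1 - i)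
  have hQ : 0 ≤ (mag a + mag b) * mag b ^ 2 :=
    mul_nonneg (add_nonneg (mag_nonneg a) (mag_nonneg b)) (sq_nonneg _)
  set Q := (mag a + mag b) * mag b ^ 2
  refine le_trans (b := |8 * Real.pi * ![c₁, c₂] i| * (3 * Q) + |8 * Real.pi * c₁₂| * (3 * Q)) ?_ ?_
  · refine le_trans (le_of_eq (congrArg _ ?_)) ((norm_add_le _ _).trans (add_le_add
      ((norm_mul_le _ _).trans (mul_le_mul (Complex.norm_real _).le e1 (norm_nonneg _) (abs_nonneg _)))
      ((norm_mul_le _ _).trans (mul_le_mul (Complex.norm_real _).le e2 (norm_nonneg _) (abs_nonneg _)))))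
    ring
  · rw [abs_mul, abs_mul _ c₁₂, abs_of_pos (by positivity : (0 : ℝ) < 8 * Real.pi), ← add_mul, gpK]
    have hi : |![c₁, c₂] i| ≤ |c₁| + |c₂| := by
      fin_cases i <;> simp
    have : 0 ≤ Real.pi * Q := mul_nonneg Real.pi_pos.le hQ
    have h3 := abs_nonneg c₁₂
    have h1 := abs_nonneg c₁
    have h2 := abs_nonneg c₂
    nlinarith [mul_nonneg this h3, mul_nonneg this (sub_nonneg.2 hi), mul_nonneg this h1, mul_nonneg this h2]

/-- The mollifier is real and nonnegative. A real linear map commutes with real weights but not with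
general complex ones, so this is needed to pull it out of the average. -/
theorem moll_eq_norm {ε : ℝ} (hε : 0 < ε) (y : R3) : moll ε hε y = (‖moll ε hε y‖ : ℂ) := by
  have h : ∃ r : ℝ, 0 ≤ r ∧ moll ε hε y = (r : ℂ) := by
    refine ⟨ε⁻¹ ^ 3 * baseBump.normed volume (ε⁻¹ • y), by have := baseBump.nonneg_normed (μ := volume) (ε⁻¹ • y); positivity, ?_⟩
    rw [moll, BumpKernel.scale_apply, Complex.ofReal_mul]
    rfl
  obtain ⟨r, h0, h⟩ := h
  rw [h, Complex.norm_real, Real.norm_of_nonneg h0]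

namespace H1Pair

/-- The modulus of the increment `u(x - y) - u(x)`. -/
noncomputable def incr (u : H1Pair) (x y : R3) : ℝ≥0∞ :=
  ENNReal.ofReal (mag fun i => u.comp i (x - y) - u.comp i x)

theorem measurable_incr (u : H1Pair) : Measurable (Function.uncurry u.incr) := by
  refine ENNReal.measurable_ofReal.comp (continuous_mag.measurable.comp (measurable_pi_lambda _ fun i => ?_))
  exact ((u.stronglyMeasurable_comp i).measurable.comp (measurable_fst.sub measurable_snd)).sub
    ((u.stronglyMeasurable_comp i).measurable.comp measurable_fst)

theorem lintegral_ofReal_smag_pow (u : H1Pair) (n : ℕ) [n.AtLeastTwo] (h6 : n ≤ 6) :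
    ∫⁻ x, ENNReal.ofReal (u.smag x) ^ n = ENNReal.ofReal (lpn n u) ^ n := by
  rw [ofReal_lpn u n h6]
  have h0 : (n : ℝ) ≠ 0 := by exact_mod_cast (NeZero.ne n)
  have : eLpNorm u.smag (OfNat.ofNat n) volume =
      (∫⁻ x, ENNReal.ofReal (u.smag x) ^ n) ^ (1 / (n : ℝ)) := by
    have h := eLpNorm_eq_lintegral_rpow_enorm_toReal (μ := volume) (f := u.smag) (p := ((n : ℝ≥0∞)))
      (by exact_mod_cast (NeZero.ne n)) (ENNReal.natCast_ne_top n)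
    rw [ENNReal.toReal_natCast] at h
    refine (show eLpNorm u.smag (OfNat.ofNat n) volume = eLpNorm u.smag (n : ℝ≥0∞) volume from rfl).trans (h.trans ?_)
    congr 1
    refine lintegral_congr fun x => ?_
    rw [ENNReal.rpow_natCast, Real.enorm_eq_ofReal (smag_nonneg _ _)]
  rw [this, ← ENNReal.rpow_natCast, ← ENNReal.rpow_mul, one_div, inv_mul_cancel₀ h0, ENNReal.rpow_one]

theorem lintegral_incr_pow (u : H1Pair) (y : R3) (n : ℕ) [n.AtLeastTwo] (h6 : n ≤ 6) :
    ∫⁻ x, u.incr x y ^ n = ENNReal.ofReal (lpn n (tr y u - u)) ^ n := by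
  rw [← lintegral_ofReal_smag_pow _ n h6]
  refine lintegral_congr_ae ?_
  filter_upwards [comp_sub_ae (tr y u) u, comp_tr_ae y u] with x h1 h2
  rw [smag, h1, h2, incr]
  rfl

variable (c₁ c₂ c₁₂ : ℝ)

/-- The commutator is quadratic in the fluctuations θ(y) = u(x − y) − (ρ ∗ u)(x): expanding the
nonlinearity at (ρ ∗ u)(x), the constant term cancels and the linear term integrates to zero against
ρ because θ has ρ-mean zero. This gain of one order makes the energy argument work. -/
theorem enorm_gpNonlinearity_mol_sub_le {ε : ℝ} (hε : 0 < ε) (u : H1Pair) (i : Fin 2) (x : R3) :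
    ‖gpNonlinearity c₁ c₂ c₁₂ (fun j => mol (moll ε hε) (u.comp j) x) i -
      mol (moll ε hε) (gpn c₁ c₂ c₁₂ i u) x‖ₑ ≤ ENNReal.ofReal (gpK c₁ c₂ c₁₂) *
      ∫⁻ y, (ENNReal.ofReal (mag fun j => mol (moll ε hε) (u.comp j) x) +
        ENNReal.ofReal (mag fun j => u.comp j (x - y) - mol (moll ε hε) (u.comp j) x)) *
        ENNReal.ofReal (mag fun j => u.comp j (x - y) - mol (moll ε hε) (u.comp j) x) ^ 2 *
          ‖moll ε hε y‖ₑ := by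
  set ρ := moll ε hε
  set m : Fin 2 → ℂ := fun j => mol ρ (u.comp j) x with hm
  have h2 : ∀ j, MemLp (u.comp j) 2 volume := fun j => Lp.memLp _
  obtain ⟨L, hL⟩ := exists_gpNonlinearity_taylor c₁ c₂ c₁₂ m i
  let θ : R3 → Fin 2 → ℂ := fun y j => u.comp j (x - y) - m j
  have hint : ∀ {f : R3 → ℂ}, MemLp f 2 volume → Integrable (fun y => f (x - y) * ρ y) := by
    intro f hf
    have := (mol_integrand_integrable ρ hf x).comp_sub_left x
    simpa using this
  have hI : ∀ j, Integrable (fun y => (‖ρ y‖ • θ y) j) := by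
    intro j
    refine ((hint (h2 j)).sub (ρ.integrable.const_mul (m j))).congr (Filter.Eventually.of_forall fun y => ?_)
    change u.comp j (x - y) * ρ y - m j * ρ y = (‖ρ y‖ : ℝ) • (u.comp j (x - y) - m j)
    rw [Complex.real_smul, ← moll_eq_norm hε y]; ring
  have hθ : ∫ y, ‖ρ y‖ • θ y = 0 := by
    ext j
    rw [eval_integral hI]
    have e := mol_moll_sub_eq hε (h2 j) x (m j)
    rw [show mol (moll ε hε) (u.comp j) x - m j = 0 from sub_self _] at e
    rw [Pi.zero_apply, e]
    refine integral_congr_ae (Filter.Eventually.of_forall fun y => ?_)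
    change (‖ρ y‖ : ℝ) • (u.comp j (x - y) - m j) = _
    rw [Complex.real_smul, ← moll_eq_norm hε y]; ring
  have hθi : Integrable (fun y => ‖ρ y‖ • θ y) := Integrable.of_eval hI
  have hL0 : ∫ y, L (‖ρ y‖ • θ y) = 0 := by rw [L.integral_comp_comm hθi, hθ, map_zero]
  have hN := u.memLp_gpNonlinearity c₁ c₂ c₁₂ i
  have key : gpNonlinearity c₁ c₂ c₁₂ m i - mol ρ (gpn c₁ c₂ c₁₂ i u) x =
      -∫ y, (gpNonlinearity c₁ c₂ c₁₂ (m + θ y) i - gpNonlinearity c₁ c₂ c₁₂ m i - L (θ y)) * ρ y := by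
    have e1 : mol ρ (gpn c₁ c₂ c₁₂ i u) x - gpNonlinearity c₁ c₂ c₁₂ m i =
        ∫ y, (gpNonlinearity c₁ c₂ c₁₂ (fun j => u.comp j (x - y)) i - gpNonlinearity c₁ c₂ c₁₂ m i) * ρ y := by
      rw [mol_congr_ae (gpn_coeFn c₁ c₂ c₁₂ i u)]
      exact mol_moll_sub_eq hε hN x _
    rw [← neg_sub, e1, neg_inj, ← sub_zero (∫ y, _), ← hL0, ← integral_sub]
    · refine integral_congr_ae (Filter.Eventually.of_forall fun y => ?_)
      have : m + θ y = fun j => u.comp j (x - y) := by ext j; simp [θ]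
      simp only [this, map_smul, Complex.real_smul]
      rw [← moll_eq_norm hε y]; ring
    · refine ((hint hN).sub (ρ.integrable.const_mul (gpNonlinearity c₁ c₂ c₁₂ m i))).congr
        (Filter.Eventually.of_forall fun y => ?_)
      exact (sub_mul _ _ _).symm
    · exact L.integrable_comp hθi
  rw [key, enorm_neg, ← lintegral_const_mul' _ _ ENNReal.ofReal_ne_top]
  refine (enorm_integral_le_lintegral_enorm _).trans (lintegral_mono fun y => ?_)
  rw [enorm_mul, ← mul_assoc]
  refine mul_le_mul_left ?_ _
  rw [← ENNReal.ofReal_add (mag_nonneg _) (mag_nonneg _), ← ENNReal.ofReal_pow (mag_nonneg _),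
    ← ENNReal.ofReal_mul (add_nonneg (mag_nonneg _) (mag_nonneg _)), ← ENNReal.ofReal_mul (gpK_nonneg _ _ _),
    ← ofReal_norm]
  exact ENNReal.ofReal_le_ofReal (hL (θ y))

end H1Pair

/-! ### Second derivatives of mollifiers -/

namespace BumpKernel

/-- Because derivatives of kernels have zero mean, u(x) can be subtracted for free, and Δ(ρ ∗ u)
depends only on increments of u. -/
theorem integral_d (ψ : BumpKernel) (v : R3) : ∫ x, ψ.d v x = 0 := by
  have h := integral_bilinear_hasLineDerivAt_right_eq_neg_left_of_integrable (μ := (volume : Measure R3))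
    (B := ContinuousLinearMap.mul ℝ ℂ) (f := fun _ : R3 => (1 : ℂ)) (f' := fun _ => 0) (g := ψ) (g' := ψ.d v)
    (v := v) (by simp) (by simpa using (ψ.d v).integrable)
    (by simpa using ψ.integrable)
    (fun x _ => by simpa using (hasFDerivAt_const (1 : ℂ) x).hasLineDerivAt v)
    (fun x _ => (ψ.smooth.differentiable (by simp) x).hasFDerivAt.hasLineDerivAt v)
  simpa using h

theorem d_eq_zero {r : ℝ} {ψ : BumpKernel} (hψ : ∀ x, r < ‖x‖ → ψ x = 0) (v x : R3) (hx : r < ‖x‖) :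
    ψ.d v x = 0 := by
  have h : ψ.toFun =ᶠ[𝓝 x] fun _ => 0 := by
    filter_upwards [(isOpen_lt continuous_const continuous_norm).mem_nhds hx] with z hz using hψ z hz
  change fderiv ℝ ψ.toFun x v = 0
  rw [h.fderiv_eq]; simp

theorem d_d_scale {ε : ℝ} (hε : ε ≠ 0) (ψ : BumpKernel) (v x : R3) :
    ((ψ.scale ε hε).d v).d v x = (ε⁻¹ ^ 2 : ℝ) * ((ψ.d v).d v).scale ε hε x := by
  have h : ((ψ.scale ε hε).d v).toFun = fun x => ((ε⁻¹ : ℝ) : ℂ) * ((ψ.d v).scale ε hε).toFun x :=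
    funext fun x => d_scale hε ψ v x
  have h1 : ((ψ.scale ε hε).d v).d v x = (ε⁻¹ : ℝ) * ((ψ.d v).scale ε hε).d v x := by
    change fderiv ℝ ((ψ.scale ε hε).d v).toFun x v = _
    rw [h, fderiv_const_mul (((ψ.d v).scale ε hε).smooth.differentiable (by simp) x)]
    rfl
  rw [h1, d_scale]
  push_cast; ring

/-- The sum of the moduli of the pure second derivatives. -/
noncomputable def lapAbs (ψ : BumpKernel) (z : R3) : ℝ≥0∞ := ∑ k, ‖(ψ.d (e3 k)).d (e3 k) z‖ₑ

theorem measurable_lapAbs (ψ : BumpKernel) : Measurable ψ.lapAbs :=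
  Finset.measurable_sum _ fun k _ => ((ψ.d (e3 k)).d (e3 k)).continuous.enorm.measurable

theorem lapAbs_moll_eq_zero {ε : ℝ} (hε : 0 < ε) {z : R3} (hz : ε < ‖z‖) : (moll ε hε).lapAbs z = 0 :=
  Finset.sum_eq_zero fun k _ => by
    rw [d_eq_zero (d_eq_zero (fun x hx => moll_eq_zero hε x hx.le) _) _ _ hz, enorm_zero]

theorem lintegral_lapAbs_ne_top (ψ : BumpKernel) : ∫⁻ z, ψ.lapAbs z ≠ ⊤ := by
  unfold lapAbs
  rw [lintegral_finsetSum _ fun k _ => ((ψ.d (e3 k)).d (e3 k)).continuous.enorm.measurable]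
  exact ENNReal.sum_ne_top.2 fun k _ => ((ψ.d (e3 k)).d (e3 k)).integrable.2.ne

theorem lintegral_lapAbs_moll {ε : ℝ} (hε : 0 < ε) :
    ∫⁻ z, (moll ε hε).lapAbs z = ENNReal.ofReal (ε⁻¹ ^ 2) * ∫⁻ z, eta.lapAbs z := by
  unfold lapAbs
  rw [lintegral_finsetSum _ fun k _ => (((moll ε hε).d (e3 k)).d (e3 k)).continuous.enorm.measurable,
    lintegral_finsetSum _ fun k _ => ((eta.d (e3 k)).d (e3 k)).continuous.enorm.measurable, Finset.mul_sum]
  refine Finset.sum_congr rfl fun k _ => ?_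
  rw [← lintegral_scale hε ((eta.d (e3 k)).d (e3 k)), ← lintegral_const_mul _ (((eta.d (e3 k)).d (e3 k)).scale ε
    hε.ne').continuous.enorm.measurable]
  refine lintegral_congr fun z => ?_
  rw [moll, d_d_scale, enorm_mul]
  congr 1
  rw [← ofReal_norm, Complex.norm_real, Real.norm_of_nonneg (by positivity)]

end BumpKernel

/-! ### The trilinear estimate for the energy error -/

theorem mul_sq_mul_le_of_pos {X q d ε l : ℝ} (hX : 0 ≤ X) (hq : 0 ≤ q) (hd : 0 ≤ d) (hε : 0 < ε)
    (hl : 0 < l) :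
    X * (d * q ^ 2) ≤ l * (ε ^ 3 * X ^ 3 + ε⁻¹ ^ 3 * q ^ 3 + d ^ 6) + l⁻¹ ^ 5 * q ^ 6 := by
  have amgm : ∀ a b p : ℝ, 0 ≤ a → 0 ≤ b → 0 ≤ p → a * b * p ≤ a ^ 3 + b ^ 3 + p ^ 3 := by
    intro a b p ha hb hp
    have h := mul_nonneg (add_nonneg (add_nonneg ha hb) hp)
      (add_nonneg (add_nonneg (sq_nonneg (a - b)) (sq_nonneg (b - p))) (sq_nonneg (p - a)))
    have := mul_nonneg (mul_nonneg ha hb) hp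
    nlinarith
  -- X stands for the Laplacian, of size ε⁻¹, q for an increment, of size ε, and d for a bounded
  -- factor in L⁶. The first two factors are normalised in L³; the third is split once more into q⁶,
  -- which is small, and d⁶, which is bounded. The parameter l transfers smallness between these
  -- terms.
  have h1 := amgm (ε * X) (ε⁻¹ * q) (l⁻¹ * (q * d)) (by positivity) (by positivity) (by positivity)
  have h2 : 2 * ((l⁻¹ ^ 3 * q ^ 3) * d ^ 3) ≤ (l⁻¹ ^ 3 * q ^ 3) ^ 2 + (d ^ 3) ^ 2 := by
    nlinarith [sq_nonneg (l⁻¹ ^ 3 * q ^ 3 - d ^ 3)]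
  have h3 : (l⁻¹ * (q * d)) ^ 3 = (l⁻¹ ^ 3 * q ^ 3) * d ^ 3 := by ring
  have h5 : 0 ≤ (l⁻¹ ^ 3 * q ^ 3) * d ^ 3 := by positivity
  have e1 : X * (d * q ^ 2) = l * ((ε * X) * (ε⁻¹ * q) * (l⁻¹ * (q * d))) := by
    field_simp
  have e2 : l⁻¹ ^ 5 * q ^ 6 = l * (l⁻¹ ^ 3 * q ^ 3) ^ 2 := by
    field_simp
  rw [e1, e2]
  nlinarith [mul_le_mul_of_nonneg_left (show (ε * X) * (ε⁻¹ * q) * (l⁻¹ * (q * d)) ≤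
    ε ^ 3 * X ^ 3 + ε⁻¹ ^ 3 * q ^ 3 + d ^ 6 + (l⁻¹ ^ 3 * q ^ 3) ^ 2 by nlinarith) hl.le]

theorem ennreal_mul_sq_mul_le (X q d : ℝ≥0∞) {ε l : ℝ} (hε : 0 < ε) (hl : 0 < l) :
    X * (d * q ^ 2) ≤ ENNReal.ofReal l * (ENNReal.ofReal (ε ^ 3) * X ^ 3 + ENNReal.ofReal (ε⁻¹ ^ 3) * q ^ 3 + d ^ 6) +
      ENNReal.ofReal (l⁻¹ ^ 5) * q ^ 6 := by
  have hl0 : ENNReal.ofReal l ≠ 0 := (ENNReal.ofReal_pos.2 hl).ne'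
  have he0 : ENNReal.ofReal (ε ^ 3) ≠ 0 := (ENNReal.ofReal_pos.2 (by positivity)).ne'
  have he1 : ENNReal.ofReal (ε⁻¹ ^ 3) ≠ 0 := (ENNReal.ofReal_pos.2 (by positivity)).ne'
  rcases eq_or_ne X ⊤ with rfl | hX
  · refine le_top.trans (le_of_eq ?_)
    simp [ENNReal.mul_top, he0, hl0]
  rcases eq_or_ne q ⊤ with rfl | hq
  · refine le_top.trans (le_of_eq ?_)
    rw [ENNReal.top_pow three_ne_zero, ENNReal.mul_top he1, add_top, top_add, ENNReal.mul_top hl0, top_add]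
  rcases eq_or_ne d ⊤ with rfl | hd
  · refine le_top.trans (le_of_eq ?_)
    simp [ENNReal.mul_top, hl0]
  have h := mul_sq_mul_le_of_pos (X := X.toReal) (q := q.toReal) (d := d.toReal) ENNReal.toReal_nonneg
    ENNReal.toReal_nonneg ENNReal.toReal_nonneg hε hl
  have h0 : X * (d * q ^ 2) ≠ ⊤ := by finiteness
  rw [← ENNReal.ofReal_toReal h0]
  have hX' := ENNReal.ofReal_toReal hX
  refine (ENNReal.ofReal_le_ofReal (le_of_eq_of_le (by simp) h)).trans (le_of_eq ?_)
  rw [ENNReal.ofReal_add (by positivity) (by positivity), ENNReal.ofReal_mul hl.le,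
    ENNReal.ofReal_add (by positivity) (by positivity), ENNReal.ofReal_add (by positivity) (by positivity),
    ENNReal.ofReal_mul (by positivity), ENNReal.ofReal_mul (by positivity), ENNReal.ofReal_mul (by positivity),
    ENNReal.ofReal_pow ENNReal.toReal_nonneg, ENNReal.ofReal_pow ENNReal.toReal_nonneg,
    ENNReal.ofReal_pow ENNReal.toReal_nonneg, ENNReal.ofReal_pow ENNReal.toReal_nonneg,
    ENNReal.ofReal_toReal hX, ENNReal.ofReal_toReal hq, ENNReal.ofReal_toReal hd]

theorem ennreal_add_pow_six_le (a b : ℝ≥0∞) : (a + b) ^ 6 ≤ 32 * (a ^ 6 + b ^ 6) := by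
  have h := ENNReal.rpow_add_le_mul_rpow_add_rpow a b (p := ((6 : ℕ) : ℝ)) (by norm_num)
  rw [show (((6 : ℕ) : ℝ) - 1) = ((5 : ℕ) : ℝ) by norm_num] at h
  simp only [ENNReal.rpow_natCast] at h
  exact h.trans (le_of_eq (by norm_num))

/-- Fluctuations around the mollified value are bounded by increments plus twice their average, and
Jensen controls the average by the same integral. This gives the numbers 36 = 4(1 + 2³) and 2080 =
32(1 + 2⁶) met below. -/
theorem lintegral_lintegral_add_pow_le {α β : Type*} [MeasurableSpace α] [MeasurableSpace β]
    {μ : Measure α} {ν : Measure β} [SFinite μ] [SFinite ν] {h : α → β → ℝ≥0∞} {K : β → ℝ≥0∞}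
    (hm : Measurable (Function.uncurry h)) (hKm : Measurable K) (hK : ∫⁻ y, K y ∂ν = 1) (k : ℕ)
    {c : ℝ≥0∞} (hc : ∀ a b : ℝ≥0∞, (a + b) ^ (k + 1) ≤ c * (a ^ (k + 1) + b ^ (k + 1))) :
    ∫⁻ x, ∫⁻ y, (h x y + 2 * ∫⁻ z, h x z * K z ∂ν) ^ (k + 1) * K y ∂ν ∂μ ≤
      c * (1 + 2 ^ (k + 1)) * ∫⁻ y, (∫⁻ x, h x y ^ (k + 1) ∂μ) * K y ∂ν := by
  have hPm : Measurable fun x => ∫⁻ z, h x z * K z ∂ν :=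
    (hm.mul (hKm.comp measurable_snd)).lintegral_prod_right
  have hx : ∀ x, Measurable fun y => h x y := fun x => hm.comp measurable_prodMk_left
  have h1 : ∫⁻ x, ∫⁻ y, h x y ^ (k + 1) * K y ∂ν ∂μ = ∫⁻ y, (∫⁻ x, h x y ^ (k + 1) ∂μ) * K y ∂ν := by
    rw [lintegral_lintegral_swap (((hm.pow_const _).mul (hKm.comp measurable_snd)).aemeasurable)]
    refine lintegral_congr fun y => ?_
    exact lintegral_mul_const _ ((hm.comp measurable_prodMk_right).pow_const _)
  have h2 : ∫⁻ x, (∫⁻ z, h x z * K z ∂ν) ^ (k + 1) ∂μ ≤ ∫⁻ y, (∫⁻ x, h x y ^ (k + 1) ∂μ) * K y ∂ν := by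
    refine (lintegral_lintegral_mul_pow_le hm.aemeasurable hKm k).trans (le_of_eq ?_)
    rw [hK, one_pow, one_mul]
  generalize ∫⁻ y, (∫⁻ x, h x y ^ (k + 1) ∂μ) * K y ∂ν = J at h1 h2 ⊢
  obtain ⟨P, hP⟩ : ∃ P : α → ℝ≥0∞, ∀ x, ∫⁻ z, h x z * K z ∂ν = P x := ⟨_, fun _ => rfl⟩
  simp only [hP] at hPm h2 ⊢
  have hm' : Measurable fun x => ∫⁻ y, h x y ^ (k + 1) * K y ∂ν :=
    ((hm.pow_const _).mul (hKm.comp measurable_snd)).lintegral_prod_right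
  have hpt : ∀ x, ∫⁻ y, (h x y + 2 * P x) ^ (k + 1) * K y ∂ν ≤
      c * ((∫⁻ y, h x y ^ (k + 1) * K y ∂ν) + 2 ^ (k + 1) * P x ^ (k + 1)) := by
    intro x
    have hb : ∀ y, (h x y + 2 * P x) ^ (k + 1) * K y ≤
        c * (h x y ^ (k + 1) * K y + 2 ^ (k + 1) * P x ^ (k + 1) * K y) := fun y => by
      refine (mul_le_mul_left (hc _ _) _).trans (le_of_eq ?_)
      rw [mul_pow]; ring
    refine (lintegral_mono hb).trans (le_of_eq ?_)
    have m : Measurable fun y => h x y ^ (k + 1) * K y := ((hx x).pow_const _).mul hKm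
    rw [lintegral_const_mul _ (by fun_prop), lintegral_add_left m, lintegral_const_mul _ hKm, hK, mul_one]
  refine (lintegral_mono hpt).trans ?_
  rw [lintegral_const_mul _ (by fun_prop), lintegral_add_left hm', h1,
    lintegral_const_mul _ (hPm.pow_const _), mul_assoc, add_mul, one_mul]
  gcongr

/-- The pointwise trilinear inequality is integrated first against the probability kernel K and then
in x. Here d = U + q, so d⁶ costs the factor 32 of (a + b)⁶ ≤ 32(a⁶ + b⁶). -/
theorem lintegral_mul_le_of_sextic {α β : Type*} [MeasurableSpace α] [MeasurableSpace β]
    {μ : Measure α} {ν : Measure β} [SFinite μ] [SFinite ν] {E X U : α → ℝ≥0∞} {q : α → β → ℝ≥0∞}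
    {K : β → ℝ≥0∞} {C A B D V : ℝ≥0∞} (hX : Measurable X) (hU : Measurable U)
    (hq : Measurable (Function.uncurry q)) (hKm : Measurable K) (hK : ∫⁻ y, K y ∂ν = 1)
    (hE : ∀ x, E x ≤ C * ∫⁻ y, (U x + q x y) * q x y ^ 2 * K y ∂ν)
    (hA : ∫⁻ x, X x ^ 3 ∂μ ≤ A) (hB : ∫⁻ x, ∫⁻ y, q x y ^ 3 * K y ∂ν ∂μ ≤ B)
    (hD : ∫⁻ x, ∫⁻ y, q x y ^ 6 * K y ∂ν ∂μ ≤ D) (hV : ∫⁻ x, U x ^ 6 ∂μ ≤ V) {ε l : ℝ} (hε : 0 < ε)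
    (hl : 0 < l) :
    ∫⁻ x, E x * X x ∂μ ≤ C * (ENNReal.ofReal l * (ENNReal.ofReal (ε ^ 3) * A +
      ENNReal.ofReal (ε⁻¹ ^ 3) * B + 32 * (V + D)) + ENNReal.ofReal (l⁻¹ ^ 5) * D) := by
  have hQ : ∀ n : ℕ, Measurable fun x => ∫⁻ y, q x y ^ n * K y ∂ν := fun n =>
    ((hq.pow_const _).mul (hKm.comp measurable_snd)).lintegral_prod_right
  have hqx : ∀ x, Measurable (q x) := fun x => hq.comp measurable_prodMk_left
  have hpt : ∀ x, E x * X x ≤ C * (ENNReal.ofReal l * (ENNReal.ofReal (ε ^ 3) * X x ^ 3 +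
        ENNReal.ofReal (ε⁻¹ ^ 3) * (∫⁻ y, q x y ^ 3 * K y ∂ν) +
        32 * (U x ^ 6 + ∫⁻ y, q x y ^ 6 * K y ∂ν)) +
        ENNReal.ofReal (l⁻¹ ^ 5) * ∫⁻ y, q x y ^ 6 * K y ∂ν) := by
    intro x
    refine (mul_le_mul_left (hE x) _).trans ?_
    rw [mul_assoc]
    refine mul_le_mul_right ?_ _
    rw [mul_comm]
    refine (lintegral_const_mul_le _ _).trans ?_
    have hb : ∀ y, X x * ((U x + q x y) * q x y ^ 2 * K y) ≤
        ENNReal.ofReal l * (ENNReal.ofReal (ε ^ 3) * X x ^ 3 * K y +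
          ENNReal.ofReal (ε⁻¹ ^ 3) * (q x y ^ 3 * K y) + 32 * (U x ^ 6 * K y + q x y ^ 6 * K y)) +
          ENNReal.ofReal (l⁻¹ ^ 5) * (q x y ^ 6 * K y) := fun y => by
      rw [← mul_assoc]
      refine (mul_le_mul_left (ennreal_mul_sq_mul_le (X x) (q x y) (U x + q x y) hε hl) _).trans ?_
      refine (mul_le_mul_left (add_le_add (mul_le_mul_right (add_le_add le_rfl
        (ennreal_add_pow_six_le _ _)) _) le_rfl) _).trans (le_of_eq ?_)
      ring
    have m3 : Measurable fun y => q x y ^ 3 * K y := ((hqx x).pow_const _).mul hKm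
    have m6 : Measurable fun y => q x y ^ 6 * K y := ((hqx x).pow_const _).mul hKm
    refine (lintegral_mono hb).trans (le_of_eq ?_)
    rw [lintegral_add_right _ (m6.const_mul _), lintegral_const_mul _ (by fun_prop),
      lintegral_add_right _ (by fun_prop), lintegral_add_right _ (by fun_prop),
      lintegral_const_mul _ hKm, lintegral_const_mul _ m3, lintegral_const_mul _ (by fun_prop),
      lintegral_add_right _ m6, lintegral_const_mul _ hKm, lintegral_const_mul _ m6, hK, mul_one, mul_one]
  refine (lintegral_mono hpt).trans ?_
  have hQ3m := hQ 3
  have hQ6m := hQ 6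
  rw [lintegral_const_mul _ (by fun_prop), lintegral_add_right _ (by fun_prop), lintegral_const_mul _ (by fun_prop),
    lintegral_add_right _ (by fun_prop), lintegral_add_right _ (by fun_prop), lintegral_const_mul _ (by fun_prop),
    lintegral_const_mul _ (by fun_prop), lintegral_const_mul _ (by fun_prop), lintegral_add_right _ (by fun_prop),
    lintegral_const_mul _ (by fun_prop)]
  gcongr

namespace H1Pair

theorem enorm_molLap_le {ε : ℝ} (hε : 0 < ε) (u : H1Pair) (i : Fin 2) (x : R3) :
    ‖molLap (moll ε hε) (u.comp i) x‖ₑ ≤ ∫⁻ z, u.incr x z * (moll ε hε).lapAbs z := by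
  have h2 : MemLp (u.comp i) 2 volume := Lp.memLp _
  have h : ∀ (χ : BumpKernel) (v : R3), mol (χ.d v) (u.comp i) x =
      ∫ z, (u.comp i (x - z) - u.comp i x) * χ.d v z := by
    intro χ v
    have h1 : Integrable (fun y => u.comp i (x - y) * χ.d v y) := by
      have := (mol_integrand_integrable (χ.d v) h2 x).comp_sub_left x
      simpa using this
    simp only [sub_mul]
    rw [integral_sub h1 ((χ.d v).integrable.const_mul _), ← mol_swap, integral_const_mul,
      BumpKernel.integral_d, mul_zero, sub_zero]
  have hm : ∀ k, Measurable fun z => u.incr x z * ‖((moll ε hε).d (e3 k)).d (e3 k) z‖ₑ := fun k =>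
    (u.measurable_incr.comp measurable_prodMk_left).mul
      (((moll ε hε).d (e3 k)).d (e3 k)).continuous.enorm.measurable
  unfold molLap BumpKernel.lapAbs
  simp only [Finset.mul_sum]
  rw [lintegral_finsetSum _ fun k _ => hm k]
  refine (enorm_sum_le _ _).trans (Finset.sum_le_sum fun k _ => ?_)
  rw [h]
  refine (enorm_integral_le_lintegral_enorm _).trans (lintegral_mono fun z => ?_)
  rw [enorm_mul]
  refine mul_le_mul_left ?_ _
  rw [← ofReal_norm]
  exact ENNReal.ofReal_le_ofReal (norm_le_mag (fun i => u.comp i (x - z) - u.comp i x) i)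

/-- The value u(x) is inserted between u(x − y) and the mollified value. The factor 2 counts the
components, each bounded by the average of the full increment. -/
theorem ofReal_mag_sub_mol_le {ε : ℝ} (hε : 0 < ε) (u : H1Pair) (x y : R3) :
    ENNReal.ofReal (mag fun j => u.comp j (x - y) - mol (moll ε hε) (u.comp j) x) ≤
      u.incr x y + 2 * ∫⁻ z, u.incr x z * ‖moll ε hε z‖ₑ := by
  have h2 : ∀ j, MemLp (u.comp j) 2 volume := fun j => Lp.memLp _
  have h : ∀ j, ENNReal.ofReal ‖mol (moll ε hε) (u.comp j) x - u.comp j x‖ ≤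
      ∫⁻ z, u.incr x z * ‖moll ε hε z‖ₑ := by
    intro j
    rw [mol_moll_sub_eq hε (h2 j), ofReal_norm]
    refine (enorm_integral_le_lintegral_enorm _).trans (lintegral_mono fun z => ?_)
    rw [enorm_mul]
    refine mul_le_mul_left ?_ _
    rw [← ofReal_norm]
    exact ENNReal.ofReal_le_ofReal (norm_le_mag (fun i => u.comp i (x - z) - u.comp i x) j)
  have e : (fun j => u.comp j (x - y) - mol (moll ε hε) (u.comp j) x) =
      (fun j => u.comp j (x - y) - u.comp j x) - fun j => mol (moll ε hε) (u.comp j) x - u.comp j x := by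
    ext j; simp
  rw [e]
  refine (ENNReal.ofReal_le_ofReal (mag_sub_le _ _)).trans ?_
  rw [ENNReal.ofReal_add (mag_nonneg _) (mag_nonneg _)]
  refine add_le_add le_rfl ?_
  rw [mag, ENNReal.ofReal_add (norm_nonneg _) (norm_nonneg _), two_mul]
  exact add_le_add (h 0) (h 1)

/-- The trilinear estimate at one fixed time, with everything expressed by L³ and L⁶ norms of
translation increments. The L³ terms become O(1) only after integration in time through the
Strichartz bound; the L⁶ terms are controlled at each time by compactness. -/
theorem lintegral_energyError_le {ε l : ℝ} (hε : 0 < ε) (hl : 0 < l) (c₁ c₂ c₁₂ : ℝ) (u : H1Pair) (i : Fin 2) :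
    ∫⁻ x, ‖gpNonlinearity c₁ c₂ c₁₂ (fun j => mol (moll ε hε) (u.comp j) x) i -
      mol (moll ε hε) (gpn c₁ c₂ c₁₂ i u) x‖ₑ * ‖molLap (moll ε hε) (u.comp i) x‖ₑ ≤
    ENNReal.ofReal (gpK c₁ c₂ c₁₂) * (ENNReal.ofReal l * (ENNReal.ofReal (ε ^ 3) *
      ((∫⁻ z, (moll ε hε).lapAbs z) ^ 2 *
        ∫⁻ z, ENNReal.ofReal (lpn 3 (tr z u - u)) ^ 3 * (moll ε hε).lapAbs z) +
      ENNReal.ofReal (ε⁻¹ ^ 3) * (36 * ∫⁻ y, ENNReal.ofReal (lpn 3 (tr y u - u)) ^ 3 * ‖moll ε hε y‖ₑ) +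
      32 * (ENNReal.ofReal (lpn 6 (molP (moll ε hε) u)) ^ 6 +
        2080 * ∫⁻ y, ENNReal.ofReal (lpn 6 (tr y u - u)) ^ 6 * ‖moll ε hε y‖ₑ)) +
      ENNReal.ofReal (l⁻¹ ^ 5) *
        (2080 * ∫⁻ y, ENNReal.ofReal (lpn 6 (tr y u - u)) ^ 6 * ‖moll ε hε y‖ₑ)) := by
  have hρ : ∫⁻ y, ‖moll ε hε y‖ₑ = 1 := lintegral_moll hε
  have hm := u.measurable_incr
  have hu2 : ∀ j, MemLp (u.comp j) 2 volume := fun j => Lp.memLp _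
  have hpt := fun x => enorm_gpNonlinearity_mol_sub_le c₁ c₂ c₁₂ hε u i x
  have hθ := fun x y => ofReal_mag_sub_mol_le hε u x y
  have hL := fun x => enorm_molLap_le hε u i x
  have hU6 : ∫⁻ x, ENNReal.ofReal (mag fun j => mol (moll ε hε) (u.comp j) x) ^ 6 =
      ENNReal.ofReal (lpn 6 (molP (moll ε hε) u)) ^ 6 := by
    rw [← lintegral_ofReal_smag_pow _ 6 (by norm_num)]
    refine lintegral_congr_ae ?_
    filter_upwards [comp_molP_ae (moll ε hε) u] with x hx
    rw [smag, hx]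
  have h3 := fun y => lintegral_incr_pow u y 3 (by norm_num)
  have h6 := fun y => lintegral_incr_pow u y 6 (by norm_num)
  generalize moll ε hε = ρ at *
  have hρm : Measurable fun y => ‖ρ y‖ₑ := ρ.continuous.enorm.measurable
  have hPm : Measurable fun x => ∫⁻ z, u.incr x z * ‖ρ z‖ₑ :=
    (hm.mul (hρm.comp measurable_snd)).lintegral_prod_right
  have hqm : Measurable (Function.uncurry fun x y => u.incr x y + 2 * ∫⁻ z, u.incr x z * ‖ρ z‖ₑ) :=
    hm.add ((hPm.comp measurable_fst).const_mul 2)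
  have hUm : Measurable fun x => ENNReal.ofReal (mag fun j => mol ρ (u.comp j) x) :=
    (ENNReal.measurable_ofReal.comp (continuous_mag.comp
      (continuous_pi fun j => mol_continuous ρ (hu2 j))).measurable)
  have hXm : Measurable fun x => ‖molLap ρ (u.comp i) x‖ₑ := by
    have : Continuous fun x => molLap ρ (u.comp i) x :=
      continuous_finsetSum _ fun k _ => mol_continuous _ (hu2 i)
    exact this.enorm.measurable
  refine lintegral_mul_le_of_sextic hXm hUm hqm hρm hρ (fun x => (hpt x).trans ?_) ?_ ?_ ?_ hU6.le hε hl
  · gcongr <;> exact hθ x _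
  · refine (lintegral_mono fun x => pow_le_pow_left' (hL x) 3).trans
      ((lintegral_lintegral_mul_pow_le hm.aemeasurable ρ.measurable_lapAbs 2).trans (le_of_eq ?_))
    simp only [← h3]
  · refine (lintegral_lintegral_add_pow_le hm hρm hρ 2 ennreal_add_cube_le).trans (le_of_eq ?_)
    simp only [← h3]
    norm_num
  · refine (lintegral_lintegral_add_pow_le hm hρm hρ 5 ennreal_add_pow_six_le).trans (le_of_eq ?_)
    simp only [← h6]
    norm_num

end H1Pair

/-! ### Time-dependent fields -/

namespace BumpKernel

theorem ext_toFun {ψ χ : BumpKernel} (h : ψ.toFun = χ.toFun) : ψ = χ := by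
  cases ψ; cases χ; cases h; rfl

theorem d_comm (ψ : BumpKernel) (v w : R3) : (ψ.d v).d w = (ψ.d w).d v := by
  refine ext_toFun (funext fun x => ?_)
  have h2 : DifferentiableAt ℝ (fderiv ℝ ψ.toFun) x :=
    (ψ.smooth.fderiv_right (m := ∞) (by simp)).differentiable (by simp) x
  have h : ∀ a b : R3, ((ψ.d a).d b).toFun x = fderiv ℝ (fderiv ℝ ψ.toFun) x b a := by
    intro a b
    change fderiv ℝ (fun z => fderiv ℝ ψ.toFun z a) x b = _
    rw [fderiv_clm_apply h2 (differentiableAt_const a)]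
    simp
  rw [h, h]
  exact (ψ.smooth.contDiffAt.isSymmSndFDerivAt (by simpa using WithTop.coe_le_coe.2 (le_top : (2 : ℕ∞) ≤ ⊤))) w v

end BumpKernel

/-- Jointly continuous functions of `(t, x)` which are locally bounded in `t` with values in `L²`. -/
structure IsL2Field (F : ℝ → R3 → ℂ) : Prop where
  continuous : Continuous (Function.uncurry F)
  bound : ∀ a b, ∃ C : ℝ, ∀ t ∈ Set.Icc a b, eLpNorm (F t) 2 volume ≤ ENNReal.ofReal C

namespace IsL2Field

theorem continuous_apply {F : ℝ → R3 → ℂ} (hF : IsL2Field F) (t : ℝ) : Continuous (F t) :=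
  hF.continuous.comp (by fun_prop : Continuous fun x : R3 => (t, x))

theorem memLp {F : ℝ → R3 → ℂ} (hF : IsL2Field F) (t : ℝ) : MemLp (F t) 2 volume :=
  ⟨(hF.continuous_apply t).aestronglyMeasurable, by
    obtain ⟨C, hC⟩ := hF.bound t t
    exact (hC t (by simp)).trans_lt ENNReal.ofReal_lt_top⟩

theorem of_continuous_norm {F : ℝ → R3 → ℂ} (hF : Continuous (Function.uncurry F)) {N : ℝ → ℝ}
    (hN : Continuous N) (h : ∀ t, eLpNorm (F t) 2 volume ≤ ENNReal.ofReal (N t)) : IsL2Field F :=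
  ⟨hF, fun a b => by
    obtain ⟨C, hC⟩ := (isCompact_Icc (a := a) (b := b)).exists_bound_of_continuousOn hN.continuousOn
    exact ⟨C, fun t ht => (h t).trans (ENNReal.ofReal_le_ofReal ((le_abs_self _).trans (hC t ht)))⟩⟩

theorem of_curve {F : ℝ → R3 → ℂ} (hF : Continuous (Function.uncurry F)) {w : ℝ → L2R3}
    (hw : Continuous w) (h : ∀ t, F t =ᵐ[volume] w t) : IsL2Field F :=
  of_continuous_norm hF hw.norm fun t => by
    rw [eLpNorm_congr_ae (h t), Lp.norm_def, ENNReal.ofReal_toReal (Lp.memLp (w t)).2.ne]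

theorem mol (ψ : BumpKernel) {w : ℝ → L2R3} (hw : Continuous w) : IsL2Field fun t => mol ψ (w t) :=
  of_curve (mol_continuous_uncurry ψ hw) ((continuous_molL ψ).comp hw) fun t => (molL_coeFn ψ (w t)).symm

theorem add {F G : ℝ → R3 → ℂ} (hF : IsL2Field F) (hG : IsL2Field G) :
    IsL2Field fun t x => F t x + G t x :=
  ⟨hF.continuous.add hG.continuous, fun a b => by
    obtain ⟨C, hC⟩ := hF.bound a b
    obtain ⟨D, hD⟩ := hG.bound a b
    refine ⟨max C 0 + max D 0, fun t ht => (eLpNorm_add_le (hF.memLp t).1 (hG.memLp t).1 (by norm_num)).trans ?_⟩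
    rw [ENNReal.ofReal_add (le_max_right _ _) (le_max_right _ _)]
    exact add_le_add ((hC t ht).trans (ENNReal.ofReal_le_ofReal (le_max_left _ _)))
      ((hD t ht).trans (ENNReal.ofReal_le_ofReal (le_max_left _ _)))⟩

theorem const_mul {F : ℝ → R3 → ℂ} (c : ℂ) (hF : IsL2Field F) : IsL2Field fun t x => c * F t x :=
  ⟨continuous_const.mul hF.continuous, fun a b => by
    obtain ⟨C, hC⟩ := hF.bound a b
    refine ⟨‖c‖ * C, fun t ht => (eLpNorm_const_smul_le (c := c)).trans ?_⟩
    rw [ENNReal.ofReal_mul (norm_nonneg _), ofReal_norm]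
    exact mul_le_mul_right (hC t ht) _⟩

theorem sub {F G : ℝ → R3 → ℂ} (hF : IsL2Field F) (hG : IsL2Field G) :
    IsL2Field fun t x => F t x - G t x := by
  simpa [sub_eq_add_neg] using hF.add (hG.const_mul (-1))

theorem zero : IsL2Field fun _ _ => 0 := ⟨continuous_const, fun _ _ => ⟨0, fun _ _ => by simp⟩⟩

theorem sum {ι : Type*} (s : Finset ι) {F : ι → ℝ → R3 → ℂ} (hF : ∀ i, IsL2Field (F i)) :
    IsL2Field fun t x => ∑ i ∈ s, F i t x := by
  classical
  induction s using Finset.induction_on with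
  | empty => simpa using zero
  | insert a s ha ih => simpa [Finset.sum_insert ha] using (hF a).add ih

theorem molLap (ψ : BumpKernel) {w : ℝ → L2R3} (hw : Continuous w) : IsL2Field fun t => molLap ψ (w t) :=
  sum Finset.univ fun k => mol ((ψ.d (e3 k)).d (e3 k)) hw

theorem lintegral_enorm_mul_le {F G : R3 → ℂ} (hF : AEStronglyMeasurable F volume)
    (hG : AEStronglyMeasurable G volume) :
    ∫⁻ x, ‖F x‖ₑ * ‖G x‖ₑ ≤ eLpNorm F 2 volume * eLpNorm G 2 volume := by
  have h := eLpNorm_smul_le_mul_eLpNorm (p := 2) (q := 2) (r := 1) hG hF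
  rw [eLpNorm_one_eq_lintegral_enorm] at h
  simpa [enorm_mul] using h

theorem exists_lintegral_mul_le {F G : ℝ → R3 → ℂ} (hF : IsL2Field F) (hG : IsL2Field G) (a b : ℝ) :
    ∃ C : ℝ≥0∞, C ≠ ⊤ ∧ ∀ t ∈ Set.Icc a b, ∫⁻ x, ‖F t x‖ₑ * ‖G t x‖ₑ ≤ C := by
  obtain ⟨C, hC⟩ := hF.bound a b
  obtain ⟨D, hD⟩ := hG.bound a b
  exact ⟨_, ENNReal.mul_ne_top ENNReal.ofReal_ne_top ENNReal.ofReal_ne_top, fun t ht =>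
    (lintegral_enorm_mul_le (hF.memLp t).1 (hG.memLp t).1).trans (mul_le_mul' (hC t ht) (hD t ht))⟩

end IsL2Field

theorem integrable_inner {F G : R3 → ℂ} (hF : MemLp F 2 volume) (hG : MemLp G 2 volume) :
    Integrable (fun x => inner ℝ (F x) (G x)) volume := by
  refine (hF.norm.integrable_mul hG.norm).mono' (hF.1.inner hG.1) (Filter.Eventually.of_forall fun x => ?_)
  exact norm_inner_le_norm _ _

theorem enorm_inner_le (a b : ℂ) : ‖(inner ℝ a b : ℝ)‖ₑ ≤ ‖a‖ₑ * ‖b‖ₑ := by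
  rw [← ofReal_norm, ← ofReal_norm, ← ofReal_norm, ← ENNReal.ofReal_mul (norm_nonneg _)]
  exact ENNReal.ofReal_le_ofReal (norm_inner_le_norm _ _)

theorem L2R3_norm_sq (f : L2R3) : ‖f‖ ^ 2 = ∫ x, ‖f x‖ ^ 2 := by
  have h := H1.inner_self_integral f
  have : ∫ x, f x * (star f : L2R3) x = ((∫ x, ‖f x‖ ^ 2 : ℝ) : ℂ) := by
    refine Eq.trans ?_ (integral_ofReal (𝕜 := ℂ))
    refine integral_congr_ae ?_
    filter_upwards [Lp.coeFn_star f] with x hx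
    rw [hx]
    simp [Complex.mul_conj, Complex.normSq_eq_norm_sq]
  rw [this] at h
  exact_mod_cast h.symm

/-- Integration by parts for the real inner product. -/
theorem integral_inner_eq_neg_of_hasLineDerivAt {F F' G G' : R3 → ℂ} {v : R3}
    (hF : MemLp F 2 volume) (hF' : MemLp F' 2 volume) (hG : MemLp G 2 volume) (hG' : MemLp G' 2 volume)
    (dF : ∀ x, HasLineDerivAt ℝ F (F' x) x v) (dG : ∀ x, HasLineDerivAt ℝ G (G' x) x v) :
    ∫ x, inner ℝ (F x) (G' x) = -∫ x, inner ℝ (F' x) (G x) :=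
  integral_bilinear_hasLineDerivAt_right_eq_neg_left_of_integrable (B := innerSL ℝ)
    (integrable_inner hF' hG) (integrable_inner hF hG') (integrable_inner hF hG) (fun x _ => dF x) (fun x _ => dG x)

/-! ### The potential energy density -/

/-- The potential energy density of the Gross-Pitaevskii system. -/
noncomputable def gpPot (c₁ c₂ c₁₂ : ℝ) (z : Fin 2 → ℂ) : ℝ :=
  4 * Real.pi * (c₁ * (‖z 0‖ ^ 2) ^ 2 + c₂ * (‖z 1‖ ^ 2) ^ 2 + 2 * c₁₂ * (‖z 0‖ ^ 2 * ‖z 1‖ ^ 2))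

section
variable (c₁ c₂ c₁₂ : ℝ)

theorem gpPot_nonneg (hc₁ : 0 ≤ c₁) (hc₂ : 0 ≤ c₂) (hc₁₂ : 0 ≤ c₁₂) (z : Fin 2 → ℂ) :
    0 ≤ gpPot c₁ c₂ c₁₂ z := by
  have := Real.pi_pos; unfold gpPot; positivity

theorem gpNonlinearity_apply_zero (z : Fin 2 → ℂ) : gpNonlinearity c₁ c₂ c₁₂ z 0 =
    (8 * Real.pi * c₁ * ‖z 0‖ ^ 2 + 8 * Real.pi * c₁₂ * ‖z 1‖ ^ 2 : ℝ) • z 0 := by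
  rw [Complex.real_smul]; rfl

theorem gpNonlinearity_apply_one (z : Fin 2 → ℂ) : gpNonlinearity c₁ c₂ c₁₂ z 1 =
    (8 * Real.pi * c₂ * ‖z 1‖ ^ 2 + 8 * Real.pi * c₁₂ * ‖z 0‖ ^ 2 : ℝ) • z 1 := by
  rw [Complex.real_smul]; rfl

theorem sum_inner_gpNonlinearity (z : Fin 2 → ℂ) :
    ∑ i, inner ℝ (z i) (gpNonlinearity c₁ c₂ c₁₂ z i) = 2 * gpPot c₁ c₂ c₁₂ z := by
  rw [Fin.sum_univ_two, gpNonlinearity_apply_zero, gpNonlinearity_apply_one, inner_smul_right, inner_smul_right,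
    real_inner_self_eq_norm_sq, real_inner_self_eq_norm_sq, gpPot]
  ring

/-- Gauge invariance: each component of the nonlinearity is a real multiple of the same component of
z. Hence the mass of each component is conserved separately. -/
theorem inner_I_mul_gpNonlinearity (z : Fin 2 → ℂ) (i : Fin 2) :
    inner ℝ (z i) (Complex.I * gpNonlinearity c₁ c₂ c₁₂ z i) = 0 := by
  have h : ∀ (r : ℝ) (w : ℂ), inner ℝ w (Complex.I * (r • w)) = 0 := by
    intro r w
    rw [Complex.inner, Complex.real_smul]
    simp
    ring
  fin_cases i
  · change inner ℝ (z 0) (Complex.I * gpNonlinearity c₁ c₂ c₁₂ z 0) = 0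
    rw [gpNonlinearity_apply_zero]; exact h _ _
  · change inner ℝ (z 1) (Complex.I * gpNonlinearity c₁ c₂ c₁₂ z 1) = 0
    rw [gpNonlinearity_apply_one]; exact h _ _

theorem hasDerivAt_gpPot {z : ℝ → Fin 2 → ℂ} {z' : Fin 2 → ℂ} {t : ℝ}
    (h : ∀ i, HasDerivAt (fun s => z s i) (z' i) t) :
    HasDerivAt (fun s => gpPot c₁ c₂ c₁₂ (z s))
      (∑ i, 2 * inner ℝ (gpNonlinearity c₁ c₂ c₁₂ (z t) i) (z' i)) t := by
  have h0 := (h 0).norm_sq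
  have h1 := (h 1).norm_sq
  have := ((((h0.pow 2).const_mul c₁).add ((h1.pow 2).const_mul c₂)).add
    ((h0.mul h1).const_mul (2 * c₁₂))).const_mul (4 * Real.pi)
  refine this.congr_deriv ?_
  rw [Fin.sum_univ_two, gpNonlinearity_apply_zero, gpNonlinearity_apply_one, real_inner_smul_left,
    real_inner_smul_left]
  simp
  ring

end

/-! ### Mollified conservation laws -/

theorem inner_self_I_mul (a : ℂ) : inner ℝ a (Complex.I * a) = 0 := by
  rw [Complex.inner]; simp; ring

section Static
variable (ρ : BumpKernel) (w G : L2R3)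

theorem memLp_molLap : MemLp (molLap ρ w) 2 volume :=
  memLp_finsetSum (f := fun k => mol ((ρ.d (e3 k)).d (e3 k)) w) Finset.univ fun _ _ => mol_memLp_two _ (Lp.memLp w)

theorem hasLineDerivAt_molLap (k : Fin 3) (x : R3) :
    HasLineDerivAt ℝ (molLap ρ w) (molLap (ρ.d (e3 k)) w x) x (e3 k) := by
  have h : ∀ j, HasLineDerivAt ℝ (mol ((ρ.d (e3 j)).d (e3 j)) w) (mol (((ρ.d (e3 k)).d (e3 j)).d (e3 j)) w x) x (e3 k) := by
    intro j
    have := mol_hasLineDerivAt ((ρ.d (e3 j)).d (e3 j)) (Lp.memLp w) x (e3 k)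
    rwa [BumpKernel.d_comm _ (e3 j) (e3 k), BumpKernel.d_comm ρ (e3 j) (e3 k)] at this
  unfold HasLineDerivAt at h ⊢
  exact HasDerivAt.fun_sum fun j _ => h j

theorem memLp_mol_rhs : MemLp (fun x => Complex.I * (molLap ρ w x - mol ρ G x)) 2 volume :=
  ((memLp_molLap ρ w).sub (mol_memLp_two ρ (Lp.memLp G))).const_mul Complex.I

theorem hasLineDerivAt_mol_rhs (k : Fin 3) (x : R3) :
    HasLineDerivAt ℝ (fun x => Complex.I * (molLap ρ w x - mol ρ G x))
      (Complex.I * (molLap (ρ.d (e3 k)) w x - mol (ρ.d (e3 k)) G x)) x (e3 k) := by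
  have h1 := hasLineDerivAt_molLap ρ w k x
  have h2 := mol_hasLineDerivAt ρ (Lp.memLp G) x (e3 k)
  unfold HasLineDerivAt at h1 h2 ⊢
  exact (h1.sub h2).const_mul Complex.I

theorem integral_inner_molLap {Z : R3 → ℂ} (hZ : MemLp Z 2 volume) {Z' : Fin 3 → R3 → ℂ}
    (hZ' : ∀ k, MemLp (Z' k) 2 volume) (dZ : ∀ k x, HasLineDerivAt ℝ Z (Z' k x) x (e3 k)) :
    ∑ k, ∫ x, inner ℝ (mol (ρ.d (e3 k)) w x) (Z' k x) = -∫ x, inner ℝ (molLap ρ w x) (Z x) := by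
  have h : ∀ k, ∫ x, inner ℝ (mol (ρ.d (e3 k)) w x) (Z' k x) =
      -∫ x, inner ℝ (mol ((ρ.d (e3 k)).d (e3 k)) w x) (Z x) := fun k =>
    integral_inner_eq_neg_of_hasLineDerivAt (mol_memLp_two _ (Lp.memLp w)) (mol_memLp_two _ (Lp.memLp w)) hZ
      (hZ' k) (fun x => mol_hasLineDerivAt _ (Lp.memLp w) x _) (dZ k)
  simp only [h]
  rw [Finset.sum_neg_distrib, ← integral_finsetSum _ fun k _ =>
    integrable_inner (mol_memLp_two _ (Lp.memLp w)) hZ]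
  congr 1
  refine integral_congr_ae (Filter.Eventually.of_forall fun x => ?_)
  simp only [molLap, sum_inner]

/-- Integration by parts turns the left side into the pairing of P − Δv with the time derivative
i(Δv − g), where v and g are the mollifications of w and G. Since Δv − g is orthogonal to i times
itself, P − Δv may be replaced by P − g. With P the nonlinearity of the mollified pair this is the
defect. -/
theorem energy_balance {P : R3 → ℂ} (hP : MemLp P 2 volume) :
    (∑ k, ∫ x, inner ℝ (mol (ρ.d (e3 k)) w x)
      (Complex.I * (molLap (ρ.d (e3 k)) w x - mol (ρ.d (e3 k)) G x))) +
      ∫ x, inner ℝ (P x) (Complex.I * (molLap ρ w x - mol ρ G x)) =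
      ∫ x, inner ℝ (P x - mol ρ G x) (Complex.I * (molLap ρ w x - mol ρ G x)) := by
  have hZ := memLp_mol_rhs ρ w G
  rw [integral_inner_molLap ρ w hZ (Z' := fun k x => Complex.I * (molLap (ρ.d (e3 k)) w x - mol (ρ.d (e3 k)) G x))
    (fun k => memLp_mol_rhs _ w G) (fun k x => hasLineDerivAt_mol_rhs ρ w G k x), neg_add_eq_sub,
    ← integral_sub (integrable_inner hP hZ) (integrable_inner (memLp_molLap ρ w) hZ)]
  refine integral_congr_ae (Filter.Eventually.of_forall fun x => ?_)
  change inner ℝ _ _ - inner ℝ _ _ = inner ℝ _ _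
  have := inner_self_I_mul (molLap ρ w x - mol ρ G x)
  rw [← inner_sub_left, ← sub_eq_zero, ← inner_sub_left, ← neg_eq_zero, ← inner_neg_left, ← this]
  congr 1
  ring

/-- The Laplacian term vanishes after one integration by parts, each derivative being orthogonal to
i times itself. By orthogonality P can be inserted for free, so only the difference between P and
the mollified source remains. -/
theorem mass_balance {P : R3 → ℂ} (hP : MemLp P 2 volume) (h0 : ∀ x, inner ℝ (mol ρ w x) (Complex.I * P x) = 0) :
    ∫ x, inner ℝ (mol ρ w x) (Complex.I * (molLap ρ w x - mol ρ G x)) =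
      ∫ x, inner ℝ (mol ρ w x) (Complex.I * (P x - mol ρ G x)) := by
  have hw := mol_memLp_two ρ (Lp.memLp w)
  have hG := mol_memLp_two ρ (Lp.memLp G)
  have h := integral_inner_molLap ρ w (hw.const_mul Complex.I)
    (Z' := fun k x => Complex.I * mol (ρ.d (e3 k)) w x)
    (fun k => (mol_memLp_two (ρ.d (e3 k)) (Lp.memLp w)).const_mul Complex.I) (fun k x => by
      have := mol_hasLineDerivAt ρ (Lp.memLp w) x (e3 k)
      unfold HasLineDerivAt at this ⊢
      exact this.const_mul Complex.I)
  simp only [inner_self_I_mul, integral_zero, Finset.sum_const_zero] at h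
  have h1 : ∫ x, inner ℝ (mol ρ w x) (Complex.I * molLap ρ w x) = 0 := by
    rw [← neg_eq_zero, ← integral_neg, ← zero_eq_neg.1 h]
    refine integral_congr_ae (Filter.Eventually.of_forall fun x => ?_)
    simp only [Complex.inner]
    simp
    ring
  have hPG : MemLp (fun x => Complex.I * (P x - mol ρ G x)) 2 volume := (hP.sub hG).const_mul Complex.I
  rw [← sub_eq_zero, ← integral_sub (integrable_inner hw (memLp_mol_rhs ρ w G)) (integrable_inner hw hPG), ← h1]
  refine integral_congr_ae (Filter.Eventually.of_forall fun x => ?_)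
  have := h0 x
  simp only [mul_sub, inner_sub_right] at this ⊢
  rw [this]
  ring

end Static

theorem enorm_integral_inner_I_mul_le (F G H : R3 → ℂ) :
    ‖∫ x, inner ℝ (F x) (Complex.I * (G x - H x))‖ₑ ≤ ∫⁻ x, ‖F x‖ₑ * (‖G x‖ₑ + ‖H x‖ₑ) := by
  refine (enorm_integral_le_lintegral_enorm _).trans (lintegral_mono fun x => (enorm_inner_le _ _).trans ?_)
  rw [enorm_mul]
  simp only [enorm_eq_nnnorm, Complex.nnnorm_I, ENNReal.coe_one, one_mul]
  gcongr
  exact_mod_cast nnnorm_sub_le (G x) (H x)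

namespace H1Pair

variable (c₁ c₂ c₁₂ : ℝ)

/-- The commutator of the nonlinearity and the mollification. -/
noncomputable def defect (ρ : BumpKernel) (i : Fin 2) (u : H1Pair) (x : R3) : ℂ :=
  gpNonlinearity c₁ c₂ c₁₂ (fun j => mol ρ (u.comp j) x) i - mol ρ (gpn c₁ c₂ c₁₂ i u) x

/-- The energy of an element of `H¹`. -/
noncomputable def energy (u : H1Pair) : ℝ := (∑ i, ∑ k, ‖H1.grad k (u i)‖ ^ 2) +
  ∑ i, (1 / 2) * (inner ℂ (H1.fn (u i)) (gpn c₁ c₂ c₁₂ i u)).re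

theorem continuous_energy : Continuous (energy c₁ c₂ c₁₂) := by
  have h1 : ∀ i, Continuous fun u : H1Pair => u i := continuous_apply
  have h2 : ∀ i, Continuous fun u : H1Pair => inner ℂ (H1.fn (u i)) (gpn c₁ c₂ c₁₂ i u) := fun i =>
    (H1.fn.continuous.comp (h1 i)).inner (continuous_gpn c₁ c₂ c₁₂ i)
  unfold energy
  refine (continuous_finsetSum _ fun i _ => continuous_finsetSum _ fun k _ => ?_).add
    (continuous_finsetSum _ fun i _ => continuous_const.mul (Complex.continuous_re.comp (h2 i)))
  exact ((H1.grad k).continuous.comp (h1 i)).norm.pow 2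

theorem integrable_inner_gpn (u : H1Pair) (i : Fin 2) :
    Integrable (fun x => inner ℝ (u.comp i x) (gpNonlinearity c₁ c₂ c₁₂ (fun j => u.comp j x) i)) volume :=
  integrable_inner (Lp.memLp _) (u.memLp_gpNonlinearity c₁ c₂ c₁₂ i)

theorem integrable_gpPot (u : H1Pair) : Integrable (fun x => gpPot c₁ c₂ c₁₂ fun j => u.comp j x) volume := by
  have h := (integrable_finsetSum Finset.univ fun i _ => integrable_inner_gpn c₁ c₂ c₁₂ u i).const_mul (1 / 2)
  refine h.congr (Filter.Eventually.of_forall fun x => ?_)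
  simp only
  rw [sum_inner_gpNonlinearity c₁ c₂ c₁₂ fun j => u.comp j x]
  ring

/-- The definition through inner products makes continuity on H¹ evident; this form shows the sign
of the potential part. The factor 1/2 is Euler's relation: the nonlinearity paired with z gives
twice the quartic density. -/
theorem energy_eq (u : H1Pair) : energy c₁ c₂ c₁₂ u = (∑ i, ∑ k, ‖H1.grad k (u i)‖ ^ 2) +
    ∫ x, gpPot c₁ c₂ c₁₂ fun j => u.comp j x := by
  rw [energy]
  congr 1
  have h : ∀ i, (inner ℂ (H1.fn (u i)) (gpn c₁ c₂ c₁₂ i u)).re =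
      ∫ x, inner ℝ (u.comp i x) (gpNonlinearity c₁ c₂ c₁₂ (fun j => u.comp j x) i) := by
    intro i
    rw [MeasureTheory.L2.inner_def]
    refine (integral_re (MeasureTheory.L2.integrable_inner (𝕜 := ℂ) (H1.fn (u i)) (gpn c₁ c₂ c₁₂ i u))).symm.trans (integral_congr_ae ?_)
    filter_upwards [gpn_coeFn c₁ c₂ c₁₂ i u] with x h2
    rw [h2, Complex.inner]
    rfl
  simp only [h]
  rw [← Finset.mul_sum, ← integral_finsetSum _ fun i _ => integrable_inner_gpn c₁ c₂ c₁₂ u i]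
  have : ∀ x, ∑ i, inner ℝ (u.comp i x) (gpNonlinearity c₁ c₂ c₁₂ (fun j => u.comp j x) i) =
      2 * gpPot c₁ c₂ c₁₂ fun j => u.comp j x := fun x => sum_inner_gpNonlinearity _ _ _ fun j => u.comp j x
  simp only [this]
  rw [integral_const_mul]
  ring

theorem norm_molL_sq (ψ : BumpKernel) (f : L2R3) : ‖molL ψ f‖ ^ 2 = ∫ x, ‖mol ψ f x‖ ^ 2 := by
  rw [L2R3_norm_sq]
  refine integral_congr_ae ?_
  filter_upwards [molL_coeFn ψ f] with x hx
  rw [hx]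

theorem norm_grad_molP_sq (ψ : BumpKernel) (u : H1Pair) (i : Fin 2) (k : Fin 3) :
    ‖H1.grad k (molP ψ u i)‖ ^ 2 = ∫ x, ‖mol (ψ.d (e3 k)) (H1.fn (u i)) x‖ ^ 2 := by
  rw [molP_apply, H1.grad_molH, norm_molL_sq, H1.mol_d]

theorem integrable_gpPot_mol (ψ : BumpKernel) (u : H1Pair) :
    Integrable (fun x => gpPot c₁ c₂ c₁₂ fun j => mol ψ (u.comp j) x) volume := by
  refine (integrable_gpPot c₁ c₂ c₁₂ (molP ψ u)).congr ?_
  filter_upwards [comp_molP_ae ψ u] with x hx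
  rw [hx]

/-- The energy density of the mollification. -/
noncomputable def molEnergyDensity (ψ : BumpKernel) (u : H1Pair) (x : R3) : ℝ :=
  (∑ i, ∑ k, ‖mol (ψ.d (e3 k)) (H1.fn (u i)) x‖ ^ 2) + gpPot c₁ c₂ c₁₂ fun j => mol ψ (u.comp j) x

theorem integrable_mol_sq (ψ : BumpKernel) (f : L2R3) : Integrable (fun x => ‖mol ψ f x‖ ^ 2) volume :=
  (mol_memLp_two ψ (Lp.memLp f)).integrable_norm_pow (by norm_num)

theorem integrable_molEnergyDensity (ψ : BumpKernel) (u : H1Pair) :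
    Integrable (molEnergyDensity c₁ c₂ c₁₂ ψ u) volume :=
  (integrable_finsetSum _ fun _ _ => integrable_finsetSum _ fun _ _ => integrable_mol_sq _ _).add
    (integrable_gpPot_mol c₁ c₂ c₁₂ ψ u)

theorem energy_molP (ψ : BumpKernel) (u : H1Pair) :
    energy c₁ c₂ c₁₂ (molP ψ u) = ∫ x, molEnergyDensity c₁ c₂ c₁₂ ψ u x := by
  unfold molEnergyDensity
  rw [energy_eq, integral_add (integrable_finsetSum _ fun i _ => integrable_finsetSum _ fun k _ =>
    integrable_mol_sq _ _) (integrable_gpPot_mol c₁ c₂ c₁₂ ψ u)]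
  congr 1
  · rw [integral_finsetSum _ fun i _ => integrable_finsetSum _ fun k _ => integrable_mol_sq _ _]
    refine Finset.sum_congr rfl fun i _ => ?_
    rw [integral_finsetSum _ fun k _ => integrable_mol_sq _ _]
    exact Finset.sum_congr rfl fun k _ => norm_grad_molP_sq ψ u i k
  · refine integral_congr_ae ?_
    filter_upwards [comp_molP_ae ψ u] with x hx
    rw [hx]

variable {c₁ c₂ c₁₂}

theorem IsSol.continuous_fn {φ : ℝ → H1Pair} (h : IsSol c₁ c₂ c₁₂ φ) (i : Fin 2) :
    Continuous fun t => H1.fn (φ t i) :=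
  H1.fn.continuous.comp ((continuous_apply i).comp h.continuous)

theorem IsSol.continuous_gpn {φ : ℝ → H1Pair} (h : IsSol c₁ c₂ c₁₂ φ) (i : Fin 2) :
    Continuous fun t => gpn c₁ c₂ c₁₂ i (φ t) :=
  (H1Pair.continuous_gpn c₁ c₂ c₁₂ i).comp h.continuous

theorem IsSol.isL2Field_rhs {φ : ℝ → H1Pair} (h : IsSol c₁ c₂ c₁₂ φ) (ρ : BumpKernel) (i : Fin 2) :
    IsL2Field fun t x => Complex.I * (molLap ρ (H1.fn (φ t i)) x - mol ρ (gpn c₁ c₂ c₁₂ i (φ t)) x) :=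
  ((IsL2Field.molLap ρ (h.continuous_fn i)).sub (IsL2Field.mol ρ (h.continuous_gpn i))).const_mul _

theorem IsSol.isL2Field_gpNonlinearity {φ : ℝ → H1Pair} (h : IsSol c₁ c₂ c₁₂ φ) (ρ : BumpKernel) (i : Fin 2) :
    IsL2Field fun t x => gpNonlinearity c₁ c₂ c₁₂ (fun j => mol ρ (H1.fn (φ t j)) x) i := by
  refine IsL2Field.of_curve (w := fun t => gpn c₁ c₂ c₁₂ i (molP ρ (φ t))) ?_
    ((H1Pair.continuous_gpn c₁ c₂ c₁₂ i).comp ((continuous_molP ρ).comp h.continuous)) fun t => ?_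
  · exact (continuous_gpNonlinearity c₁ c₂ c₁₂ i).comp
      (continuous_pi fun j => mol_continuous_uncurry ρ (h.continuous_fn j))
  · filter_upwards [gpn_coeFn c₁ c₂ c₁₂ i (molP ρ (φ t)), comp_molP_ae ρ (φ t)] with x h1 h2
    rw [h1, h2]
    rfl

/-- The time derivative of the energy density of the mollification of a solution. -/
noncomputable def molEnergyDeriv (c₁ c₂ c₁₂ : ℝ) (ρ : BumpKernel) (u : H1Pair) (x : R3) : ℝ :=
  (∑ i, ∑ k, 2 * inner ℝ (mol (ρ.d (e3 k)) (H1.fn (u i)) x) (Complex.I *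
    (molLap (ρ.d (e3 k)) (H1.fn (u i)) x - mol (ρ.d (e3 k)) (gpn c₁ c₂ c₁₂ i u) x))) +
  ∑ i, 2 * inner ℝ (gpNonlinearity c₁ c₂ c₁₂ (fun j => mol ρ (H1.fn (u j)) x) i)
    (Complex.I * (molLap ρ (H1.fn (u i)) x - mol ρ (gpn c₁ c₂ c₁₂ i u) x))

theorem IsSol.hasDerivAt_molEnergyDensity {φ : ℝ → H1Pair} (h : IsSol c₁ c₂ c₁₂ φ) (ρ : BumpKernel) (t : ℝ)
    (x : R3) : HasDerivAt (fun s => molEnergyDensity c₁ c₂ c₁₂ ρ (φ s) x)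
      (molEnergyDeriv c₁ c₂ c₁₂ ρ (φ t) x) t :=
  (HasDerivAt.fun_sum fun i _ => HasDerivAt.fun_sum fun k _ =>
    ((h.weak i).hasDerivAt_mol (ρ.d (e3 k)) x t).norm_sq).add
    (hasDerivAt_gpPot c₁ c₂ c₁₂ fun i => (h.weak i).hasDerivAt_mol ρ x t)

theorem continuous_inner_field {F G : ℝ → R3 → ℂ} (hF : IsL2Field F) (hG : IsL2Field G) :
    Continuous (Function.uncurry fun t x => 2 * (inner ℝ (F t x) (G t x) : ℝ)) :=
  continuous_const.mul (hF.continuous.inner hG.continuous)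

theorem lintegral_enorm_inner_le {F G : ℝ → R3 → ℂ} (hF : IsL2Field F) (hG : IsL2Field G) (a b : ℝ) :
    ∃ C : ℝ≥0∞, C ≠ ⊤ ∧ ∀ t ∈ Set.Icc a b, ∫⁻ x, ‖2 * (inner ℝ (F t x) (G t x) : ℝ)‖ₑ ≤ C := by
  obtain ⟨C, hC, h⟩ := hF.exists_lintegral_mul_le hG a b
  refine ⟨2 * C, by finiteness, fun t ht => ?_⟩
  refine le_trans (lintegral_mono fun x => ?_) ((lintegral_const_mul _
    (((hF.continuous_apply t).enorm.measurable).mul (hG.continuous_apply t).enorm.measurable)).le.trans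
    (mul_le_mul_right (h t ht) 2))
  rw [enorm_mul]
  refine mul_le_mul' (le_of_eq ?_) (enorm_inner_le _ _)
  rw [← ofReal_norm]; simp

theorem exists_lintegral_enorm_sum_le {ι : Type*} (s : Finset ι) {f : ι → ℝ → R3 → ℝ}
    (hf : ∀ i t, Continuous (f i t)) {a b : ℝ}
    (h : ∀ i, ∃ C : ℝ≥0∞, C ≠ ⊤ ∧ ∀ t ∈ Set.Icc a b, ∫⁻ x, ‖f i t x‖ₑ ≤ C) :
    ∃ C : ℝ≥0∞, C ≠ ⊤ ∧ ∀ t ∈ Set.Icc a b, ∫⁻ x, ‖∑ i ∈ s, f i t x‖ₑ ≤ C := by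
  choose C hC h using h
  refine ⟨∑ i ∈ s, C i, ENNReal.sum_ne_top.2 fun i _ => hC i, fun t ht => ?_⟩
  refine (lintegral_mono fun x => enorm_sum_le _ _).trans ?_
  rw [lintegral_finsetSum _ fun i _ => (hf i t).enorm.measurable]
  exact Finset.sum_le_sum fun i _ => h i t ht

theorem IsSol.continuous_molEnergyDeriv {φ : ℝ → H1Pair} (h : IsSol c₁ c₂ c₁₂ φ) (ρ : BumpKernel) :
    Continuous (Function.uncurry fun t x => molEnergyDeriv c₁ c₂ c₁₂ ρ (φ t) x) :=
  (continuous_finsetSum _ fun i _ => continuous_finsetSum _ fun k _ =>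
    continuous_inner_field (IsL2Field.mol (ρ.d (e3 k)) (h.continuous_fn i)) (h.isL2Field_rhs (ρ.d (e3 k)) i)).add
    (continuous_finsetSum _ fun i _ => continuous_inner_field (h.isL2Field_gpNonlinearity ρ i) (h.isL2Field_rhs ρ i))

theorem _root_.Continuous.of_uncurry {f : ℝ → R3 → ℝ} (h : Continuous (Function.uncurry f)) (t : ℝ) : Continuous (f t) :=
  h.comp (by fun_prop : Continuous fun x : R3 => (t, x))

theorem IsSol.exists_lintegral_molEnergyDeriv_le {φ : ℝ → H1Pair} (h : IsSol c₁ c₂ c₁₂ φ) (ρ : BumpKernel)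
    (a b : ℝ) : ∃ C : ℝ≥0∞, C ≠ ⊤ ∧ ∀ t ∈ Set.Icc a b, ∫⁻ x, ‖molEnergyDeriv c₁ c₂ c₁₂ ρ (φ t) x‖ₑ ≤ C := by
  have f1 := fun (i : Fin 2) (k : Fin 3) => IsL2Field.mol (ρ.d (e3 k)) (h.continuous_fn i)
  have f2 := fun (i : Fin 2) (k : Fin 3) => h.isL2Field_rhs (ρ.d (e3 k)) i
  obtain ⟨C, hC, hC'⟩ := exists_lintegral_enorm_sum_le Finset.univ (fun i t => continuous_finsetSum _ fun k _ =>
      (continuous_inner_field (f1 i k) (f2 i k)).of_uncurry t) fun i =>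
    exists_lintegral_enorm_sum_le Finset.univ (fun k t => (continuous_inner_field (f1 i k) (f2 i k)).of_uncurry t)
      fun k => lintegral_enorm_inner_le (f1 i k) (f2 i k) a b
  obtain ⟨D, hD, hD'⟩ := exists_lintegral_enorm_sum_le Finset.univ
    (fun i t => (continuous_inner_field (h.isL2Field_gpNonlinearity ρ i) (h.isL2Field_rhs ρ i)).of_uncurry t)
    fun i => lintegral_enorm_inner_le (h.isL2Field_gpNonlinearity ρ i) (h.isL2Field_rhs ρ i) a b
  refine ⟨C + D, ENNReal.add_ne_top.2 ⟨hC, hD⟩, fun t ht => ?_⟩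
  have hm : Measurable fun x => ‖∑ i, ∑ k, 2 * (inner ℝ (mol (ρ.d (e3 k)) (H1.fn (φ t i)) x) (Complex.I *
      (molLap (ρ.d (e3 k)) (H1.fn (φ t i)) x - mol (ρ.d (e3 k)) (gpn c₁ c₂ c₁₂ i (φ t)) x)) : ℝ)‖ₑ :=
    (continuous_finsetSum _ fun i _ => continuous_finsetSum _ fun k _ =>
      (continuous_inner_field (f1 i k) (f2 i k)).of_uncurry t).enorm.measurable
  refine (lintegral_mono fun x => enorm_add_le _ _).trans ?_
  rw [lintegral_add_left hm]
  exact add_le_add (hC' t ht) (hD' t ht)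

theorem IsSol.integral_molEnergyDeriv {φ : ℝ → H1Pair} (h : IsSol c₁ c₂ c₁₂ φ) (ρ : BumpKernel) (t : ℝ) :
    ∫ x, molEnergyDeriv c₁ c₂ c₁₂ ρ (φ t) x = 2 * ∑ i, ∫ x, inner ℝ (defect c₁ c₂ c₁₂ ρ i (φ t) x)
      (Complex.I * (molLap ρ (H1.fn (φ t i)) x - mol ρ (gpn c₁ c₂ c₁₂ i (φ t)) x)) := by
  have i1 : ∀ (i : Fin 2) (k : Fin 3), Integrable (fun x => 2 * (inner ℝ (mol (ρ.d (e3 k)) (H1.fn (φ t i)) x) (Complex.I *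
    (molLap (ρ.d (e3 k)) (H1.fn (φ t i)) x - mol (ρ.d (e3 k)) (gpn c₁ c₂ c₁₂ i (φ t)) x)) : ℝ)) := fun i k =>
    (integrable_inner (mol_memLp_two _ (Lp.memLp _)) (memLp_mol_rhs (ρ.d (e3 k)) _ _)).const_mul 2
  have i2 : ∀ i : Fin 2, Integrable (fun x => 2 * (inner ℝ (gpNonlinearity c₁ c₂ c₁₂ (fun j => mol ρ (H1.fn (φ t j)) x) i)
    (Complex.I * (molLap ρ (H1.fn (φ t i)) x - mol ρ (gpn c₁ c₂ c₁₂ i (φ t)) x)) : ℝ)) := fun i =>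
    (integrable_inner ((h.isL2Field_gpNonlinearity ρ i).memLp t) (memLp_mol_rhs ρ _ _)).const_mul 2
  unfold molEnergyDeriv
  rw [integral_add (integrable_finsetSum _ fun i _ => integrable_finsetSum _ fun k _ => i1 i k)
    (integrable_finsetSum _ fun i _ => i2 i),
    integral_finsetSum _ fun i _ => integrable_finsetSum _ fun k _ => i1 i k,
    integral_finsetSum _ fun i _ => i2 i, ← Finset.sum_add_distrib, Finset.mul_sum]
  refine Finset.sum_congr rfl fun i _ => ?_
  rw [integral_finsetSum _ fun k _ => i1 i k, integral_const_mul]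
  simp only [integral_const_mul]
  rw [← Finset.mul_sum, ← mul_add,
    energy_balance ρ (H1.fn (φ t i)) (gpn c₁ c₂ c₁₂ i (φ t)) ((h.isL2Field_gpNonlinearity ρ i).memLp t)]
  rfl

theorem IsSol.enorm_integral_molEnergyDeriv_le {φ : ℝ → H1Pair} (h : IsSol c₁ c₂ c₁₂ φ) (ρ : BumpKernel) (t : ℝ) :
    ‖∫ x, molEnergyDeriv c₁ c₂ c₁₂ ρ (φ t) x‖ₑ ≤ 2 * ∑ i, ∫⁻ x, ‖defect c₁ c₂ c₁₂ ρ i (φ t) x‖ₑ *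
      (‖molLap ρ ((φ t).comp i) x‖ₑ + ‖mol ρ (gpn c₁ c₂ c₁₂ i (φ t)) x‖ₑ) := by
  rw [h.integral_molEnergyDeriv, enorm_mul]
  refine mul_le_mul' (le_of_eq (by rw [← ofReal_norm]; simp)) ((enorm_sum_le _ _).trans
    (Finset.sum_le_sum fun i _ => enorm_integral_inner_I_mul_le _ _ _))

theorem enorm_intervalIntegral_le' {f : ℝ → ℝ} {g : ℝ → ℝ≥0∞} {a b : ℝ} (hab : a ≤ b)
    (h : ∀ t, ‖f t‖ₑ ≤ g t) : ‖∫ t in a..b, f t‖ₑ ≤ ∫⁻ t in Set.Ioc a b, g t := by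
  rw [intervalIntegral.integral_of_le hab]
  exact (enorm_integral_le_lintegral_enorm _).trans (lintegral_mono h)

theorem IsSol.enorm_energy_molP_sub_le {φ : ℝ → H1Pair} (h : IsSol c₁ c₂ c₁₂ φ) (ρ : BumpKernel) {a b : ℝ}
    (hab : a ≤ b) :
    ‖energy c₁ c₂ c₁₂ (molP ρ (φ b)) - energy c₁ c₂ c₁₂ (molP ρ (φ a))‖ₑ ≤
      ∫⁻ t in Set.Ioc a b, 2 * ∑ i, ∫⁻ x, ‖defect c₁ c₂ c₁₂ ρ i (φ t) x‖ₑ *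
      (‖molLap ρ ((φ t).comp i) x‖ₑ + ‖mol ρ (gpn c₁ c₂ c₁₂ i (φ t)) x‖ₑ) := by
  obtain ⟨C, hC, hb⟩ := h.exists_lintegral_molEnergyDeriv_le ρ a b
  rw [energy_molP, energy_molP, integral_sub_integral_eq_intervalIntegral hab
    (h.hasDerivAt_molEnergyDensity ρ) (h.continuous_molEnergyDeriv ρ) (integrable_molEnergyDensity c₁ c₂ c₁₂ ρ _)
    (integrable_molEnergyDensity c₁ c₂ c₁₂ ρ _) hC fun t ht => hb t (Set.Ioc_subset_Icc_self ht)]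
  exact enorm_intervalIntegral_le' hab (h.enorm_integral_molEnergyDeriv_le ρ)

theorem IsSol.enorm_mass_molP_sub_le {φ : ℝ → H1Pair} (h : IsSol c₁ c₂ c₁₂ φ) (ρ : BumpKernel) (i : Fin 2) {a b : ℝ}
    (hab : a ≤ b) :
    ‖‖molL ρ (H1.fn (φ b i))‖ ^ 2 - ‖molL ρ (H1.fn (φ a i))‖ ^ 2‖ₑ ≤
      ∫⁻ t in Set.Ioc a b, 2 * ∫⁻ x, ‖mol ρ (H1.fn (φ t i)) x‖ₑ * ‖defect c₁ c₂ c₁₂ ρ i (φ t) x‖ₑ := by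
  have f1 := IsL2Field.mol ρ (h.continuous_fn i)
  have f2 := h.isL2Field_rhs ρ i
  obtain ⟨C, hC, hb⟩ := lintegral_enorm_inner_le f1 f2 a b
  rw [norm_molL_sq, norm_molL_sq, integral_sub_integral_eq_intervalIntegral hab
    (fun t x => ((h.weak i).hasDerivAt_mol ρ x t).norm_sq) (continuous_inner_field f1 f2) (integrable_mol_sq ρ _)
    (integrable_mol_sq ρ _) hC fun t ht => hb t (Set.Ioc_subset_Icc_self ht)]
  refine enorm_intervalIntegral_le' hab fun t => ?_
  rw [integral_const_mul, mass_balance ρ _ _ ((h.isL2Field_gpNonlinearity ρ i).memLp t) fun x =>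
    inner_I_mul_gpNonlinearity c₁ c₂ c₁₂ (fun j => mol ρ (H1.fn (φ t j)) x) i, enorm_mul]
  refine mul_le_mul' (le_of_eq (by rw [← ofReal_norm]; simp)) ((enorm_integral_le_lintegral_enorm _).trans
    (lintegral_mono fun x => (enorm_inner_le _ _).trans (mul_le_mul_right (le_of_eq ?_) _)))
  rw [enorm_mul, ← ofReal_norm, Complex.norm_I, ENNReal.ofReal_one, one_mul]
  rfl

end H1Pair

/-! ### Conservation of mass and energy -/

/-- Time integration of the energy error. By Tonelli the increments are integrated in time first,
for each fixed translation, which is the form of the Strichartz bound. The time measure has total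
mass at most one, so constants are not enlarged. -/
theorem lintegral_le_of_forall_kernel_bound {α β : Type*} [MeasurableSpace α] [MeasurableSpace β]
    {μ : Measure α} {ν : Measure β} [SFinite μ] [SFinite ν] (hμ : μ Set.univ ≤ 1) {E : α → ℝ≥0∞}
    {D : α → β → ℝ≥0∞} (hD : Measurable (Function.uncurry D)) {K R : β → ℝ≥0∞} (hK : Measurable K)
    (hR : Measurable R) {G L a c W S A B : ℝ≥0∞}
    (hA : ∫⁻ z, (∫⁻ t, D t z ∂μ) * K z ∂ν ≤ A) (hB : ∫⁻ z, (∫⁻ t, D t z ∂μ) * R z ∂ν ≤ B)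
    (hE : ∀ᵐ t ∂μ, E t ≤ G * (L * (a * (∫⁻ z, D t z * K z ∂ν) + c * (∫⁻ z, D t z * R z ∂ν) + W) + S)) :
    ∫⁻ t, E t ∂μ ≤ G * (L * (a * A + c * B + W) + S) := by
  have hsw : ∀ {K : β → ℝ≥0∞}, Measurable K →
      ∫⁻ t, ∫⁻ z, D t z * K z ∂ν ∂μ = ∫⁻ z, (∫⁻ t, D t z ∂μ) * K z ∂ν := fun {K} hK => by
    rw [lintegral_lintegral_swap ((hD.mul (hK.comp measurable_snd)).aemeasurable)]
    exact lintegral_congr fun z => lintegral_mul_const _ (hD.comp measurable_prodMk_right)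
  have hm : ∀ {K : β → ℝ≥0∞}, Measurable K → Measurable fun t => ∫⁻ z, D t z * K z ∂ν := fun {K} hK =>
    (hD.mul (hK.comp measurable_snd)).lintegral_prod_right
  have mK := hm hK
  have mR := hm hR
  have hc : ∀ k : ℝ≥0∞, ∫⁻ _, k ∂μ ≤ k := fun k => by
    rw [lintegral_const]
    exact (mul_le_mul_right hμ k).trans (mul_one k).le
  refine (lintegral_mono_ae hE).trans ?_
  rw [lintegral_const_mul _ (by fun_prop), lintegral_add_right _ (by fun_prop), lintegral_const_mul _ (by fun_prop),
    lintegral_add_right _ (by fun_prop), lintegral_add_right _ (by fun_prop), lintegral_const_mul _ mK,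
    lintegral_const_mul _ mR, hsw hK, hsw hR]
  gcongr <;> exact hc _

/-- The powers of ε cancel: ε³ from the weight, ε⁻² from each of three integrals of the second
derivatives of the mollifier, and ε³ from the cubic bound on its support. -/
theorem lintegral_cube_mul_lapAbs_le {ε C : ℝ} (hε : 0 < ε) (hC : 0 ≤ C) {D : R3 → ℝ≥0∞}
    (hD : ∀ z, D z ≤ ENNReal.ofReal (C * ‖z‖ ^ 3)) :
    ENNReal.ofReal (ε ^ 3) * (∫⁻ z, (moll ε hε).lapAbs z) ^ 2 * ∫⁻ z, D z * (moll ε hε).lapAbs z ≤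
      ENNReal.ofReal C * (∫⁻ z, eta.lapAbs z) ^ 3 := by
  have h1 : ∫⁻ z, D z * (moll ε hε).lapAbs z ≤ ENNReal.ofReal (C * ε ^ 3) * ∫⁻ z, (moll ε hε).lapAbs z := by
    rw [← lintegral_const_mul _ (moll ε hε).measurable_lapAbs]
    refine lintegral_mono fun z => ?_
    by_cases hz : ε < ‖z‖
    · rw [BumpKernel.lapAbs_moll_eq_zero hε hz]; simp
    · refine mul_le_mul_left ((hD z).trans (ENNReal.ofReal_le_ofReal ?_)) _
      have := not_lt.1 hz
      gcongr
  refine (mul_le_mul_right h1 _).trans (le_of_eq ?_)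
  rw [BumpKernel.lintegral_lapAbs_moll]
  generalize ∫⁻ z, eta.lapAbs z = κ
  have : ENNReal.ofReal (ε ^ 3) * (ENNReal.ofReal (ε⁻¹ ^ 2) * κ) ^ 2 * (ENNReal.ofReal (C * ε ^ 3) *
      (ENNReal.ofReal (ε⁻¹ ^ 2) * κ)) = (ENNReal.ofReal (ε ^ 3) * ENNReal.ofReal (ε⁻¹ ^ 2) ^ 3 *
      ENNReal.ofReal (C * ε ^ 3)) * κ ^ 3 := by ring
  rw [this, ← ENNReal.ofReal_pow (by positivity), ← ENNReal.ofReal_mul (by positivity),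
    ← ENNReal.ofReal_mul (by positivity)]
  congr 2
  field_simp

theorem lintegral_mul_moll_le {ε : ℝ} (hε : 0 < ε) {D : R3 → ℝ≥0∞} {B : ℝ≥0∞}
    (hD : ∀ z, ‖z‖ < ε → D z ≤ B) : ∫⁻ z, D z * ‖moll ε hε z‖ₑ ≤ B := by
  have : B = ∫⁻ z, B * ‖moll ε hε z‖ₑ := by
    rw [lintegral_const_mul _ (moll ε hε).continuous.enorm.measurable, lintegral_moll, mul_one]
  rw [this]
  refine lintegral_mono fun z => ?_
  by_cases hz : ‖z‖ < ε
  · exact mul_le_mul_left (hD z hz) _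
  · rw [moll_eq_zero hε z (not_lt.1 hz)]; simp

namespace H1Pair

theorem continuous_lpn_tr_sub (n : ℕ) [n.AtLeastTwo] (h6 : n ≤ 6) :
    Continuous fun p : R3 × H1Pair => lpn n (tr p.1 p.2 - p.2) :=
  (continuous_lpn n h6).comp (continuous_tr.sub continuous_snd)

theorem lpn_zero (n : ℕ) [n.AtLeastTwo] (h6 : n ≤ 6) : lpn n 0 = 0 := by
  have h := eLpNorm_smag_le 0 n h6
  rw [← ofReal_lpn _ _ h6, norm_zero, mul_zero, ENNReal.ofReal_zero, nonpos_iff_eq_zero,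
    ENNReal.ofReal_eq_zero] at h
  exact le_antisymm h ENNReal.toReal_nonneg

theorem exists_lpn_tr_sub_le {K : Set H1Pair} (hK : IsCompact K) (n : ℕ) [n.AtLeastTwo] (h6 : n ≤ 6) {r : ℝ}
    (hr : 0 < r) : ∃ δ > 0, ∀ u ∈ K, ∀ y : R3, ‖y‖ < δ → lpn n (tr y u - u) < r :=
  exists_forall_norm_lt_of_isCompact (continuous_lpn_tr_sub n h6)
    (fun u => by simp only [tr_zero, sub_self, lpn_zero n h6]) hK hr

variable {c₁ c₂ c₁₂ : ℝ}

theorem IsSol.lintegral_energyError_le {φ : ℝ → H1Pair} (h : IsSol c₁ c₂ c₁₂ φ) {τ C A : ℝ} (hτ1 : τ ≤ 1)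
    (hC : 0 ≤ C) (hA : ∀ t ∈ Set.Icc 0 τ, ‖φ t‖ ≤ A)
    (hS : ∀ y, ∫⁻ t in Set.Ioc 0 τ, ENNReal.ofReal (lpn 3 (tr y (φ t) - φ t)) ^ 3 ≤ ENNReal.ofReal (C * ‖y‖ ^ 3))
    {ε l r : ℝ} (hε : 0 < ε) (hl : 0 < l)
    (hr : ∀ t ∈ Set.Icc 0 τ, ∀ y : R3, ‖y‖ < ε → lpn 6 (tr y (φ t) - φ t) ≤ r) (i : Fin 2) :
    ∫⁻ t in Set.Ioc 0 τ, ∫⁻ x, ‖defect c₁ c₂ c₁₂ (moll ε hε) i (φ t) x‖ₑ * ‖molLap (moll ε hε) ((φ t).comp i) x‖ₑ ≤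
      ENNReal.ofReal (gpK c₁ c₂ c₁₂) * (ENNReal.ofReal l * (ENNReal.ofReal C * (∫⁻ z, eta.lapAbs z) ^ 3 +
        36 * ENNReal.ofReal C + 32 * (ENNReal.ofReal (2 * H1.sob * A) ^ 6 + 2080 * ENNReal.ofReal r ^ 6)) +
        ENNReal.ofReal (l⁻¹ ^ 5) * (2080 * ENNReal.ofReal r ^ 6)) := by
  have hD : Measurable (Function.uncurry fun (t : ℝ) (z : R3) => ENNReal.ofReal (lpn 3 (tr z (φ t) - φ t)) ^ 3) := by
    have h1 : Continuous fun p : ℝ × R3 => (p.2, φ p.1) := continuous_snd.prodMk (h.continuous.comp continuous_fst)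
    have h2 := (continuous_lpn_tr_sub 3 (by norm_num)).comp h1
    exact (ENNReal.measurable_ofReal.comp h2.measurable).pow_const 3
  have hμ : (volume.restrict (Set.Ioc 0 τ)) Set.univ ≤ 1 := by
    rw [Measure.restrict_apply_univ, Real.volume_Ioc]
    exact ENNReal.ofReal_le_one.2 (by linarith)
  refine (lintegral_le_of_forall_kernel_bound (ν := (volume : Measure R3)) hμ hD (moll ε hε).measurable_lapAbs
    (moll ε hε).continuous.enorm.measurable (G := ENNReal.ofReal (gpK c₁ c₂ c₁₂)) (L := ENNReal.ofReal l)
    (a := ENNReal.ofReal (ε ^ 3) * (∫⁻ z, (moll ε hε).lapAbs z) ^ 2) (c := ENNReal.ofReal (ε⁻¹ ^ 3) * 36)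
    (W := 32 * (ENNReal.ofReal (2 * H1.sob * A) ^ 6 + 2080 * ENNReal.ofReal r ^ 6))
    (S := ENNReal.ofReal (l⁻¹ ^ 5) * (2080 * ENNReal.ofReal r ^ 6)) le_rfl
    (lintegral_mul_moll_le hε (B := ENNReal.ofReal (C * ε ^ 3)) fun z hz => (hS z).trans
      (ENNReal.ofReal_le_ofReal (by gcongr))) ?_).trans ?_
  · refine (ae_restrict_iff' measurableSet_Ioc).2 (Filter.Eventually.of_forall fun t ht => ?_)
    have ht' := Set.Ioc_subset_Icc_self ht
    have h6 : ∫⁻ y, ENNReal.ofReal (lpn 6 (tr y (φ t) - φ t)) ^ 6 * ‖moll ε hε y‖ₑ ≤ ENNReal.ofReal r ^ 6 :=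
      lintegral_mul_moll_le hε fun y hy => pow_le_pow_left' (ENNReal.ofReal_le_ofReal (hr t ht' y hy)) 6
    have hV : ENNReal.ofReal (lpn 6 (molP (moll ε hε) (φ t))) ^ 6 ≤ ENNReal.ofReal (2 * H1.sob * A) ^ 6 := by
      refine pow_le_pow_left' ?_ 6
      rw [ofReal_lpn _ 6 (by norm_num)]
      refine (eLpNorm_smag_le _ 6 (by norm_num)).trans (ENNReal.ofReal_le_ofReal ?_)
      have := sob_nonneg
      have := (norm_molP_le hε (φ t)).trans (hA t ht')
      gcongr
    refine (H1Pair.lintegral_energyError_le hε hl c₁ c₂ c₁₂ (φ t) i).trans ?_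
    rw [← mul_assoc (ENNReal.ofReal (ε ^ 3)), ← mul_assoc (ENNReal.ofReal (ε⁻¹ ^ 3))]
    gcongr
  · have h1 := lintegral_cube_mul_lapAbs_le hε hC hS
    refine mul_le_mul_right (add_le_add (mul_le_mul_right (add_le_add (add_le_add h1 (le_of_eq ?_)) le_rfl) _) le_rfl) _
    rw [mul_comm (ENNReal.ofReal (ε⁻¹ ^ 3)), mul_assoc, ← ENNReal.ofReal_mul (by positivity)]
    congr 2
    field_simp

/-- The error is at most a constant times l B + 2080 l⁻⁵ r⁶, where r bounds the L⁶ increments at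
scale ε. First l is taken small, then r depending on l, then ε, by equicontinuity of translations on
the compact orbit. -/
theorem IsSol.exists_energyError_le {φ : ℝ → H1Pair} (h : IsSol c₁ c₂ c₁₂ φ) {τ C A : ℝ} (hτ1 : τ ≤ 1)
    (hC : 0 ≤ C) (hA : ∀ t ∈ Set.Icc 0 τ, ‖φ t‖ ≤ A)
    (hS : ∀ y, ∫⁻ t in Set.Ioc 0 τ, ENNReal.ofReal (lpn 3 (tr y (φ t) - φ t)) ^ 3 ≤ ENNReal.ofReal (C * ‖y‖ ^ 3))
    {η : ℝ} (hη : 0 < η) : ∃ ε₀ > 0, ∀ ε (hε : 0 < ε), ε ≤ ε₀ → ∀ i : Fin 2,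
    ∫⁻ t in Set.Ioc 0 τ, ∫⁻ x, ‖defect c₁ c₂ c₁₂ (moll ε hε) i (φ t) x‖ₑ * ‖molLap (moll ε hε) ((φ t).comp i) x‖ₑ ≤
      ENNReal.ofReal η := by
  have hκ := eta.lintegral_lapAbs_ne_top
  -- The bracket is bounded with r replaced by 1, so that B and hence l can be fixed before r.
  have hB : ENNReal.ofReal C * (∫⁻ z, eta.lapAbs z) ^ 3 + 36 * ENNReal.ofReal C +
      32 * (ENNReal.ofReal (2 * H1.sob * A) ^ 6 + 2080 * ENNReal.ofReal 1 ^ 6) ≠ ⊤ := by finiteness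
  obtain ⟨B, hB0, hB'⟩ : ∃ B : ℝ, 0 ≤ B ∧ _ = ENNReal.ofReal B :=
    ⟨_, ENNReal.toReal_nonneg, (ENNReal.ofReal_toReal hB).symm⟩
  have hG := gpK_nonneg c₁ c₂ c₁₂
  set l := η / (2 * (gpK c₁ c₂ c₁₂ * B + 1)) with hl
  have hl0 : 0 < l := by positivity
  -- Since r ≤ 1, the sixth power is at most r, and a choice linear in η suffices.
  set r := min 1 (η / (2 * (gpK c₁ c₂ c₁₂ * l⁻¹ ^ 5 * 2080 + 1))) with hr
  have hr0 : 0 < r := lt_min one_pos (by positivity)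
  have hr1 : r ≤ 1 := min_le_left _ _
  have hr2 : r ≤ η / (2 * (gpK c₁ c₂ c₁₂ * l⁻¹ ^ 5 * 2080 + 1)) := min_le_right _ _
  obtain ⟨δ, hδ, hδ'⟩ := exists_lpn_tr_sub_le (isCompact_Icc.image h.continuous : IsCompact (φ '' Set.Icc 0 τ)) 6
    (by norm_num) hr0
  refine ⟨δ, hδ, fun ε hε hεδ i => ?_⟩
  refine (h.lintegral_energyError_le hτ1 hC hA hS hε hl0 (r := r) (fun t ht y hy =>
    (hδ' _ (Set.mem_image_of_mem φ ht) y (hy.trans_le hεδ)).le) i).trans ?_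
  calc _ ≤ ENNReal.ofReal (gpK c₁ c₂ c₁₂) * (ENNReal.ofReal l * ENNReal.ofReal B +
      ENNReal.ofReal (l⁻¹ ^ 5) * (2080 * ENNReal.ofReal r)) := by
        rw [← hB']
        gcongr
        rw [← ENNReal.ofReal_pow hr0.le]
        exact ENNReal.ofReal_le_ofReal (pow_le_of_le_one hr0.le hr1 (by norm_num))
    _ = ENNReal.ofReal (gpK c₁ c₂ c₁₂ * (l * B + l⁻¹ ^ 5 * (2080 * r))) := by
        rw [ENNReal.ofReal_mul hG, ENNReal.ofReal_add (by positivity) (by positivity), ENNReal.ofReal_mul hl0.le,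
          ENNReal.ofReal_mul (by positivity : 0 ≤ l⁻¹ ^ 5), ENNReal.ofReal_mul (by norm_num : (0 : ℝ) ≤ 2080)]
        norm_num
    _ ≤ ENNReal.ofReal η := by
        refine ENNReal.ofReal_le_ofReal ?_
        have e1 : gpK c₁ c₂ c₁₂ * (l * B) ≤ η / 2 := by
          have : l * (2 * (gpK c₁ c₂ c₁₂ * B + 1)) = η := div_mul_cancel₀ _ (by positivity)
          nlinarith
        have e2 : gpK c₁ c₂ c₁₂ * (l⁻¹ ^ 5 * (2080 * r)) ≤ η / 2 := by
          have := (le_div_iff₀ (by positivity)).1 hr2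
          nlinarith
        linarith

end H1Pair

open Filter in
theorem eq_zero_of_forall_enorm_le {X : ℕ → ℝ} {x : ℝ} (hX : Tendsto X atTop (𝓝 x))
    (h : ∀ η > 0, ∀ᶠ n in atTop, ‖X n‖ₑ ≤ ENNReal.ofReal η) : x = 0 := by
  refine norm_le_zero_iff.1 (le_of_forall_pos_le_add fun η hη => ?_)
  rw [zero_add]
  refine le_of_tendsto hX.norm ((h η hη).mono fun n hn => ?_)
  rw [← ofReal_norm] at hn
  exact (ENNReal.ofReal_le_ofReal_iff hη.le).1 hn

/-- A sequence of mollifiers concentrating at the origin. -/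
noncomputable def mollSeq (n : ℕ) : BumpKernel := moll (1 / ((n : ℝ) + 1)) Nat.one_div_pos_of_nat

open Filter in
theorem eventually_mollSeq {p : BumpKernel → Prop} (h : ∃ ε₀ > 0, ∀ ε (hε : 0 < ε), ε ≤ ε₀ → p (moll ε hε)) :
    ∀ᶠ n in atTop, p (mollSeq n) := by
  obtain ⟨ε₀, h0, h⟩ := h
  filter_upwards [(tendsto_one_div_add_atTop_nhds_zero_nat (𝕜 := ℝ)).eventually (gt_mem_nhds h0)] with n hn
  exact h _ _ hn.le

open Filter in
theorem tendsto_molL_mollSeq (f : L2R3) : Tendsto (fun n => molL (mollSeq n) f) atTop (𝓝 f) := by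
  refine Metric.tendsto_nhds.2 fun r hr => ?_
  obtain ⟨ε₀, h0, h⟩ := exists_molL_sub_le (isCompact_singleton (x := f)) (half_pos hr)
  refine (eventually_mollSeq (p := fun ψ => ‖molL ψ f - f‖ ≤ r / 2) ⟨ε₀, h0, h f rfl⟩).mono fun n hn => ?_
  rw [dist_eq_norm]
  linarith

namespace H1Pair

open Filter in
theorem tendsto_molP_mollSeq (u : H1Pair) : Tendsto (fun n => molP (mollSeq n) u) atTop (𝓝 u) := by
  refine Metric.tendsto_nhds.2 fun r hr => ?_
  obtain ⟨ε₀, h0, h⟩ := exists_molP_sub_le (isCompact_singleton (x := u)) (half_pos hr)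
  refine (eventually_mollSeq (p := fun ψ => ‖molP ψ u - u‖ ≤ r / 2) ⟨ε₀, h0, h u rfl⟩).mono fun n hn => ?_
  rw [dist_eq_norm]
  linarith

variable (c₁ c₂ c₁₂ : ℝ)

theorem defect_ae (ψ : BumpKernel) (i : Fin 2) (u : H1Pair) :
    defect c₁ c₂ c₁₂ ψ i u =ᵐ[volume] (gpn c₁ c₂ c₁₂ i (molP ψ u) - molL ψ (gpn c₁ c₂ c₁₂ i u) : L2R3) := by
  filter_upwards [gpn_coeFn c₁ c₂ c₁₂ i (molP ψ u), comp_molP_ae ψ u, molL_coeFn ψ (gpn c₁ c₂ c₁₂ i u),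
    Lp.coeFn_sub (gpn c₁ c₂ c₁₂ i (molP ψ u)) (molL ψ (gpn c₁ c₂ c₁₂ i u))] with x h1 h2 h3 h4
  rw [h4, Pi.sub_apply, h1, h2, h3, defect]

theorem eLpNorm_defect (ψ : BumpKernel) (i : Fin 2) (u : H1Pair) : eLpNorm (defect c₁ c₂ c₁₂ ψ i u) 2 volume =
    ENNReal.ofReal ‖gpn c₁ c₂ c₁₂ i (molP ψ u) - molL ψ (gpn c₁ c₂ c₁₂ i u)‖ := by
  rw [eLpNorm_congr_ae (defect_ae c₁ c₂ c₁₂ ψ i u), Lp.norm_def, ENNReal.ofReal_toReal (Lp.memLp _).2.ne]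

/-- The defect is split at N(u): the first difference is small by the Lipschitz bound and
convergence of mollifications in H¹, the second by convergence of mollifications in L² on the image
of K under the nonlinearity, which is again compact. -/
theorem exists_defect_le {K : Set H1Pair} (hK : IsCompact K) {r : ℝ} (hr : 0 < r) :
    ∃ ε₀ > 0, ∀ ε (hε : 0 < ε), ε ≤ ε₀ → ∀ u ∈ K, ∀ i,
      eLpNorm (defect c₁ c₂ c₁₂ (moll ε hε) i u) 2 volume ≤ ENNReal.ofReal r := by
  obtain ⟨A, hA⟩ := hK.exists_bound_of_continuousOn (f := fun u : H1Pair => u) continuousOn_id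
  set Q := gpK c₁ c₂ c₁₂ * ((2 * H1.sob * (|A| + |A|)) ^ 2 * (2 * H1.sob)) with hQ
  have hs := sob_nonneg
  have hG := gpK_nonneg c₁ c₂ c₁₂
  have hQ0 : 0 ≤ Q := by positivity
  obtain ⟨ε₁, h1, h1'⟩ := exists_molP_sub_le hK (show 0 < r / (2 * (Q + 1)) by positivity)
  have h2 := fun i => exists_molL_sub_le (hK.image (continuous_gpn c₁ c₂ c₁₂ i)) (half_pos hr)
  choose ε₂ h2 h2' using h2
  refine ⟨min ε₁ (min (ε₂ 0) (ε₂ 1)), lt_min h1 (lt_min (h2 0) (h2 1)), fun ε hε hle u hu i => ?_⟩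
  have hi : ε ≤ ε₂ i := by
    have := hle.trans (min_le_right _ _)
    fin_cases i
    · exact this.trans (min_le_left _ _)
    · exact this.trans (min_le_right _ _)
  rw [eLpNorm_defect]
  refine ENNReal.ofReal_le_ofReal ?_
  have e1 := h2' i _ (Set.mem_image_of_mem _ hu) ε hε hi
  have e2 := h1' u hu ε hε (hle.trans (min_le_left _ _))
  have e3 := norm_gpn_sub_le c₁ c₂ c₁₂ (molP (moll ε hε) u) u i
  have hu' : ‖u‖ ≤ |A| := (hA u hu).trans (le_abs_self A)
  have hm' := (norm_molP_le hε u).trans hu'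
  have e4 : ‖gpn c₁ c₂ c₁₂ i (molP (moll ε hε) u) - gpn c₁ c₂ c₁₂ i u‖ ≤ Q * (r / (2 * (Q + 1))) := by
    refine e3.trans ?_
    calc _ ≤ gpK c₁ c₂ c₁₂ * ((2 * H1.sob * (|A| + |A|)) ^ 2 * (2 * H1.sob * (r / (2 * (Q + 1))))) := by gcongr
      _ = _ := by rw [hQ]; ring
  have e5 : Q * (r / (2 * (Q + 1))) ≤ r / 2 := by
    rw [mul_div_assoc', div_le_div_iff₀ (by positivity) (by norm_num)]
    nlinarith
  have e6 := norm_sub_le_norm_sub_add_norm_sub (gpn c₁ c₂ c₁₂ i (molP (moll ε hε) u)) (gpn c₁ c₂ c₁₂ i u)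
    (molL (moll ε hε) (gpn c₁ c₂ c₁₂ i u))
  rw [norm_sub_rev (gpn c₁ c₂ c₁₂ i u)] at e6
  linarith

variable {c₁ c₂ c₁₂}

theorem continuous_defect (ψ : BumpKernel) (i : Fin 2) (u : H1Pair) : Continuous (defect c₁ c₂ c₁₂ ψ i u) :=
  ((continuous_gpNonlinearity c₁ c₂ c₁₂ i).comp (continuous_pi fun j => mol_continuous ψ (Lp.memLp (H1.fn (u j))))).sub
    (mol_continuous ψ (Lp.memLp _))

theorem IsSol.exists_eventually_defect_le {φ : ℝ → H1Pair} (h : IsSol c₁ c₂ c₁₂ φ) (a b : ℝ) {r : ℝ} (hr : 0 < r) :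
    ∃ ε₀ > 0, ∀ ε (hε : 0 < ε), ε ≤ ε₀ → ∀ t ∈ Set.Icc a b, ∀ i,
      eLpNorm (defect c₁ c₂ c₁₂ (moll ε hε) i (φ t)) 2 volume ≤ ENNReal.ofReal r := by
  obtain ⟨ε₀, h0, h'⟩ := exists_defect_le c₁ c₂ c₁₂ (isCompact_Icc.image h.continuous : IsCompact (φ '' Set.Icc a b)) hr
  exact ⟨ε₀, h0, fun ε hε hle t ht => h' ε hε hle _ (Set.mem_image_of_mem φ ht)⟩

theorem lintegral_mul_defect_le {f : R3 → ℂ} {N r : ℝ} (hf : Continuous f) (hN : eLpNorm f 2 volume ≤ ENNReal.ofReal N)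
    {ψ : BumpKernel} {i : Fin 2} {u : H1Pair}
    (h : eLpNorm (defect c₁ c₂ c₁₂ ψ i u) 2 volume ≤ ENNReal.ofReal r) :
    ∫⁻ x, ‖f x‖ₑ * ‖defect c₁ c₂ c₁₂ ψ i u x‖ₑ ≤ ENNReal.ofReal N * ENNReal.ofReal r :=
  (IsL2Field.lintegral_enorm_mul_le hf.aestronglyMeasurable
    (continuous_defect ψ i u).aestronglyMeasurable).trans (mul_le_mul' hN h)

theorem eLpNorm_mol_moll_le {ε : ℝ} (hε : 0 < ε) (f : L2R3) {N : ℝ} (hN : ‖f‖ ≤ N) :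
    eLpNorm (mol (moll ε hε) f) 2 volume ≤ ENNReal.ofReal N := by
  refine (mol_moll_eLpNorm_two_le hε (Lp.memLp f).1).trans ?_
  rw [← ENNReal.ofReal_toReal (Lp.memLp f).2.ne, ← Lp.norm_def]
  exact ENNReal.ofReal_le_ofReal hN

theorem IsSol.exists_norm_le {φ : ℝ → H1Pair} (h : IsSol c₁ c₂ c₁₂ φ) (a b : ℝ) :
    ∃ A, 0 ≤ A ∧ ∀ t ∈ Set.Icc a b, ‖φ t‖ ≤ A ∧ ∀ i, ‖gpn c₁ c₂ c₁₂ i (φ t)‖ ≤ A := by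
  obtain ⟨A, hA⟩ := isCompact_Icc.exists_bound_of_continuousOn (h.continuous.continuousOn (s := Set.Icc a b))
  have hg := fun i => isCompact_Icc.exists_bound_of_continuousOn ((h.continuous_gpn i).continuousOn (s := Set.Icc a b))
  choose B hB using hg
  refine ⟨max |A| (max (B 0) (B 1)), le_trans (abs_nonneg A) (le_max_left _ _), fun t ht =>
    ⟨(hA t ht).trans ((le_abs_self A).trans (le_max_left _ _)), fun i => (hB i t ht).trans ?_⟩⟩
  fin_cases i
  · exact (le_max_left _ _).trans (le_max_right _ _)
  · exact (le_max_right _ _).trans (le_max_right _ _)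

theorem norm_fn_apply_le (u : H1Pair) (i : Fin 2) : ‖H1.fn (u i)‖ ≤ ‖u‖ :=
  (H1.norm_fn_le _).trans (norm_apply_le' u i)

-- The mass of the mollification changes only through the pairing of the solution with the defect,
-- which tends to zero in L² uniformly on the interval. No Strichartz estimate is needed.
open Filter in
theorem IsSol.norm_fn_eq_of_le {φ : ℝ → H1Pair} (h : IsSol c₁ c₂ c₁₂ φ) (i : Fin 2) {a b : ℝ} (hab : a ≤ b) :
    ‖H1.fn (φ b i)‖ = ‖H1.fn (φ a i)‖ := by
  suffices hs : ‖H1.fn (φ b i)‖ ^ 2 - ‖H1.fn (φ a i)‖ ^ 2 = 0 from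
    (sq_eq_sq₀ (norm_nonneg _) (norm_nonneg _)).1 (sub_eq_zero.1 hs)
  refine eq_zero_of_forall_enorm_le (((tendsto_molL_mollSeq (H1.fn (φ b i))).norm.pow 2).sub
    ((tendsto_molL_mollSeq (H1.fn (φ a i))).norm.pow 2)) fun η hη => ?_
  obtain ⟨A, hA0, hA⟩ := h.exists_norm_le a b
  -- Makes the total change 2 · A · r · (b − a) at most η; the added ones allow a = b and A = 0.
  have hr : 0 < η / (2 * (b - a + 1) * (A + 1)) := by
    have := sub_nonneg.2 hab
    positivity
  obtain ⟨ε₀, h0, h1⟩ := h.exists_eventually_defect_le a b hr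
  refine eventually_mollSeq (p := fun ψ => ‖‖molL ψ (H1.fn (φ b i))‖ ^ 2 - ‖molL ψ (H1.fn (φ a i))‖ ^ 2‖ₑ ≤
    ENNReal.ofReal η) ⟨ε₀, h0, fun ε hε hle => ?_⟩
  refine (h.enorm_mass_molP_sub_le (moll ε hε) i hab).trans ?_
  refine (setLIntegral_mono' measurableSet_Ioc fun t ht => mul_le_mul_right (lintegral_mul_defect_le
    (mol_continuous _ (Lp.memLp _)) (eLpNorm_mol_moll_le hε _ ((norm_fn_apply_le (φ t) i).trans
      (hA t (Set.Ioc_subset_Icc_self ht)).1)) (h1 ε hε hle t (Set.Ioc_subset_Icc_self ht) i)) 2).trans ?_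
  rw [lintegral_const, Measure.restrict_apply_univ, Real.volume_Ioc, ← ENNReal.ofReal_mul hA0,
    show (2 : ℝ≥0∞) = ENNReal.ofReal 2 by norm_num, ← ENNReal.ofReal_mul zero_le_two,
    ← ENNReal.ofReal_mul (by positivity)]
  refine ENNReal.ofReal_le_ofReal ?_
  have hb := sub_nonneg.2 hab
  rw [mul_div_assoc', mul_div_assoc', div_mul_eq_mul_div, div_le_iff₀ (by positivity)]
  nlinarith [mul_nonneg hη.le hb, mul_nonneg hη.le hA0, mul_nonneg (mul_nonneg hη.le hb) hA0]

theorem IsSol.norm_fn_eq {φ : ℝ → H1Pair} (h : IsSol c₁ c₂ c₁₂ φ) (i : Fin 2) (t : ℝ) :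
    ‖H1.fn (φ t i)‖ = ‖H1.fn (φ 0 i)‖ := by
  rcases le_total 0 t with ht | ht
  · exact h.norm_fn_eq_of_le i ht
  · exact (h.norm_fn_eq_of_le i ht).symm

-- The defect meets Δ(ρ ∗ φ), handled by the trilinear estimate, and the mollified nonlinearity,
-- bounded in L², for which L² smallness of the defect suffices. The length τ is the one on which
-- the Strichartz estimate holds for the bound A of the solution on [0, 1].
open Filter in
theorem IsSol.exists_energy_eq {φ : ℝ → H1Pair} (h : IsSol c₁ c₂ c₁₂ φ) : ∃ τ > 0, ∀ s ∈ Set.Icc 0 τ,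
    energy c₁ c₂ c₁₂ (φ s) = energy c₁ c₂ c₁₂ (φ 0) := by
  obtain ⟨A, hA0, hA⟩ := h.exists_norm_le 0 1
  obtain ⟨τ, C, hτ, hτ1, hC, hS⟩ := exists_strichartz c₁ c₂ c₁₂ A
  have hA' : ∀ t ∈ Set.Icc 0 τ, ‖φ t‖ ≤ A := fun t ht => (hA t ⟨ht.1, ht.2.trans hτ1⟩).1
  have hS' := hS φ h hA'
  refine ⟨τ, hτ, fun s hs => sub_eq_zero.1 ?_⟩
  refine eq_zero_of_forall_enorm_le ((((continuous_energy c₁ c₂ c₁₂).tendsto _).comp (tendsto_molP_mollSeq (φ s))).sub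
    (((continuous_energy c₁ c₂ c₁₂).tendsto _).comp (tendsto_molP_mollSeq (φ 0)))) fun η hη => ?_
  obtain ⟨ε₁, h1, h1'⟩ := h.exists_energyError_le hτ1 hC hA' hS' (show 0 < η / 8 by positivity)
  obtain ⟨ε₂, h2, h2'⟩ := h.exists_eventually_defect_le 0 τ (show 0 < η / (8 * (A + 1)) by positivity)
  refine eventually_mollSeq (p := fun ψ => ‖energy c₁ c₂ c₁₂ (molP ψ (φ s)) - energy c₁ c₂ c₁₂ (molP ψ (φ 0))‖ₑ ≤
    ENNReal.ofReal η) ⟨min ε₁ ε₂, lt_min h1 h2, fun ε hε hle => ?_⟩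
  refine (h.enorm_energy_molP_sub_le (moll ε hε) hs.1).trans ?_
  have hpt : ∀ t ∈ Set.Ioc 0 τ, 2 * ∑ i, ∫⁻ x, ‖defect c₁ c₂ c₁₂ (moll ε hε) i (φ t) x‖ₑ *
      (‖molLap (moll ε hε) ((φ t).comp i) x‖ₑ + ‖mol (moll ε hε) (gpn c₁ c₂ c₁₂ i (φ t)) x‖ₑ) ≤
      2 * ∑ i, (∫⁻ x, ‖defect c₁ c₂ c₁₂ (moll ε hε) i (φ t) x‖ₑ * ‖molLap (moll ε hε) ((φ t).comp i) x‖ₑ) +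
        ENNReal.ofReal (η / 2) := by
    intro t ht
    have ht' := Set.Ioc_subset_Icc_self ht
    have e1 : ∀ i, ∫⁻ x, ‖defect c₁ c₂ c₁₂ (moll ε hε) i (φ t) x‖ₑ *
        (‖molLap (moll ε hε) ((φ t).comp i) x‖ₑ + ‖mol (moll ε hε) (gpn c₁ c₂ c₁₂ i (φ t)) x‖ₑ) ≤
        (∫⁻ x, ‖defect c₁ c₂ c₁₂ (moll ε hε) i (φ t) x‖ₑ * ‖molLap (moll ε hε) ((φ t).comp i) x‖ₑ) +
          ENNReal.ofReal (η / 8) := by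
      intro i
      simp only [mul_add]
      have m : Measurable fun x => ‖defect c₁ c₂ c₁₂ (moll ε hε) i (φ t) x‖ₑ *
          ‖mol (moll ε hε) (gpn c₁ c₂ c₁₂ i (φ t)) x‖ₑ :=
        (continuous_defect _ i (φ t)).enorm.measurable.mul (mol_continuous _ (Lp.memLp _)).enorm.measurable
      rw [lintegral_add_right _ m]
      refine add_le_add le_rfl ?_
      simp only [mul_comm ‖defect c₁ c₂ c₁₂ (moll ε hε) i (φ t) _‖ₑ]
      refine (lintegral_mul_defect_le (mol_continuous _ (Lp.memLp _)) (eLpNorm_mol_moll_le hε _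
        ((hA t ⟨ht'.1, ht'.2.trans hτ1⟩).2 i)) (h2' ε hε (hle.trans (min_le_right _ _)) t ht' i)).trans ?_
      rw [← ENNReal.ofReal_mul hA0]
      refine ENNReal.ofReal_le_ofReal ?_
      rw [mul_div_assoc', div_le_div_iff₀ (by positivity) (by norm_num)]
      nlinarith
    refine (mul_le_mul_right (Finset.sum_le_sum fun i _ => e1 i) 2).trans (le_of_eq ?_)
    rw [Finset.sum_add_distrib, mul_add, Fin.sum_univ_two (fun _ => ENNReal.ofReal (η / 8)), ← ENNReal.ofReal_add
      (by positivity) (by positivity)]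
    congr 1
    rw [show (2 : ℝ≥0∞) = ENNReal.ofReal 2 by norm_num, ← ENNReal.ofReal_mul zero_le_two]
    congr 1
    ring
  have hsub : Set.Ioc 0 s ⊆ Set.Ioc 0 τ := Set.Ioc_subset_Ioc_right hs.2
  refine (lintegral_mono_set hsub).trans ((setLIntegral_mono' measurableSet_Ioc hpt).trans ?_)
  rw [lintegral_add_right _ measurable_const, lintegral_const, Measure.restrict_apply_univ, Real.volume_Ioc]
  have e2 : ∫⁻ t in Set.Ioc 0 τ, 2 * ∑ i, (∫⁻ x, ‖defect c₁ c₂ c₁₂ (moll ε hε) i (φ t) x‖ₑ *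
      ‖molLap (moll ε hε) ((φ t).comp i) x‖ₑ) ≤ ENNReal.ofReal (η / 2) := by
    have hm : ∀ i, Measurable fun t => ∫⁻ x, ‖defect c₁ c₂ c₁₂ (moll ε hε) i (φ t) x‖ₑ *
      ‖molLap (moll ε hε) ((φ t).comp i) x‖ₑ := fun i => by
      have c1 : Continuous fun p : ℝ × R3 => defect c₁ c₂ c₁₂ (moll ε hε) i (φ p.1) p.2 :=
        (h.isL2Field_gpNonlinearity (moll ε hε) i).continuous.sub
          (IsL2Field.mol (moll ε hε) (h.continuous_gpn i)).continuous
      have c2 : Continuous fun p : ℝ × R3 => molLap (moll ε hε) ((φ p.1).comp i) p.2 :=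
        (IsL2Field.molLap (moll ε hε) (h.continuous_fn i)).continuous
      exact (c1.enorm.measurable.mul c2.enorm.measurable).lintegral_prod_right'
    rw [lintegral_const_mul _ (Finset.measurable_sum _ fun i _ => hm i), lintegral_finsetSum _ fun i _ => hm i]
    refine (mul_le_mul_right (Finset.sum_le_sum fun i _ => h1' ε hε (hle.trans (min_le_left _ _)) i) 2).trans
      (le_of_eq ?_)
    rw [Fin.sum_univ_two, ← ENNReal.ofReal_add (by positivity) (by positivity),
      show (2 : ℝ≥0∞) = ENNReal.ofReal 2 by norm_num, ← ENNReal.ofReal_mul zero_le_two]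
    congr 1
    ring
  refine (add_le_add e2 (mul_le_mul_right (ENNReal.ofReal_le_one.2 (by linarith : τ - 0 ≤ 1)) _)).trans (le_of_eq ?_)
  rw [mul_one, ← ENNReal.ofReal_add (by positivity) (by positivity), add_halves]

/-- Local constancy to the right of every time gives a vanishing right derivative, which with
continuity forces constancy. The local length may vary with the time, so no uniform bound is
presupposed. -/
theorem IsSol.energy_eq_of_le {φ : ℝ → H1Pair} (h : IsSol c₁ c₂ c₁₂ φ) {a b : ℝ} (hab : a ≤ b) :
    energy c₁ c₂ c₁₂ (φ b) = energy c₁ c₂ c₁₂ (φ a) := by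
  refine constant_of_has_deriv_right_zero (f := fun t => energy c₁ c₂ c₁₂ (φ t))
    ((continuous_energy c₁ c₂ c₁₂).comp h.continuous).continuousOn (fun t _ => ?_) b ⟨hab, le_rfl⟩
  obtain ⟨τ, hτ, hc⟩ := (h.shift t).exists_energy_eq
  refine (hasDerivWithinAt_const t (Set.Ici t) (energy c₁ c₂ c₁₂ (φ t))).congr_of_eventuallyEq ?_ rfl
  filter_upwards [Icc_mem_nhdsGE (show t < t + τ by linarith)] with s hs
  have := hc (s - t) ⟨by linarith [hs.1], by linarith [hs.2]⟩
  simpa using this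

theorem IsSol.energy_eq {φ : ℝ → H1Pair} (h : IsSol c₁ c₂ c₁₂ φ) (t : ℝ) :
    energy c₁ c₂ c₁₂ (φ t) = energy c₁ c₂ c₁₂ (φ 0) := by
  rcases le_total 0 t with ht | ht
  · exact h.energy_eq_of_le ht
  · exact (h.energy_eq_of_le ht).symm

theorem norm_sq_eq' (u : H1Pair) : ‖u‖ ^ 2 = (∑ i, ‖H1.fn (u i)‖ ^ 2) + ∑ i, ∑ k, ‖H1.grad k (u i)‖ ^ 2 := by
  rw [PiLp.norm_sq_eq_of_L2, ← Finset.sum_add_distrib]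
  exact Finset.sum_congr rfl fun i _ => H1.norm_sq_eq (u i)

theorem gpn_zero (i : Fin 2) : gpn c₁ c₂ c₁₂ i 0 = 0 := by
  refine Lp.ext ?_
  have h0 : ∀ j, (0 : H1Pair).comp j =ᵐ[volume] 0 := fun j => by
    rw [comp_eq, show (0 : H1Pair) j = 0 from rfl, map_zero]
    exact Lp.coeFn_zero _ _ _
  filter_upwards [gpn_coeFn c₁ c₂ c₁₂ i 0, Lp.coeFn_zero ℂ 2 (volume : Measure R3), ae_all_iff.2 h0] with x h1 h2 h3
  have : (fun j => (0 : H1Pair).comp j x) = 0 := funext h3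
  rw [h1, this, gpNonlinearity_zero, h2]
  rfl

theorem energy_le (u : H1Pair) : energy c₁ c₂ c₁₂ u ≤ ‖u‖ ^ 2 + ‖u‖ *
    (gpK c₁ c₂ c₁₂ * ((2 * H1.sob * ‖u‖) ^ 2 * (2 * H1.sob * ‖u‖))) := by
  have h1 := norm_sq_eq' u
  have h2 : 0 ≤ ∑ i, ‖H1.fn (u i)‖ ^ 2 := Finset.sum_nonneg fun i _ => sq_nonneg _
  have h3 : ∀ i, (inner ℂ (H1.fn (u i)) (gpn c₁ c₂ c₁₂ i u)).re ≤ ‖u‖ *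
      (gpK c₁ c₂ c₁₂ * ((2 * H1.sob * ‖u‖) ^ 2 * (2 * H1.sob * ‖u‖))) := fun i => by
    refine (Complex.re_le_norm _).trans ((norm_inner_le_norm _ _).trans (mul_le_mul (norm_fn_apply_le u i) ?_
      (norm_nonneg _) (norm_nonneg _)))
    have := norm_gpn_sub_le c₁ c₂ c₁₂ u 0 i
    simpa [gpn_zero] using this
  rw [energy, Fin.sum_univ_two (fun i => (1 / 2 : ℝ) * _)]
  linarith [h3 0, h3 1]

/-- The only place where conservation of energy enters: with nonnegative couplings the kinetic part
is at most the conserved energy, which the Sobolev embedding bounds in terms of M. Mass conservation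
supplies the L² part. -/
theorem exists_uniform_bound (hc₁ : 0 ≤ c₁) (hc₂ : 0 ≤ c₂) (hc₁₂ : 0 ≤ c₁₂) (M : ℝ) :
    ∃ A, 0 ≤ A ∧ ∀ φ, IsSol c₁ c₂ c₁₂ φ → ‖φ 0‖ ≤ M → ∀ t, ‖φ t‖ ≤ A := by
  set B := M ^ 2 + (M ^ 2 + M * (gpK c₁ c₂ c₁₂ * ((2 * H1.sob * M) ^ 2 * (2 * H1.sob * M)))) with hB
  refine ⟨√B, Real.sqrt_nonneg _, fun φ h hM t => ?_⟩
  have h0 := norm_nonneg (φ 0)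
  have hs := sob_nonneg
  have hG := gpK_nonneg c₁ c₂ c₁₂
  refine Real.le_sqrt_of_sq_le ?_
  have e1 := energy_le (c₁ := c₁) (c₂ := c₂) (c₁₂ := c₁₂) (φ 0)
  have e2 : ‖φ 0‖ ^ 2 + (‖φ 0‖ ^ 2 + ‖φ 0‖ * (gpK c₁ c₂ c₁₂ * ((2 * H1.sob * ‖φ 0‖) ^ 2 * (2 * H1.sob * ‖φ 0‖)))) ≤ B := by
    have := h0.trans hM
    rw [hB]; gcongr
  have e3 := h.energy_eq t
  rw [energy_eq c₁ c₂ c₁₂ (φ t)] at e3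
  have e4 : 0 ≤ ∫ x, gpPot c₁ c₂ c₁₂ fun j => (φ t).comp j x :=
    integral_nonneg fun x => gpPot_nonneg c₁ c₂ c₁₂ hc₁ hc₂ hc₁₂ _
  have e5 := norm_sq_eq' (φ t)
  have e6 := norm_sq_eq' (φ 0)
  simp only [h.norm_fn_eq _ t] at e5
  have e7 : 0 ≤ ∑ i, ∑ k, ‖H1.grad k (φ 0 i)‖ ^ 2 :=
    Finset.sum_nonneg fun i _ => Finset.sum_nonneg fun k _ => sq_nonneg _
  linarith

end H1Pair

/-! ### Weights -/

/-- Bounded continuous functions. -/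
structure IsBddCont (c : R3 → ℝ) : Prop where
  continuous : Continuous c
  bdd : ∃ C, 0 ≤ C ∧ ∀ x, ‖c x‖ ≤ C

namespace IsBddCont

theorem of_le {c : R3 → ℝ} (hc : Continuous c) {C : ℝ} (h : ∀ x, ‖c x‖ ≤ C) : IsBddCont c :=
  ⟨hc, C, (norm_nonneg _).trans (h 0), h⟩

theorem const (a : ℝ) : IsBddCont fun _ => a := of_le continuous_const fun _ => le_rfl

theorem add {c d : R3 → ℝ} (hc : IsBddCont c) (hd : IsBddCont d) : IsBddCont fun x => c x + d x := by
  obtain ⟨C, _, hC⟩ := hc.bdd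
  obtain ⟨D, _, hD⟩ := hd.bdd
  exact of_le (hc.continuous.add hd.continuous) fun x => (norm_add_le _ _).trans (add_le_add (hC x) (hD x))

theorem mul {c d : R3 → ℝ} (hc : IsBddCont c) (hd : IsBddCont d) : IsBddCont fun x => c x * d x := by
  obtain ⟨C, hC0, hC⟩ := hc.bdd
  obtain ⟨D, _, hD⟩ := hd.bdd
  exact of_le (hc.continuous.mul hd.continuous) fun x => (norm_mul_le _ _).trans
    (mul_le_mul (hC x) (hD x) (norm_nonneg _) hC0)

theorem sub {c d : R3 → ℝ} (hc : IsBddCont c) (hd : IsBddCont d) : IsBddCont fun x => c x - d x := by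
  simpa [sub_eq_add_neg] using hc.add ((const (-1)).mul hd)

theorem neg {c : R3 → ℝ} (hc : IsBddCont c) : IsBddCont fun x => -c x := by
  simpa using (const (-1)).mul hc

theorem pow {c : R3 → ℝ} (hc : IsBddCont c) (n : ℕ) : IsBddCont fun x => c x ^ n := by
  induction n with
  | zero => simpa using const 1
  | succ n ih => simpa [pow_succ] using ih.mul hc

theorem sub_right {c : R3 → ℝ} (hc : IsBddCont c) (y : R3) : IsBddCont fun x => c (x - y) := by
  obtain ⟨C, _, hC⟩ := hc.bdd
  exact of_le (hc.continuous.comp (by fun_prop)) fun x => hC _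

theorem sub_left {c : R3 → ℝ} (hc : IsBddCont c) (x : R3) : IsBddCont fun y => c (x - y) := by
  obtain ⟨C, _, hC⟩ := hc.bdd
  exact of_le (hc.continuous.comp (by fun_prop)) fun x => hC _

theorem integrable_mul {c f : R3 → ℝ} (hc : IsBddCont c) (hf : Integrable f volume) :
    Integrable (fun x => c x * f x) volume := by
  obtain ⟨C, _, hC⟩ := hc.bdd
  exact hf.bdd_mul hc.continuous.aestronglyMeasurable (Filter.Eventually.of_forall hC)

end IsBddCont

theorem integral_eq_zero_of_hasLineDerivAt {f f' : R3 → ℝ} {v : R3} (hf : Integrable f volume)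
    (hf' : Integrable f' volume) (d : ∀ x, HasLineDerivAt ℝ f (f' x) x v) : ∫ x, f' x = 0 := by
  have h := integral_bilinear_hasLineDerivAt_right_eq_neg_left_of_integrable (μ := (volume : Measure R3))
    (B := ContinuousLinearMap.mul ℝ ℝ) (f := fun _ : R3 => (1 : ℝ)) (f' := fun _ => 0) (g := f) (g' := f')
    (v := v) (by simp) (by simpa using hf') (by simpa using hf)
    (fun x _ => by simpa using (hasFDerivAt_const (1 : ℝ) x).hasLineDerivAt v) (fun x _ => d x)
  simpa using h

/-- Integration by parts against a bounded weight. -/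
theorem integral_weight_mul_deriv {b b' f f' : R3 → ℝ} {v : R3} (hb : IsBddCont b) (hb' : IsBddCont b')
    (db : ∀ x, HasLineDerivAt ℝ b (b' x) x v) (hf : Integrable f volume) (hf' : Integrable f' volume)
    (df : ∀ x, HasLineDerivAt ℝ f (f' x) x v) : ∫ x, b x * f' x = -∫ x, b' x * f x := by
  have h := integral_eq_zero_of_hasLineDerivAt (hb.integrable_mul hf)
    ((hb'.integrable_mul hf).add (hb.integrable_mul hf')) (v := v) fun x => by
      have h1 := db x
      have h2 := df x
      unfold HasLineDerivAt at h1 h2 ⊢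
      exact (h1.fun_mul h2).congr_deriv (by simp)
  rw [integral_add' (hb'.integrable_mul hf) (hb.integrable_mul hf')] at h
  linarith

/-! ### Weighted pairings and integration by parts -/

/-- The weighted pairing `∫ b Re(F̄ G)`. -/
noncomputable def wint (b : R3 → ℝ) (F G : R3 → ℂ) : ℝ := ∫ x, b x * inner ℝ (F x) (G x)

section Wint
variable {b b' : R3 → ℝ} {F G F' G' H : R3 → ℂ}

theorem wint_comm : wint b F G = wint b G F :=
  integral_congr_ae (Filter.Eventually.of_forall fun x => by
    change _ * _ = _ * _
    rw [real_inner_comm])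

theorem integrable_wint (hb : IsBddCont b) (hF : MemLp F 2 volume) (hG : MemLp G 2 volume) :
    Integrable (fun x => b x * inner ℝ (F x) (G x)) volume := hb.integrable_mul (integrable_inner hF hG)

theorem wint_sub (hb : IsBddCont b) (hF : MemLp F 2 volume) (hG : MemLp G 2 volume) (hH : MemLp H 2 volume) :
    wint b F (fun x => G x - H x) = wint b F G - wint b F H := by
  unfold wint
  simp only [inner_sub_right, mul_sub]
  exact integral_sub (integrable_wint hb hF hG) (integrable_wint hb hF hH)

theorem wint_sum {ι : Type*} (s : Finset ι) {G : ι → R3 → ℂ} (hb : IsBddCont b) (hF : MemLp F 2 volume)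
    (hG : ∀ i, MemLp (G i) 2 volume) : wint b F (fun x => ∑ i ∈ s, G i x) = ∑ i ∈ s, wint b F (G i) := by
  unfold wint
  simp only [inner_sum, Finset.mul_sum]
  exact integral_finsetSum _ fun i _ => integrable_wint hb hF (hG i)

theorem wint_sum_weight {ι : Type*} (s : Finset ι) {b : ι → R3 → ℝ} (hb : ∀ i, IsBddCont (b i))
    (hF : MemLp F 2 volume) (hG : MemLp G 2 volume) :
    wint (fun x => ∑ i ∈ s, b i x) F G = ∑ i ∈ s, wint (b i) F G := by
  unfold wint
  simp only [Finset.sum_mul]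
  exact integral_finsetSum _ fun i _ => integrable_wint (hb i) hF hG

theorem wint_I_mul_I_mul : wint b (fun x => Complex.I * F x) (fun x => Complex.I * G x) = wint b F G :=
  integral_congr_ae (Filter.Eventually.of_forall fun x => by
    simp only [Complex.inner]; simp)

theorem wint_I_mul_left : wint b (fun x => Complex.I * F x) G = -wint b F (fun x => Complex.I * G x) := by
  unfold wint
  rw [← integral_neg]
  refine integral_congr_ae (Filter.Eventually.of_forall fun x => ?_)
  simp only [Complex.inner]; simp; ring

theorem hasLineDerivAt_inner {f g : R3 → ℂ} {f' g' : ℂ} {x v : R3} (hf : HasLineDerivAt ℝ f f' x v)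
    (hg : HasLineDerivAt ℝ g g' x v) :
    HasLineDerivAt ℝ (fun x => (inner ℝ (f x) (g x) : ℝ)) (inner ℝ (f x) g' + inner ℝ f' (g x)) x v := by
  unfold HasLineDerivAt at hf hg ⊢
  simpa using hf.inner ℝ hg

theorem wint_by_parts {v : R3} (hb : IsBddCont b) (hb' : IsBddCont b') (db : ∀ x, HasLineDerivAt ℝ b (b' x) x v)
    (hF : MemLp F 2 volume) (hF' : MemLp F' 2 volume) (hG : MemLp G 2 volume) (hG' : MemLp G' 2 volume)
    (dF : ∀ x, HasLineDerivAt ℝ F (F' x) x v) (dG : ∀ x, HasLineDerivAt ℝ G (G' x) x v) :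
    wint b F G' = -(wint b' F G + wint b F' G) := by
  have h := integral_weight_mul_deriv hb hb' db (integrable_inner hF hG)
    ((integrable_inner hF hG').add (integrable_inner hF' hG)) fun x => hasLineDerivAt_inner (dF x) (dG x)
  simp only [Pi.add_apply, mul_add] at h
  rw [integral_add (integrable_wint hb hF hG') (integrable_wint hb hF' hG)] at h
  unfold wint
  linarith

end Wint

section Virial
variable (ρ : BumpKernel) (w : L2R3) {b : Fin 3 → R3 → ℝ} {b2 : Fin 3 → Fin 3 → R3 → ℝ} {L : R3 → ℝ}
  {L1 L2 : Fin 3 → R3 → ℝ}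

/-- The linear virial identity. Here b plays the gradient of a weight, b2 its Hessian and L its
Laplacian. In the first sum integration by parts leaves the Hessian against the stress and minus
half of L against |∇u|², doubled by the factor 2; the L term cancels the latter and leaves half of
ΔL against the mass. -/
theorem wint_molLap_eq (hb : ∀ l, IsBddCont (b l)) (hb2 : ∀ l k, IsBddCont (b2 l k)) (hL : IsBddCont L)
    (hL1 : ∀ k, IsBddCont (L1 k)) (hL2 : ∀ k, IsBddCont (L2 k))
    (db : ∀ l k x, HasLineDerivAt ℝ (b l) (b2 l k x) x (e3 k)) (hbL : ∀ x, L x = ∑ l, b2 l l x)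
    (dL : ∀ k x, HasLineDerivAt ℝ L (L1 k x) x (e3 k)) (dL1 : ∀ k x, HasLineDerivAt ℝ (L1 k) (L2 k x) x (e3 k)) :
    (∑ l, 2 * wint (b l) (mol (ρ.d (e3 l)) w) (molLap ρ w)) + wint L (mol ρ w) (molLap ρ w) =
      (1 / 2) * (∑ k, wint (L2 k) (mol ρ w) (mol ρ w)) -
        2 * ∑ l, ∑ k, wint (b2 l k) (mol (ρ.d (e3 l)) w) (mol (ρ.d (e3 k)) w) := by
  have hm : ∀ ψ : BumpKernel, MemLp (mol ψ w) 2 volume := fun ψ => mol_memLp_two ψ (Lp.memLp w)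
  have dm : ∀ (ψ : BumpKernel) (v x : R3), HasLineDerivAt ℝ (mol ψ w) (mol (ψ.d v) w x) x v := fun ψ v x =>
    mol_hasLineDerivAt ψ (Lp.memLp w) x v
  have e1 : ∀ l, wint (b l) (mol (ρ.d (e3 l)) w) (molLap ρ w) =
      -∑ k, (wint (b2 l k) (mol (ρ.d (e3 l)) w) (mol (ρ.d (e3 k)) w) +
        wint (b l) (mol ((ρ.d (e3 l)).d (e3 k)) w) (mol (ρ.d (e3 k)) w)) := fun l => by
    rw [← Finset.sum_neg_distrib]
    refine (wint_sum Finset.univ (hb l) (hm _) fun k => hm _).trans (Finset.sum_congr rfl fun k _ => ?_)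
    exact wint_by_parts (hb l) (hb2 l k) (db l k) (hm _) (hm _) (hm _) (hm _) (dm _ _) (dm _ _)
  have e2 : ∀ l k, wint (b l) (mol ((ρ.d (e3 l)).d (e3 k)) w) (mol (ρ.d (e3 k)) w) =
      -((1 / 2) * wint (b2 l l) (mol (ρ.d (e3 k)) w) (mol (ρ.d (e3 k)) w)) := fun l k => by
    have := wint_by_parts (hb l) (hb2 l l) (db l l) (hm (ρ.d (e3 k))) (hm _) (hm (ρ.d (e3 k))) (hm _) (dm _ _) (dm _ _)
    rw [wint_comm (G := mol ((ρ.d (e3 k)).d (e3 l)) w), ρ.d_comm (e3 k)] at this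
    linarith
  have e3' : wint L (mol ρ w) (molLap ρ w) =
      -∑ k, (wint (L1 k) (mol ρ w) (mol (ρ.d (e3 k)) w) + wint L (mol (ρ.d (e3 k)) w) (mol (ρ.d (e3 k)) w)) := by
    rw [← Finset.sum_neg_distrib]
    refine (wint_sum Finset.univ hL (hm _) fun k => hm _).trans (Finset.sum_congr rfl fun k _ => ?_)
    exact wint_by_parts hL (hL1 k) (dL k) (hm _) (hm _) (hm _) (hm _) (dm _ _) (dm _ _)
  have e4 : ∀ k, wint (L1 k) (mol ρ w) (mol (ρ.d (e3 k)) w) = -((1 / 2) * wint (L2 k) (mol ρ w) (mol ρ w)) := fun k => by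
    have := wint_by_parts (hL1 k) (hL2 k) (dL1 k) (hm ρ) (hm _) (hm ρ) (hm _) (dm _ _) (dm _ _)
    rw [wint_comm (F := mol (ρ.d (e3 k)) w)] at this
    linarith
  have e5 : ∀ k, wint L (mol (ρ.d (e3 k)) w) (mol (ρ.d (e3 k)) w) =
      ∑ l, wint (b2 l l) (mol (ρ.d (e3 k)) w) (mol (ρ.d (e3 k)) w) := fun k => by
    rw [← wint_sum_weight Finset.univ (fun l => hb2 l l) (hm _) (hm _)]
    congr 1
    exact funext hbL
  simp only [e1, e2, e3', e4, e5, Fin.sum_univ_three]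
  ring

end Virial

/-! ### The Morawetz weight `√(δ² + |z|²)` -/

/-- The inverse of the weight. -/
noncomputable def wq (δ : ℝ) (z : R3) : ℝ := (√(δ ^ 2 + ‖z‖ ^ 2))⁻¹

/-- The gradient of the weight. -/
noncomputable def ws (δ : ℝ) (l : Fin 3) (z : R3) : ℝ := z l * wq δ z

/-- The Hessian of the weight. -/
noncomputable def wH (δ : ℝ) (l k : Fin 3) (z : R3) : ℝ := (if l = k then 1 else 0) * wq δ z - ws δ l z * ws δ k z * wq δ z

/-- The Laplacian of the weight. -/
noncomputable def wL (δ : ℝ) (z : R3) : ℝ := 2 * wq δ z + δ ^ 2 * wq δ z ^ 3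

/-- The gradient of the Laplacian of the weight. -/
noncomputable def wL1 (δ : ℝ) (k : Fin 3) (z : R3) : ℝ := (-2) * (ws δ k z * wq δ z ^ 2) - 3 * δ ^ 2 * (ws δ k z * wq δ z ^ 4)

/-- The pure second derivatives of the Laplacian of the weight. -/
noncomputable def wL2 (δ : ℝ) (k : Fin 3) (z : R3) : ℝ := ((-2) * wq δ z ^ 3 + 6 * (ws δ k z ^ 2 * wq δ z ^ 3)) +
  ((-3) * δ ^ 2 * wq δ z ^ 5 + 15 * δ ^ 2 * (ws δ k z ^ 2 * wq δ z ^ 5))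

section Weight
variable {δ : ℝ} (hδ : 0 < δ)
include hδ

theorem wq_pos (z : R3) : 0 < wq δ z := by unfold wq; positivity

theorem wq_sq (z : R3) : wq δ z ^ 2 * (δ ^ 2 + ‖z‖ ^ 2) = 1 := by
  have h : 0 < δ ^ 2 + ‖z‖ ^ 2 := by positivity
  rw [wq, inv_pow, Real.sq_sqrt h.le, inv_mul_cancel₀ h.ne']

theorem sum_ws_sq (z : R3) : ∑ l, ws δ l z ^ 2 = 1 - δ ^ 2 * wq δ z ^ 2 := by
  have h := wq_sq hδ z
  have h2 : ‖z‖ ^ 2 = ∑ l, z l ^ 2 := by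
    rw [EuclideanSpace.norm_sq_eq]; simp
  rw [h2] at h
  simp only [ws, Fin.sum_univ_three] at h ⊢
  linear_combination h

theorem norm_ws_le (l : Fin 3) (z : R3) : ‖ws δ l z‖ ≤ 1 := by
  have h := sum_ws_sq hδ z
  have h1 : ws δ l z ^ 2 ≤ ∑ l, ws δ l z ^ 2 :=
    Finset.single_le_sum (f := fun l => ws δ l z ^ 2) (fun i _ => sq_nonneg _) (Finset.mem_univ l)
  have h2 : 0 ≤ δ ^ 2 * wq δ z ^ 2 := by positivity
  rw [Real.norm_eq_abs]
  exact abs_le_one_iff_mul_self_le_one.2 (by nlinarith)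

theorem wq_le (z : R3) : wq δ z ≤ δ⁻¹ := by
  unfold wq
  refine inv_anti₀ hδ (Real.le_sqrt_of_sq_le ?_)
  nlinarith [sq_nonneg ‖z‖]

theorem continuous_wq : Continuous (wq δ) :=
  (Continuous.sqrt (by fun_prop)).inv₀ fun z => by positivity

theorem isBddCont_wq : IsBddCont (wq δ) := .of_le (continuous_wq hδ) (C := δ⁻¹) fun z => by
  rw [Real.norm_of_nonneg (wq_pos hδ z).le]; exact wq_le hδ z

theorem isBddCont_ws (l : Fin 3) : IsBddCont (ws δ l) :=
  .of_le ((by fun_prop : Continuous fun z : R3 => z l).mul (continuous_wq hδ)) (norm_ws_le hδ l)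

theorem isBddCont_wH (l k : Fin 3) : IsBddCont (wH δ l k) :=
  ((IsBddCont.const _).mul (isBddCont_wq hδ)).sub (((isBddCont_ws hδ l).mul (isBddCont_ws hδ k)).mul (isBddCont_wq hδ))

theorem isBddCont_wL : IsBddCont (wL δ) :=
  ((IsBddCont.const _).mul (isBddCont_wq hδ)).add ((IsBddCont.const _).mul ((isBddCont_wq hδ).pow 3))

theorem isBddCont_wL1 (k : Fin 3) : IsBddCont (wL1 δ k) :=
  ((IsBddCont.const _).mul ((isBddCont_ws hδ k).mul ((isBddCont_wq hδ).pow 2))).sub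
    ((IsBddCont.const _).mul ((isBddCont_ws hδ k).mul ((isBddCont_wq hδ).pow 4)))

theorem isBddCont_wL2 (k : Fin 3) : IsBddCont (wL2 δ k) :=
  (((IsBddCont.const _).mul ((isBddCont_wq hδ).pow 3)).add
    ((IsBddCont.const _).mul (((isBddCont_ws hδ k).pow 2).mul ((isBddCont_wq hδ).pow 3)))).add
  (((IsBddCont.const _).mul ((isBddCont_wq hδ).pow 5)).add
    ((IsBddCont.const _).mul (((isBddCont_ws hδ k).pow 2).mul ((isBddCont_wq hδ).pow 5))))

theorem wL_nonneg (z : R3) : 0 ≤ wL δ z := by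
  have := wq_pos hδ z; unfold wL; positivity

theorem sum_wH (z : R3) : wL δ z = ∑ l, wH δ l l z := by
  have h := sum_ws_sq hδ z
  simp only [Fin.sum_univ_three, wH, wL, if_true] at h ⊢
  linear_combination wq δ z * h

/-- The trace is Δ² of the weight. For the smoothed weight it is a negative approximate identity at
scale δ, up to a constant: in dimension three the bilaplacian of |z| is a negative multiple of the
Dirac mass. -/
theorem sum_wL2 (z : R3) : ∑ k, wL2 δ k z = -15 * δ ^ 4 * wq δ z ^ 7 := by
  have h := sum_ws_sq hδ z
  simp only [Fin.sum_univ_three, wL2] at h ⊢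
  linear_combination (6 * wq δ z ^ 3 + 15 * δ ^ 2 * wq δ z ^ 5) * h

theorem hasLineDerivAt_wq (k : Fin 3) (z : R3) : HasLineDerivAt ℝ (wq δ) (-(ws δ k z * wq δ z ^ 2)) z (e3 k) := by
  have h0 : HasLineDerivAt ℝ (fun z : R3 => ‖z‖ ^ 2) (2 * z k) z (e3 k) := by
    have := ((hasStrictFDerivAt_norm_sq z).hasFDerivAt).hasLineDerivAt (e3 k)
    simpa [e3, EuclideanSpace.inner_single_right] using this
  unfold HasLineDerivAt at h0 ⊢
  have hp : 0 < δ ^ 2 + ‖z‖ ^ 2 := by positivity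
  have h1 := ((h0.const_add (δ ^ 2)).sqrt (by simpa using hp.ne')).inv (by simpa using (Real.sqrt_pos.2 hp).ne')
  refine h1.congr_deriv ?_
  simp only [zero_smul, add_zero, ws, wq]
  field_simp

theorem hasLineDerivAt_ws (l k : Fin 3) (z : R3) : HasLineDerivAt ℝ (ws δ l) (wH δ l k z) z (e3 k) := by
  have h0 : HasDerivAt (fun t : ℝ => (z + t • e3 k) l) (if l = k then 1 else 0) 0 := by
    have : (fun t : ℝ => (z + t • e3 k) l) = fun t => z l + t * (if l = k then 1 else 0) := by
      funext t
      simp [e3]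
    rw [this]
    simpa using ((hasDerivAt_id (0 : ℝ)).mul_const (if l = k then (1 : ℝ) else 0)).const_add (z l)
  have h1 := hasLineDerivAt_wq hδ k z
  unfold HasLineDerivAt at h1 ⊢
  refine (h0.fun_mul h1).congr_deriv ?_
  simp only [zero_smul, add_zero, wH, ws]
  ring

theorem hasLineDerivAt_wL (k : Fin 3) (z : R3) : HasLineDerivAt ℝ (wL δ) (wL1 δ k z) z (e3 k) := by
  have h1 := hasLineDerivAt_wq hδ k z
  unfold HasLineDerivAt at h1 ⊢
  refine ((h1.const_mul 2).fun_add ((h1.fun_pow 3).const_mul (δ ^ 2))).congr_deriv ?_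
  simp only [zero_smul, add_zero, wL1]
  push_cast
  ring

theorem hasLineDerivAt_wL1 (k : Fin 3) (z : R3) : HasLineDerivAt ℝ (wL1 δ k) (wL2 δ k z) z (e3 k) := by
  have h1 := hasLineDerivAt_wq hδ k z
  have h2 := hasLineDerivAt_ws hδ k k z
  unfold HasLineDerivAt at h1 h2 ⊢
  refine (((h2.fun_mul (h1.fun_pow 2)).const_mul (-2)).fun_sub
    ((h2.fun_mul (h1.fun_pow 4)).const_mul (3 * δ ^ 2))).congr_deriv ?_
  simp only [zero_smul, add_zero, wL2, wH, if_true]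
  push_cast
  ring

omit hδ in
theorem wq_neg (z : R3) : wq δ (-z) = wq δ z := by simp [wq]

omit hδ in
theorem wH_neg (l k : Fin 3) (z : R3) : wH δ l k (-z) = wH δ l k z := by simp [wH, ws, wq_neg]

/-- The Hessian of the weight is positive semidefinite. -/
theorem sum_wH_mul_nonneg (z : R3) (v : Fin 3 → ℝ) : 0 ≤ ∑ l, ∑ k, wH δ l k z * (v l * v k) := by
  have h := sum_ws_sq hδ z
  have hq := wq_pos hδ z
  -- The Hessian is q(Id − s ⊗ s) with |s| ≤ 1, so nonnegativity is Cauchy–Schwarz.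
  have e : ∑ l, ∑ k, wH δ l k z * (v l * v k) = wq δ z * ((∑ l, v l ^ 2) - (∑ l, ws δ l z * v l) ^ 2) := by
    simp only [Fin.sum_univ_three, wH]
    simp
    ring
  rw [e]
  refine mul_nonneg hq.le (sub_nonneg.2 ?_)
  have := Finset.sum_mul_sq_le_sq_mul_sq Finset.univ (fun l => ws δ l z) v
  refine this.trans ?_
  have h2 : 0 ≤ δ ^ 2 * wq δ z ^ 2 := by positivity
  have h3 : 0 ≤ ∑ l, v l ^ 2 := Finset.sum_nonneg fun l _ => sq_nonneg _
  nlinarith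

end Weight

theorem HasLineDerivAt.comp_sub {f : R3 → ℝ} {f' : ℝ} {x y v : R3} (h : HasLineDerivAt ℝ f f' (x - y) v) :
    HasLineDerivAt ℝ (fun x => f (x - y)) f' x v := by
  unfold HasLineDerivAt at h ⊢
  simpa [add_sub_right_comm] using h

theorem HasLineDerivAt.comp_const_sub {f : R3 → ℝ} {f' : ℝ} {x y v : R3} (h : HasLineDerivAt ℝ f f' (x - y) v) :
    HasLineDerivAt ℝ (fun y => f (x - y)) (-f') y v := by
  unfold HasLineDerivAt at h ⊢
  have h' : HasDerivAt (fun t : ℝ => f (x - y + t • v)) f' (-0) := by simpa using h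
  have := h'.scomp (0 : ℝ) (hasDerivAt_neg (0 : ℝ))
  simpa [Function.comp_def, sub_add_eq_sub_sub, ← sub_eq_add_neg] using this

/-! ### The localized virial identity -/

/-- The momentum density is ⟨iu, ∂ₗu⟩ = Im(ū ∂ₗu). One integration by parts moves the spatial
derivative off ∂ₜ∂ₗu, after which the remaining factors i cancel in pairs. -/
theorem wint_momentum_deriv (ρ : BumpKernel) (w G : L2R3) {b : Fin 3 → R3 → ℝ} {b2 : Fin 3 → Fin 3 → R3 → ℝ}
    {L : R3 → ℝ} (hb : ∀ l, IsBddCont (b l)) (hb2 : ∀ l k, IsBddCont (b2 l k))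
    (db : ∀ l k x, HasLineDerivAt ℝ (b l) (b2 l k x) x (e3 k)) (hbL : ∀ x, L x = ∑ l, b2 l l x) :
    ∑ l, (wint (b l) (fun x => Complex.I * mol ρ w x)
        (fun x => Complex.I * (molLap (ρ.d (e3 l)) w x - mol (ρ.d (e3 l)) G x)) +
      wint (b l) (fun x => Complex.I * (Complex.I * (molLap ρ w x - mol ρ G x))) (mol (ρ.d (e3 l)) w)) =
    -((∑ l, 2 * wint (b l) (mol (ρ.d (e3 l)) w) (fun x => molLap ρ w x - mol ρ G x)) +
      wint L (mol ρ w) (fun x => molLap ρ w x - mol ρ G x)) := by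
  have hI : ∀ ψ : BumpKernel, MemLp (fun x => Complex.I * mol ψ w x) 2 volume := fun ψ =>
    (mol_memLp_two ψ (Lp.memLp w)).const_mul _
  have hZ := memLp_mol_rhs ρ w G
  have hY : MemLp (fun x => molLap ρ w x - mol ρ G x) 2 volume :=
    (memLp_molLap ρ w).sub (mol_memLp_two ρ (Lp.memLp G))
  have dI : ∀ (v x : R3), HasLineDerivAt ℝ (fun x => Complex.I * mol ρ w x) (Complex.I * mol (ρ.d v) w x) x v :=
    fun v x => by
      have := mol_hasLineDerivAt ρ (Lp.memLp w) x v
      unfold HasLineDerivAt at this ⊢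
      exact this.const_mul Complex.I
  have e1 : ∀ l, wint (b l) (fun x => Complex.I * mol ρ w x)
        (fun x => Complex.I * (molLap (ρ.d (e3 l)) w x - mol (ρ.d (e3 l)) G x)) =
      -(wint (b2 l l) (mol ρ w) (fun x => molLap ρ w x - mol ρ G x) +
        wint (b l) (mol (ρ.d (e3 l)) w) (fun x => molLap ρ w x - mol ρ G x)) := fun l => by
    rw [wint_by_parts (hb l) (hb2 l l) (db l l) (hI ρ) (hI (ρ.d (e3 l))) hZ (memLp_mol_rhs (ρ.d (e3 l)) w G)
      (fun x => dI (e3 l) x) fun x => hasLineDerivAt_mol_rhs ρ w G l x, wint_I_mul_I_mul, wint_I_mul_I_mul]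
  have e2 : ∀ l, wint (b l) (fun x => Complex.I * (Complex.I * (molLap ρ w x - mol ρ G x))) (mol (ρ.d (e3 l)) w) =
      -wint (b l) (mol (ρ.d (e3 l)) w) (fun x => molLap ρ w x - mol ρ G x) := fun l => by
    rw [wint_I_mul_left, wint_I_mul_I_mul, wint_comm]
  have e3' : wint L (mol ρ w) (fun x => molLap ρ w x - mol ρ G x) =
      ∑ l, wint (b2 l l) (mol ρ w) (fun x => molLap ρ w x - mol ρ G x) := by
    rw [← wint_sum_weight Finset.univ (fun l => hb2 l l) (mol_memLp_two ρ (Lp.memLp w)) hY]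
    congr 1
    exact funext hbL
  simp only [e1, e2, e3', Fin.sum_univ_three]
  ring

/-! ### Mass, momentum and stress densities, and the virial identity for solutions -/

namespace H1Pair

/-- The mass density of the mollification. -/
noncomputable def mass (ρ : BumpKernel) (u : H1Pair) (x : R3) : ℝ := ∑ i, ‖mol ρ (H1.fn (u i)) x‖ ^ 2

/-- The momentum density of the mollification. -/
noncomputable def mom (ρ : BumpKernel) (u : H1Pair) (l : Fin 3) (x : R3) : ℝ :=
  ∑ i, inner ℝ (Complex.I * mol ρ (H1.fn (u i)) x) (mol (ρ.d (e3 l)) (H1.fn (u i)) x)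

/-- The momentum flux of the mollification. -/
noncomputable def stress (ρ : BumpKernel) (u : H1Pair) (l k : Fin 3) (x : R3) : ℝ :=
  ∑ i, inner ℝ (mol (ρ.d (e3 l)) (H1.fn (u i)) x) (mol (ρ.d (e3 k)) (H1.fn (u i)) x)

/-- The potential energy density of the mollification. -/
noncomputable def pot (c₁ c₂ c₁₂ : ℝ) (ρ : BumpKernel) (u : H1Pair) (x : R3) : ℝ :=
  gpPot c₁ c₂ c₁₂ fun j => mol ρ (H1.fn (u j)) x

variable (c₁ c₂ c₁₂ : ℝ)

/-- The time derivative of the mollification of a solution. -/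
noncomputable def molRhs (ρ : BumpKernel) (u : H1Pair) (i : Fin 2) (x : R3) : ℂ :=
  Complex.I * (molLap ρ (H1.fn (u i)) x - mol ρ (gpn c₁ c₂ c₁₂ i u) x)

/-- The time derivative of the mass density. -/
noncomputable def massDeriv (ρ : BumpKernel) (u : H1Pair) (x : R3) : ℝ :=
  ∑ i, 2 * inner ℝ (mol ρ (H1.fn (u i)) x) (molRhs c₁ c₂ c₁₂ ρ u i x)

/-- The time derivative of the momentum density. -/
noncomputable def momDeriv (ρ : BumpKernel) (u : H1Pair) (l : Fin 3) (x : R3) : ℝ :=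
  ∑ i, (inner ℝ (Complex.I * mol ρ (H1.fn (u i)) x) (molRhs c₁ c₂ c₁₂ (ρ.d (e3 l)) u i x) +
    inner ℝ (Complex.I * molRhs c₁ c₂ c₁₂ ρ u i x) (mol (ρ.d (e3 l)) (H1.fn (u i)) x))

section Static
variable (ρ : BumpKernel) (u : H1Pair)

theorem memLp_mol (ψ : BumpKernel) (i : Fin 2) : MemLp (mol ψ (H1.fn (u i))) 2 volume := mol_memLp_two ψ (Lp.memLp _)

theorem memLp_I_mul_mol (ψ : BumpKernel) (i : Fin 2) : MemLp (fun x => Complex.I * mol ψ (H1.fn (u i)) x) 2 volume :=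
  (memLp_mol u ψ i).const_mul _

theorem memLp_molRhs (ψ : BumpKernel) (i : Fin 2) : MemLp (molRhs c₁ c₂ c₁₂ ψ u i) 2 volume := memLp_mol_rhs ψ _ _

theorem memLp_nonlinear (i : Fin 2) :
    MemLp (fun x => gpNonlinearity c₁ c₂ c₁₂ (fun j => mol ρ (H1.fn (u j)) x) i) 2 volume := by
  refine (memLp_congr_ae ?_).1 ((molP ρ u).memLp_gpNonlinearity c₁ c₂ c₁₂ i)
  filter_upwards [comp_molP_ae ρ u] with x hx
  rw [hx]
  rfl

theorem memLp_defect (i : Fin 2) : MemLp (defect c₁ c₂ c₁₂ ρ i u) 2 volume :=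
  (memLp_nonlinear c₁ c₂ c₁₂ ρ u i).sub (mol_memLp_two ρ (Lp.memLp _))

theorem integrable_mass : Integrable (mass ρ u) volume := integrable_finsetSum _ fun _ _ => integrable_mol_sq ρ _

theorem integrable_mom (l : Fin 3) : Integrable (mom ρ u l) volume :=
  integrable_finsetSum _ fun i _ => integrable_inner (memLp_I_mul_mol u ρ i) (memLp_mol u _ i)

theorem integrable_stress (l k : Fin 3) : Integrable (stress ρ u l k) volume :=
  integrable_finsetSum _ fun i _ => integrable_inner (memLp_mol u _ i) (memLp_mol u _ i)

theorem integrable_pot : Integrable (pot c₁ c₂ c₁₂ ρ u) volume := integrable_gpPot_mol c₁ c₂ c₁₂ ρ u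

theorem integrable_massDeriv : Integrable (massDeriv c₁ c₂ c₁₂ ρ u) volume :=
  integrable_finsetSum _ fun i _ => (integrable_inner (memLp_mol u ρ i) (memLp_molRhs c₁ c₂ c₁₂ u ρ i)).const_mul 2

theorem integrable_momDeriv (l : Fin 3) : Integrable (momDeriv c₁ c₂ c₁₂ ρ u l) volume :=
  integrable_finsetSum _ fun i _ => (integrable_inner (memLp_I_mul_mol u ρ i) (memLp_molRhs c₁ c₂ c₁₂ u _ i)).add
    (integrable_inner ((memLp_molRhs c₁ c₂ c₁₂ u ρ i).const_mul Complex.I) (memLp_mol u _ i))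

theorem integral_weight_mul_sum {b : R3 → ℝ} (hb : IsBddCont b) {F G : Fin 2 → R3 → ℂ}
    (hF : ∀ i, MemLp (F i) 2 volume) (hG : ∀ i, MemLp (G i) 2 volume) :
    ∫ x, b x * ∑ i, inner ℝ (F i x) (G i x) = ∑ i, wint b (F i) (G i) := by
  simp only [Finset.mul_sum]
  exact integral_finsetSum _ fun i _ => integrable_wint hb (hF i) (hG i)

theorem hasLineDerivAt_pot (l : Fin 3) (x : R3) : HasLineDerivAt ℝ (pot c₁ c₂ c₁₂ ρ u)
    (∑ i, 2 * inner ℝ (gpNonlinearity c₁ c₂ c₁₂ (fun j => mol ρ (H1.fn (u j)) x) i)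
      (mol (ρ.d (e3 l)) (H1.fn (u i)) x)) x (e3 l) := by
  have h : ∀ i, HasDerivAt (fun t : ℝ => mol ρ (H1.fn (u i)) (x + t • e3 l)) (mol (ρ.d (e3 l)) (H1.fn (u i)) x) 0 :=
    fun i => mol_hasLineDerivAt ρ (Lp.memLp _) x (e3 l)
  have := hasDerivAt_gpPot c₁ c₂ c₁₂ (z := fun t j => mol ρ (H1.fn (u j)) (x + t • e3 l)) h
  unfold HasLineDerivAt
  refine this.congr_deriv ?_
  simp only [zero_smul, add_zero]

/-- Summed over the components, 2⟨∂ₗuᵢ, Nᵢ⟩ is the derivative of the potential density, so the first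
group equals −∫ L · pot. Euler's relation makes the second +2∫ L · pot. It is the sum over i that is
exact, which is where the symmetric coupling is used. -/
theorem sum_wint_nonlinearity {b : Fin 3 → R3 → ℝ} {b2 : Fin 3 → R3 → ℝ}
    {L : R3 → ℝ} (hb : ∀ l, IsBddCont (b l)) (hb2 : ∀ l, IsBddCont (b2 l)) (hL : IsBddCont L)
    (db : ∀ l x, HasLineDerivAt ℝ (b l) (b2 l x) x (e3 l)) (hbL : ∀ x, L x = ∑ l, b2 l x)
    {P : Fin 2 → R3 → ℂ} (hP : P = fun i x => gpNonlinearity c₁ c₂ c₁₂ (fun j => mol ρ (H1.fn (u j)) x) i) :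
    ∑ i, ((∑ l, 2 * wint (b l) (mol (ρ.d (e3 l)) (H1.fn (u i))) (P i)) + wint L (mol ρ (H1.fn (u i))) (P i)) =
      ∫ x, L x * pot c₁ c₂ c₁₂ ρ u x := by
  have hPm : ∀ i, MemLp (P i) 2 volume := fun i => by rw [hP]; exact memLp_nonlinear c₁ c₂ c₁₂ ρ u i
  have hp := integrable_pot c₁ c₂ c₁₂ ρ u
  have e1 : ∀ l, ∑ i, 2 * wint (b l) (mol (ρ.d (e3 l)) (H1.fn (u i))) (P i) =
      -∫ x, b2 l x * pot c₁ c₂ c₁₂ ρ u x := fun l => by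
    rw [← integral_weight_mul_deriv (hb l) (hb2 l) (db l) hp (integrable_finsetSum _ fun i _ =>
      (integrable_inner (memLp_nonlinear c₁ c₂ c₁₂ ρ u i) (memLp_mol u _ i)).const_mul 2)
      (hasLineDerivAt_pot c₁ c₂ c₁₂ ρ u l), ← Finset.mul_sum]
    simp only [wint_comm (G := P _)]
    rw [← integral_weight_mul_sum (hb l) hPm (fun i => memLp_mol u _ i), ← integral_const_mul]
    refine integral_congr_ae (Filter.Eventually.of_forall fun x => ?_)
    simp only [← Finset.mul_sum, hP]
    ring
  have e2 : ∑ i, wint L (mol ρ (H1.fn (u i))) (P i) = 2 * ∫ x, L x * pot c₁ c₂ c₁₂ ρ u x := by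
    rw [← integral_weight_mul_sum hL (fun i => memLp_mol u _ i) hPm, ← integral_const_mul]
    refine integral_congr_ae (Filter.Eventually.of_forall fun x => ?_)
    simp only [hP]
    rw [sum_inner_gpNonlinearity c₁ c₂ c₁₂ fun j => mol ρ (H1.fn (u j)) x, pot]
    ring
  have e4 : ∫ x, L x * pot c₁ c₂ c₁₂ ρ u x = ∑ l, ∫ x, b2 l x * pot c₁ c₂ c₁₂ ρ u x := by
    rw [← integral_finsetSum _ fun l _ => (hb2 l).integrable_mul hp]
    refine integral_congr_ae (Filter.Eventually.of_forall fun x => ?_)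
    simp only [hbL, Finset.sum_mul]
  rw [Finset.sum_add_distrib, Finset.sum_comm, e2]
  simp only [e1]
  rw [Finset.sum_neg_distrib, ← e4]
  ring

/-- The mollified source is written as the nonlinearity of the mollified pair minus the defect; the
first yields the potential term, the second the error. -/
theorem virial {b : Fin 3 → R3 → ℝ} {b2 : Fin 3 → Fin 3 → R3 → ℝ} {L : R3 → ℝ}
    {L1 L2 : Fin 3 → R3 → ℝ} (hb : ∀ l, IsBddCont (b l)) (hb2 : ∀ l k, IsBddCont (b2 l k)) (hL : IsBddCont L)
    (hL1 : ∀ k, IsBddCont (L1 k)) (hL2 : ∀ k, IsBddCont (L2 k))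
    (db : ∀ l k x, HasLineDerivAt ℝ (b l) (b2 l k x) x (e3 k)) (hbL : ∀ x, L x = ∑ l, b2 l l x)
    (dL : ∀ k x, HasLineDerivAt ℝ L (L1 k x) x (e3 k)) (dL1 : ∀ k x, HasLineDerivAt ℝ (L1 k) (L2 k x) x (e3 k)) :
    ∑ l, ∫ x, b l x * momDeriv c₁ c₂ c₁₂ ρ u l x =
      2 * (∑ l, ∑ k, ∫ x, b2 l k x * stress ρ u l k x) - (1 / 2) * (∫ x, (∑ k, L2 k x) * mass ρ u x) +
      (∫ x, L x * pot c₁ c₂ c₁₂ ρ u x) -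
      ∑ i, ((∑ l, 2 * wint (b l) (mol (ρ.d (e3 l)) (H1.fn (u i))) (defect c₁ c₂ c₁₂ ρ i u)) +
        wint L (mol ρ (H1.fn (u i))) (defect c₁ c₂ c₁₂ ρ i u)) := by
  have hm : ∀ (ψ : BumpKernel) i, MemLp (mol ψ (H1.fn (u i))) 2 volume := fun ψ i => mol_memLp_two ψ (Lp.memLp _)
  have hG : ∀ i, MemLp (mol ρ (gpn c₁ c₂ c₁₂ i u)) 2 volume := fun i => mol_memLp_two ρ (Lp.memLp _)
  have hlap : ∀ i, MemLp (molLap ρ (H1.fn (u i))) 2 volume := fun i => memLp_molLap ρ _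
  have hP := memLp_nonlinear c₁ c₂ c₁₂ ρ u
  have e0 : ∀ l, ∫ x, b l x * momDeriv c₁ c₂ c₁₂ ρ u l x =
      ∑ i, (wint (b l) (fun x => Complex.I * mol ρ (H1.fn (u i)) x) (molRhs c₁ c₂ c₁₂ (ρ.d (e3 l)) u i) +
        wint (b l) (fun x => Complex.I * molRhs c₁ c₂ c₁₂ ρ u i x) (mol (ρ.d (e3 l)) (H1.fn (u i)))) := fun l => by
    have i1 := fun i => integrable_wint (hb l) (memLp_I_mul_mol u ρ i) (memLp_molRhs c₁ c₂ c₁₂ u (ρ.d (e3 l)) i)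
    have i2 := fun i => integrable_wint (hb l) ((memLp_molRhs c₁ c₂ c₁₂ u ρ i).const_mul Complex.I) (hm (ρ.d (e3 l)) i)
    simp only [momDeriv, Finset.mul_sum, mul_add]
    refine (integral_finsetSum _ fun i _ => (i1 i).add (i2 i)).trans ?_
    exact Finset.sum_congr rfl fun i _ => integral_add (i1 i) (i2 i)
  have e1 : ∀ i, ∑ l, (wint (b l) (fun x => Complex.I * mol ρ (H1.fn (u i)) x) (molRhs c₁ c₂ c₁₂ (ρ.d (e3 l)) u i) +
        wint (b l) (fun x => Complex.I * molRhs c₁ c₂ c₁₂ ρ u i x) (mol (ρ.d (e3 l)) (H1.fn (u i)))) =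
      -((∑ l, 2 * wint (b l) (mol (ρ.d (e3 l)) (H1.fn (u i))) (molLap ρ (H1.fn (u i)))) +
          wint L (mol ρ (H1.fn (u i))) (molLap ρ (H1.fn (u i)))) +
      ((∑ l, 2 * wint (b l) (mol (ρ.d (e3 l)) (H1.fn (u i))) (mol ρ (gpn c₁ c₂ c₁₂ i u))) +
          wint L (mol ρ (H1.fn (u i))) (mol ρ (gpn c₁ c₂ c₁₂ i u))) := fun i => by
    have hs := fun l => wint_sub (hb l) (hm (ρ.d (e3 l)) i) (hlap i) (hG i)
    refine (wint_momentum_deriv ρ (H1.fn (u i)) (gpn c₁ c₂ c₁₂ i u) hb hb2 db hbL).trans ?_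
    simp only [hs, wint_sub hL (hm ρ i) (hlap i) (hG i), Fin.sum_univ_three]
    ring
  have e2 := fun i => wint_molLap_eq ρ (H1.fn (u i)) hb hb2 hL hL1 hL2 db hbL dL dL1
  have e3' : ∀ i, (∑ l, 2 * wint (b l) (mol (ρ.d (e3 l)) (H1.fn (u i))) (defect c₁ c₂ c₁₂ ρ i u)) +
        wint L (mol ρ (H1.fn (u i))) (defect c₁ c₂ c₁₂ ρ i u) =
      ((∑ l, 2 * wint (b l) (mol (ρ.d (e3 l)) (H1.fn (u i))) (fun x => gpNonlinearity c₁ c₂ c₁₂ (fun j => mol ρ (H1.fn (u j)) x) i)) +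
        wint L (mol ρ (H1.fn (u i))) (fun x => gpNonlinearity c₁ c₂ c₁₂ (fun j => mol ρ (H1.fn (u j)) x) i)) -
      ((∑ l, 2 * wint (b l) (mol (ρ.d (e3 l)) (H1.fn (u i))) (mol ρ (gpn c₁ c₂ c₁₂ i u))) +
          wint L (mol ρ (H1.fn (u i))) (mol ρ (gpn c₁ c₂ c₁₂ i u))) := fun i => by
    have hs := fun l => wint_sub (hb l) (hm (ρ.d (e3 l)) i) (hP i) (hG i)
    have hd : defect c₁ c₂ c₁₂ ρ i u = fun x => gpNonlinearity c₁ c₂ c₁₂ (fun j => mol ρ (H1.fn (u j)) x) i -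
      mol ρ (gpn c₁ c₂ c₁₂ i u) x := rfl
    simp only [hd, hs, wint_sub hL (hm ρ i) (hP i) (hG i), Fin.sum_univ_three]
    ring
  have e4 := sum_wint_nonlinearity c₁ c₂ c₁₂ ρ u hb (fun l => hb2 l l) hL (fun l => db l l) hbL rfl
  have e5 : ∀ l k, ∫ x, b2 l k x * stress ρ u l k x =
      ∑ i, wint (b2 l k) (mol (ρ.d (e3 l)) (H1.fn (u i))) (mol (ρ.d (e3 k)) (H1.fn (u i))) := fun l k =>
    integral_weight_mul_sum (hb2 l k) (hm _) (hm _)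
  have e6 : ∫ x, (∑ k, L2 k x) * mass ρ u x = ∑ i, ∑ k, wint (L2 k) (mol ρ (H1.fn (u i))) (mol ρ (H1.fn (u i))) := by
    have h1 : ∀ k, ∫ x, L2 k x * mass ρ u x = ∑ i, wint (L2 k) (mol ρ (H1.fn (u i))) (mol ρ (H1.fn (u i))) := fun k => by
      rw [← integral_weight_mul_sum (hL2 k) (hm ρ) (hm ρ)]
      simp only [mass, real_inner_self_eq_norm_sq]
    rw [Finset.sum_comm]
    simp only [← h1, Finset.sum_mul]
    exact integral_finsetSum _ fun k _ => (hL2 k).integrable_mul (integrable_mass ρ u)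
  simp only [e0]
  rw [Finset.sum_comm]
  simp only [e1, e2, e3', e5, e6]
  rw [Finset.sum_sub_distrib, e4]
  simp only [Fin.sum_univ_two, Fin.sum_univ_three]
  ring

end Static

end H1Pair

/-! ### Interaction integrals -/

/-- The double integral `∬ c (x - y) F x G y`. -/
noncomputable def dint (c F G : R3 → ℝ) : ℝ := ∫ z : R3 × R3, F z.1 * G z.2 * c (z.1 - z.2)

section Dint
variable {c F G F' G' : R3 → ℝ}

theorem integrable_dint (hc : IsBddCont c) (hF : Integrable F volume) (hG : Integrable G volume) :
    Integrable (fun z : R3 × R3 => F z.1 * G z.2 * c (z.1 - z.2)) volume := by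
  obtain ⟨C, -, hC⟩ := hc.bdd
  have hm : Continuous fun z : R3 × R3 => c (z.1 - z.2) := hc.continuous.comp (continuous_fst.sub continuous_snd)
  exact (hF.mul_prod hG).mul_bdd hm.aestronglyMeasurable (Filter.Eventually.of_forall fun z => hC _)

theorem dint_eq_integral_right (hc : IsBddCont c) (hF : Integrable F volume) (hG : Integrable G volume) :
    dint c F G = ∫ y, G y * ∫ x, c (x - y) * F x := by
  rw [dint, Measure.volume_eq_prod, integral_prod_symm _ (integrable_dint hc hF hG)]
  refine integral_congr_ae (Filter.Eventually.of_forall fun y => ?_)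
  simp only [← integral_const_mul]
  refine integral_congr_ae (Filter.Eventually.of_forall fun x => ?_)
  simp only
  ring

theorem integrable_dint_right (hc : IsBddCont c) (hF : Integrable F volume) (hG : Integrable G volume) :
    Integrable (fun y => G y * ∫ x, c (x - y) * F x) volume := by
  refine ((integrable_dint hc hF hG).integral_prod_right (μ := volume) (ν := volume)).congr
    (Filter.Eventually.of_forall fun y => ?_)
  simp only [← integral_const_mul]
  refine integral_congr_ae (Filter.Eventually.of_forall fun x => ?_)
  simp only
  ring

theorem dint_swap (he : ∀ z, c (-z) = c z) : dint c F G = dint c G F := by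
  unfold dint
  rw [Measure.volume_eq_prod, ← integral_prod_swap]
  refine integral_congr_ae (Filter.Eventually.of_forall fun z => ?_)
  simp only [Prod.fst_swap, Prod.snd_swap]
  rw [← neg_sub z.1 z.2, he]
  ring

theorem dint_eq_integral_left (hc : IsBddCont c) (hF : Integrable F volume) (hG : Integrable G volume) :
    dint c F G = ∫ x, F x * ∫ y, c (x - y) * G y := by
  rw [dint, Measure.volume_eq_prod, integral_prod _ (integrable_dint hc hF hG)]
  refine integral_congr_ae (Filter.Eventually.of_forall fun x => ?_)
  simp only [← integral_const_mul]
  refine integral_congr_ae (Filter.Eventually.of_forall fun y => ?_)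
  simp only
  ring

theorem integrable_dint_left (hc : IsBddCont c) (hF : Integrable F volume) (hG : Integrable G volume) :
    Integrable (fun x => F x * ∫ y, c (x - y) * G y) volume := by
  refine ((integrable_dint hc hF hG).integral_prod_left (μ := volume) (ν := volume)).congr
    (Filter.Eventually.of_forall fun x => ?_)
  simp only [← integral_const_mul]
  refine integral_congr_ae (Filter.Eventually.of_forall fun y => ?_)
  simp only
  ring

theorem norm_dint_le {C : ℝ} (hC : ∀ z, ‖c z‖ ≤ C) {a b : ℝ} (ha : 0 ≤ a)
    (hF : Integrable F volume) (hG : Integrable G volume) (hFa : ∫ x, ‖F x‖ ≤ a) (hGb : ∫ x, ‖G x‖ ≤ b) :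
    |dint c F G| ≤ C * (a * b) := by
  have hC0 : 0 ≤ C := (norm_nonneg _).trans (hC 0)
  have h1 : ∀ z : R3 × R3, ‖F z.1 * G z.2 * c (z.1 - z.2)‖ ≤ C * (‖F z.1‖ * ‖G z.2‖) := fun z => by
    rw [norm_mul, norm_mul, mul_comm C]
    exact mul_le_mul_of_nonneg_left (hC _) (by positivity)
  have h2 := (hF.norm.mul_prod hG.norm).const_mul C
  refine (norm_integral_le_of_norm_le h2 (Filter.Eventually.of_forall h1)).trans ?_
  rw [integral_const_mul, integral_prod_mul (fun x => ‖F x‖) fun y => ‖G y‖]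
  exact mul_le_mul_of_nonneg_left (mul_le_mul hFa hGb (integral_nonneg fun _ => norm_nonneg _) ha) hC0

theorem dint_nonneg (hc : ∀ z, 0 ≤ c z) (hF : ∀ x, 0 ≤ F x) (hG : ∀ x, 0 ≤ G x) : 0 ≤ dint c F G :=
  integral_nonneg fun _ => mul_nonneg (mul_nonneg (hF _) (hG _)) (hc _)

end Dint

/-- With a = u(x), c = v(y) and gradients A, B, the vectors on the right are (∇ₓ − ∇ᵧ)(u(x)v(y)) and
(∇ₓ + ∇ᵧ)(u(x) v̄(y)). The stress–momentum combination is half the sum of their quadratic forms. -/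
theorem momentum_pair_identity (a c : ℂ) (A B : Fin 3 → ℂ) (l k : Fin 3) :
    2 * (inner ℝ (A l) (A k) * ‖c‖ ^ 2 + ‖a‖ ^ 2 * inner ℝ (B l) (B k) -
      inner ℝ (Complex.I * a) (A l) * inner ℝ (Complex.I * c) (B k) -
      inner ℝ (Complex.I * a) (A k) * inner ℝ (Complex.I * c) (B l)) =
    (A l * c - a * B l).re * (A k * c - a * B k).re + (A l * c - a * B l).im * (A k * c - a * B k).im +
    ((A l * star c + a * star (B l)).re * (A k * star c + a * star (B k)).re +
      (A l * star c + a * star (B l)).im * (A k * star c + a * star (B k)).im) := by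
  simp only [Complex.inner, ← Complex.normSq_eq_norm_sq, Complex.normSq_apply, Complex.star_def, Complex.mul_re, Complex.mul_im, Complex.sub_re,
    Complex.sub_im, Complex.add_re, Complex.add_im, Complex.conj_re, Complex.conj_im, Complex.I_re, Complex.I_im]
  ring

theorem sum_momentum_pair_nonneg {H : Fin 3 → Fin 3 → ℝ} (hH : ∀ v : Fin 3 → ℝ, 0 ≤ ∑ l, ∑ k, H l k * (v l * v k))
    (a c : ℂ) (A B : Fin 3 → ℂ) :
    0 ≤ ∑ l, ∑ k, H l k * (inner ℝ (A l) (A k) * ‖c‖ ^ 2 + ‖a‖ ^ 2 * inner ℝ (B l) (B k) -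
      inner ℝ (Complex.I * a) (A l) * inner ℝ (Complex.I * c) (B k) -
      inner ℝ (Complex.I * a) (A k) * inner ℝ (Complex.I * c) (B l)) := by
  have h1 := hH fun l => (A l * c - a * B l).re
  have h2 := hH fun l => (A l * c - a * B l).im
  have h3 := hH fun l => (A l * star c + a * star (B l)).re
  have h4 := hH fun l => (A l * star c + a * star (B l)).im
  refine nonneg_of_mul_nonneg_right (a := 2) ?_ two_pos
  simp only [Finset.mul_sum, mul_left_comm (2 : ℝ), momentum_pair_identity, mul_add, Finset.sum_add_distrib]
  linarith

namespace H1Pair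
variable (c₁ c₂ c₁₂ : ℝ) (ρ : BumpKernel) (u : H1Pair)

/-- Mass, momentum and stress are sums over components, so the combination is the sum over all pairs
of components, one taken at x and one at y, of nonnegative scalar expressions. -/
theorem sum_weight_stress_nonneg {H : Fin 3 → Fin 3 → ℝ} (hH : ∀ v : Fin 3 → ℝ, 0 ≤ ∑ l, ∑ k, H l k * (v l * v k))
    (x y : R3) :
    0 ≤ ∑ l, ∑ k, H l k * (stress ρ u l k x * mass ρ u y + mass ρ u x * stress ρ u l k y -
      mom ρ u l x * mom ρ u k y - mom ρ u k x * mom ρ u l y) := by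
  have h := Finset.sum_nonneg fun i (_ : i ∈ Finset.univ) => Finset.sum_nonneg fun j (_ : j ∈ Finset.univ) =>
    sum_momentum_pair_nonneg hH (mol ρ (H1.fn (u i)) x) (mol ρ (H1.fn (u j)) y)
    (fun l => mol (ρ.d (e3 l)) (H1.fn (u i)) x) fun l => mol (ρ.d (e3 l)) (H1.fn (u j)) y
  refine h.trans_eq ?_
  simp only [Finset.sum_comm (s := (Finset.univ : Finset (Fin 2))) (t := (Finset.univ : Finset (Fin 3))), ← Finset.mul_sum]
  refine Finset.sum_congr rfl fun l _ => Finset.sum_congr rfl fun k _ => ?_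
  simp only [stress, mass, mom, Finset.sum_sub_distrib, Finset.sum_add_distrib, Finset.sum_mul_sum]

/-- The continuity equation, tested against b: integrating the Laplacian by parts leaves only the
gradient of the weight, since each derivative is orthogonal to i times itself. The nonlinearity
drops out by gauge invariance, up to the defect. -/
theorem wint_mass_deriv (ρ : BumpKernel) (w G : L2R3) {P : R3 → ℂ} (hP : MemLp P 2 volume)
    (h0 : ∀ x, inner ℝ (mol ρ w x) (Complex.I * P x) = 0) {b : R3 → ℝ} {b1 : Fin 3 → R3 → ℝ} (hb : IsBddCont b)
    (hb1 : ∀ k, IsBddCont (b1 k)) (db : ∀ k x, HasLineDerivAt ℝ b (b1 k x) x (e3 k)) :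
    wint b (mol ρ w) (fun x => Complex.I * (molLap ρ w x - mol ρ G x)) =
      (∑ k, wint (b1 k) (fun x => Complex.I * mol ρ w x) (mol (ρ.d (e3 k)) w)) +
      wint b (mol ρ w) (fun x => Complex.I * (P x - mol ρ G x)) := by
  have hm : ∀ ψ : BumpKernel, MemLp (mol ψ w) 2 volume := fun ψ => mol_memLp_two ψ (Lp.memLp w)
  have hG : MemLp (mol ρ G) 2 volume := mol_memLp_two ρ (Lp.memLp G)
  have hl := memLp_molLap ρ w
  have e1 : wint b (mol ρ w) (fun x => Complex.I * (molLap ρ w x - mol ρ G x)) =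
      wint b (mol ρ w) (fun x => Complex.I * molLap ρ w x) - wint b (mol ρ w) (fun x => Complex.I * mol ρ G x) := by
    rw [← wint_sub hb (hm ρ) (hl.const_mul _) (hG.const_mul _)]
    simp only [mul_sub]
  have e2 : wint b (mol ρ w) (fun x => Complex.I * (P x - mol ρ G x)) =
      - wint b (mol ρ w) (fun x => Complex.I * mol ρ G x) := by
    have : wint b (mol ρ w) (fun x => Complex.I * P x) = 0 := by
      simp only [wint, h0, mul_zero, integral_zero]
    rw [← zero_sub, ← this, ← wint_sub hb (hm ρ) (hP.const_mul _) (hG.const_mul _)]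
    simp only [mul_sub]
  have e3' : wint b (mol ρ w) (fun x => Complex.I * molLap ρ w x) =
      ∑ k, wint b (mol ρ w) (fun x => Complex.I * mol ((ρ.d (e3 k)).d (e3 k)) w x) := by
    rw [← wint_sum Finset.univ hb (hm ρ) fun k => (hm _).const_mul _]
    congr 1
    funext x
    rw [molLap, Finset.mul_sum]
  have e4 : ∀ k, wint b (mol ρ w) (fun x => Complex.I * mol ((ρ.d (e3 k)).d (e3 k)) w x) =
      wint (b1 k) (fun x => Complex.I * mol ρ w x) (mol (ρ.d (e3 k)) w) := fun k => by
    have dI : ∀ x, HasLineDerivAt ℝ (fun x => Complex.I * mol (ρ.d (e3 k)) w x)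
        (Complex.I * mol ((ρ.d (e3 k)).d (e3 k)) w x) x (e3 k) := fun x => by
      have := mol_hasLineDerivAt (ρ.d (e3 k)) (Lp.memLp w) x (e3 k)
      unfold HasLineDerivAt at this ⊢
      exact this.const_mul Complex.I
    have hz : wint b (mol (ρ.d (e3 k)) w) (fun x => Complex.I * mol (ρ.d (e3 k)) w x) = 0 := by
      simp only [wint, inner_self_I_mul, mul_zero, integral_zero]
    rw [wint_by_parts hb (hb1 k) (db k) (hm ρ) (hm _) ((hm _).const_mul _) ((hm _).const_mul _)
      (fun x => mol_hasLineDerivAt ρ (Lp.memLp w) x (e3 k)) dI, hz, add_zero, wint_I_mul_left]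
  rw [e1, e2, e3', Finset.sum_congr rfl fun k _ => e4 k]
  ring

theorem integral_weight_mul_massDeriv {b : R3 → ℝ} {b1 : Fin 3 → R3 → ℝ} (hb : IsBddCont b)
    (hb1 : ∀ k, IsBddCont (b1 k)) (db : ∀ k x, HasLineDerivAt ℝ b (b1 k x) x (e3 k)) :
    ∫ x, b x * massDeriv c₁ c₂ c₁₂ ρ u x = 2 * (∑ k, ∫ x, b1 k x * mom ρ u k x) +
      2 * ∑ i, wint b (mol ρ (H1.fn (u i))) (fun x => Complex.I * defect c₁ c₂ c₁₂ ρ i u x) := by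
  have e1 : ∫ x, b x * massDeriv c₁ c₂ c₁₂ ρ u x =
      2 * ∑ i, wint b (mol ρ (H1.fn (u i))) (molRhs c₁ c₂ c₁₂ ρ u i) := by
    rw [← integral_weight_mul_sum hb (fun i => memLp_mol u ρ i) (fun i => memLp_molRhs c₁ c₂ c₁₂ u ρ i),
      ← integral_const_mul]
    refine integral_congr_ae (Filter.Eventually.of_forall fun x => ?_)
    simp only [massDeriv, ← Finset.mul_sum]
    ring
  have e2 : ∀ i, wint b (mol ρ (H1.fn (u i))) (molRhs c₁ c₂ c₁₂ ρ u i) = _ := fun i =>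
    wint_mass_deriv ρ (H1.fn (u i)) (gpn c₁ c₂ c₁₂ i u) (memLp_nonlinear c₁ c₂ c₁₂ ρ u i)
      (fun x => inner_I_mul_gpNonlinearity c₁ c₂ c₁₂ (fun j => mol ρ (H1.fn (u j)) x) i) hb hb1 db
  have e4 : ∀ k, ∫ x, b1 k x * mom ρ u k x =
      ∑ i, wint (b1 k) (fun x => Complex.I * mol ρ (H1.fn (u i)) x) (mol (ρ.d (e3 k)) (H1.fn (u i))) := fun k =>
    integral_weight_mul_sum (hb1 k) (fun i => memLp_I_mul_mol u ρ i) (fun i => memLp_mol u _ i)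
  simp only [e1, e2, e4]
  rw [Finset.sum_add_distrib, Finset.sum_comm, mul_add]
  rfl

end H1Pair

/-! ### The interaction Morawetz inequality for a regularized state -/

theorem integral_norm_inner_le {F G : R3 → ℂ} (hF : MemLp F 2 volume) (hG : MemLp G 2 volume) {a b : ℝ}
    (ha : 0 ≤ a) (hb : 0 ≤ b)
    (hFa : eLpNorm F 2 volume ≤ ENNReal.ofReal a) (hGb : eLpNorm G 2 volume ≤ ENNReal.ofReal b) :
    ∫ x, ‖(inner ℝ (F x) (G x) : ℝ)‖ ≤ a * b := by
  rw [integral_norm_eq_lintegral_enorm (integrable_inner hF hG).aestronglyMeasurable]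
  refine ENNReal.toReal_le_of_le_ofReal (mul_nonneg ha hb) ?_
  rw [ENNReal.ofReal_mul ha]
  exact (lintegral_mono fun x => enorm_inner_le _ _).trans
    ((IsL2Field.lintegral_enorm_mul_le hF.1 hG.1).trans (mul_le_mul' hFa hGb))

theorem integral_norm_sum_inner_le {F G : Fin 2 → R3 → ℂ} (hF : ∀ i, MemLp (F i) 2 volume)
    (hG : ∀ i, MemLp (G i) 2 volume) {a b : ℝ} (ha : 0 ≤ a) (hb : 0 ≤ b)
    (hFa : ∀ i, eLpNorm (F i) 2 volume ≤ ENNReal.ofReal a) (hGb : ∀ i, eLpNorm (G i) 2 volume ≤ ENNReal.ofReal b) :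
    ∫ x, ‖(∑ i, inner ℝ (F i x) (G i x) : ℝ)‖ ≤ 2 * (a * b) := by
  have h1 := fun i => (integrable_inner (hF i) (hG i)).norm
  refine (integral_mono (integrable_finsetSum _ fun i _ => integrable_inner (hF i) (hG i)).norm
    (integrable_finsetSum Finset.univ fun i _ => h1 i) fun x => norm_sum_le _ _).trans ?_
  rw [integral_finsetSum _ fun i _ => h1 i, Fin.sum_univ_two]
  have h2 := fun i => integral_norm_inner_le (hF i) (hG i) ha hb (hFa i) (hGb i)
  linarith [h2 0, h2 1]

theorem norm_wL_le {δ : ℝ} (hδ : 0 < δ) (z : R3) : ‖wL δ z‖ ≤ 3 * δ⁻¹ := by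
  have h1 := wq_le hδ z
  have h0 := (wq_pos hδ z).le
  rw [Real.norm_of_nonneg (wL_nonneg hδ z), wL]
  have h3 : δ ^ 2 * wq δ z ^ 3 ≤ δ ^ 2 * δ⁻¹ ^ 3 := by gcongr
  have h4 : δ ^ 2 * δ⁻¹ ^ 3 = δ⁻¹ := by field_simp
  linarith

namespace H1Pair
variable (c₁ c₂ c₁₂ : ℝ) (ρ : BumpKernel) (u : H1Pair)

theorem mass_nonneg (x : R3) : 0 ≤ mass ρ u x := Finset.sum_nonneg fun _ _ => sq_nonneg _

theorem mass_eq (x : R3) : mass ρ u x = ∑ i, inner ℝ (mol ρ (H1.fn (u i)) x) (mol ρ (H1.fn (u i)) x) := by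
  simp only [mass, real_inner_self_eq_norm_sq]

theorem integrable_inner_defect (ψ : BumpKernel) (i : Fin 2) :
    Integrable (fun x => inner ℝ (mol ψ (H1.fn (u i)) x) (defect c₁ c₂ c₁₂ ρ i u x)) volume :=
  integrable_inner (memLp_mol u ψ i) (memLp_defect c₁ c₂ c₁₂ ρ u i)

theorem memLp_I_mul_defect (i : Fin 2) : MemLp (fun x => Complex.I * defect c₁ c₂ c₁₂ ρ i u x) 2 volume :=
  (memLp_defect c₁ c₂ c₁₂ ρ u i).const_mul _

/-- The interaction functional. -/
noncomputable def interaction (δ : ℝ) : ℝ := ∑ l, dint (ws δ l) (mom ρ u l) (mass ρ u)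

/-- The time derivative of the interaction functional. -/
noncomputable def interactionDeriv (δ : ℝ) : ℝ :=
  ∑ l, (dint (ws δ l) (momDeriv c₁ c₂ c₁₂ ρ u l) (mass ρ u) + dint (ws δ l) (mom ρ u l) (massDeriv c₁ c₂ c₁₂ ρ u))

variable {δ : ℝ} (hδ : 0 < δ)
include hδ

/-- For each fixed y the virial identity is applied with the weight centred at y, and the result is
integrated against the mass density in y. The coefficient 15/2 is −1/2 times the −15 of the
bilaplacian. -/
theorem sum_dint_momDeriv : ∑ l, dint (ws δ l) (momDeriv c₁ c₂ c₁₂ ρ u l) (mass ρ u) =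
    2 * (∑ l, ∑ k, dint (wH δ l k) (stress ρ u l k) (mass ρ u)) +
      (15 / 2) * dint (fun z => δ ^ 4 * wq δ z ^ 7) (mass ρ u) (mass ρ u) +
      dint (wL δ) (pot c₁ c₂ c₁₂ ρ u) (mass ρ u) -
      ∑ i, ((∑ l, 2 * dint (ws δ l)
          (fun x => inner ℝ (mol (ρ.d (e3 l)) (H1.fn (u i)) x) (defect c₁ c₂ c₁₂ ρ i u x)) (mass ρ u)) +
        dint (wL δ) (fun x => inner ℝ (mol ρ (H1.fn (u i)) x) (defect c₁ c₂ c₁₂ ρ i u x)) (mass ρ u)) := by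
  have hm := integrable_mass ρ u
  have hk : IsBddCont fun z => δ ^ 4 * wq δ z ^ 7 := (IsBddCont.const _).mul ((isBddCont_wq hδ).pow 7)
  have hs := isBddCont_ws hδ
  have hH := isBddCont_wH hδ
  have hL := isBddCont_wL hδ
  have iS := integrable_stress ρ u
  have iP := integrable_pot c₁ c₂ c₁₂ ρ u
  have iD := integrable_momDeriv c₁ c₂ c₁₂ ρ u
  have iE := integrable_inner_defect c₁ c₂ c₁₂ ρ u
  have j1 := fun l => integrable_dint_right (hs l) (iD l) hm
  have j2 := fun l k => integrable_dint_right (hH l k) (iS l k) hm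
  have j3 := integrable_dint_right hk hm hm
  have j4 := integrable_dint_right hL iP hm
  have j5 := fun i l => integrable_dint_right (hs l) (iE (ρ.d (e3 l)) i) hm
  have j6 := fun i => integrable_dint_right hL (iE ρ i) hm
  simp only [dint_eq_integral_right (hs _) (iD _) hm, dint_eq_integral_right (hH _ _) (iS _ _) hm,
    dint_eq_integral_right hk hm hm, dint_eq_integral_right hL iP hm, dint_eq_integral_right (hs _) (iE _ _) hm,
    dint_eq_integral_right hL (iE _ _) hm]
  have key : ∀ y, ∑ l, mass ρ u y * ∫ x, ws δ l (x - y) * momDeriv c₁ c₂ c₁₂ ρ u l x =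
      2 * (∑ l, ∑ k, mass ρ u y * ∫ x, wH δ l k (x - y) * stress ρ u l k x) +
      (15 / 2) * (mass ρ u y * ∫ x, δ ^ 4 * wq δ (x - y) ^ 7 * mass ρ u x) +
      mass ρ u y * (∫ x, wL δ (x - y) * pot c₁ c₂ c₁₂ ρ u x) -
      ∑ i, ((∑ l, 2 * (mass ρ u y * ∫ x, ws δ l (x - y) *
          inner ℝ (mol (ρ.d (e3 l)) (H1.fn (u i)) x) (defect c₁ c₂ c₁₂ ρ i u x))) +
        mass ρ u y * ∫ x, wL δ (x - y) * inner ℝ (mol ρ (H1.fn (u i)) x) (defect c₁ c₂ c₁₂ ρ i u x)) := fun y => by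
    have hv := virial c₁ c₂ c₁₂ ρ u (fun l => (hs l).sub_right y) (fun l k => (hH l k).sub_right y) (hL.sub_right y)
      (fun k => (isBddCont_wL1 hδ k).sub_right y) (fun k => (isBddCont_wL2 hδ k).sub_right y)
      (fun l k x => (hasLineDerivAt_ws hδ l k (x - y)).comp_sub) (fun x => sum_wH hδ (x - y))
      (fun k x => (hasLineDerivAt_wL hδ k (x - y)).comp_sub) fun k x => (hasLineDerivAt_wL1 hδ k (x - y)).comp_sub
    have hw : ∫ x, (∑ k, wL2 δ k (x - y)) * mass ρ u x = -15 * ∫ x, δ ^ 4 * wq δ (x - y) ^ 7 * mass ρ u x := by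
      rw [← integral_const_mul]
      refine integral_congr_ae (Filter.Eventually.of_forall fun x => ?_)
      simp only [sum_wL2 hδ]
      ring
    rw [hw] at hv
    simp only [← Finset.mul_sum, mul_left_comm (2 : ℝ), ← mul_add] at hv ⊢
    rw [hv]
    simp only [wint]
    ring
  rw [← integral_finsetSum _ fun l _ => j1 l, integral_congr_ae (Filter.Eventually.of_forall key)]
  have j2' := integrable_finsetSum Finset.univ fun l _ => integrable_finsetSum Finset.univ fun k _ => j2 l k
  have j5' := fun i => integrable_finsetSum Finset.univ fun l _ => (j5 i l).const_mul 2
  have j7 := fun i => (j5' i).add (j6 i)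
  refine (integral_sub (((j2'.const_mul 2).add (j3.const_mul (15 / 2))).add j4)
    (integrable_finsetSum _ fun i _ => j7 i)).trans ?_
  refine congr_arg₂ _ ?_ ?_
  · refine (integral_add ((j2'.const_mul 2).add (j3.const_mul (15 / 2))) j4).trans (congr_arg₂ _ ?_ rfl)
    refine (integral_add (j2'.const_mul 2) (j3.const_mul (15 / 2))).trans ?_
    rw [integral_const_mul, integral_const_mul, integral_finsetSum _ fun l _ =>
      integrable_finsetSum Finset.univ fun k _ => j2 l k]
    simp only [integral_finsetSum _ fun k _ => j2 _ k]
  · refine (integral_finsetSum _ fun i _ => j7 i).trans (Finset.sum_congr rfl fun i _ => ?_)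
    refine (integral_add (j5' i) (j6 i)).trans (congr_arg₂ _ ?_ rfl)
    rw [integral_finsetSum _ fun l _ => (j5 i l).const_mul 2]
    simp only [integral_const_mul]

/-- The continuity equation in y for each fixed x. Differentiating ∂ₗa(x − y) in y produces the
Hessian with a minus sign. -/
theorem dint_massDeriv (l : Fin 3) : dint (ws δ l) (mom ρ u l) (massDeriv c₁ c₂ c₁₂ ρ u) =
    -2 * (∑ k, dint (wH δ l k) (mom ρ u l) (mom ρ u k)) +
      2 * dint (ws δ l) (mom ρ u l)
        (fun x => ∑ i, inner ℝ (mol ρ (H1.fn (u i)) x) (Complex.I * defect c₁ c₂ c₁₂ ρ i u x)) := by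
  have hs := isBddCont_ws hδ l
  have hH := isBddCont_wH hδ l
  have ip := integrable_mom ρ u
  have iE : Integrable (fun x => ∑ i, (inner ℝ (mol ρ (H1.fn (u i)) x) (Complex.I * defect c₁ c₂ c₁₂ ρ i u x) : ℝ))
    volume := integrable_finsetSum _ fun i _ => integrable_inner (memLp_mol u ρ i) (memLp_I_mul_defect c₁ c₂ c₁₂ ρ u i)
  have j2 := fun k => integrable_dint_left (hH k) (ip l) (ip k)
  have j3 := integrable_dint_left hs (ip l) iE
  rw [dint_eq_integral_left hs (ip l) (integrable_massDeriv c₁ c₂ c₁₂ ρ u), dint_eq_integral_left hs (ip l) iE]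
  simp only [dint_eq_integral_left (hH _) (ip l) (ip _)]
  rw [← integral_finsetSum _ fun k _ => j2 k, ← integral_const_mul, ← integral_const_mul]
  refine Eq.trans ?_ (integral_add ((integrable_finsetSum _ fun k _ => j2 k).const_mul _) (j3.const_mul _))
  refine integral_congr_ae (Filter.Eventually.of_forall fun x => ?_)
  have h := integral_weight_mul_massDeriv c₁ c₂ c₁₂ ρ u (hs.sub_left x) (fun k => ((hH k).sub_left x).neg)
    fun k y => (hasLineDerivAt_ws hδ l k (x - y)).comp_const_sub
  have h2 := integral_weight_mul_sum (hs.sub_left x) (fun i => memLp_mol u ρ i)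
    (fun i => memLp_I_mul_defect c₁ c₂ c₁₂ ρ u i)
  simp only
  rw [h, h2, ← Finset.mul_sum]
  simp only [neg_mul, integral_neg, Finset.sum_neg_distrib]
  ring

/-- The Hessian of the weight is even, so twice the difference of the two sides can be symmetrised
in x and y; the resulting integrand is nonnegative at every pair of points by convexity of the
weight. -/
theorem sum_dint_mom_le : ∑ l, ∑ k, dint (wH δ l k) (mom ρ u l) (mom ρ u k) ≤
    ∑ l, ∑ k, dint (wH δ l k) (stress ρ u l k) (mass ρ u) := by
  have hm := integrable_mass ρ u
  have hH := isBddCont_wH hδ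
  have iS := integrable_stress ρ u
  have ip := integrable_mom ρ u
  have i1 := fun l k => integrable_dint (hH l k) (iS l k) hm
  have i2 := fun l k => integrable_dint (hH l k) hm (iS l k)
  have i3 := fun l k => integrable_dint (hH l k) (ip l) (ip k)
  have i4 := fun l k => integrable_dint (hH l k) (ip k) (ip l)
  have e1 : ∀ l k, 2 * (dint (wH δ l k) (stress ρ u l k) (mass ρ u) - dint (wH δ l k) (mom ρ u l) (mom ρ u k)) =
      ∫ z : R3 × R3, stress ρ u l k z.1 * mass ρ u z.2 * wH δ l k (z.1 - z.2) +
        mass ρ u z.1 * stress ρ u l k z.2 * wH δ l k (z.1 - z.2) -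
        mom ρ u l z.1 * mom ρ u k z.2 * wH δ l k (z.1 - z.2) -
        mom ρ u k z.1 * mom ρ u l z.2 * wH δ l k (z.1 - z.2) := fun l k => by
    have e4 := integral_sub (((i1 l k).add (i2 l k)).sub (i3 l k)) (i4 l k)
    have e2 := integral_sub ((i1 l k).add (i2 l k)) (i3 l k)
    have e3' := integral_add (i1 l k) (i2 l k)
    have s1 := dint_swap (F := stress ρ u l k) (G := mass ρ u) (wH_neg (δ := δ) l k)
    have s2 := dint_swap (F := mom ρ u l) (G := mom ρ u k) (wH_neg (δ := δ) l k)
    simp only [Pi.add_apply, Pi.sub_apply] at e4 e2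
    rw [e4, e2, e3']
    change _ = dint (wH δ l k) (stress ρ u l k) (mass ρ u) + dint (wH δ l k) (mass ρ u) (stress ρ u l k) -
      dint (wH δ l k) (mom ρ u l) (mom ρ u k) - dint (wH δ l k) (mom ρ u k) (mom ρ u l)
    rw [← s1, ← s2]
    ring
  have j : ∀ l k, Integrable (fun z : R3 × R3 => stress ρ u l k z.1 * mass ρ u z.2 * wH δ l k (z.1 - z.2) +
        mass ρ u z.1 * stress ρ u l k z.2 * wH δ l k (z.1 - z.2) -
        mom ρ u l z.1 * mom ρ u k z.2 * wH δ l k (z.1 - z.2) -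
        mom ρ u k z.1 * mom ρ u l z.2 * wH δ l k (z.1 - z.2)) volume := fun l k =>
    (((i1 l k).add (i2 l k)).sub (i3 l k)).sub (i4 l k)
  rw [← sub_nonneg]
  refine nonneg_of_mul_nonneg_right (a := 2) ?_ two_pos
  simp only [← Finset.sum_sub_distrib, Finset.mul_sum, e1]
  simp only [← integral_finsetSum Finset.univ fun k _ => j _ k]
  rw [← integral_finsetSum Finset.univ fun l _ => integrable_finsetSum Finset.univ fun k _ => j l k]
  refine integral_nonneg fun z => (sum_weight_stress_nonneg ρ u (sum_wH_mul_nonneg hδ (z.1 - z.2)) z.1 z.2).trans_eq ?_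
  refine Finset.sum_congr rfl fun l _ => Finset.sum_congr rfl fun k _ => ?_
  ring

/-- The Hessian and potential terms are dropped by sign. The errors contain at most first
derivatives of the mollification, so L² smallness of the defect is enough; δ⁻¹ appears through the
bound 3δ⁻¹ for the Laplacian of the weight, so δ has to be fixed before the mollifier. -/
theorem le_interactionDeriv (hc₁ : 0 ≤ c₁) (hc₂ : 0 ≤ c₂) (hc₁₂ : 0 ≤ c₁₂) {A r : ℝ} (hA : 0 ≤ A) (hr : 0 ≤ r)
    (h0 : ∀ i, eLpNorm (mol ρ (H1.fn (u i))) 2 volume ≤ ENNReal.ofReal A)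
    (h1 : ∀ l i, eLpNorm (mol (ρ.d (e3 l)) (H1.fn (u i))) 2 volume ≤ ENNReal.ofReal A)
    (hd : ∀ i, eLpNorm (defect c₁ c₂ c₁₂ ρ i u) 2 volume ≤ ENNReal.ofReal r) :
    (15 / 2) * dint (fun z => δ ^ 4 * wq δ z ^ 7) (mass ρ u) (mass ρ u) - (48 + 12 * δ⁻¹) * A ^ 3 * r ≤
      interactionDeriv c₁ c₂ c₁₂ ρ u δ := by
  have hmol := memLp_mol u
  have hdef := memLp_defect c₁ c₂ c₁₂ ρ u
  have hI : ∀ i, eLpNorm (fun x => Complex.I * defect c₁ c₂ c₁₂ ρ i u x) 2 volume ≤ ENNReal.ofReal r := fun i => by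
    refine (eLpNorm_congr_norm_ae (Filter.Eventually.of_forall fun x => ?_)).trans_le (hd i)
    rw [norm_mul, Complex.norm_I, one_mul]
  have hI' : ∀ i, eLpNorm (fun x => Complex.I * mol ρ (H1.fn (u i)) x) 2 volume ≤ ENNReal.ofReal A := fun i => by
    refine (eLpNorm_congr_norm_ae (Filter.Eventually.of_forall fun x => ?_)).trans_le (h0 i)
    rw [norm_mul, Complex.norm_I, one_mul]
  have hM : ∫ x, ‖mass ρ u x‖ ≤ 2 * (A * A) := by
    simp only [mass_eq]
    exact integral_norm_sum_inner_le (hmol ρ) (hmol ρ) hA hA h0 h0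
  have hP : ∀ l, ∫ x, ‖mom ρ u l x‖ ≤ 2 * (A * A) := fun l =>
    integral_norm_sum_inner_le (fun i => memLp_I_mul_mol u ρ i) (hmol _) hA hA hI' (h1 l)
  have im := integrable_mass ρ u
  have iE := integrable_inner_defect c₁ c₂ c₁₂ ρ u
  have b1 : ∀ i l, |dint (ws δ l) (fun x => inner ℝ (mol (ρ.d (e3 l)) (H1.fn (u i)) x) (defect c₁ c₂ c₁₂ ρ i u x))
      (mass ρ u)| ≤ 1 * (A * r * (2 * (A * A))) := fun i l =>
    norm_dint_le (norm_ws_le hδ l) (by positivity) (iE _ i) im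
      (integral_norm_inner_le (hmol _ i) (hdef i) hA hr (h1 l i) (hd i)) hM
  have b2 : ∀ i, |dint (wL δ) (fun x => inner ℝ (mol ρ (H1.fn (u i)) x) (defect c₁ c₂ c₁₂ ρ i u x))
      (mass ρ u)| ≤ 3 * δ⁻¹ * (A * r * (2 * (A * A))) := fun i =>
    norm_dint_le (norm_wL_le hδ) (by positivity) (iE _ i) im
      (integral_norm_inner_le (hmol _ i) (hdef i) hA hr (h0 i) (hd i)) hM
  have b3 : ∀ l, |dint (ws δ l) (mom ρ u l)
        (fun x => ∑ i, inner ℝ (mol ρ (H1.fn (u i)) x) (Complex.I * defect c₁ c₂ c₁₂ ρ i u x))| ≤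
      1 * (2 * (A * A) * (2 * (A * r))) := fun l =>
    norm_dint_le (norm_ws_le hδ l) (by positivity) (integrable_mom ρ u l)
      (integrable_finsetSum _ fun i _ => integrable_inner (hmol ρ i) (memLp_I_mul_defect c₁ c₂ c₁₂ ρ u i)) (hP l)
      (integral_norm_sum_inner_le (hmol ρ) (memLp_I_mul_defect c₁ c₂ c₁₂ ρ u) hA hr h0 hI)
  have b4 : 0 ≤ dint (wL δ) (pot c₁ c₂ c₁₂ ρ u) (mass ρ u) :=
    dint_nonneg (wL_nonneg hδ) (fun x => gpPot_nonneg c₁ c₂ c₁₂ hc₁ hc₂ hc₁₂ _) (mass_nonneg ρ u)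
  have b5 := sum_dint_mom_le ρ u hδ
  have b6 : ∑ i, ((∑ l, 2 * dint (ws δ l)
          (fun x => inner ℝ (mol (ρ.d (e3 l)) (H1.fn (u i)) x) (defect c₁ c₂ c₁₂ ρ i u x)) (mass ρ u)) +
        dint (wL δ) (fun x => inner ℝ (mol ρ (H1.fn (u i)) x) (defect c₁ c₂ c₁₂ ρ i u x)) (mass ρ u)) ≤
      ∑ i : Fin 2, ((∑ l : Fin 3, 2 * (1 * (A * r * (2 * (A * A))))) + 3 * δ⁻¹ * (A * r * (2 * (A * A)))) :=
    Finset.sum_le_sum fun i _ => add_le_add (Finset.sum_le_sum fun l _ =>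
      mul_le_mul_of_nonneg_left ((le_abs_self _).trans (b1 i l)) zero_le_two) ((le_abs_self _).trans (b2 i))
  have b7 : ∑ l : Fin 3, -(1 * (2 * (A * A) * (2 * (A * r)))) ≤ ∑ l, dint (ws δ l) (mom ρ u l)
        (fun x => ∑ i, inner ℝ (mol ρ (H1.fn (u i)) x) (Complex.I * defect c₁ c₂ c₁₂ ρ i u x)) :=
    Finset.sum_le_sum fun l _ => (abs_le.1 (b3 l)).1
  rw [interactionDeriv, Finset.sum_add_distrib, sum_dint_momDeriv c₁ c₂ c₁₂ ρ u hδ]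
  have b8 : ∑ l, dint (ws δ l) (mom ρ u l) (massDeriv c₁ c₂ c₁₂ ρ u) =
      -2 * (∑ l, ∑ k, dint (wH δ l k) (mom ρ u l) (mom ρ u k)) + 2 * ∑ l, dint (ws δ l) (mom ρ u l)
        (fun x => ∑ i, inner ℝ (mol ρ (H1.fn (u i)) x) (Complex.I * defect c₁ c₂ c₁₂ ρ i u x)) := by
    rw [Finset.mul_sum, Finset.mul_sum, ← Finset.sum_add_distrib]
    exact Finset.sum_congr rfl fun l _ => dint_massDeriv c₁ c₂ c₁₂ ρ u hδ l
  rw [b8]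
  simp only [Finset.sum_const, Finset.card_univ, Fintype.card_fin, nsmul_eq_mul, Nat.cast_ofNat] at b6 b7
  linarith

theorem abs_interaction_le {A : ℝ} (hA : 0 ≤ A)
    (h0 : ∀ i, eLpNorm (mol ρ (H1.fn (u i))) 2 volume ≤ ENNReal.ofReal A)
    (h1 : ∀ l i, eLpNorm (mol (ρ.d (e3 l)) (H1.fn (u i))) 2 volume ≤ ENNReal.ofReal A) :
    |interaction ρ u δ| ≤ 12 * A ^ 4 := by
  have hI' : ∀ i, eLpNorm (fun x => Complex.I * mol ρ (H1.fn (u i)) x) 2 volume ≤ ENNReal.ofReal A := fun i => by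
    refine (eLpNorm_congr_norm_ae (Filter.Eventually.of_forall fun x => ?_)).trans_le (h0 i)
    rw [norm_mul, Complex.norm_I, one_mul]
  have hmol := memLp_mol u
  have hM : ∫ x, ‖mass ρ u x‖ ≤ 2 * (A * A) := by
    simp only [mass_eq]
    exact integral_norm_sum_inner_le (hmol ρ) (hmol ρ) hA hA h0 h0
  have b : ∀ l, |dint (ws δ l) (mom ρ u l) (mass ρ u)| ≤ 1 * (2 * (A * A) * (2 * (A * A))) := fun l =>
    norm_dint_le (norm_ws_le hδ l) (by positivity) (integrable_mom ρ u l) (integrable_mass ρ u)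
      (integral_norm_sum_inner_le (fun i => memLp_I_mul_mol u ρ i) (hmol _) hA hA hI' (h1 l)) hM
  refine (Finset.abs_sum_le_sum_abs _ _).trans ((Finset.sum_le_sum fun l _ => b l).trans_eq ?_)
  simp only [Finset.sum_const, Finset.card_univ, Fintype.card_fin, nsmul_eq_mul, Nat.cast_ofNat]
  ring

end H1Pair

/-! ### Evolution of the interaction functional -/

theorem intervalIntegrable_integral {X : Type*} [TopologicalSpace X]
    [SecondCountableTopology X] [MeasurableSpace X] [BorelSpace X] {μ : Measure X} [SFinite μ]
    {f : ℝ → X → ℝ} {a b : ℝ} (hab : a ≤ b) (hc : Continuous (Function.uncurry f))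
    {C : ℝ≥0∞} (hC : C ≠ ⊤) (hb : ∀ t ∈ Set.Ioc a b, ∫⁻ x, ‖f t x‖ₑ ∂μ ≤ C) :
    IntervalIntegrable (fun t => ∫ x, f t x ∂μ) volume a b := by
  rw [intervalIntegrable_iff_integrableOn_Ioc_of_le hab]
  have hm : AEStronglyMeasurable (Function.uncurry f) ((volume.restrict (Set.Ioc a b)).prod μ) :=
    hc.aestronglyMeasurable
  have hi : Integrable (Function.uncurry f) ((volume.restrict (Set.Ioc a b)).prod μ) := by
    refine ⟨hm, ?_⟩
    rw [HasFiniteIntegral, lintegral_prod _ hm.enorm]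
    refine lt_of_le_of_lt (setLIntegral_mono' measurableSet_Ioc hb) ?_
    rw [lintegral_const, Measure.restrict_apply_univ, Real.volume_Ioc]
    exact ENNReal.mul_lt_top hC.lt_top ENNReal.ofReal_lt_top
  exact hi.integral_prod_left

/-- A jointly continuous field whose `L¹` norm is locally bounded in time. -/
structure IsL1Field {X : Type*} [TopologicalSpace X] [MeasureSpace X] (f : ℝ → X → ℝ) : Prop where
  continuous : Continuous (Function.uncurry f)
  bound : ∀ a b, ∃ C : ℝ≥0∞, C ≠ ⊤ ∧ ∀ t ∈ Set.Icc a b, ∫⁻ x, ‖f t x‖ₑ ≤ C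

namespace IsL1Field
section General
variable {X : Type*} [TopologicalSpace X] [MeasureSpace X] {f g : ℝ → X → ℝ}

theorem continuous_apply (hf : IsL1Field f) (t : ℝ) : Continuous (f t) :=
  hf.continuous.comp (by fun_prop : Continuous fun x : X => (t, x))

variable [OpensMeasurableSpace X]

theorem sum {ι : Type*} (s : Finset ι) {f : ι → ℝ → X → ℝ} (hf : ∀ i, IsL1Field (f i)) :
    IsL1Field fun t x => ∑ i ∈ s, f i t x := by
  refine ⟨continuous_finsetSum _ fun i _ => (hf i).continuous, fun a b => ?_⟩
  choose C hC h using fun i => (hf i).bound a b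
  refine ⟨∑ i ∈ s, C i, ENNReal.sum_ne_top.2 fun i _ => hC i, fun t ht => ?_⟩
  refine (lintegral_mono fun x => enorm_sum_le _ _).trans ?_
  rw [lintegral_finsetSum _ fun i _ => ((hf i).continuous_apply t).enorm.measurable]
  exact Finset.sum_le_sum fun i _ => h i t ht

theorem add (hf : IsL1Field f) (hg : IsL1Field g) : IsL1Field fun t x => f t x + g t x := by
  have := sum Finset.univ (f := ![f, g]) (Fin.forall_fin_two.2 ⟨hf, hg⟩)
  simpa only [Fin.sum_univ_two, Matrix.cons_val_zero, Matrix.cons_val_one] using this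

theorem bdd_mul [SecondCountableTopology X] {c : X → ℝ} (hc : Continuous c) {K : ℝ} (hK : ∀ x, ‖c x‖ ≤ K)
    (hf : IsL1Field f) : IsL1Field fun t x => c x * f t x := by
  refine ⟨(hc.comp continuous_snd).mul hf.continuous, fun a b => ?_⟩
  obtain ⟨C, hC, h⟩ := hf.bound a b
  refine ⟨ENNReal.ofReal K * C, by finiteness, fun t ht => ?_⟩
  refine le_trans (lintegral_mono fun x => ?_) ((lintegral_const_mul _
    (hf.continuous_apply t).enorm.measurable).le.trans (mul_le_mul_right (h t ht) _))
  rw [enorm_mul, ← ofReal_norm (c x)]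
  exact mul_le_mul_left (ENNReal.ofReal_le_ofReal (hK x)) _

end General

variable {f g : ℝ → R3 → ℝ}

theorem inner {F G : ℝ → R3 → ℂ} (hF : IsL2Field F) (hG : IsL2Field G) :
    IsL1Field fun t x => (inner ℝ (F t x) (G t x) : ℝ) := by
  refine ⟨hF.continuous.inner hG.continuous, fun a b => ?_⟩
  obtain ⟨C, hC, h⟩ := hF.exists_lintegral_mul_le hG a b
  exact ⟨C, hC, fun t ht => (lintegral_mono fun x => enorm_inner_le _ _).trans (h t ht)⟩

theorem mul_prod (hf : IsL1Field f) (hg : IsL1Field g) :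
    IsL1Field fun t (z : R3 × R3) => f t z.1 * g t z.2 := by
  refine ⟨(hf.continuous.comp (by fun_prop : Continuous fun p : ℝ × R3 × R3 => (p.1, p.2.1))).mul
    (hg.continuous.comp (by fun_prop : Continuous fun p : ℝ × R3 × R3 => (p.1, p.2.2))), fun a b => ?_⟩
  obtain ⟨C, hC, h⟩ := hf.bound a b
  obtain ⟨D, hD, h'⟩ := hg.bound a b
  refine ⟨C * D, by finiteness, fun t ht => ?_⟩
  simp only [enorm_mul]
  rw [Measure.volume_eq_prod, lintegral_prod_mul (f := fun x => ‖f t x‖ₑ) (g := fun x => ‖g t x‖ₑ)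
    (hf.continuous_apply t).enorm.aemeasurable (hg.continuous_apply t).enorm.aemeasurable]
  exact mul_le_mul' (h t ht) (h' t ht)

end IsL1Field

theorem sum_dint_eq {c F G : Fin 3 → R3 → ℝ} (hc : ∀ l, IsBddCont (c l)) (hF : ∀ l, Integrable (F l) volume)
    (hG : ∀ l, Integrable (G l) volume) :
    ∑ l, dint (c l) (F l) (G l) = ∫ z : R3 × R3, ∑ l, c l (z.1 - z.2) * (F l z.1 * G l z.2) := by
  rw [integral_finsetSum _ fun l _ => by simpa only [mul_comm] using integrable_dint (hc l) (hF l) (hG l)]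
  simp only [dint, mul_comm]

/-- A lower bound for the derivative of an interaction functional integrates to one for its increment. -/
theorem integral_le_sum_dint_sub {c : Fin 3 → R3 → ℝ} {p p' : Fin 3 → ℝ → R3 → ℝ} {m m' : ℝ → R3 → ℝ}
    (hc : ∀ l, IsBddCont (c l)) (hp : ∀ l, IsL1Field (p l)) (hp' : ∀ l, IsL1Field (p' l)) (hm : IsL1Field m)
    (hm' : IsL1Field m') (dp : ∀ l t x, HasDerivAt (fun s => p l s x) (p' l t x) t)
    (dm : ∀ t x, HasDerivAt (fun s => m s x) (m' t x) t)
    (ip : ∀ l t, Integrable (p l t) volume) (ip' : ∀ l t, Integrable (p' l t) volume)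
    (im : ∀ t, Integrable (m t) volume) (im' : ∀ t, Integrable (m' t) volume)
    {a b : ℝ} (hab : a ≤ b) {h : ℝ → ℝ}
    (hh : ContinuousOn h (Set.Icc a b)) (hle : ∀ t ∈ Set.Icc a b, h t ≤ ∑ l, (dint (c l) (p' l t) (m t) + dint (c l) (p l t) (m' t))) :
    ∫ t in a..b, h t ≤ (∑ l, dint (c l) (p l b) (m b)) - ∑ l, dint (c l) (p l a) (m a) := by
  have hw : ∀ l, Continuous fun z : R3 × R3 => c l (z.1 - z.2) := fun l =>
    (hc l).continuous.comp (continuous_fst.sub continuous_snd)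
  have f1 : IsL1Field fun t (z : R3 × R3) => ∑ l, c l (z.1 - z.2) * (p' l t z.1 * m t z.2 + p l t z.1 * m' t z.2) :=
    IsL1Field.sum _ fun l => by
      obtain ⟨K, -, hK⟩ := (hc l).bdd
      exact (((hp' l).mul_prod hm).add ((hp l).mul_prod hm')).bdd_mul (hw l) fun z => hK _
  obtain ⟨C, hC, hb⟩ := f1.bound a b
  have hb' : ∀ t ∈ Set.Ioc a b, _ := fun t ht => hb t (Set.Ioc_subset_Icc_self ht)
  have i1 : ∀ l t, Integrable (fun z : R3 × R3 => c l (z.1 - z.2) * (p l t z.1 * m t z.2)) volume := fun l t => by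
    simpa only [mul_comm] using integrable_dint (hc l) (ip l t) (im t)
  have e1 : ∀ t, ∑ l, (dint (c l) (p' l t) (m t) + dint (c l) (p l t) (m' t)) =
      ∫ z : R3 × R3, ∑ l, c l (z.1 - z.2) * (p' l t z.1 * m t z.2 + p l t z.1 * m' t z.2) := fun t => by
    have j1 : ∀ l, Integrable (fun z : R3 × R3 => c l (z.1 - z.2) * (p' l t z.1 * m t z.2)) volume := fun l => by
      simpa only [mul_comm] using integrable_dint (hc l) (ip' l t) (im t)
    have j2 : ∀ l, Integrable (fun z : R3 × R3 => c l (z.1 - z.2) * (p l t z.1 * m' t z.2)) volume := fun l => by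
      simpa only [mul_comm] using integrable_dint (hc l) (ip l t) (im' t)
    rw [Finset.sum_add_distrib, sum_dint_eq hc (fun l => ip' l t) fun _ => im t,
      sum_dint_eq hc (fun l => ip l t) fun _ => im' t, ← integral_add (integrable_finsetSum _ fun l _ => j1 l)
      (integrable_finsetSum _ fun l _ => j2 l)]
    simp only [mul_add, Finset.sum_add_distrib]
  rw [sum_dint_eq hc (fun l => ip l b) fun _ => im b, sum_dint_eq hc (fun l => ip l a) fun _ => im a,
    integral_sub_integral_eq_intervalIntegral (f := fun t (z : R3 × R3) => ∑ l, c l (z.1 - z.2) * (p l t z.1 * m t z.2))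
      hab (fun t z => HasDerivAt.fun_sum fun l _ => ((dp l t z.1).fun_mul (dm t z.2)).const_mul _) f1.continuous
      (integrable_finsetSum _ fun l _ => i1 l a) (integrable_finsetSum _ fun l _ => i1 l b) hC hb']
  refine intervalIntegral.integral_mono_on hab (hh.intervalIntegrable_of_Icc hab)
    (intervalIntegrable_integral hab f1.continuous hC hb') fun t ht => ?_
  rw [← e1]
  exact hle t ht

namespace H1Pair
variable {c₁ c₂ c₁₂ : ℝ} {φ : ℝ → H1Pair} (h : IsSol c₁ c₂ c₁₂ φ) (ρ : BumpKernel)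
include h

theorem IsSol.isL1Field_mass : IsL1Field fun t => mass ρ (φ t) := by
  have := IsL1Field.sum Finset.univ fun i => IsL1Field.inner (IsL2Field.mol ρ (h.continuous_fn i)) (IsL2Field.mol ρ (h.continuous_fn i))
  simp only [real_inner_self_eq_norm_sq] at this
  exact this

theorem IsSol.isL1Field_mom (l : Fin 3) : IsL1Field fun t => mom ρ (φ t) l :=
  IsL1Field.sum _ fun i => IsL1Field.inner ((IsL2Field.mol ρ (h.continuous_fn i)).const_mul _)
    (IsL2Field.mol _ (h.continuous_fn i))

theorem IsSol.isL1Field_massDeriv : IsL1Field fun t => massDeriv c₁ c₂ c₁₂ ρ (φ t) :=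
  IsL1Field.sum _ fun i => (IsL1Field.inner (IsL2Field.mol ρ (h.continuous_fn i)) (h.isL2Field_rhs ρ i)).bdd_mul
    continuous_const (K := ‖(2 : ℝ)‖) fun _ => le_rfl

theorem IsSol.isL1Field_momDeriv (l : Fin 3) : IsL1Field fun t => momDeriv c₁ c₂ c₁₂ ρ (φ t) l :=
  IsL1Field.sum _ fun i => (IsL1Field.inner ((IsL2Field.mol ρ (h.continuous_fn i)).const_mul _) (h.isL2Field_rhs _ i)).add
    (IsL1Field.inner ((h.isL2Field_rhs ρ i).const_mul _) (IsL2Field.mol _ (h.continuous_fn i)))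

theorem IsSol.hasDerivAt_mass (t : ℝ) (x : R3) :
    HasDerivAt (fun s => mass ρ (φ s) x) (massDeriv c₁ c₂ c₁₂ ρ (φ t) x) t :=
  HasDerivAt.fun_sum fun i _ => ((h.weak i).hasDerivAt_mol ρ x t).norm_sq

theorem IsSol.hasDerivAt_mom (l : Fin 3) (t : ℝ) (x : R3) :
    HasDerivAt (fun s => mom ρ (φ s) l x) (momDeriv c₁ c₂ c₁₂ ρ (φ t) l x) t :=
  HasDerivAt.fun_sum fun i _ => HasDerivAt.inner ℝ (((h.weak i).hasDerivAt_mol ρ x t).const_mul Complex.I)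
    ((h.weak i).hasDerivAt_mol (ρ.d (e3 l)) x t)

theorem IsSol.integral_le_interaction_sub {δ : ℝ} (hδ : 0 < δ) {a b : ℝ} (hab : a ≤ b) {f : ℝ → ℝ}
    (hf : ContinuousOn f (Set.Icc a b)) (hle : ∀ t ∈ Set.Icc a b, f t ≤ interactionDeriv c₁ c₂ c₁₂ ρ (φ t) δ) :
    ∫ t in a..b, f t ≤ interaction ρ (φ b) δ - interaction ρ (φ a) δ :=
  integral_le_sum_dint_sub (isBddCont_ws hδ) (h.isL1Field_mom ρ) (h.isL1Field_momDeriv ρ) (h.isL1Field_mass ρ)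
    (h.isL1Field_massDeriv ρ) (h.hasDerivAt_mom ρ) (h.hasDerivAt_mass ρ) (fun l _ => integrable_mom ρ _ l)
    (fun l _ => integrable_momDeriv c₁ c₂ c₁₂ ρ _ l) (fun _ => integrable_mass ρ _)
    (fun _ => integrable_massDeriv c₁ c₂ c₁₂ ρ _) hab hf hle

end H1Pair

/-! ### Autocorrelation of the density -/

/-- The density |u|² is the modulus of |u|ū, so its L² continuity is inherited from that function
through a 1-Lipschitz map. -/
theorem lipschitzWith_ofReal_norm : LipschitzWith 1 fun z : ℂ => ((‖z‖ : ℝ) : ℂ) :=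
  LipschitzWith.of_dist_le_mul fun a b => by
    rw [NNReal.coe_one, one_mul, dist_eq_norm, dist_eq_norm, ← Complex.ofReal_sub, Complex.norm_real]
    exact abs_norm_sub_norm_le a b

namespace H1

/-- The function `‖u‖ ^ 2`, as an element of `L²`. -/
noncomputable def nsq (u : H1R3) : L2R3 := lipschitzWith_ofReal_norm.compLp (by simp) (sqc u)

theorem nsq_coeFn (u : H1R3) : nsq u =ᵐ[volume] fun x => ((‖fn u x‖ ^ 2 : ℝ) : ℂ) := by
  filter_upwards [lipschitzWith_ofReal_norm.coeFn_compLp (by simp) (sqc u), sqc_coeFn u] with x h1 h2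
  rw [nsq, h1, Function.comp_apply, h2, norm_mul, Complex.norm_real, norm_norm, RCLike.norm_conj, ← sq]

theorem norm_nsq_sub_le (u v : H1R3) : ‖nsq u - nsq v‖ ≤ H1.sob * (‖u‖ + ‖v‖) * (H1.sob * ‖u - v‖) := by
  refine le_trans ?_ (norm_sqc_sub_le u v)
  exact (lipschitzWith_ofReal_norm.norm_compLp_sub_le _ (sqc u) (sqc v)).trans_eq (by rw [NNReal.coe_one, one_mul])

theorem continuous_nsq : Continuous nsq := (lipschitzWith_ofReal_norm.continuous_compLp _).comp continuous_sqc

end H1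

namespace H1Pair

/-- The density `∑ i, ‖u i‖ ^ 2`. -/
noncomputable def dens (u : H1Pair) (x : R3) : ℝ := ∑ i, ‖u.comp i x‖ ^ 2

/-- The density, as an element of `L²`. -/
noncomputable def msq (u : H1Pair) : L2R3 := ∑ i, H1.nsq (u i)

theorem dens_nonneg (u : H1Pair) (x : R3) : 0 ≤ dens u x := Finset.sum_nonneg fun _ _ => sq_nonneg _

theorem msq_coeFn (u : H1Pair) : msq u =ᵐ[volume] fun x => (dens u x : ℂ) := by
  have h : ∀ᵐ x, ∀ i, H1.nsq (u i) x = ((‖H1.fn (u i) x‖ ^ 2 : ℝ) : ℂ) := ae_all_iff.2 fun i => H1.nsq_coeFn (u i)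
  have h2 := Lp.coeFn_add (H1.nsq (u 0)) (H1.nsq (u 1))
  filter_upwards [h, h2] with x h h2
  rw [msq, Fin.sum_univ_two, h2, Pi.add_apply, h, h, dens, Fin.sum_univ_two, Complex.ofReal_add]
  rfl

theorem continuous_msq : Continuous msq :=
  continuous_finsetSum _ fun i _ => H1.continuous_nsq.comp (continuous_apply i)

theorem norm_msq_sub_le (u v : H1Pair) : ‖msq u - msq v‖ ≤ 2 * (H1.sob ^ 2 * ((‖u‖ + ‖v‖) * ‖u - v‖)) := by
  have h0 := sob_nonneg
  have h : ∀ i, ‖H1.nsq (u i) - H1.nsq (v i)‖ ≤ H1.sob ^ 2 * ((‖u‖ + ‖v‖) * ‖u - v‖) := fun i => by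
    have h1 : ‖u i - v i‖ ≤ ‖u - v‖ := norm_apply_le' (u - v) i
    refine (H1.norm_nsq_sub_le (u i) (v i)).trans ?_
    have : H1.sob * (‖u i‖ + ‖v i‖) * (H1.sob * ‖u i - v i‖) ≤ H1.sob * (‖u‖ + ‖v‖) * (H1.sob * ‖u - v‖) := by
      gcongr
      · exact norm_apply_le' u i
      · exact norm_apply_le' v i
    linarith
  rw [msq, msq, ← Finset.sum_sub_distrib]
  refine (norm_sum_le _ _).trans ((Finset.sum_le_sum fun i _ => h i).trans_eq ?_)
  simp

theorem msq_zero : msq 0 = 0 := by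
  have h : ∀ᵐ x, (H1.fn 0 : L2R3) x = 0 := by rw [map_zero]; exact Lp.coeFn_zero _ _ _
  refine Lp.ext ?_
  filter_upwards [msq_coeFn 0, Lp.coeFn_zero ℂ 2 (volume : Measure R3), h] with x h1 h2 h3
  have h4 : ∀ i, (0 : H1Pair).comp i x = 0 := fun i => h3
  rw [h1, h2, dens]
  simp [h4]

theorem norm_msq_le (u : H1Pair) : ‖msq u‖ ≤ 2 * (H1.sob ^ 2 * ‖u‖ ^ 2) := by
  simpa [msq_zero, ← sq] using norm_msq_sub_le u 0

/-- The autocorrelation of the density. -/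
noncomputable def autocorr (z : R3) (u : H1Pair) : ℝ := (bil (msq u) (trL z (msq u))).re

theorem continuous_autocorr : Continuous fun p : R3 × H1Pair => autocorr p.1 p.2 :=
  Complex.continuous_re.comp (continuous_bil.comp ((continuous_msq.comp continuous_snd).prodMk
    (trL_continuous.comp (continuous_fst.prodMk (continuous_msq.comp continuous_snd)))))

theorem memLp_dens (u : H1Pair) : MemLp (dens u) 2 volume :=
  ((memLp_congr_ae (msq_coeFn u)).1 (Lp.memLp _)).re

theorem integrable_dens_mul (u : H1Pair) (z : R3) : Integrable (fun x => dens u x * dens u (x - z)) volume :=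
  (memLp_dens u).integrable_mul ((memLp_dens u).comp_measurePreserving (measurePreserving_sub_right volume z))

theorem autocorr_eq (z : R3) (u : H1Pair) : autocorr z u = ∫ x, dens u x * dens u (x - z) := by
  rw [autocorr, bil_apply]
  have h : ∀ᵐ x, msq u x * trL z (msq u) x = ((dens u x * dens u (x - z) : ℝ) : ℂ) := by
    filter_upwards [msq_coeFn u, trL_coeFn z (msq u), ae_comp_sub (msq_coeFn u) z] with x h1 h2 h3
    rw [h1, h2, h3, Complex.ofReal_mul]
  rw [integral_congr_ae h, integral_complex_ofReal, Complex.ofReal_re]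

theorem ofReal_autocorr (z : R3) (u : H1Pair) :
    ENNReal.ofReal (autocorr z u) = ∫⁻ x, ENNReal.ofReal (dens u x * dens u (x - z)) := by
  rw [autocorr_eq, ofReal_integral_eq_lintegral_ofReal (integrable_dens_mul u z)
    (Filter.Eventually.of_forall fun x => mul_nonneg (dens_nonneg u _) (dens_nonneg u _))]

/-- Translations are isometries of L², so the bound is uniform in z; replacing u by its
mollification is therefore harmless for all translations at once. -/
theorem abs_autocorr_sub_le (z : R3) (u v : H1Pair) :
    |autocorr z u - autocorr z v| ≤ ‖msq u - msq v‖ * (‖msq u‖ + ‖msq v‖) := by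
  have h : autocorr z u - autocorr z v =
      (bil (msq u - msq v) (trL z (msq u)) + bil (msq v) (trL z (msq u - msq v))).re := by
    rw [map_sub, map_sub, map_sub, sub_apply, Complex.add_re, Complex.sub_re, Complex.sub_re, autocorr, autocorr]
    ring
  rw [h]
  refine (Complex.abs_re_le_norm _).trans ((norm_add_le _ _).trans ?_)
  have h1 := norm_bil_le (msq u - msq v) (trL z (msq u))
  have h2 := norm_bil_le (msq v) (trL z (msq u - msq v))
  rw [LinearIsometry.norm_map] at h1 h2
  linarith

theorem mass_ae (ρ : BumpKernel) (u : H1Pair) : mass ρ u =ᵐ[volume] dens (molP ρ u) := by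
  filter_upwards [comp_molP_ae ρ u] with x hx
  have hx' := fun i => congr_fun hx i
  simp only [mass, dens, hx']
  rfl

end H1Pair

/-! ### The interaction Morawetz estimate -/

/-- The volume of the unit ball of `ℝ³`. -/
noncomputable def ballVol : ℝ := (volume (Metric.ball (0 : R3) 1)).toReal

theorem ballVol_pos : 0 < ballVol := ENNReal.toReal_pos (Metric.measure_ball_pos _ _ one_pos).ne' measure_ball_lt_top.ne

theorem volume_ball_eq {δ : ℝ} (hδ : 0 < δ) : volume (Metric.ball (0 : R3) δ) = ENNReal.ofReal (δ ^ 3 * ballVol) := by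
  rw [Measure.addHaar_ball _ _ hδ.le, finrank_euclideanSpace_fin, ENNReal.ofReal_mul (by positivity), ballVol,
    ENNReal.ofReal_toReal measure_ball_lt_top.ne]

/-- On the ball √(δ² + |z|²) ≤ 2δ, and 2⁷ = 128. The scaling δ⁻³ matches the volume of the ball, so
the kernel keeps a mass independent of δ. -/
theorem le_morawetz_kernel {δ : ℝ} (hδ : 0 < δ) {z : R3} (hz : ‖z‖ < δ) : (128 * δ ^ 3)⁻¹ ≤ δ ^ 4 * wq δ z ^ 7 := by
  have h1 : (2 * δ)⁻¹ ≤ wq δ z := by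
    rw [wq]
    refine inv_anti₀ (by positivity) ?_
    rw [Real.sqrt_le_left (by positivity)]
    nlinarith [norm_nonneg z]
  have h2 : δ ^ 4 * (2 * δ)⁻¹ ^ 7 = (128 * δ ^ 3)⁻¹ := by
    field_simp
    norm_num
  rw [← h2]
  gcongr

theorem mul_div_add_one_le {D r : ℝ} (hD : 0 ≤ D) (hr : 0 ≤ r) : D * (r / (D + 1)) ≤ r := by
  rw [mul_div_assoc', div_le_iff₀ (by positivity)]
  nlinarith

namespace H1Pair

theorem continuous_mass (ρ : BumpKernel) (u : H1Pair) : Continuous (mass ρ u) :=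
  continuous_finsetSum _ fun i _ => ((IsL2Field.mol ρ (w := fun _ => H1.fn (u i)) continuous_const).continuous_apply
    0).norm.pow 2

theorem lintegral_mass_eq (ρ : BumpKernel) (u : H1Pair) (z : R3) :
    ∫⁻ x, ENNReal.ofReal (mass ρ u x * mass ρ u (x - z)) = ENNReal.ofReal (autocorr z (molP ρ u)) := by
  rw [ofReal_autocorr]
  refine lintegral_congr_ae ?_
  filter_upwards [mass_ae ρ u, ae_comp_sub (mass_ae ρ u) z] with x h1 h2
  rw [h1, h2]

/-- The substitution z = x − y writes the interaction integral as the kernel integrated against the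
autocorrelation of the density, which is continuous in z and at z = 0 equals ∫ m². -/
theorem ofReal_dint_mass (ρ : BumpKernel) (u : H1Pair) {k : R3 → ℝ} (hk : IsBddCont k) (hk0 : ∀ z, 0 ≤ k z) :
    ENNReal.ofReal (dint k (mass ρ u) (mass ρ u)) =
      ∫⁻ z, ENNReal.ofReal (k z) * ENNReal.ofReal (autocorr z (molP ρ u)) := by
  have hm := integrable_mass ρ u
  have hc := continuous_mass ρ u
  have hkc := hk.continuous
  have m1 : Measurable fun z : R3 × R3 => ENNReal.ofReal (mass ρ u z.1 * mass ρ u z.2 * k (z.1 - z.2)) :=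
    (Continuous.measurable (by fun_prop)).ennreal_ofReal
  have m2 : Measurable (Function.uncurry fun x z : R3 => ENNReal.ofReal (mass ρ u x * mass ρ u (x - z) * k z)) :=
    (Continuous.measurable (f := fun p : R3 × R3 => mass ρ u p.1 * mass ρ u (p.1 - p.2) * k p.2)
      (by fun_prop)).ennreal_ofReal
  rw [dint, ofReal_integral_eq_lintegral_ofReal (integrable_dint hk hm hm) (Filter.Eventually.of_forall fun z =>
    mul_nonneg (mul_nonneg (mass_nonneg ρ u _) (mass_nonneg ρ u _)) (hk0 _)), Measure.volume_eq_prod,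
    lintegral_prod _ m1.aemeasurable]
  have e1 : ∀ x, ∫⁻ y, ENNReal.ofReal (mass ρ u x * mass ρ u y * k (x - y)) =
      ∫⁻ z, ENNReal.ofReal (mass ρ u x * mass ρ u (x - z) * k z) := fun x => by
    rw [← lintegral_sub_left_eq_self (fun z => ENNReal.ofReal (mass ρ u x * mass ρ u (x - z) * k z)) x]
    simp only [sub_sub_cancel]
  simp only [e1]
  rw [lintegral_lintegral_swap m2.aemeasurable]
  refine lintegral_congr fun z => ?_
  rw [← lintegral_mass_eq, ← lintegral_const_mul _ (Continuous.measurable (by fun_prop)).ennreal_ofReal]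
  refine lintegral_congr fun x => ?_
  rw [← ENNReal.ofReal_mul (hk0 z), mul_comm]

theorem mul_le_dint_mass (ρ : BumpKernel) (u : H1Pair) {δ : ℝ} (hδ : 0 < δ) {g : ℝ}
    (hg : ∀ z, ‖z‖ < δ → g ≤ autocorr z (molP ρ u)) :
    ballVol / 128 * g ≤ dint (fun z => δ ^ 4 * wq δ z ^ 7) (mass ρ u) (mass ρ u) := by
  have hk : IsBddCont fun z => δ ^ 4 * wq δ z ^ 7 := (IsBddCont.const _).mul ((isBddCont_wq hδ).pow 7)
  have hk0 : ∀ z, 0 ≤ δ ^ 4 * wq δ z ^ 7 := fun z => by have := wq_pos hδ z; positivity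
  rw [← ENNReal.ofReal_le_ofReal_iff (dint_nonneg hk0 (mass_nonneg ρ u) (mass_nonneg ρ u)), ofReal_dint_mass ρ u hk hk0]
  refine le_trans ?_ (setLIntegral_le_lintegral (Metric.ball (0 : R3) δ) _)
  refine le_trans ?_ (setLIntegral_mono' (f := fun _ => ENNReal.ofReal ((128 * δ ^ 3)⁻¹ * g)) Metric.isOpen_ball.measurableSet fun z hz => ?_)
  · rw [setLIntegral_const, volume_ball_eq hδ, ← ENNReal.ofReal_mul' (by have := ballVol_pos; positivity)]
    refine ENNReal.ofReal_le_ofReal (le_of_eq ?_)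
    field_simp
  · rw [mem_ball_zero_iff] at hz
    rw [ENNReal.ofReal_mul (by positivity)]
    exact mul_le_mul' (ENNReal.ofReal_le_ofReal (le_morawetz_kernel hδ hz)) (ENNReal.ofReal_le_ofReal (hg z hz))

theorem continuous_autocorr_comp {φ : ℝ → H1Pair} (h : Continuous φ) (z : R3) : Continuous fun t => autocorr z (φ t) :=
  Continuous.comp (g := fun p : R3 × H1Pair => autocorr p.1 p.2) (f := fun t => (z, φ t)) continuous_autocorr
    (continuous_const.prodMk h)

theorem exists_autocorr_ge {K : Set H1Pair} (hK : IsCompact K) {η : ℝ} (hη : 0 < η) :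
    ∃ δ > 0, ∀ u ∈ K, ∀ z : R3, ‖z‖ < δ → autocorr 0 u - η ≤ autocorr z u := by
  obtain ⟨δ, hδ, h⟩ := exists_forall_norm_lt_of_isCompact
    (F := fun p : R3 × H1Pair => autocorr 0 p.2 - autocorr p.1 p.2)
    ((continuous_autocorr.comp (continuous_const.prodMk continuous_snd)).sub continuous_autocorr)
    (fun u => sub_self _) hK hη
  exact ⟨δ, hδ, fun u hu z hz => by linarith [h u hu z hz]⟩

theorem exists_autocorr_molP_ge {K : Set H1Pair} (hK : IsCompact K) {η : ℝ} (hη : 0 < η) :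
    ∃ ε₀ > 0, ∀ u ∈ K, ∀ ε (hε : 0 < ε), ε ≤ ε₀ → ∀ z, autocorr z u - η ≤ autocorr z (molP (moll ε hε) u) := by
  obtain ⟨A, hA⟩ := hK.isBounded.exists_norm_le
  set B := max A 0 with hB
  have hB0 : 0 ≤ B := le_max_right _ _
  have hs := sob_nonneg
  set D := 2 * (H1.sob ^ 2 * (B + B)) * (2 * (H1.sob ^ 2 * B ^ 2) + 2 * (H1.sob ^ 2 * B ^ 2)) with hD
  have hD0 : 0 ≤ D := by positivity
  obtain ⟨ε₀, hε₀, h⟩ := exists_molP_sub_le hK (r := η / (D + 1)) (by positivity)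
  refine ⟨ε₀, hε₀, fun u hu ε hε hle z => ?_⟩
  have h1 : ‖u‖ ≤ B := (hA u hu).trans (le_max_left _ _)
  have h2 : ‖molP (moll ε hε) u‖ ≤ B := (norm_molP_le hε u).trans h1
  have h3 := (abs_le.1 (abs_autocorr_sub_le z (molP (moll ε hε) u) u)).1
  have h4 := norm_msq_sub_le (molP (moll ε hε) u) u
  have h5 := norm_msq_le u
  have h6 := norm_msq_le (molP (moll ε hε) u)
  have h7 := h u hu ε hε hle
  have h8 : ‖msq (molP (moll ε hε) u) - msq u‖ * (‖msq (molP (moll ε hε) u)‖ + ‖msq u‖) ≤ η := by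
    calc _ ≤ (2 * (H1.sob ^ 2 * ((B + B) * (η / (D + 1))))) * (2 * (H1.sob ^ 2 * B ^ 2) + 2 * (H1.sob ^ 2 * B ^ 2)) := by
          refine mul_le_mul (h4.trans ?_) (add_le_add (h6.trans ?_) (h5.trans ?_)) (by positivity) (by positivity)
          all_goals gcongr
      _ = D * (η / (D + 1)) := by rw [hD]; ring
      _ ≤ η := mul_div_add_one_le hD0 hη.le
  linarith

variable {c₁ c₂ c₁₂ : ℝ}

/-- For given η, δ is fixed first so that the autocorrelation on the δ-ball stays within η of its
value at 0 along the orbit. Then the mollifier is chosen, depending on δ, to keep the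
autocorrelation within another η and the defect error below η. The right side 24A⁴ is twice the
bound 12A⁴ of the functional and depends on none of these choices. -/
theorem IsSol.integral_autocorr_le_add {φ : ℝ → H1Pair} (h : IsSol c₁ c₂ c₁₂ φ) (hc₁ : 0 ≤ c₁) (hc₂ : 0 ≤ c₂)
    (hc₁₂ : 0 ≤ c₁₂) {A : ℝ} (hA : 0 ≤ A) (hφ : ∀ t, ‖φ t‖ ≤ A) {a b : ℝ} (hab : a ≤ b) {η : ℝ} (hη : 0 < η) :
    ∫ t in a..b, (15 / 2 * (ballVol / 128 * (autocorr 0 (φ t) - 2 * η)) - η) ≤ 24 * A ^ 4 := by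
  have hK : IsCompact (φ '' Set.Icc a b) := isCompact_Icc.image h.continuous
  obtain ⟨δ, hδ, h1⟩ := exists_autocorr_ge hK hη
  obtain ⟨ε₁, hε₁, h2⟩ := exists_autocorr_molP_ge hK hη
  set D := (48 + 12 * δ⁻¹) * A ^ 3 with hD
  have hD0 : 0 ≤ D := by positivity
  obtain ⟨ε₂, hε₂, h3⟩ := h.exists_eventually_defect_le a b (r := η / (D + 1)) (by positivity)
  obtain ⟨ρ, b0, b1, h2', h3'⟩ : ∃ ρ : BumpKernel,
      (∀ t i, eLpNorm (mol ρ (H1.fn (φ t i))) 2 volume ≤ ENNReal.ofReal A) ∧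
      (∀ t l i, eLpNorm (mol (ρ.d (e3 l)) (H1.fn (φ t i))) 2 volume ≤ ENNReal.ofReal A) ∧
      (∀ u ∈ φ '' Set.Icc a b, ∀ z, autocorr z u - η ≤ autocorr z (molP ρ u)) ∧
      ∀ t ∈ Set.Icc a b, ∀ i, eLpNorm (defect c₁ c₂ c₁₂ ρ i (φ t)) 2 volume ≤ ENNReal.ofReal (η / (D + 1)) := by
    have hε : 0 < min ε₁ ε₂ := lt_min hε₁ hε₂
    refine ⟨moll (min ε₁ ε₂) hε, fun t i => ?_, fun t l i => ?_, fun u hu => h2 u hu _ hε (min_le_left _ _),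
      h3 _ hε (min_le_right _ _)⟩
    · exact eLpNorm_mol_moll_le hε _ ((norm_fn_apply_le (φ t) i).trans (hφ t))
    · rw [H1.mol_d]
      exact eLpNorm_mol_moll_le hε _ ((H1.norm_grad_le _ l).trans ((norm_apply_le' _ i).trans (hφ t)))
  have hcont : Continuous fun t => 15 / 2 * (ballVol / 128 * (autocorr 0 (φ t) - 2 * η)) - η := by
    have : Continuous fun t => autocorr 0 (φ t) := continuous_autocorr_comp h.continuous 0
    fun_prop
  have hle : ∀ t ∈ Set.Icc a b, 15 / 2 * (ballVol / 128 * (autocorr 0 (φ t) - 2 * η)) - η ≤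
      interactionDeriv c₁ c₂ c₁₂ ρ (φ t) δ := fun t ht => by
    have h5 := le_interactionDeriv c₁ c₂ c₁₂ ρ (φ t) hδ hc₁ hc₂ hc₁₂ hA (r := η / (D + 1)) (by positivity) (b0 t) (b1 t)
      (h3' t ht)
    have h6 := mul_le_dint_mass ρ (φ t) hδ (g := autocorr 0 (φ t) - 2 * η) fun z hz => by
      have h7 := h1 (φ t) (Set.mem_image_of_mem φ ht) z hz
      have h8 := h2' (φ t) (Set.mem_image_of_mem φ ht) z
      linarith
    have h9 : D * (η / (D + 1)) ≤ η := mul_div_add_one_le hD0 hη.le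
    refine le_trans ?_ h5
    linarith
  have h4 := h.integral_le_interaction_sub ρ hδ hab hcont.continuousOn hle
  have i1 := abs_le.1 (abs_interaction_le ρ (φ b) hδ hA (b0 b) (b1 b))
  have i2 := abs_le.1 (abs_interaction_le ρ (φ a) hδ hA (b0 a) (b1 a))
  linarith [i1.2, i2.1]

/-- The limit η → 0 on a fixed interval; the length of the interval multiplies only η, so it
disappears from the bound. -/
theorem IsSol.integral_autocorr_le {φ : ℝ → H1Pair} (h : IsSol c₁ c₂ c₁₂ φ) (hc₁ : 0 ≤ c₁) (hc₂ : 0 ≤ c₂)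
    (hc₁₂ : 0 ≤ c₁₂) {A : ℝ} (hA : 0 ≤ A) (hφ : ∀ t, ‖φ t‖ ≤ A) {a b : ℝ} (hab : a ≤ b) :
    15 / 2 * (ballVol / 128) * ∫ t in a..b, autocorr 0 (φ t) ≤ 24 * A ^ 4 := by
  have hi : IntervalIntegrable (fun t => autocorr 0 (φ t)) volume a b :=
    (continuous_autocorr_comp h.continuous 0).intervalIntegrable a b
  have hV := ballVol_pos
  set D := (b - a) * (15 / 2 * (ballVol / 128) * 2 + 1) with hD
  have hD0 : 0 ≤ D := mul_nonneg (sub_nonneg.2 hab) (by positivity)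
  refine le_of_forall_pos_le_add fun r hr => ?_
  have h1 := h.integral_autocorr_le_add hc₁ hc₂ hc₁₂ hA hφ hab (η := r / (D + 1)) (by positivity)
  have h2 : ∀ η, ∫ t in a..b, (15 / 2 * (ballVol / 128 * (autocorr 0 (φ t) - 2 * η)) - η) =
      15 / 2 * (ballVol / 128) * (∫ t in a..b, autocorr 0 (φ t)) - D * η := fun η => by
    have e : ∀ t, 15 / 2 * (ballVol / 128 * (autocorr 0 (φ t) - 2 * η)) - η =
        15 / 2 * (ballVol / 128) * autocorr 0 (φ t) - (15 / 2 * (ballVol / 128) * 2 + 1) * η := fun t => by ring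
    simp only [e]
    rw [intervalIntegral.integral_sub (hi.const_mul _) intervalIntegrable_const,
      intervalIntegral.integral_const_mul, intervalIntegral.integral_const, smul_eq_mul, hD]
    ring
  rw [h2] at h1
  have h9 : D * (r / (D + 1)) ≤ r := mul_div_add_one_le hD0 hr.le
  linarith

theorem autocorr_zero_nonneg (u : H1Pair) : 0 ≤ autocorr 0 u := by
  rw [autocorr_eq]
  exact integral_nonneg fun x => mul_nonneg (dens_nonneg u _) (dens_nonneg u _)

theorem lintegral_comp_pow_four_le (u : H1Pair) : ∑ i, ∫⁻ x, ‖u.comp i x‖ₑ ^ 4 ≤ ENNReal.ofReal (autocorr 0 u) := by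
  rw [ofReal_autocorr, ← lintegral_finsetSum _ fun i _ => ((stronglyMeasurable_comp u i).enorm.pow_const 4)]
  refine lintegral_mono fun x => ?_
  simp only [sub_zero, dens, Fin.sum_univ_two, ← ofReal_norm, ← ENNReal.ofReal_pow (norm_nonneg _)]
  rw [← ENNReal.ofReal_add (by positivity) (by positivity)]
  refine ENNReal.ofReal_le_ofReal ?_
  -- The square of the density contains both fourth powers and a nonnegative cross term.
  nlinarith [mul_nonneg (sq_nonneg ‖u.comp 0 x‖) (sq_nonneg ‖u.comp 1 x‖)]

theorem l4Norm_pow_four_le (u : H1Pair) : l4Norm u.comp ^ 4 ≤ 2 * ENNReal.ofReal (autocorr 0 u) := by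
  have h1 : l4Norm u.comp ^ 4 = (∑ i, eLpNorm (u.comp i) 4 volume ^ 2) ^ 2 := by
    rw [l4Norm, ← ENNReal.rpow_natCast, ← ENNReal.rpow_mul, ← ENNReal.rpow_natCast]
    norm_num
  have h2 : ∀ i, eLpNorm (u.comp i) 4 volume ^ 4 = ∫⁻ x, ‖u.comp i x‖ₑ ^ 4 := fun i => by
    have := eLpNorm_nnreal_pow_eq_lintegral (f := u.comp i) (μ := volume) (p := 4) (by norm_num)
    simpa only [NNReal.coe_ofNat, ENNReal.coe_ofNat, ENNReal.rpow_ofNat] using this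
  have h3 : ∀ a b : ℝ≥0∞, (a ^ 2 + b ^ 2) ^ 2 ≤ 2 * (a ^ 4 + b ^ 4) := fun a b => by
    have := ENNReal.rpow_add_le_mul_rpow_add_rpow (a ^ 2) (b ^ 2) (p := 2) (by norm_num)
    norm_num [← pow_mul] at this
    exact this
  rw [h1, Fin.sum_univ_two]
  refine (h3 _ _).trans (mul_le_mul_right ?_ 2)
  rw [h2, h2]
  have := lintegral_comp_pow_four_le u
  rwa [Fin.sum_univ_two] at this

/-- The bound does not depend on the interval, so the integrals over (−n, n] converge to the
integral over all of time with the same bound. -/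
theorem IsSol.spaceTimeL4Norm_le {φ : ℝ → H1Pair} (h : IsSol c₁ c₂ c₁₂ φ) {B : ℝ}
    (hB : ∀ n : ℕ, ∫ t in (-n : ℝ)..n, autocorr 0 (φ t) ≤ B) :
    spaceTimeL4Norm φ ≤ ENNReal.ofReal (2 * B) ^ (1 / 4 : ℝ) := by
  have hc : Continuous fun t => autocorr 0 (φ t) := continuous_autocorr_comp h.continuous 0
  refine ENNReal.rpow_le_rpow ?_ (by norm_num)
  refine (lintegral_mono fun t => l4Norm_pow_four_le (φ t)).trans ?_
  rw [lintegral_const_mul _ hc.measurable.ennreal_ofReal, ENNReal.ofReal_mul zero_le_two, ENNReal.ofReal_ofNat]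
  refine mul_le_mul_right ?_ 2
  have hcov : AECover (volume : Measure ℝ) Filter.atTop fun n : ℕ => Set.Ioc (-n : ℝ) n :=
    aecover_Ioc (Filter.tendsto_neg_atTop_atBot.comp tendsto_natCast_atTop_atTop) tendsto_natCast_atTop_atTop
  refine le_of_tendsto' (hcov.lintegral_tendsto_of_nat hc.measurable.ennreal_ofReal.aemeasurable) fun n => ?_
  have hn : (-n : ℝ) ≤ n := by linarith [n.cast_nonneg (α := ℝ)]
  rw [← ofReal_integral_eq_lintegral_ofReal ((hc.intervalIntegrable _ _).1)
    (Filter.Eventually.of_forall fun t => autocorr_zero_nonneg (φ t)), ← intervalIntegral.integral_of_le hn]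
  exact ENNReal.ofReal_le_ofReal (hB n)

end H1Pair

/-! ### Conclusion -/

theorem mainTheorem7 (c₁ c₂ c₁₂ : ℝ) (hc₁ : 0 ≤ c₁) (hc₂ : 0 ≤ c₂) (hc₁₂ : 0 ≤ c₁₂) (M : ℝ) :
    ∃ C : ℝ, 0 < C ∧ ∀ φ : ℝ → H1Pair, IsGlobalGPSolution c₁ c₂ c₁₂ φ → ‖φ 0‖ ≤ M →
      spaceTimeL4Norm φ ≤ ENNReal.ofReal C := by
  obtain ⟨A, hA, hb⟩ := H1Pair.exists_uniform_bound hc₁ hc₂ hc₁₂ M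
  have hV := ballVol_pos
  have hk : 0 < 15 / 2 * (ballVol / 128) := by positivity
  set B := 24 * A ^ 4 / (15 / 2 * (ballVol / 128)) with hB
  have hB0 : 0 ≤ B := by positivity
  -- The summand 1 only secures positivity of the constant, as B may vanish.
  refine ⟨(2 * B) ^ (1 / 4 : ℝ) + 1, by positivity, fun φ hφ h0 => ?_⟩
  have h := hφ.isSol
  refine (h.spaceTimeL4Norm_le (B := B) fun n => ?_).trans ?_
  · rw [hB, le_div_iff₀' hk]
    exact h.integral_autocorr_le hc₁ hc₂ hc₁₂ hA (hb φ h h0) (by linarith [n.cast_nonneg (α := ℝ)])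
  · rw [ENNReal.ofReal_rpow_of_nonneg (by positivity) (by norm_num)]
    exact ENNReal.ofReal_le_ofReal (by linarith)
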